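/- Let $k$ be a field and let $\square_p$ be the $\mathbb N^3$-coloured operad of stackings of boxes: a box of colour $(p,q,r)$ has $p$ horizontal inputs, $q$ vertical inputs, $r$ horizontal outputs and one vertical output; $\square_p$ is generated by a unit $\eta$ of colour $(0,1,0)$ and by the operations $C^{p_0,\dots,p_n;p,r}_{q_1,\dots,q_n}$ which put a row of boxes of colours $(p_{i-1},q_i,p_i)$, $1\le i\le n$, on a box of colour $(p,n,r)$, with result of colour $(p+p_0,\sum_i q_i,r+p_n)$ (for $n=0$: $p_0$ horizontal lines run over a box without vertical inputs). A dg box operad is an algebra over $\square_p$ in chain complexes. Let $\mathcal B$ be an augmented dg box operad with augmentation ideal $\overline{\mathcal B}$, and let $s_{\mathrm{thin}}\overline{\mathcal B}$ be its thin suspension, i.e. the suspension on the thin colours $(0,q,0)$ and the identity on all other colours. A colour is semi-thin if exactly one of $p,r$ is zero, and non-thin if $p,r>0$. Let $T=T(s_{\mathrm{thin}}\overline{\mathcal B})$ be the cofree conilpotent box cooperad: $T$ is the direct sum, over the stackings $S$ in standard order (a box precedes the boxes above it and to its right), of the tensor products of $s_{\mathrm{thin}}\overline{\mathcal B}$ over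 the boxes of $S$, and its comultiplication is the sum, with Koszul signs, over all decompositions of a stacking into nonempty substackings. A stacking $S$ of $n$ boxes, in standard order and of colour $(p,q,r)$, is thin-quadratic if it has no semi-thin box, if $\mathrm{td}(S)=2-n$, where $\mathrm{td}(S)=0$ for $(p,r)=(0,0)$ and $\mathrm{td}(S)=1+\#\{\text{thin boxes}\}-n$ otherwise, and if its horizontal composite graph has exactly two connected components (a horizontal line which meets no box is an edge without vertices, and counts as a component). Such an $S$ is of type I (two thin boxes), of type II (a thin box on a non-thin box) or of type III (the bottom box is thin and all other boxes are non-thin; this includes the degenerate stacking of a single box of colour $(0,0,0)$ with one line over it). Define the map $\mu_{(1)}$ of degree $-1$ on the thin-quadratic stackings by $$\mu_{(1)}(S;s_{\mathrm{thin}}x_1\otimes\dots\otimes s_{\mathrm{thin}}x_n)=\begin{cases}(-1)^{|x_1|+1}\,s\,\mu_S(x_1\otimes x_2)&\text{type I}\\(-1)^{|x_1|}\,\mu_S(x_1\otimes x_2)&\text{type II}\\-\mu_S(x_1\otimes\dots\otimes x_n)&\text{type III.}\end{cases}$$ Let $d_\square$ be the coderivation $T(\varepsilon;\psi)\circ\Delta$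 of $T$, where $\varepsilon$ is the projection of $T$ to the one-box stackings and $\psi:T\to s_{\mathrm{thin}}\overline{\mathcal B}$ is the projection to the thin-quadratic stackings followed by $\mu_{(1)}$; let $d_{s\overline{\mathcal B}}$ be the coderivation induced by the differential of $s_{\mathrm{thin}}\overline{\mathcal B}$. Then $d_\square$ is the unique coderivation of $T$ with $\varepsilon d_\square=\psi$; it has degree $-1$ and $d_\square^2=0$; $d_{s\overline{\mathcal B}}+d_\square$ has degree $-1$ and squares to zero; and with this differential $T$, i.e. the bar construction $\mathrm B\mathcal B$, is a conilpotent dg box cooperad. -/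

import Mathlib

universe u v w

namespace BoxOperad

/-! ### Colours and stackings of boxes -/

/-- A colour: a box with `p` horizontal inputs, `q` vertical inputs, `r` horizontal outputs. -/
@[ext] structure Colour where
  p : ℕ
  q : ℕ
  r : ℕ

def Colour.Thin (c : Colour) : Prop := c.p = 0 ∧ c.r = 0

def Colour.SemiThin (c : Colour) : Prop := (c.p = 0 ∧ 0 < c.r) ∨ (0 < c.p ∧ c.r = 0)

def Colour.NonThin (c : Colour) : Prop := ¬ c.Thin ∧ ¬ c.SemiThin

/-- Stackings of boxes labelled in `α`.  `eta` is the operadic unit (no box at all), and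
`box a n w ch` is the bottom box `a` with `n` vertical inputs on which the stackings
`ch 0, …, ch (n-1)` are placed; `w i` is the number of horizontal lines crossing the vertical
line between `ch (i-1)` and `ch i` (so `w 0` and `w n` are the outer sides of the row).
This is the generator `C^{w 0, …, w n; p, r}` applied to `a` and the `ch i`.  If `n = 0`, then
`w 0` horizontal lines run over the box `a`. -/
inductive Stacking (α : Type u) : Type u
  | eta : Stacking α
  | box (a : α) (n : ℕ) (w : Fin (n + 1) → ℕ) (ch : Fin n → Stacking α) : Stacking α

/-- `before f i = f 0 + … + f (i-1)`. -/
def before {n : ℕ} (f : Fin n → ℕ) (i : ℕ) : ℕ := ∑ j : Fin n, if j.val < i then f j else 0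

namespace Stacking

variable {α : Type u} {β : Type v} {γ : Type w}

def map (f : α → β) : Stacking α → Stacking β
  | eta => eta
  | box a n w ch => box (f a) n w (fun i => (ch i).map f)

/-- The labels of the boxes in standard order: a box precedes the boxes above it and the boxes to
its right. -/
def nodes : Stacking α → List α
  | eta => []
  | box a _ _ ch => a :: (List.ofFn fun i => (ch i).nodes).flatten

/-- The number of boxes. -/
def size (t : Stacking α) : ℕ := t.nodes.length

/-- The number of vertical inputs. -/
def leaves : Stacking α → ℕ
  | eta => 1
  | box _ n _ ch => ∑ i : Fin n, (ch i).leaves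

/-- The number of horizontal inputs. -/
def left (col : α → Colour) : Stacking α → ℕ
  | eta => 0
  | box a _ w _ => (col a).p + w 0

/-- The number of horizontal outputs. -/
def right (col : α → Colour) : Stacking α → ℕ
  | eta => 0
  | box a n w _ => (col a).r + w (Fin.last n)

/-- The colour of the box formed by a stacking. -/
def arity (col : α → Colour) (t : Stacking α) : Colour := ⟨t.left col, t.leaves, t.right col⟩

/-- All the inputs and outputs match. -/
def Valid (col : α → Colour) : Stacking α → Prop
  | eta => True
  | box a n w ch => (col a).q = n ∧
      ∀ i : Fin n, (ch i).Valid col ∧ (ch i).left col = w i.castSucc ∧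
        (ch i).right col = w i.succ

/-- `graft X w ch o`: on top of the stacking `X` put a row of stackings, namely `ch (o + i)` on
its `i`-th vertical input, where `w (o + i)` lines cross the side between the entries `i - 1` and
`i` of the row.  Lines of the row run over the closed parts of `X`. -/
def graft : Stacking α → (ℕ → ℕ) → (ℕ → Stacking α) → ℕ → Stacking α
  | eta, _, ch, o => ch o
  | box a n w' X, w, ch, o =>
      box a n (fun i => w' i + w (o + before (fun j => (X j).leaves) i))
        (fun i => (X i).graft w ch (o + before (fun j => (X j).leaves) i))

/-- The operadic composition: substitution of stackings into the boxes of a stacking. -/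
def flatten : Stacking (Stacking α) → Stacking α
  | eta => eta
  | box X n w ch =>
      X.graft (fun i => if h : i < n + 1 then w ⟨i, h⟩ else 0)
        (fun i => if h : i < n then (ch ⟨i, h⟩).flatten else eta) 0

/-- Number the boxes in standard order, starting with `o`. -/
def number : ℕ → Stacking α → Stacking (ℕ × α)
  | _, eta => eta
  | o, box a n w ch =>
      box (o, a) n w (fun i => (ch i).number (o + 1 + before (fun j => (ch j).size) i))

/-- The underlying stacking, its boxes labelled `0, 1, …` in standard order. -/
def skel (t : Stacking α) : Stacking ℕ := (t.number 0).map Prod.fst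

/-- The one-box stacking. -/
def corolla (col : α → Colour) (a : α) : Stacking α := box a (col a).q (fun _ => 0) (fun _ => eta)

/-- A stacking of stackings whose parts match. -/
def NestValid (col : α → Colour) (N : Stacking (Stacking α)) : Prop :=
  (∀ X ∈ N.nodes, X.Valid col) ∧ N.Valid (arity col)

/-- The labels of a stacking of stackings: its parts in standard order, and in each part the boxes
in standard order. -/
def nestNodes (N : Stacking (Stacking α)) : List α := N.nodes.flatMap nodes

/-- The ways to decompose the stacking `S` into nonempty substackings. -/
def nestings (col : α → Colour) (S : Stacking α) : Set (Stacking (Stacking α)) :=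
  {N | N.NestValid col ∧ (∀ X ∈ N.nodes, X ≠ eta) ∧ N.flatten = S}

/-! ### Horizontal composite graph, thin-quadratic stackings -/

/-- The horizontal lines over a box `i` without vertical inputs. -/
def lines (i m : ℕ) : List (ℕ × Option ℕ) := (List.range m).map fun s => (i, some s)

/-- What the horizontal inputs are attached to, from bottom to top: `(i, none)` is box `i`, and
`(i, some s)` is the `s`-th line over box `i`. -/
def leftBd : Stacking (ℕ × Colour) → List (ℕ × Option ℕ)
  | eta => []
  | box a n w ch => List.replicate a.2.p (a.1, none) ++
      (if h : 0 < n then (ch ⟨0, h⟩).leftBd else lines a.1 (w 0))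

/-- What the horizontal outputs are attached to, from bottom to top. -/
def rightBd : Stacking (ℕ × Colour) → List (ℕ × Option ℕ)
  | eta => []
  | box a n w ch => List.replicate a.2.r (a.1, none) ++
      (if h : 0 < n then (ch ⟨n - 1, by omega⟩).rightBd else lines a.1 (w 0))

/-- All boxes and all lines over boxes. -/
def pieces : Stacking (ℕ × Colour) → Set (ℕ × Option ℕ)
  | eta => ∅
  | box a n w ch => {x | x = (a.1, none) ∨ (n = 0 ∧ x ∈ lines a.1 (w 0)) ∨
      ∃ i : Fin n, x ∈ (ch i).pieces}

/-- Horizontal adjacency: `y` is directly to the right of `x`. -/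
def HAdj : Stacking (ℕ × Colour) → ℕ × Option ℕ → ℕ × Option ℕ → Prop
  | eta, _, _ => False
  | box _ n _ ch, x, y => (∃ i : Fin n, (ch i).HAdj x y) ∨
      ∃ i j : Fin n, j.val = i.val + 1 ∧ (x, y) ∈ (ch i).rightBd.zip (ch j).leftBd

/-- The horizontal composite graph.  A horizontal line of the stacking which meets no box is an
edge without vertices of the planar graph, and is a connected component of its own. -/
def hGraph (S : Stacking Colour) : SimpleGraph (S.number 0).pieces :=
  SimpleGraph.fromRel fun x y => (S.number 0).HAdj x.1 y.1

open Classical in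
/-- The thin desuspended degree. -/
noncomputable def thinDegree (S : Stacking Colour) : ℤ :=
  if S.left id = 0 ∧ S.right id = 0 then 0
  else 1 + (S.nodes.countP fun c => c.Thin) - S.size

/-- Thin-quadratic stackings (in standard order). -/
def ThinQuadratic (S : Stacking Colour) : Prop :=
  (∀ c ∈ S.nodes, ¬ c.SemiThin) ∧ S.thinDegree = 2 - S.size ∧
    Nat.card S.hGraph.ConnectedComponent = 2

/-- Two thin boxes. -/
def IsTypeI (S : Stacking Colour) : Prop :=
  S.ThinQuadratic ∧ ∃ a b, S.nodes = [a, b] ∧ a.Thin ∧ b.Thin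

/-- A thin box stacked on a non-thin box. -/
def IsTypeII (S : Stacking Colour) : Prop :=
  S.ThinQuadratic ∧ ∃ a b, S.nodes = [a, b] ∧ a.NonThin ∧ b.Thin

/-- The bottom box is thin, and the other boxes are non-thin.  (The only thin-quadratic stacking with
a single box is a box of colour `(0, 0, 0)` with one line over it; it is of this type.) -/
def IsTypeIII (S : Stacking Colour) : Prop :=
  S.ThinQuadratic ∧ ∃ a l, S.nodes = a :: l ∧ a.Thin ∧ ∀ b ∈ l, b.NonThin

end Stacking

/-- The Koszul sign for sorting the list `l` of indices of elements of degrees `deg i`. -/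
def koszul (deg : ℕ → ℤ) : List ℕ → ℤˣ
  | [] => 1
  | a :: l => (l.map fun b => if b < a then (deg a * deg b).negOnePow else 1).prod * koszul deg l

/-! ### Helper facts on stackings -/

section Before

theorem before_castSucc {n : ℕ} (f : Fin (n + 1) → ℕ) (i : ℕ) (h : i ≤ n) :
    before f i = before (fun j : Fin n => f j.castSucc) i := by
  unfold before
  rw [Fin.sum_univ_castSucc]
  simp [Nat.not_lt.mpr h]

theorem before_all {n : ℕ} (f : Fin n → ℕ) (i : ℕ) (h : n ≤ i) : before f i = ∑ j, f j := by
  unfold before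
  refine Finset.sum_congr rfl fun j _ => ?_
  rw [if_pos (lt_of_lt_of_le j.2 h)]

theorem before_succ {n : ℕ} (f : Fin n → ℕ) (i : Fin n) :
    before f (i.val + 1) = before f i + f i := by
  unfold before
  have : f i = ∑ j : Fin n, if j = i then f j else 0 := by simp
  rw [this, ← Finset.sum_add_distrib]
  refine Finset.sum_congr rfl fun j _ => ?_
  rcases lt_trichotomy j i with h | h | h
  · have h' : j.val < i.val := h
    simp [h.ne, h', Nat.lt_succ_of_lt h']
  · subst h; simp
  · have h' : i.val < j.val := h
    have h1 : ¬ j.val < i.val + 1 := by omega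
    have h2 : ¬ j.val < i.val := by omega
    simp [h.ne', h1, h2]

theorem sum_segments {n : ℕ} (f : Fin n → ℕ) (g : ℕ → ℕ) :
    ∑ i : Fin n, ∑ j ∈ Finset.range (f i), g (before f i + j) =
      ∑ j ∈ Finset.range (∑ i, f i), g j := by
  induction n with
  | zero => simp
  | succ n ih =>
    rw [Fin.sum_univ_castSucc, Fin.sum_univ_castSucc, Finset.sum_range_add,
      ← ih (fun j => f j.castSucc)]
    congr 1
    · refine Finset.sum_congr rfl fun i _ => ?_
      refine Finset.sum_congr rfl fun j _ => ?_
      rw [Fin.val_castSucc, before_castSucc f _ i.2.le]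
    · refine Finset.sum_congr rfl fun j _ => ?_
      rw [Fin.val_last, before_castSucc f _ le_rfl, before_all _ _ le_rfl]

theorem flatten_ranges {n : ℕ} (f : Fin n → ℕ) (o : ℕ) :
    (List.ofFn fun i => List.range' (o + before f i) (f i)).flatten =
      List.range' o (∑ i, f i) := by
  induction n with
  | zero => simp
  | succ n ih =>
    rw [List.ofFn_succ', List.concat_eq_append, List.flatten_append, Fin.sum_univ_castSucc,
      ← List.range'_append_1, ← ih (fun j => f j.castSucc)]
    congr 1
    · congr 2
      funext i
      rw [Fin.val_castSucc, before_castSucc f _ i.2.le]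
    · rw [Fin.val_last, before_castSucc f _ le_rfl, before_all _ _ le_rfl]
      simp

end Before

namespace Stacking

variable {α : Type u} {β : Type v} {γ : Type w}

theorem nodes_map (f : α → β) (t : Stacking α) : (t.map f).nodes = t.nodes.map f := by
  induction t with
  | eta => rfl
  | box a n w ch ih =>
    simp only [map, nodes, List.map_cons, List.map_flatten, ih, List.map_ofFn]
    rfl

theorem size_map (f : α → β) (t : Stacking α) : (t.map f).size = t.size := by
  simp [size, nodes_map]

theorem map_map (f : α → β) (g : β → γ) (t : Stacking α) :
    (t.map f).map g = t.map (fun a => g (f a)) := by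
  induction t with
  | eta => rfl
  | box a n w ch ih => simp only [map, ih]

theorem map_congr {f g : α → β} {t : Stacking α} (h : ∀ a ∈ t.nodes, f a = g a) :
    t.map f = t.map g := by
  induction t with
  | eta => rfl
  | box a n w ch ih =>
    simp only [map]
    rw [h a (by simp [nodes])]
    congr 1
    funext i
    refine ih i fun b hb => h b ?_
    simp only [nodes, List.mem_cons, List.mem_flatten, List.mem_ofFn]
    exact Or.inr ⟨_, ⟨i, rfl⟩, hb⟩

theorem leaves_map (f : α → β) (t : Stacking α) : (t.map f).leaves = t.leaves := by
  induction t with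
  | eta => rfl
  | box a n w ch ih => simp only [map, leaves, ih]

theorem left_map (f : α → β) (col : β → Colour) (t : Stacking α) :
    (t.map f).left col = t.left fun a => col (f a) := by
  cases t <;> rfl

theorem right_map (f : α → β) (col : β → Colour) (t : Stacking α) :
    (t.map f).right col = t.right fun a => col (f a) := by
  cases t <;> rfl

theorem arity_map (f : α → β) (col : β → Colour) (t : Stacking α) :
    (t.map f).arity col = t.arity fun a => col (f a) := by
  simp only [arity, left_map, right_map, leaves_map]

theorem valid_map (f : α → β) (col : β → Colour) (t : Stacking α) :
    (t.map f).Valid col ↔ t.Valid fun a => col (f a) := by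
  induction t with
  | eta => rfl
  | box a n w ch ih => simp only [map, Valid, ih, left_map, right_map]

theorem map_eq_eta {f : α → β} {t : Stacking α} : t.map f = eta ↔ t = eta := by
  cases t <;> simp [map]

theorem number_map (f : α → β) (t : Stacking α) (o : ℕ) :
    (t.map f).number o = (t.number o).map fun x => (x.1, f x.2) := by
  induction t generalizing o with
  | eta => rfl
  | box a n w ch ih => simp only [map, number, ih, size_map]

theorem skel_map (f : α → β) (t : Stacking α) : (t.map f).skel = t.skel := by
  simp only [skel, number_map, map_map]

theorem nodes_number (t : Stacking α) (o : ℕ) :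
    ((t.number o).map Prod.fst).nodes = List.range' o t.size := by
  induction t generalizing o with
  | eta => rfl
  | box a n w ch ih =>
    simp only [number, map, nodes, ih, flatten_ranges, size, List.length_cons,
      List.length_flatten, List.map_ofFn, List.sum_ofFn, List.range'_succ]
    rfl

theorem nodes_skel (t : Stacking α) : t.skel.nodes = List.range t.size := by
  rw [skel, nodes_number, List.range_eq_range']

theorem size_skel (t : Stacking α) : t.skel.size = t.size := by
  rw [size, nodes_skel, List.length_range]

open Classical in
theorem count_graft (a : α) (X : Stacking α) (w : ℕ → ℕ) (ch : ℕ → Stacking α) (o : ℕ) :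
    (X.graft w ch o).nodes.count a =
      X.nodes.count a + ∑ i ∈ Finset.range X.leaves, (ch (o + i)).nodes.count a := by
  induction X generalizing o with
  | eta => simp [graft, nodes, leaves]
  | box b n w' X ih =>
    simp only [graft, nodes, leaves, List.count_cons, List.count_flatten, List.map_ofFn,
      List.sum_ofFn, Function.comp_def, ih, Finset.sum_add_distrib, add_assoc]
    rw [sum_segments (fun j => (X j).leaves) fun j => (ch (o + j)).nodes.count a]
    ring

theorem sum_range_dite {n : ℕ} (f : ℕ → ℕ) (g : Fin n → ℕ)
    (h : ∀ i : Fin n, f i = g i) : ∑ i ∈ Finset.range n, f i = ∑ i, g i := by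
  rw [Finset.sum_range]
  exact Finset.sum_congr rfl fun i _ => h i

open Classical in
theorem count_flatten (a : α) (N : Stacking (Stacking α)) (col : Stacking α → Colour)
    (hcol : ∀ X, (col X).q = X.leaves) (hN : N.Valid col) :
    N.flatten.nodes.count a = N.nestNodes.count a := by
  induction N with
  | eta => rfl
  | box X n w ch ih =>
    obtain ⟨h1, h2⟩ := hN
    rw [hcol] at h1
    simp only [flatten, count_graft, nestNodes, nodes, List.flatMap_cons, List.count_append, h1]
    congr 1
    rw [sum_range_dite _ (fun i => (ch i).nestNodes.count a)]
    · simp only [nestNodes, List.count_flatMap, List.map_flatten, List.sum_flatten,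
        List.map_ofFn, List.sum_ofFn, Function.comp_def]
    · intro i
      simp only [zero_add, i.2, dif_pos]
      exact ih i (h2 i).1

/-- An auxiliary measure: boxes, vertical inputs and horizontal lines. -/
def mass : Stacking α → ℕ
  | eta => 1
  | box _ n w ch => 1 + ∑ i, w i + ∑ i : Fin n, (ch i).mass

theorem one_le_mass (t : Stacking α) : 1 ≤ t.mass := by
  cases t <;> simp [mass, add_assoc]

theorem mass_graft (X : Stacking α) (w : ℕ → ℕ) (ch : ℕ → Stacking α) (o : ℕ) :
    X.mass + ∑ i ∈ Finset.range X.leaves, (ch (o + i)).mass ≤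
      (X.graft w ch o).mass + X.leaves := by
  induction X generalizing o with
  | eta => simp [graft, mass, leaves, add_comm]
  | box b n w' X ih =>
    have h := Finset.sum_le_sum fun i (_ : i ∈ (Finset.univ : Finset (Fin n))) =>
      ih i (o + before (fun j => (X j).leaves) i)
    simp only [Finset.sum_add_distrib, add_assoc] at h
    rw [sum_segments (fun j => (X j).leaves) fun j => (ch (o + j)).mass] at h
    simp only [graft, mass, leaves, Finset.sum_add_distrib]
    omega

theorem exists_segment {n : ℕ} (f : Fin n → ℕ) (j : ℕ) (hj : j ≤ ∑ i, f i) :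
    (∃ i : Fin (n + 1), j = before f i) ∨
      ∃ i : Fin n, before f i < j ∧ j < before f i + f i := by
  by_contra! hc
  have key : ∀ i : ℕ, i ≤ n → before f i < j := by
    intro i
    induction i with
    | zero =>
      intro _
      have := hc.1 0
      have h0 : before f 0 = 0 := by simp [before]
      simp only [Fin.val_zero, h0] at this ⊢
      omega
    | succ i ih =>
      intro hi
      have h1 := ih (by omega)
      have h2 := hc.2 ⟨i, by omega⟩ h1
      have h3 := hc.1 ⟨i + 1, by omega⟩
      have h4 := before_succ f ⟨i, by omega⟩
      simp only at h2 h3 h4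
      omega
  have := key n le_rfl
  rw [before_all _ _ le_rfl] at this
  omega

theorem width_le_mass_graft (X : Stacking α) (hX : X ≠ eta) (w : ℕ → ℕ) (ch : ℕ → Stacking α)
    (o j : ℕ) (hj : j ≤ X.leaves) : w (o + j) ≤ (X.graft w ch o).mass := by
  induction X generalizing o j with
  | eta => exact absurd rfl hX
  | box b n w' X ih =>
    simp only [graft, mass]
    rcases exists_segment (fun i => (X i).leaves) j hj with ⟨i, hi⟩ | ⟨i, h1, h2⟩
    · have := Finset.single_le_sum
        (f := fun i : Fin (n + 1) => w' i + w (o + before (fun j => (X j).leaves) i))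
        (fun _ _ => Nat.zero_le _) (Finset.mem_univ i)
      simp only [← hi] at this
      omega
    · have hne : X i ≠ eta := by
        intro h
        simp only [h, leaves] at h2
        omega
      have h3 := ih i hne (o + before (fun j => (X j).leaves) i)
        (j - before (fun j => (X j).leaves) i) (by omega)
      have h4 := Finset.single_le_sum
        (f := fun i : Fin n => ((X i).graft w ch (o + before (fun j => (X j).leaves) i)).mass)
        (fun _ _ => Nat.zero_le _) (Finset.mem_univ i)
      have h5 : o + before (fun j => (X j).leaves) i + (j - before (fun j => (X j).leaves) i)
        = o + j := by omega
      rw [h5] at h3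
      omega

theorem leaves_le_mass (X : Stacking α) : X.leaves ≤ X.mass := by
  induction X with
  | eta => exact le_rfl
  | box b n w' X ih =>
    have h := Finset.sum_le_sum fun i (_ : i ∈ (Finset.univ : Finset (Fin n))) => ih i
    simp only [leaves, mass]
    omega

theorem leaves_lt_mass (X : Stacking α) (hX : X ≠ eta) : X.leaves < X.mass := by
  cases X with
  | eta => exact absurd rfl hX
  | box b n w' X =>
    have h := Finset.sum_le_sum fun i (_ : i ∈ (Finset.univ : Finset (Fin n))) =>
      leaves_le_mass (X i)
    simp only [leaves, mass]
    omega

/-- Stackings put together from finitely many possible bottoms, widths and upper parts. -/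
theorem finite_boxes {A : Set α} {C : Set (Stacking α)} (hA : A.Finite) (hC : C.Finite) (K : ℕ) :
    {t : Stacking α | ∃ a n w ch, t = box a n w ch ∧ a ∈ A ∧ n ≤ K ∧ (∀ i, w i ≤ K) ∧
      ∀ i, ch i ∈ C}.Finite := by
  have h : ∀ n : ℕ, {t : Stacking α | ∃ a w ch, t = box a n w ch ∧ a ∈ A ∧ (∀ i, w i ≤ K) ∧
      ∀ i, ch i ∈ C}.Finite := by
    intro n
    have hW : (Set.univ.pi fun _ : Fin (n + 1) => Set.Iic K).Finite :=
      Set.Finite.pi fun _ => Set.finite_Iic K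
    have hCh : (Set.univ.pi fun _ : Fin n => C).Finite := Set.Finite.pi fun _ => hC
    refine (((hA.prod (hW.prod hCh))).image fun x => box x.1 n x.2.1 x.2.2).subset ?_
    rintro t ⟨a, w, ch, rfl, ha, hw, hch⟩
    exact ⟨(a, w, ch), ⟨ha, fun i _ => hw i, fun i _ => hch i⟩, rfl⟩
  refine ((Set.finite_Iic K).biUnion fun n _ => h n).subset ?_
  rintro t ⟨a, n, w, ch, rfl, ha, hn, hw, hch⟩
  exact Set.mem_biUnion hn ⟨a, w, ch, rfl, ha, hw, hch⟩

theorem mem_nodes_box {a b : α} {n : ℕ} {w : Fin (n + 1) → ℕ} {ch : Fin n → Stacking α} :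
    b ∈ (box a n w ch).nodes ↔ b = a ∨ ∃ i, b ∈ (ch i).nodes := by
  simp [nodes, List.mem_flatten, List.mem_ofFn]

theorem finite_mass_le {A : Set α} (hA : A.Finite) (K : ℕ) :
    {t : Stacking α | (∀ a ∈ t.nodes, a ∈ A) ∧ t.mass ≤ K}.Finite := by
  induction K with
  | zero =>
    refine Set.finite_empty.subset ?_
    rintro t ⟨-, h⟩
    have := one_le_mass t
    omega
  | succ K ih =>
    refine ((Set.finite_singleton (eta : Stacking α)).union (finite_boxes hA ih K)).subset ?_
    rintro t ⟨h1, h2⟩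
    cases t with
    | eta => exact Or.inl rfl
    | box a n w ch =>
      simp only [mass] at h2
      have h3 : ∀ i, w i ≤ ∑ i, w i := fun i =>
        Finset.single_le_sum (fun _ _ => Nat.zero_le _) (Finset.mem_univ i)
      have h4 : ∀ i, (ch i).mass ≤ ∑ i, (ch i).mass := fun i =>
        Finset.single_le_sum (f := fun i => (ch i).mass) (fun _ _ => Nat.zero_le _)
          (Finset.mem_univ i)
      have h5 := Finset.sum_le_sum fun i (_ : i ∈ (Finset.univ : Finset (Fin n))) =>
        one_le_mass (ch i)
      simp only [Finset.sum_const, Finset.card_univ, Fintype.card_fin, smul_eq_mul,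
        mul_one] at h5
      refine Or.inr ⟨a, n, w, ch, rfl, h1 a (mem_nodes_box.2 (Or.inl rfl)), by omega,
        fun i => ?_, fun i => ⟨fun b hb => h1 b (mem_nodes_box.2 (Or.inr ⟨i, hb⟩)), ?_⟩⟩
      · have := h3 i; omega
      · have := h4 i; omega

theorem finite_nests {A : Set α} (hA : A.Finite) (K : ℕ) :
    {N : Stacking (Stacking α) | (∀ X ∈ N.nodes, X ≠ eta ∧ ∀ a ∈ X.nodes, a ∈ A) ∧
      (∃ col : Stacking α → Colour, (∀ X, (col X).q = X.leaves) ∧ N.Valid col) ∧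
      N.flatten.mass ≤ K}.Finite := by
  induction K with
  | zero =>
    refine Set.finite_empty.subset ?_
    rintro t ⟨-, -, h⟩
    have := one_le_mass t.flatten
    omega
  | succ K ih =>
    refine ((Set.finite_singleton (eta : Stacking (Stacking α))).union
      (finite_boxes (finite_mass_le hA (K + 1)) ih (K + 1))).subset ?_
    rintro t ⟨h1, ⟨col, hcol, hV⟩, h2⟩
    cases t with
    | eta => exact Or.inl rfl
    | box X n w ch =>
      obtain ⟨hn, hV⟩ := hV
      rw [hcol] at hn
      obtain ⟨hX, hXA⟩ := h1 X (mem_nodes_box.2 (Or.inl rfl))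
      simp only [flatten] at h2
      set W : ℕ → ℕ := fun i => if h : i < n + 1 then w ⟨i, h⟩ else 0 with hW
      set CH : ℕ → Stacking α := fun i => if h : i < n then (ch ⟨i, h⟩).flatten else eta with hCH
      have h3 := mass_graft X W CH 0
      have h4 : ∑ i ∈ Finset.range X.leaves, (CH (0 + i)).mass = ∑ i, (ch i).flatten.mass := by
        rw [hn]
        refine sum_range_dite _ _ fun i => ?_
        simp [hCH]
      rw [h4] at h3
      have h5 := Finset.sum_le_sum fun i (_ : i ∈ (Finset.univ : Finset (Fin n))) =>
        one_le_mass (ch i).flatten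
      simp only [Finset.sum_const, Finset.card_univ, Fintype.card_fin, smul_eq_mul,
        mul_one] at h5
      have h6 := leaves_lt_mass X hX
      refine Or.inr ⟨X, n, w, ch, rfl, ⟨hXA, ?_⟩, ?_, fun i => ?_, fun i => ⟨?_, ?_, ?_⟩⟩
      · omega
      · omega
      · have h7 := width_le_mass_graft X hX W CH 0 i.val (by omega)
        have h8 : W (0 + i.val) = w i := by simp [hW, Nat.lt_succ_iff.1 i.2]
        rw [h8] at h7
        omega
      · exact fun Y hY => h1 Y (mem_nodes_box.2 (Or.inr ⟨i, hY⟩))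
      · exact ⟨col, hcol, (hV i).1⟩
      · have h9 : (ch i).flatten.mass ≤ ∑ i, (ch i).flatten.mass :=
          Finset.single_le_sum (f := fun i => (ch i).flatten.mass) (fun _ _ => Nat.zero_le _)
            (Finset.mem_univ i)
        omega

theorem finite_nestings (col : α → Colour) (S : Stacking α) : (nestings col S).Finite := by
  classical
  refine (finite_nests (A := {a | a ∈ S.nodes}) (List.finite_toSet _) S.mass).subset ?_
  rintro N ⟨hN, hne, rfl⟩
  refine ⟨fun X hX => ⟨hne X hX, fun a ha => ?_⟩, ⟨arity col, fun _ => rfl, hN.2⟩, le_rfl⟩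
  have h := count_flatten a N (arity col) (fun _ => rfl) hN.2
  have h1 : 0 < N.nestNodes.count a :=
    List.count_pos_iff.2 (List.mem_flatMap.2 ⟨X, hX, ha⟩)
  rw [← h] at h1
  exact List.count_pos_iff.1 h1

end Stacking

/-! ### Graded modules and the cofree conilpotent box cooperad -/

/-- A box labelled by an element of a family of graded modules. -/
structure Box (M : Colour → ℤ → Type v) where
  c : Colour
  deg : ℤ
  x : M c deg

open Stacking

/-- The degree of a stacking of elements. -/
def degree {M : Colour → ℤ → Type v} (t : Stacking (Box M)) : ℤ := (t.nodes.map Box.deg).sum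

/-- A stacking `(S; x₁, …, xₙ)` of elements (in standard order) of colour `c` and degree `n`.  For
`u = false` the stacking without boxes is excluded. -/
def Good {M : Colour → ℤ → Type v} (u : Bool) (c : Colour) (n : ℤ) (t : Stacking (Box M)) : Prop :=
  t.Valid Box.c ∧ t.arity Box.c = c ∧ degree t = n ∧ (u = false → t ≠ eta)

/-- Fill the holes of a stacking of elements with `b`. -/
def fill {M : Colour → ℤ → Type v} (W : Stacking (Option (Box M))) (b : Box M) :
    Stacking (Box M) := W.map fun o => o.getD b

def OneHole {M : Colour → ℤ → Type v} (W : Stacking (Option (Box M))) : Prop :=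
  W.nodes.countP Option.isNone = 1

theorem update_c {M : Colour → ℤ → Type v} (v : ℕ → Box M) (i : ℕ) (c' : Colour) (n' : ℤ) (x : M c' n') (j : ℕ) :
    (Function.update v i ⟨c', n', x⟩ j).c = Function.update (fun j => (v j).c) i c' j := by
  by_cases h : j = i
  · subst h; simp
  · simp [h]

theorem update_deg {M : Colour → ℤ → Type v} (v : ℕ → Box M) (i : ℕ) (c' : Colour) (n' : ℤ) (x : M c' n') (j : ℕ) :
    (Function.update v i ⟨c', n', x⟩ j).deg = Function.update (fun j => (v j).deg) i n' j := by
  by_cases h : j = i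
  · subst h; simp
  · simp [h]

section Modules

variable (k : Type u) [CommRing k]
variable (M : Colour → ℤ → Type v) [∀ c n, AddCommGroup (M c n)] [∀ c n, Module k (M c n)]

/-- The relations: stackings of the wrong colour or degree are omitted, and stackings of elements
are multilinear in the elements. -/
def relations (u : Bool) (c : Colour) (n : ℤ) : Set (Stacking (Box M) →₀ k) :=
  {z | (∃ t, ¬ Good u c n t ∧ z = Finsupp.single t 1) ∨
    ∃ W : Stacking (Option (Box M)), OneHole W ∧ ∃ (c' : Colour) (n' : ℤ) (x y : M c' n') (a : k),
      z = Finsupp.single (fill W ⟨c', n', a • x + y⟩) 1 -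
        (a • Finsupp.single (fill W ⟨c', n', x⟩) 1 + Finsupp.single (fill W ⟨c', n', y⟩) 1)}

/-- The direct sum, over the stackings `S` of colour `c` in standard order, of the tensor products
of the modules `M` over the boxes of `S`, in degree `n`.  For `u = true` this is the (co)free
box (co)operad; for `u = false` the stacking without boxes is omitted (the coaugmentation
coideal). -/
def T (u : Bool) (c : Colour) (n : ℤ) : Type (max u v) :=
  (Stacking (Box M) →₀ k) ⧸ Submodule.span k (relations k M u c n)

noncomputable instance (u : Bool) (c : Colour) (n : ℤ) : AddCommGroup (T k M u c n) :=
  inferInstanceAs (AddCommGroup (_ ⧸ Submodule.span k (relations k M u c n)))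

noncomputable instance (u : Bool) (c : Colour) (n : ℤ) : Module k (T k M u c n) :=
  inferInstanceAs (Module k (_ ⧸ Submodule.span k (relations k M u c n)))

variable {M}

/-- The element `(S; x₁, …, xₙ)`. -/
noncomputable def gen (u : Bool) (c : Colour) (n : ℤ) (t : Stacking (Box M)) : T k M u c n :=
  (Submodule.span k (relations k M u c n)).mkQ (Finsupp.single t 1)

variable {k}

theorem gen_of_not_good {u : Bool} {c : Colour} {n : ℤ} {t : Stacking (Box M)}
    (h : ¬ Good u c n t) : gen k u c n t = 0 :=
  (Submodule.Quotient.mk_eq_zero _).2 (Submodule.subset_span (Or.inl ⟨t, h, rfl⟩))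

theorem gen_fill {u : Bool} {c : Colour} {n : ℤ} {W : Stacking (Option (Box M))} (hW : OneHole W)
    (c' : Colour) (n' : ℤ) (a : k) (x y : M c' n') :
    gen k u c n (fill W ⟨c', n', a • x + y⟩) =
      a • gen k u c n (fill W ⟨c', n', x⟩) + gen k u c n (fill W ⟨c', n', y⟩) := by
  refine sub_eq_zero.1 ((Submodule.Quotient.mk_eq_zero _).2
    (Submodule.subset_span (Or.inr ⟨W, hW, c', n', x, y, a, rfl⟩)))

/-- `gen` is linear in every label. -/
theorem gen_map {β : Type w} {u : Bool} {c : Colour} {n : ℤ} (S : Stacking β) (p : β → Bool)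
    (hp : S.nodes.countP p = 1) (c' : Colour) (n' : ℤ) (a : k) (x y : M c' n')
    (h0 h1 h2 : β → Box M)
    (e1 : ∀ b ∈ S.nodes, p b = false → h1 b = h0 b) (e2 : ∀ b ∈ S.nodes, p b = false → h2 b = h0 b)
    (f0 : ∀ b ∈ S.nodes, p b = true → h0 b = ⟨c', n', a • x + y⟩)
    (f1 : ∀ b ∈ S.nodes, p b = true → h1 b = ⟨c', n', x⟩)
    (f2 : ∀ b ∈ S.nodes, p b = true → h2 b = ⟨c', n', y⟩) :
    gen k u c n (S.map h0) = a • gen k u c n (S.map h1) + gen k u c n (S.map h2) := by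
  have key : ∀ (h : β → Box M) (z : M c' n'), (∀ b ∈ S.nodes, p b = false → h b = h0 b) →
      (∀ b ∈ S.nodes, p b = true → h b = ⟨c', n', z⟩) →
      S.map h = fill (S.map fun b => if p b then none else some (h0 b)) ⟨c', n', z⟩ := by
    intro h z e f
    rw [fill, map_map]
    refine map_congr fun b hb => ?_
    cases hpb : p b
    · simpa using e b hb hpb
    · simpa using f b hb hpb
  rw [key h0 _ (fun _ _ _ => rfl) f0, key h1 _ e1 f1, key h2 _ e2 f2]
  refine gen_fill ?_ c' n' a x y
  rw [OneHole, nodes_map, List.countP_map, ← hp]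
  refine List.countP_congr fun b _ => ?_
  cases h : p b <;> simp [h]

variable {N : Type w} [AddCommGroup N] [Module k N]

open Classical in
/-- The linear map defined by a function on stackings of elements which is multilinear in the
elements. -/
noncomputable def T.lift (u : Bool) (c : Colour) (n : ℤ) (F : Stacking (Box M) → N)
    (hF : ∀ W : Stacking (Option (Box M)), OneHole W → ∀ (c' : Colour) (n' : ℤ) (a : k)
      (x y : M c' n'), F (fill W ⟨c', n', a • x + y⟩) =
        a • F (fill W ⟨c', n', x⟩) + F (fill W ⟨c', n', y⟩)) :
    T k M u c n →ₗ[k] N :=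
  Submodule.liftQ _ (Finsupp.lift N k _ fun t => if Good u c n t then F t else 0) <| by
    rw [Submodule.span_le]
    rintro z (⟨t, ht, rfl⟩ | ⟨W, hW, c', n', x, y, a, rfl⟩)
    · simp [Finsupp.lift_apply, ht]
    · have h : ∀ z : M c' n', Good u c n (fill W ⟨c', n', z⟩) ↔
          Good u c n (fill W ⟨c', n', 0⟩) := by
        intro z
        have e1 : ∀ z : M c' n', (fun o : Option (Box M) => (o.getD ⟨c', n', z⟩).c) =
            fun o => (o.getD ⟨c', n', 0⟩).c := fun z => by funext o; cases o <;> rfl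
        have e2 : ∀ z : M c' n', (fun o : Option (Box M) => (o.getD ⟨c', n', z⟩).deg) =
            fun o => (o.getD ⟨c', n', 0⟩).deg := fun z => by funext o; cases o <;> rfl
        simp only [Good, fill, valid_map, arity_map, degree, nodes_map, List.map_map,
          Function.comp_def, e1 z, e2 z, ne_eq, map_eq_eta]
      rw [SetLike.mem_coe, LinearMap.mem_ker, map_sub, map_add, map_smul]
      simp only [Finsupp.lift_apply, Finsupp.sum_single_index, zero_smul, one_smul, h (a • x + y),
        h x, h y]
      split_ifs
      · rw [hF W hW, sub_self]
      · simp

open Classical in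
theorem T.lift_gen (u : Bool) (c : Colour) (n : ℤ) (F : Stacking (Box M) → N) (hF)
    (t : Stacking (Box M)) :
    T.lift (k := k) u c n F hF (gen k u c n t) = if Good u c n t then F t else 0 := by
  refine (Submodule.liftQ_apply _ _ _).trans ?_
  simp [Finsupp.lift_apply]

theorem T.hom_ext {u : Bool} {c : Colour} {n : ℤ} {f g : T k M u c n →ₗ[k] N}
    (h : ∀ t, Good u c n t → f (gen k u c n t) = g (gen k u c n t)) : f = g := by
  refine Submodule.linearMap_qext _ (Finsupp.lhom_ext' fun t => LinearMap.ext_ring ?_)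
  by_cases ht : Good u c n t
  · exact h t ht
  · have h0 := gen_of_not_good (k := k) ht
    have e : ∀ f : T k M u c n →ₗ[k] N, f (gen k u c n t) = 0 := fun f => by rw [h0, map_zero]
    exact (e f).trans (e g).symm

/-- The `i`-th element of a stacking of elements. -/
def lookup (t : Stacking (Box M)) (i : ℕ) : Box M := t.nodes.getD i ⟨⟨0, 0, 0⟩, 0, 0⟩

theorem lookup_fill {W : Stacking (Option (Box M))} (hW : OneHole W) :
    ∃ (i : ℕ) (v : ℕ → Box M), i < W.size ∧ ∀ b, lookup (fill W b) = Function.update v i b := by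
  have key : ∀ l : List (Option (Box M)), l.countP Option.isNone = 1 →
      ∃ i : ℕ, l[i]? = some none ∧ ∀ j, j ≠ i → l[j]? ≠ some none := by
    intro l
    induction l with
    | nil => simp
    | cons o l ih =>
      intro h
      cases o with
      | none =>
        have h0 : ∀ o ∈ l, ¬ Option.isNone o = true := by
          simpa [List.countP_eq_zero] using h
        refine ⟨0, rfl, fun j hj hj' => ?_⟩
        obtain ⟨j, rfl⟩ := Nat.exists_eq_succ_of_ne_zero hj
        exact h0 none (List.mem_of_getElem? hj') rfl
      | some b =>
        obtain ⟨i, h1, h2⟩ := ih (by simpa using h)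
        refine ⟨i + 1, by simpa using h1, fun j hj => ?_⟩
        cases j with
        | zero => simp
        | succ j => simpa using h2 j (by omega)
  obtain ⟨i, h1, h2⟩ := key _ hW
  refine ⟨i, lookup (fill W ⟨⟨0, 0, 0⟩, 0, 0⟩), ?_, fun b => ?_⟩
  · exact (List.getElem?_eq_some_iff.1 h1).1
  · funext j
    by_cases hj : j = i
    · subst hj
      simp [lookup, fill, nodes_map, List.getD_eq_getElem?_getD, h1]
    · rw [Function.update_of_ne hj]
      simp only [lookup, fill, nodes_map, List.getD_eq_getElem?_getD, List.getElem?_map]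
      cases h : W.nodes[j]? with
      | none => rfl
      | some o =>
        cases o with
        | none => exact absurd h (h2 j hj)
        | some b => rfl

theorem countP_skel {β : Type w} (t : Stacking β) (i : ℕ) (hi : i < t.size) :
    t.skel.nodes.countP (fun j => decide (j = i)) = 1 := by
  rw [nodes_skel]
  exact (List.count_eq_one_of_mem List.nodup_range (List.mem_range.2 hi))

end Modules

section Functors

variable {k : Type u} [CommRing k]
variable {M : Colour → ℤ → Type v} [∀ c n, AddCommGroup (M c n)] [∀ c n, Module k (M c n)]
variable {M' : Colour → ℤ → Type w} [∀ c n, AddCommGroup (M' c n)] [∀ c n, Module k (M' c n)]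

def Box.map (f : ∀ c n, M c n →ₗ[k] M' c n) (b : Box M) : Box M' := ⟨b.c, b.deg, f b.c b.deg b.x⟩

/-- Apply a map of degree `e`. -/
def Box.shift (g : ∀ c i j, M c i →ₗ[k] M' c j) (e : ℤ) (b : Box M) : Box M' :=
  ⟨b.c, b.deg + e, g b.c b.deg (b.deg + e) b.x⟩

/-- The functor `T` on maps of degree `0`. -/
noncomputable def T.map (u : Bool) (f : ∀ c n, M c n →ₗ[k] M' c n) (c : Colour) (n : ℤ) :
    T k M u c n →ₗ[k] T k M' u c n :=
  T.lift u c n (fun t => gen k u c n (Stacking.map (Box.map f) t)) <| by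
    intro W hW c' n' a x y
    simp only [fill, map_map]
    refine gen_map W Option.isNone hW c' n' a (f c' n' x) (f c' n' y) _ _ _ ?_ ?_ ?_ ?_ ?_ <;>
      intro o _ ho <;> cases o <;> simp_all [Box.map]

/-- The inclusion of the stackings with at least one box. -/
noncomputable def T.incl (c : Colour) (n : ℤ) : T k M false c n →ₗ[k] T k M true c n :=
  T.lift false c n (fun t => gen k true c n t) fun _ hW c' n' a x y => gen_fill hW c' n' a x y

/-- The pseudo-linear composite `T(f; g)`, for `f` of degree `0` and `g` of degree `e`:
`(S; x₁, …, xₙ) ↦ ∑ₘ (-1)^(e (|x₁| + … + |xₘ₋₁|)) (S; f x₁, …, g xₘ, …, f xₙ)`. -/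
noncomputable def T.inf (u : Bool) (f : ∀ c n, M c n →ₗ[k] M' c n)
    (g : ∀ c i j, M c i →ₗ[k] M' c j) (e : ℤ) (c : Colour) (i j : ℤ) :
    T k M u c i →ₗ[k] T k M' u c j :=
  T.lift u c i (fun t => ∑ m ∈ Finset.range t.size,
      ((e * ∑ l ∈ Finset.range m, (lookup t l).deg).negOnePow : ℤ) •
        gen k u c j (t.skel.map fun l =>
          if l = m then (lookup t l).shift g e else (lookup t l).map f)) <| by
    intro W hW c' n' a x y
    obtain ⟨i0, v, hi0, hv⟩ := lookup_fill hW
    simp only [hv, update_deg]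
    simp only [fill, skel_map, size_map, Finset.smul_sum, ← Finset.sum_add_distrib]
    refine Finset.sum_congr rfl fun m _ => ?_
    rw [smul_comm a, ← smul_add]
    congr 1
    by_cases hm : i0 = m
    · subst hm
      refine gen_map W.skel (fun j => decide (j = i0)) (countP_skel W i0 hi0) c' (n' + e) a
        (g c' n' (n' + e) x) (g c' n' (n' + e) y) _ _ _ ?_ ?_ ?_ ?_ ?_ <;>
      intro o _ ho <;>
      simp only [decide_eq_true_eq, decide_eq_false_iff_not] at ho
      · simp [ho]
      · simp [ho]
      all_goals
        subst ho
        simp only [if_true, Function.update_self]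
        simp [Box.shift]
    · refine gen_map W.skel (fun j => decide (j = i0)) (countP_skel W i0 hi0) c' n' a
        (f c' n' x) (f c' n' y) _ _ _ ?_ ?_ ?_ ?_ ?_ <;>
      intro o _ ho <;>
      simp only [decide_eq_true_eq, decide_eq_false_iff_not] at ho
      · simp [Function.update_of_ne ho]
      · simp [Function.update_of_ne ho]
      all_goals
        subst ho
        simp only [hm, if_false, Function.update_self]
        simp [Box.map]

open Classical in
/-- The element of a box, as an element of `M c n`; zero if the box has another colour or degree. -/
noncomputable def Box.val (b : Box M) (c : Colour) (n : ℤ) : M c n :=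
  if h : b.c = c ∧ b.deg = n then h.1 ▸ h.2 ▸ b.x else 0

theorem Box.val_linear (c' : Colour) (n' : ℤ) (a : k) (x y : M c' n') (c : Colour) (n : ℤ) :
    (⟨c', n', a • x + y⟩ : Box M).val c n =
      a • (⟨c', n', x⟩ : Box M).val c n + (⟨c', n', y⟩ : Box M).val c n := by
  unfold Box.val
  by_cases h : c' = c ∧ n' = n
  · obtain ⟨rfl, rfl⟩ := h
    simp
  · simp [h]

open Classical in
/-- The counit of the comonad: the projection to the one-box stackings. -/
noncomputable def counit (u : Bool) (c : Colour) (n : ℤ) : T k M u c n →ₗ[k] M c n :=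
  T.lift u c n (fun t => if ∃ c' : Colour, Stacking.map Box.c t = corolla id c' then
      (lookup t 0).val c n else 0) <| by
    intro W hW c' n' a x y
    obtain ⟨i0, v, hi0, hv⟩ := lookup_fill hW
    have e1 : ∀ z : M c' n', Stacking.map Box.c (fill W ⟨c', n', z⟩) =
        Stacking.map Box.c (fill W ⟨c', n', 0⟩) := fun z => by
      simp only [fill, map_map]
      refine map_congr fun o _ => ?_
      cases o <;> rfl
    simp only [e1 (a • x + y), e1 x, e1 y]
    split_ifs with h
    · obtain ⟨d, hd⟩ := h
      have h1 : W.size = 1 := by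
        have := congrArg Stacking.size hd
        simp only [fill, size_map] at this
        rw [this]
        simp [corolla, size, nodes]
      have h2 : i0 = 0 := by omega
      subst h2
      simp only [hv, Function.update_self]
      exact Box.val_linear c' n' a x y c n
    · simp

end Functors

section Decomposition

variable {k : Type u} [CommRing k]
variable {M : Colour → ℤ → Type v} [∀ c n, AddCommGroup (M c n)] [∀ c n, Module k (M c n)]

variable (k) in
/-- A stacking of elements, as a label for a box. -/
noncomputable def part (X : Stacking (Box M)) : Box (T k M false) :=
  ⟨X.arity Box.c, degree X, gen k false _ _ X⟩

theorem unique_part (l : List (Stacking ℕ)) (i : ℕ) (h : (l.flatMap nodes).count i = 1) :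
    ∃ X : Stacking ℕ, X.nodes.count i = 1 ∧ l.countP (fun Y => decide (i ∈ Y.nodes)) = 1 ∧
      ∀ Y ∈ l, i ∈ Y.nodes → Y = X := by
  induction l with
  | nil => simp at h
  | cons Z l ih =>
    rw [List.flatMap_cons, List.count_append] at h
    by_cases hZ : i ∈ Z.nodes
    · have h1 : 0 < Z.nodes.count i := List.count_pos_iff.2 hZ
      have h2 : (l.flatMap nodes).count i = 0 := by omega
      rw [List.count_eq_zero] at h2
      have h3 : ∀ Y ∈ l, i ∉ Y.nodes := fun Y hY hi => h2 (List.mem_flatMap.2 ⟨Y, hY, hi⟩)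
      refine ⟨Z, by omega, ?_, ?_⟩
      · rw [List.countP_cons_of_pos (by simpa using hZ), List.countP_eq_zero.2]
        intro Y hY
        simpa using h3 Y hY
      · intro Y hY hi
        rcases List.mem_cons.1 hY with rfl | hY
        · rfl
        · exact absurd hi (h3 Y hY)
    · have h1 : Z.nodes.count i = 0 := List.count_eq_zero.2 hZ
      obtain ⟨X, hX, hc, hu⟩ := ih (by omega)
      refine ⟨X, hX, ?_, ?_⟩
      · rw [List.countP_cons_of_neg (by simpa using hZ), hc]
      · intro Y hY hi
        rcases List.mem_cons.1 hY with rfl | hY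
        · exact absurd hi hZ
        · exact hu Y hY hi

theorem nodes_countP_eq (X : Stacking ℕ) (i : ℕ) :
    X.nodes.countP (fun j => decide (j = i)) = X.nodes.count i := rfl

/-- The comultiplication of the comonad: the sum over all ways to decompose a stacking into
nonempty substackings, with the Koszul sign of the reordering of the elements. -/
noncomputable def decomp (u : Bool) (c : Colour) (n : ℤ) :
    T k M u c n →ₗ[k] T k (T k M false) u c n :=
  T.lift u c n (fun t =>
      ∑ N ∈ (finite_nestings (fun i => (lookup t i).c) t.skel).toFinset,
        (koszul (fun i => (lookup t i).deg) N.nestNodes : ℤ) •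
          gen k u c n (Stacking.map (fun X => part k (Stacking.map (lookup t) X)) N)) <| by
    intro W hW c' n' a x y
    obtain ⟨i0, v, hi0, hv⟩ := lookup_fill hW
    simp only [hv, update_deg, update_c]
    simp only [fill, skel_map, Finset.smul_sum, ← Finset.sum_add_distrib]
    refine Finset.sum_congr rfl fun N hN => ?_
    rw [smul_comm a, ← smul_add]
    congr 1
    obtain ⟨hN1, -, hN2⟩ := (Set.Finite.mem_toFinset _).1 hN
    have hc : N.nestNodes.count i0 = 1 := by
      have h1 := count_flatten i0 N _ (fun _ => rfl) hN1.2
      have h2 := countP_skel W i0 hi0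
      rw [nodes_countP_eq, ← hN2] at h2
      have h3 : List.count i0 N.flatten.nodes = 1 := h2
      convert h3 using 1
      convert h1.symm
    obtain ⟨X, hX, hcX, huX⟩ := unique_part N.nodes i0 hc
    have harity : ∀ z : M c' n', arity Box.c (Stacking.map (Function.update v i0 ⟨c', n', z⟩) X) =
        arity (Function.update (fun j => (v j).c) i0 c') X := fun z => by
      rw [arity_map]; simp only [update_c]
    have hdeg : ∀ z : M c' n', degree (Stacking.map (Function.update v i0 ⟨c', n', z⟩) X) =
        (X.nodes.map (Function.update (fun j => (v j).deg) i0 n')).sum := fun z => by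
      rw [degree, nodes_map, List.map_map]
      congr 1
      refine List.map_congr_left fun j _ => ?_
      simp only [Function.comp, update_deg]
    have hpart : ∀ z : M c' n', part k (Stacking.map (Function.update v i0 ⟨c', n', z⟩) X) =
        ⟨arity (Function.update (fun j => (v j).c) i0 c') X,
          (X.nodes.map (Function.update (fun j => (v j).deg) i0 n')).sum,
          gen k false _ _ (Stacking.map (Function.update v i0 ⟨c', n', z⟩) X)⟩ := fun z => by
      rw [part, harity, hdeg]
    have hne : ∀ (z z' : M c' n') (Y : Stacking ℕ), i0 ∉ Y.nodes →
        Stacking.map (Function.update v i0 ⟨c', n', z⟩) Y =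
          Stacking.map (Function.update v i0 ⟨c', n', z'⟩) Y := fun z z' Y hY =>
      map_congr fun j hj => by
        have : j ≠ i0 := fun h => hY (h ▸ hj)
        simp [this]
    refine gen_map N (fun Y => decide (i0 ∈ Y.nodes)) hcX
      (arity (Function.update (fun j => (v j).c) i0 c') X)
      (X.nodes.map (Function.update (fun j => (v j).deg) i0 n')).sum a
      (gen k false _ _ (Stacking.map (Function.update v i0 ⟨c', n', x⟩) X))
      (gen k false _ _ (Stacking.map (Function.update v i0 ⟨c', n', y⟩) X)) _ _ _ ?_ ?_ ?_ ?_ ?_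
    · intro Y _ hY; rw [hne _ _ Y (by simpa using hY)]
    · intro Y _ hY; rw [hne _ _ Y (by simpa using hY)]
    · intro Y hY hi
      rw [huX Y hY (by simpa using hi), hpart]
      congr 1
      refine gen_map X (fun j => decide (j = i0)) hX c' n' a x y _ _ _ ?_ ?_ ?_ ?_ ?_ <;>
        intro o _ ho <;>
        simp only [decide_eq_true_eq, decide_eq_false_iff_not] at ho <;>
        simp [ho]
    · intro Y hY hi
      rw [huX Y hY (by simpa using hi), hpart]
    · intro Y hY hi
      rw [huX Y hY (by simpa using hi), hpart]

end Decomposition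

/-! ### Differentials, conilpotent dg box cooperads, coderivations -/

section Cooperads

variable {k : Type u} [CommRing k]
variable {C : Colour → ℤ → Type v} [∀ c n, AddCommGroup (C c n)] [∀ c n, Module k (C c n)]

/-- A family of maps `C c i → C c j` is homogeneous of degree `-1` and squares to zero. -/
def IsDifferential (d : ∀ c i j, C c i →ₗ[k] C c j) : Prop :=
  (∀ c i j, j + 1 ≠ i → d c i j = 0) ∧ ∀ c i j l, d c j l ∘ₗ d c i j = 0

/-- A coalgebra in dg modules over the comonad `T k · false`; `C` is the coaugmentation coideal of
the conilpotent dg box cooperad. -/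
structure IsConilpotentDGBoxCooperad (d : ∀ c i j, C c i →ₗ[k] C c j)
    (Δ : ∀ c n, C c n →ₗ[k] T k C false c n) : Prop where
  differential : IsDifferential d
  counit_comp : ∀ c n, counit false c n ∘ₗ Δ c n = LinearMap.id
  coassoc : ∀ c n, T.map false Δ c n ∘ₗ Δ c n = decomp false c n ∘ₗ Δ c n
  comul_d : ∀ c i j,
    T.inf false (fun _ _ => LinearMap.id) d (-1) c i j ∘ₗ Δ c i = Δ c j ∘ₗ d c i j

end Cooperads

/-! ### dg box operads -/

/-- A dg box operad: an algebra in dg modules over the monad `T k · true`, whose multiplication is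
the substitution of stackings. `mu (S; x₁, …, xₙ)` is the composite of the `xᵢ` along `S`. -/
structure DGBoxOperad (k : Type u) [CommRing k] where
  carrier : Colour → ℤ → Type v
  [addCommGroup : ∀ c n, AddCommGroup (carrier c n)]
  [module : ∀ c n, Module k (carrier c n)]
  d : ∀ c i j, carrier c i →ₗ[k] carrier c j
  differential : IsDifferential d
  mu : ∀ c n, T k carrier true c n →ₗ[k] carrier c n
  mu_corolla : ∀ b : Box carrier, mu b.c b.deg (gen k true b.c b.deg (corolla Box.c b)) = b.x
  /-- Associativity: if the boxes of `N.flatten` are numbered in standard order, then composing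
  first the parts of `N` and then the results agrees with composing along `N.flatten`, up to the
  Koszul sign. -/
  mu_flatten : ∀ (N : Stacking (Stacking ℕ)) (v : ℕ → Box carrier) (c : Colour) (n : ℤ),
    N.NestValid (fun i => (v i).c) → N.flatten.nodes = List.range N.flatten.size →
    Good true c n (Stacking.map v N.flatten) →
    mu c n (gen k true c n (Stacking.map v N.flatten)) =
      (koszul (fun i => (v i).deg) N.nestNodes : ℤ) •
        mu c n (gen k true c n (Stacking.map (fun X =>
          (⟨arity Box.c (Stacking.map v X), degree (Stacking.map v X),
            mu _ _ (gen k true _ _ (Stacking.map v X))⟩ : Box carrier)) N))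
  mu_d : ∀ c i j, mu c j ∘ₗ T.inf true (fun _ _ => LinearMap.id) d (-1) c i j = d c i j ∘ₗ mu c i

attribute [instance] DGBoxOperad.addCommGroup DGBoxOperad.module

variable {k : Type u} [CommRing k]

/-- An augmentation: a morphism of dg box operads to the unit box operad, which is `k` in colour
`(0, 1, 0)` and degree `0`, and zero otherwise. -/
structure DGBoxOperad.Augmentation (B : DGBoxOperad.{u, v} k) where
  aug : ∀ c n, B.carrier c n →ₗ[k] k
  aug_eq_zero : ∀ c n, ¬ (c = ⟨0, 1, 0⟩ ∧ n = 0) → aug c n = 0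
  aug_d : ∀ c i j, aug c j ∘ₗ B.d c i j = 0
  aug_mu : ∀ c n t, Good true c n t →
    aug c n (B.mu c n (gen k true c n t)) = (t.nodes.map fun b => aug b.c b.deg b.x).prod

open Classical in
/-- The degree of the suspension on boxes of colour `c`. -/
noncomputable def thinShift (c : Colour) : ℤ := if c.Thin then 1 else 0

/-- The thin suspension. -/
def sThin (M : Colour → ℤ → Type v) (c : Colour) (n : ℤ) : Type v := M c (n - thinShift c)

noncomputable instance (M : Colour → ℤ → Type v) [∀ c n, AddCommGroup (M c n)] (c : Colour) (n : ℤ) :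
    AddCommGroup (sThin M c n) := inferInstanceAs (AddCommGroup (M c (n - thinShift c)))

noncomputable instance (M : Colour → ℤ → Type v) [∀ c n, AddCommGroup (M c n)] [∀ c n, Module k (M c n)]
    (c : Colour) (n : ℤ) : Module k (sThin M c n) :=
  inferInstanceAs (Module k (M c (n - thinShift c)))

/-- Remove the thin suspension from an element. -/
noncomputable def unsuspend {M : Colour → ℤ → Type v} (b : Box (sThin M)) : Box M :=
  ⟨b.c, b.deg - thinShift b.c, b.x⟩

open Classical in
/-- The sign of the thin suspended infinitesimal composition, for a stacking whose boxes are
labelled by their colour and the degree of the (unsuspended) element; zero if the stacking is not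
thin-quadratic. -/
noncomputable def barSign (S : Stacking (Colour × ℤ)) : ℤ :=
  if (S.map Prod.fst).IsTypeI then (((S.nodes.map Prod.snd).headD 0 + 1).negOnePow : ℤ)
  else if (S.map Prod.fst).IsTypeII then (((S.nodes.map Prod.snd).headD 0).negOnePow : ℤ)
  else if (S.map Prod.fst).IsTypeIII then -1
  else 0

namespace DGBoxOperad.Augmentation

variable {B : DGBoxOperad.{u, v} k} (ε : B.Augmentation)

/-- The augmentation ideal. -/
abbrev ideal (c : Colour) (n : ℤ) : Type v := LinearMap.ker (ε.aug c n)

/-- Its differential. -/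
def idealD (c : Colour) (i j : ℤ) : ε.ideal c i →ₗ[k] ε.ideal c j :=
  (B.d c i j ∘ₗ Submodule.subtype _).codRestrict _ fun x =>
    LinearMap.congr_fun (ε.aug_d c i j) x.1

/-- The composition of the augmentation ideal. -/
noncomputable def idealMu (c : Colour) (n : ℤ) : T k ε.ideal false c n →ₗ[k] ε.ideal c n :=
  (B.mu c n ∘ₗ T.incl c n ∘ₗ T.map false (fun _ _ => Submodule.subtype _) c n).codRestrict _ <| by
    intro z
    rw [LinearMap.mem_ker, ← LinearMap.comp_apply]
    refine LinearMap.congr_fun (g := 0) (T.hom_ext fun t ht => ?_) z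
    have e : T.map false (fun c n => Submodule.subtype (LinearMap.ker (ε.aug c n))) c n
        (gen k false c n t) = gen k false c n (Stacking.map (Box.map fun _ _ =>
          Submodule.subtype _) t) := by
      rw [T.map, T.lift_gen, if_pos ht]
    simp only [LinearMap.comp_apply, LinearMap.zero_apply, e]
    rw [T.incl, T.lift_gen]
    split_ifs with h
    · rw [ε.aug_mu _ _ _ ⟨h.1, h.2.1, h.2.2.1, by simp⟩]
      cases t with
      | eta => exact absurd rfl (ht.2.2.2 rfl)
      | box b n w ch =>
        simp only [Stacking.map, nodes, List.map_cons, List.prod_cons]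
        have : ε.aug (Box.map (fun _ _ => Submodule.subtype _) b).c
            (Box.map (fun _ _ => Submodule.subtype _) b).deg
            (Box.map (fun c n => Submodule.subtype (LinearMap.ker (ε.aug c n))) b).x = 0 := b.x.2
        rw [this, zero_mul]
    · simp

/-- The thin suspension of the augmentation ideal. -/
abbrev sIdeal : Colour → ℤ → Type v := sThin ε.ideal

/-- The differential of the thin suspension: `d (s x) = - s (d x)` on thin boxes. -/
noncomputable def sIdealD (c : Colour) (i j : ℤ) : ε.sIdeal c i →ₗ[k] ε.sIdeal c j :=
  ((thinShift c).negOnePow : ℤ) •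
    (ε.idealD c (i - thinShift c) (j - thinShift c) : ε.sIdeal c i →ₗ[k] ε.sIdeal c j)

/-- The composite `T(s B) → s B ⟶ B` of the projection to the thin-quadratic stackings, the thin
suspended infinitesimal composition, and the removal of the suspension. -/
noncomputable def infCompAux (u : Bool) (c : Colour) (i m : ℤ) :
    T k ε.sIdeal u c i →ₗ[k] ε.ideal c m :=
  T.lift u c i (fun t => barSign (Stacking.map (fun b => (b.c, b.deg - thinShift b.c)) t) •
      ε.idealMu c m (gen k false c m (Stacking.map unsuspend t))) <| by
    intro W hW c' n' a x y
    have e1 : ∀ z : ε.sIdeal c' n',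
        Stacking.map (fun b => (b.c, b.deg - thinShift b.c)) (fill W ⟨c', n', z⟩) =
        Stacking.map (fun b => (b.c, b.deg - thinShift b.c)) (fill W ⟨c', n', 0⟩) := fun z => by
      simp only [fill, map_map]
      refine map_congr fun o _ => ?_
      cases o <;> rfl
    have e2 : gen k false c m (Stacking.map unsuspend (fill W ⟨c', n', a • x + y⟩)) =
        a • gen k false c m (Stacking.map unsuspend (fill W ⟨c', n', x⟩)) +
          gen k false c m (Stacking.map unsuspend (fill W ⟨c', n', y⟩)) := by
      simp only [fill, map_map]
      refine gen_map (M := ε.ideal) W Option.isNone hW c' (n' - thinShift c') a x y _ _ _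
        ?_ ?_ ?_ ?_ ?_ <;>
      intro o _ ho <;> cases o <;> first | rfl | simp_all
    rw [e1 (a • x + y), e1 x, e1 y, e2, map_add, map_smul, smul_add, smul_comm]

/-- The projection of `T(s B)` to the thin-quadratic stackings, followed by the thin suspended
infinitesimal composition; it is homogeneous of degree `-1`. -/
noncomputable def infComp (u : Bool) (c : Colour) (i j : ℤ) :
    T k ε.sIdeal u c i →ₗ[k] ε.sIdeal c j :=
  ε.infCompAux u c i (j - thinShift c)

/-- The differential `d_{s B}` of `T(s B)` induced by the differential of `B`. -/
noncomputable def barInternal (u : Bool) :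
    ∀ c i j, T k ε.sIdeal u c i →ₗ[k] T k ε.sIdeal u c j :=
  T.inf u (fun _ _ => LinearMap.id) ε.sIdealD (-1)

/-- The coderivation `d_□` of `T(s B)` induced by the thin suspended infinitesimal composition. -/
noncomputable def barSquare (u : Bool) (c : Colour) (i j : ℤ) :
    T k ε.sIdeal u c i →ₗ[k] T k ε.sIdeal u c j :=
  T.inf u (counit false) (ε.infComp false) (-1) c i j ∘ₗ decomp u c i

/-- The differential of the bar construction. -/
noncomputable def barD (u : Bool) (c : Colour) (i j : ℤ) :
    T k ε.sIdeal u c i →ₗ[k] T k ε.sIdeal u c j :=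
  ε.barInternal u c i j + ε.barSquare u c i j

end DGBoxOperad.Augmentation

end BoxOperad

/-!
# The bar construction of an augmented dg box operad

All the maps in question are coderivations of the cofree conilpotent box cooperad `T`. The
comultiplication of `T` is natural with respect to infinitesimal composites (`decomp_comp_inf`) and
coassociative (`map_decomp_comp_decomp`), so a map `φ` of degree `-1` from `T` to its cogenerators
is the corestriction of exactly one coderivation, `T(ε; φ) ∘ Δ` (`counit_comp_coderivation`,
`inf_coderivation_comp_decomp`, `eq_coderivation`). The square of a coderivation of odd degree is
governed by its corestriction: it vanishes as soon as `φ` composed with the coderivation does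
(`coderivation_comp_self`). Hence everything follows from three facts on the thin suspended
infinitesimal composition `ψ` (`bar_properties`): it has degree `-1`, it anticommutes with the
internal differential, and `ψ ∘ d_□ = 0`. Signs of permutations are handled by the relation `KPerm`,
which only needs a symmetric pairing, so that several sign rules can be compared at once.

To prove `ψ ∘ d_□ = 0`, the thin-quadratic stackings are described without the graph. A horizontal
cut separates the lower horizontal lines of a stacking from the upper ones (`Level`), and unions of
connected components of the horizontal composite graph correspond to cuts. So a stacking is
thin-quadratic if and only if it consists of two boxes, one on the other, without horizontal lines
over the lower one (`IsDuo`; types I and II), or has a thin box under non-thin ones and only the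
two trivial cuts (`IsPrime`; type III).

By associativity, `ψ ∘ d_□` on a stacking `S` is a multiple of the composite of all of `S`
(`infComp_comp_barSquare_of`), and the coefficient is the sum of the signs of the ways to write `S`
as a thin-quadratic stacking of single boxes and one thin-quadratic substacking. If there is such a
pair, then `S` either consists of three boxes and is flat, or has the cuts of a prime stacking and
exactly one more thin box `t` besides the bottom one, since cuts do not see the decomposition
(`IsNest.level_nest`). In both cases there are exactly two pairs (`IsDoublePrime.exists_two_pairs`,
`IsTriple.exists_two_pairs`). One of them joins `t` with the box below it. In the other one `t` is
the bottom box of a prime substacking, which is the lower part of the lowest cut of what is over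
`t`; or, if there are no horizontal lines over `t`, then `t` is at the top and is taken off. The
signs of the two pairs are opposite (`pairCoeff_doublePrime`, `pairCoeff_triple`).
-/

set_option linter.unusedSectionVars false

namespace BoxOperad

/-! ### Grafting and flattening -/

namespace Stacking

variable {α : Type u} {β : Type v} {γ : Type w}

theorem before_zero {n : ℕ} (f : Fin n → ℕ) : before f 0 = 0 := by simp [before]

theorem before_const_one {n : ℕ} (i : ℕ) (h : i ≤ n) : before (fun _ : Fin n => 1) i = i := by
  induction i with
  | zero => exact before_zero _
  | succ i ih =>
    have := before_succ (fun _ : Fin n => 1) ⟨i, h⟩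
    simp only at this
    rw [this, ih (by omega)]

theorem before_le_sum {n : ℕ} (f : Fin n → ℕ) (i : ℕ) : before f i ≤ ∑ j, f j := by
  refine Finset.sum_le_sum fun j _ => ?_
  split_ifs <;> simp

theorem before_add_le {n : ℕ} (f : Fin n → ℕ) (i : Fin n) : before f i + f i ≤ ∑ j, f j := by
  rw [← before_succ]; exact before_le_sum f _

/-- Offsets add up along a row. -/
theorem offset_before {n : ℕ} (F : ℕ → ℕ) (o : ℕ) (f g : Fin n → ℕ)
    (h : ∀ i : Fin n, F (o + before f i) + g i = F (o + (before f i + f i))) (i : ℕ) (hi : i ≤ n) :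
    F o + before g i = F (o + before f i) := by
  induction i with
  | zero => simp [before_zero]
  | succ i ih =>
    have h1 := before_succ f ⟨i, hi⟩
    have h2 := before_succ g ⟨i, hi⟩
    simp only at h1 h2
    rw [h1, h2, ← add_assoc, ih (by omega)]
    exact h ⟨i, hi⟩

/-- `graft` only reads the values of its arguments on the vertical inputs. -/
theorem graft_congr (X : Stacking α) {w w' : ℕ → ℕ} {ch ch' : ℕ → Stacking α} {o o' : ℕ}
    (hw : ∀ i ≤ X.leaves, w (o + i) = w' (o' + i))
    (hc : ∀ i < X.leaves, ch (o + i) = ch' (o' + i)) :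
    X.graft w ch o = X.graft w' ch' o' := by
  induction X generalizing o o' with
  | eta => simpa [graft, leaves] using hc 0 (by simp [leaves])
  | box a n w₀ X ih =>
    simp only [graft, leaves] at *
    congr 1
    · funext i
      rw [hw _ (before_le_sum _ _)]
    · funext i
      have := before_add_le (fun j => (X j).leaves) i
      refine ih i (fun j hj => ?_) fun j hj => ?_
      · rw [add_assoc, add_assoc]; exact hw _ (by omega)
      · rw [add_assoc, add_assoc]; exact hc _ (by omega)

/-- Grafting determines the widths and the upper parts. -/
theorem graft_inj (X : Stacking α) {w w' : ℕ → ℕ} {ch ch' : ℕ → Stacking α} {o o' : ℕ}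
    (h : X.graft w ch o = X.graft w' ch' o') :
    (X ≠ eta → ∀ i ≤ X.leaves, w (o + i) = w' (o' + i)) ∧
      ∀ i < X.leaves, ch (o + i) = ch' (o' + i) := by
  induction X generalizing o o' with
  | eta =>
    refine ⟨fun h => absurd rfl h, fun i hi => ?_⟩
    simp only [leaves] at hi
    obtain rfl : i = 0 := by omega
    simpa [graft] using h
  | box a n w₀ X ih =>
    simp only [graft, box.injEq, heq_eq_eq, true_and] at h
    obtain ⟨h1, h2⟩ := h
    have h2' := fun i => ih i (congrFun h2 i)
    have seg : ∀ i < (box a n w₀ X).leaves, ∃ (j : Fin n) (l : ℕ), l < (X j).leaves ∧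
        i = before (fun j => (X j).leaves) j + l := by
      intro i hi
      simp only [leaves] at hi
      by_contra! hc
      have key : ∀ j : ℕ, j ≤ n → before (fun j => (X j).leaves) j ≤ i := by
        intro j
        induction j with
        | zero => intro _; simp [before_zero]
        | succ j ih =>
          intro hj
          have h1 := ih (by omega)
          have h2 := before_succ (fun j => (X j).leaves) ⟨j, hj⟩
          simp only at h2
          by_contra hlt
          exact hc ⟨j, hj⟩ (i - before (fun j => (X j).leaves) j) (by omega)
            (by dsimp only; omega)
      have := key n le_rfl
      rw [before_all _ _ le_rfl] at this
      omega
    refine ⟨fun _ i hi => ?_, fun i hi => ?_⟩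
    · simp only [leaves] at hi
      rcases exists_segment _ i hi with ⟨j, rfl⟩ | ⟨j, hj1, hj2⟩
      · exact Nat.add_left_cancel (congrFun h1 j)
      · have hne : X j ≠ eta := by
          intro h
          simp only [h, leaves] at hj2
          omega
        have := (h2' j).1 hne (i - before (fun j => (X j).leaves) j) (by omega)
        rw [add_assoc, add_assoc] at this
        rwa [Nat.add_sub_cancel' hj1.le] at this
    · obtain ⟨j, l, hl, rfl⟩ := seg i hi
      have := (h2' j).2 l hl
      rwa [add_assoc, add_assoc] at this

theorem map_graft (f : α → β) (X : Stacking α) (w : ℕ → ℕ) (ch : ℕ → Stacking α) (o : ℕ) :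
    (X.graft w ch o).map f = (X.map f).graft w (fun i => (ch i).map f) o := by
  induction X generalizing o with
  | eta => rfl
  | box a n w₀ X ih => simp only [graft, map, ih, leaves_map]

theorem map_flatten (f : α → β) (N : Stacking (Stacking α)) :
    N.flatten.map f = (N.map (Stacking.map f)).flatten := by
  induction N with
  | eta => rfl
  | box X n w ch ih =>
    simp only [flatten, map, map_graft]
    congr 1
    funext i
    split_ifs with h
    · exact ih _
    · rfl

theorem leaves_graft (X : Stacking α) (w : ℕ → ℕ) (ch : ℕ → Stacking α) (o : ℕ) :
    (X.graft w ch o).leaves = ∑ i ∈ Finset.range X.leaves, (ch (o + i)).leaves := by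
  induction X generalizing o with
  | eta => simp [graft, leaves]
  | box b n w' X ih =>
    simp only [graft, leaves, ih, add_assoc]
    rw [sum_segments (fun j => (X j).leaves) fun j => (ch (o + j)).leaves]

/-- Every part of a stacking of stackings has as many vertical inputs as the box it is substituted
for. This is the part of validity which the combinatorics of `flatten` depends on. -/
def Matched (N : Stacking (Stacking α)) : Prop :=
  ∃ c : Stacking α → Colour, (∀ X, (c X).q = X.leaves) ∧ N.Valid c

theorem Matched.of_valid {col : α → Colour} {N : Stacking (Stacking α)} (h : N.Valid (arity col)) :
    N.Matched := ⟨arity col, fun _ => rfl, h⟩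

theorem Matched.leaves_eq {X : Stacking α} {n w ch} (h : Matched (box X n w ch)) :
    X.leaves = n := by
  obtain ⟨c, hc, h1, -⟩ := h
  rw [← hc, h1]

theorem Matched.child {X : Stacking α} {n w ch} (h : Matched (box X n w ch)) (i) :
    Matched (ch i) := by
  obtain ⟨c, hc, -, h2⟩ := h
  exact ⟨c, hc, (h2 i).1⟩

theorem leaves_flatten {N : Stacking (Stacking α)} (h : N.Matched) :
    N.flatten.leaves = N.leaves := by
  induction N with
  | eta => rfl
  | box X n w ch ih =>
    rw [flatten, leaves_graft, h.leaves_eq, leaves]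
    refine sum_range_dite _ _ fun i => ?_
    simp [ih i (h.child i)]

/-- If `F` counts vertical inputs of the entries of a row from the left, then it does so for a row
of rows. -/
theorem offset_graft (X : Stacking α) (w : ℕ → ℕ) (ch : ℕ → Stacking α) (o : ℕ) (F : ℕ → ℕ)
    (hF : ∀ i < X.leaves, F (o + i + 1) = F (o + i) + (ch (o + i)).leaves) :
    F o + (X.graft w ch o).leaves = F (o + X.leaves) := by
  rw [leaves_graft]
  generalize X.leaves = n at *
  induction n with
  | zero => simp
  | succ n ih =>
    rw [Finset.sum_range_succ, ← add_assoc, ih fun i hi => hF i (by omega), ← hF n (by omega)]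
    rfl

/-- Grafting is associative: two rows on top of each other may be composed first, if `F` gives the
position of the inputs of the entries of the lower row. -/
theorem graft_graft (X : Stacking α) (w W : ℕ → ℕ) (ch CH : ℕ → Stacking α) (o : ℕ) (F : ℕ → ℕ)
    (hF : ∀ i < X.leaves, F (o + i + 1) = F (o + i) + (ch (o + i)).leaves) :
    (X.graft w ch o).graft W CH (F o) =
      X.graft (fun i => w i + W (F i)) (fun i => (ch i).graft W CH (F i)) o := by
  induction X generalizing o with
  | eta => rfl
  | box a n w₀ X ih =>
    simp only [graft]
    have hF' : ∀ (i : Fin n), ∀ j < (X i).leaves,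
        F (o + before (fun j => (X j).leaves) i + j + 1) =
        F (o + before (fun j => (X j).leaves) i + j) +
          (ch (o + before (fun j => (X j).leaves) i + j)).leaves := by
      intro i j hj
      have := before_add_le (fun j => (X j).leaves) i
      have := hF (before (fun j => (X j).leaves) i + j) (by simp only [leaves]; omega)
      simpa only [add_assoc] using this
    have key := offset_before F o (fun j => (X j).leaves)
      (fun j => ((X j).graft w ch (o + before (fun j => (X j).leaves) j)).leaves) (fun i => by
        rw [offset_graft (X i) w ch _ F (hF' i), add_assoc])
    congr 1
    · funext i
      rw [key i (Nat.lt_succ_iff.1 i.2), add_assoc]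
    · funext i
      rw [key i i.2.le]
      exact ih i _ (hF' i)

theorem graft_eta (X : Stacking α) (o : ℕ) : X.graft (fun _ => 0) (fun _ => eta) o = X := by
  induction X generalizing o with
  | eta => rfl
  | box a n w X ih => simp only [graft, ih, add_zero]

theorem graft_eta' {X : Stacking α} {w : ℕ → ℕ} {ch : ℕ → Stacking α} {o : ℕ}
    (hw : ∀ i ≤ X.leaves, w (o + i) = 0) (hc : ∀ i < X.leaves, ch (o + i) = eta) :
    X.graft w ch o = X := by
  conv_rhs => rw [← graft_eta X o]
  exact graft_congr X hw hc

theorem graft_corolla (col : α → Colour) (a : α) (w : ℕ → ℕ) (ch : ℕ → Stacking α) (o : ℕ) :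
    (corolla col a).graft w ch o = box a (col a).q (fun i => w (o + i)) (fun i => ch (o + i)) := by
  simp only [corolla, graft, leaves]
  congr 1
  · funext i; rw [before_const_one _ (Nat.lt_succ_iff.1 i.2), zero_add]
  · funext i; rw [before_const_one _ i.2.le]

theorem flatten_map_corolla (col : α → Colour) {S : Stacking α} (h : S.Valid col) :
    (S.map (corolla col)).flatten = S := by
  induction S with
  | eta => rfl
  | box a n w ch ih =>
    obtain ⟨h1, h2⟩ := h
    subst h1
    simp only [map, flatten, graft_corolla, zero_add]
    congr 1
    · funext i; rw [dif_pos i.2]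
    · funext i; simp [ih i (h2 i).1]

theorem flatten_corolla (c : Stacking α → Colour) (X : Stacking α) :
    (corolla c X).flatten = X := by
  rw [corolla, flatten]
  refine graft_eta' (fun i _ => ?_) fun i _ => ?_ <;> split_ifs <;> rfl

theorem flatten_graft (N : Stacking (Stacking α)) (w : ℕ → ℕ) (ch : ℕ → Stacking (Stacking α))
    (o : ℕ) (h : N.Matched) :
    (N.graft w ch o).flatten = N.flatten.graft w (fun i => (ch i).flatten) o := by
  induction N generalizing o with
  | eta => rfl
  | box X n w₀ Ch ih =>
    simp only [graft, flatten]
    have hl := h.leaves_eq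
    have := graft_graft X (fun i => if h : i < n + 1 then w₀ ⟨i, h⟩ else 0) w
      (fun i => if h : i < n then (Ch ⟨i, h⟩).flatten else eta) (fun i => (ch i).flatten) 0
      (fun i => o + before (fun j => (Ch j).leaves) i) (fun i hi => by
        rw [hl] at hi
        have := before_succ (fun j => (Ch j).leaves) ⟨i, hi⟩
        simp only at this
        simp only [zero_add, this, hi, dif_pos, add_assoc,
          leaves_flatten (h.child ⟨i, hi⟩)])
    simp only [before_zero, add_zero] at this
    rw [this]
    refine graft_congr X (fun i hi => ?_) fun i hi => ?_
    · simp only [zero_add]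
      rw [dif_pos (by omega), dif_pos (by omega)]
    · simp only [zero_add]
      rw [dif_pos (by omega), dif_pos (by omega)]
      exact ih _ _ (h.child _)

/-- Associativity of the substitution of stackings. -/
theorem flatten_flatten (Q : Stacking (Stacking (Stacking α))) (h : Q.Matched)
    (hQ : ∀ N ∈ Q.nodes, N.Matched) : Q.flatten.flatten = (Q.map flatten).flatten := by
  induction Q with
  | eta => rfl
  | box N n w ch ih =>
    simp only [flatten, map]
    rw [flatten_graft _ _ _ _ (hQ N (mem_nodes_box.2 (Or.inl rfl)))]
    refine graft_congr _ (fun i hi => rfl) fun i hi => ?_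
    simp only [zero_add]
    split_ifs with hn
    · exact ih _ (h.child _) fun X hX => hQ X (mem_nodes_box.2 (Or.inr ⟨_, hX⟩))
    · rfl

/-! ### Numbers of horizontal inputs and outputs of composites -/

/-- The stackings `ch (o + i)`, `i < n`, form a valid row with widths `w (o + i)`. -/
def Row (col : α → Colour) (w : ℕ → ℕ) (ch : ℕ → Stacking α) (o n : ℕ) : Prop :=
  ∀ i < n, (ch (o + i)).Valid col ∧ (ch (o + i)).left col = w (o + i) ∧
    (ch (o + i)).right col = w (o + i + 1)

theorem Row.segment {col : α → Colour} {w : ℕ → ℕ} {ch : ℕ → Stacking α} {o : ℕ} {n : ℕ}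
    {f : Fin n → ℕ} (h : Row col w ch o (∑ i, f i)) (i : Fin n) :
    Row col w ch (o + before f i) (f i) := by
  intro j hj
  have := before_add_le f i
  have := h (before f i + j) (by omega)
  simpa only [add_assoc] using this

theorem left_graft (col : α → Colour) (X : Stacking α) (w : ℕ → ℕ) (ch : ℕ → Stacking α) (o : ℕ)
    (h : Row col w ch o X.leaves) : (X.graft w ch o).left col = X.left col + w o := by
  cases X with
  | eta => simpa [graft, left] using (h 0 (by simp [leaves])).2.1
  | box a n w₀ X => simp [graft, left, before_zero, add_assoc]

theorem right_graft (col : α → Colour) (X : Stacking α) (w : ℕ → ℕ) (ch : ℕ → Stacking α) (o : ℕ)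
    (h : Row col w ch o X.leaves) :
    (X.graft w ch o).right col = X.right col + w (o + X.leaves) := by
  cases X with
  | eta => simpa [graft, right, leaves] using (h 0 (by simp [leaves])).2.2
  | box a n w₀ X =>
    simp [graft, right, leaves, before_all _ n le_rfl, add_assoc]

theorem valid_graft (col : α → Colour) (X : Stacking α) (w : ℕ → ℕ) (ch : ℕ → Stacking α) (o : ℕ)
    (hX : X.Valid col) (h : Row col w ch o X.leaves) : (X.graft w ch o).Valid col := by
  induction X generalizing o with
  | eta => exact (h 0 (by simp [leaves])).1
  | box a n w₀ X ih =>
    obtain ⟨h1, h2⟩ := hX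
    refine ⟨h1, fun i => ?_⟩
    have hr := h.segment i
    refine ⟨ih i _ (h2 i).1 hr, ?_, ?_⟩
    · rw [left_graft _ _ _ _ _ hr, (h2 i).2.1]; rfl
    · rw [right_graft _ _ _ _ _ hr, (h2 i).2.2]
      simp only [Fin.val_succ, before_succ, add_assoc]

theorem flatten_valid {col : α → Colour} {N : Stacking (Stacking α)} (h : N.NestValid col) :
    N.flatten.Valid col ∧ N.flatten.left col = N.left (arity col) ∧
      N.flatten.right col = N.right (arity col) := by
  induction N with
  | eta => exact ⟨trivial, rfl, rfl⟩
  | box X n w ch ih =>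
    obtain ⟨h0, h1, h2⟩ := h
    have h1' : X.leaves = n := h1
    have ih' := fun i => ih i ⟨fun Y hY => h0 Y (mem_nodes_box.2 (Or.inr ⟨i, hY⟩)), (h2 i).1⟩
    have hr : Row col (fun i => if h : i < n + 1 then w ⟨i, h⟩ else 0)
        (fun i => if h : i < n then (ch ⟨i, h⟩).flatten else eta) 0 X.leaves := by
      intro i hi
      rw [h1'] at hi
      have hi' : i < n + 1 := by omega
      obtain ⟨a, b, c⟩ := ih' ⟨i, hi⟩
      simp only [zero_add, hi, hi', dif_pos, Nat.add_lt_add_iff_right]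
      exact ⟨a, b.trans (h2 ⟨i, hi⟩).2.1, c.trans (h2 ⟨i, hi⟩).2.2⟩
    refine ⟨valid_graft _ _ _ _ _ (h0 X (mem_nodes_box.2 (Or.inl rfl))) hr, ?_, ?_⟩
    · rw [flatten, left_graft _ _ _ _ _ hr]; rfl
    · rw [flatten, right_graft _ _ _ _ _ hr]
      simp only [right, arity, h1', zero_add, Nat.lt_succ_self, dif_pos]
      rfl

theorem arity_flatten {col : α → Colour} {N : Stacking (Stacking α)} (h : N.NestValid col) :
    N.flatten.arity col = N.arity (arity col) := by
  obtain ⟨-, h1, h2⟩ := flatten_valid h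
  simp only [arity, h1, h2, leaves_flatten (Matched.of_valid h.2)]

theorem flatten_eq_eta {N : Stacking (Stacking α)} (h : ∀ X ∈ N.nodes, X ≠ eta) :
    N.flatten = eta ↔ N = eta := by
  cases N with
  | eta => simp [flatten]
  | box X n w ch =>
    have := h X (mem_nodes_box.2 (Or.inl rfl))
    cases X with
    | eta => exact absurd rfl this
    | box a m w' ch' => simp [flatten, graft]

theorem nodes_eq_nil {S : Stacking α} : S.nodes = [] ↔ S = eta := by
  cases S <;> simp [nodes]

/-- The boxes of a composite, part by part. The standard order of the composite is different in
general, because the boxes over the first input of a part precede the boxes over the second one. -/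
theorem perm_flatten {N : Stacking (Stacking α)} (h : N.Matched) :
    N.flatten.nodes.Perm N.nestNodes := by
  classical
  obtain ⟨c, hc, hv⟩ := h
  rw [List.perm_iff_count]
  intro a
  convert count_flatten a N c hc hv

theorem perm_graft (X : Stacking α) (w : ℕ → ℕ) (ch : ℕ → Stacking α) (o : ℕ) :
    (X.graft w ch o).nodes.Perm
      (X.nodes ++ (List.ofFn fun i : Fin X.leaves => (ch (o + i)).nodes).flatten) := by
  classical
  rw [List.perm_iff_count]
  intro a
  have := count_graft a X w ch o
  rw [List.count_append, List.count_flatten, List.map_ofFn, List.sum_ofFn]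
  rw [Finset.sum_range] at this
  exact this

end Stacking

end BoxOperad

namespace BoxOperad

/-! ### Koszul signs -/

section Signs

variable {α : Type u} {γ : Type v}

/-- `KPerm β l l' s`: the list `l` can be rearranged to `l'` by swaps of neighbours, and `s` is the
product of the signs `β a b` of the swaps. -/
inductive KPerm (β : α → α → ℤˣ) : List α → List α → ℤˣ → Prop
  | nil : KPerm β [] [] 1
  | cons (a : α) {l l' : List α} {s : ℤˣ} : KPerm β l l' s → KPerm β (a :: l) (a :: l') s
  | swap (a b : α) (l : List α) : KPerm β (a :: b :: l) (b :: a :: l) (β a b)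
  | trans {l₁ l₂ l₃ : List α} {s t : ℤˣ} :
      KPerm β l₁ l₂ s → KPerm β l₂ l₃ t → KPerm β l₁ l₃ (s * t)

/-- The Koszul pairing of elements of degrees `d`. -/
def kos (d : α → ℤ) (a b : α) : ℤˣ := (d a * d b).negOnePow

/-- The Koszul pairing is symmetric. -/
theorem kos_symm (d : α → ℤ) (a b : α) : kos d a b = kos d b a := by
  rw [kos, kos, mul_comm]

namespace KPerm

variable {β β' : α → α → ℤˣ}

theorem perm {l l' : List α} {s : ℤˣ} (h : KPerm β l l' s) : l.Perm l' := by
  induction h with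
  | nil => exact .nil
  | cons a _ ih => exact .cons a ih
  | swap a b l => exact .swap b a l
  | trans _ _ h1 h2 => exact h1.trans h2

theorem refl (l : List α) : KPerm β l l 1 := by
  induction l with
  | nil => exact .nil
  | cons a l ih => exact .cons a ih

theorem of_eq {l l' : List α} {s t : ℤˣ} (h : KPerm β l l' s) (e : s = t) : KPerm β l l' t := e ▸ h

theorem append_left (l₀ : List α) {l l' : List α} {s : ℤˣ} (h : KPerm β l l' s) :
    KPerm β (l₀ ++ l) (l₀ ++ l') s := by
  induction l₀ with
  | nil => exact h
  | cons a l₀ ih => exact .cons a ih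

theorem append_right (l₀ : List α) {l l' : List α} {s : ℤˣ} (h : KPerm β l l' s) :
    KPerm β (l ++ l₀) (l' ++ l₀) s := by
  induction h with
  | nil => exact refl _
  | cons a _ ih => exact .cons a ih
  | swap a b l => exact .swap a b _
  | trans _ _ h1 h2 => exact h1.trans h2

theorem append {l₁ l₁' l₂ l₂' : List α} {s t : ℤˣ} (h : KPerm β l₁ l₁' s) (h' : KPerm β l₂ l₂' t) :
    KPerm β (l₁ ++ l₂) (l₁' ++ l₂') (s * t) := (h.append_right l₂).trans (h'.append_left l₁')

theorem move (a : α) (l : List α) : KPerm β (a :: l) (l ++ [a]) (l.map (β a)).prod := by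
  induction l with
  | nil => exact refl _
  | cons b l ih =>
    rw [List.map_cons, List.prod_cons]
    exact (swap a b l).trans (.cons b ih)

theorem move' (a : α) (l l' : List α) :
    KPerm β (a :: (l ++ l')) (l ++ a :: l') (l.map (β a)).prod := by
  have := (move (β := β) a l).append_right l'
  simpa using this

theorem symm (hβ : ∀ a b, β a b = β b a) {l l' : List α} {s : ℤˣ} (h : KPerm β l l' s) :
    KPerm β l' l s := by
  induction h with
  | nil => exact .nil
  | cons a _ ih => exact .cons a ih
  | swap a b l => exact (swap b a l).of_eq (hβ _ _)
  | trans _ _ h1 h2 => exact (h2.trans h1).of_eq (mul_comm _ _)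

/-- Two blocks of elements are exchanged with the product of all the mutual signs. -/
theorem swap_blocks (l₁ l₂ : List α) :
    KPerm β (l₁ ++ l₂) (l₂ ++ l₁) (l₁.map fun a => (l₂.map (β a)).prod).prod := by
  induction l₁ with
  | nil => simpa using refl _
  | cons a l₁ ih =>
    have h1 := (ih.cons a).trans (move' a l₂ l₁)
    refine h1.of_eq ?_
    rw [List.map_cons, List.prod_cons, mul_comm]

theorem congr {l l' : List α} {s : ℤˣ} (h : KPerm β l l' s)
    (hb : ∀ a ∈ l, ∀ b ∈ l, β a b = β' a b) : KPerm β' l l' s := by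
  induction h with
  | nil => exact .nil
  | cons a h ih =>
    exact .cons a (ih fun a ha b hb' => hb a (List.mem_cons_of_mem _ ha) b
      (List.mem_cons_of_mem _ hb'))
  | swap a b l => exact (swap a b l).of_eq (hb a (by simp) b (by simp)).symm
  | trans h1 h2 ih1 ih2 =>
    refine (ih1 hb).trans (ih2 fun a ha b hb' => hb a (h1.perm.mem_iff.2 ha) b ?_)
    exact h1.perm.mem_iff.2 hb'

theorem map {β : γ → γ → ℤˣ} (g : α → γ) {l l' : List α} {s : ℤˣ}
    (h : KPerm (fun a b => β (g a) (g b)) l l' s) : KPerm β (l.map g) (l'.map g) s := by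
  induction h with
  | nil => exact .nil
  | cons a _ ih => exact .cons _ ih
  | swap a b l => exact swap (g a) (g b) _
  | trans _ _ h1 h2 => exact h1.trans h2

/-- One rearrangement computes two signs, and their product, simultaneously. -/
theorem exists_both (β β' : α → α → ℤˣ) {l l' : List α} (h : l.Perm l') :
    ∃ s s', KPerm β l l' s ∧ KPerm β' l l' s' ∧
      KPerm (fun a b => β a b * β' a b) l l' (s * s') := by
  induction h with
  | nil => exact ⟨1, 1, .nil, .nil, .nil⟩
  | cons a _ ih =>
    obtain ⟨s, s', h1, h2, h3⟩ := ih
    exact ⟨s, s', .cons a h1, .cons a h2, .cons a h3⟩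
  | swap a b l => exact ⟨_, _, swap b a l, swap b a l, swap b a l⟩
  | trans _ _ h1 h2 =>
    obtain ⟨s, s', a1, a2, a3⟩ := h1
    obtain ⟨t, t', b1, b2, b3⟩ := h2
    exact ⟨_, _, a1.trans b1, a2.trans b2, (a3.trans b3).of_eq (by rw [mul_mul_mul_comm])⟩

theorem exists_sign (β : α → α → ℤˣ) {l l' : List α} (h : l.Perm l') : ∃ s, KPerm β l l' s := by
  obtain ⟨s, -, h, -⟩ := exists_both β β h
  exact ⟨s, h⟩

theorem one_of_trivial {l l' : List α} (h : l.Perm l') (hb : ∀ a ∈ l, ∀ b ∈ l, β a b = 1) :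
    KPerm β l l' 1 := by
  have key : ∀ l l' : List α, l.Perm l' → KPerm (fun _ _ => 1) l l' 1 := by
    intro l l' h
    induction h with
    | nil => exact .nil
    | cons a _ ih => exact .cons a ih
    | swap a b l => exact swap b a l
    | trans _ _ h1 h2 => exact (h1.trans h2).of_eq (one_mul 1)
  exact (key l l' h).congr fun a ha b hb' => (hb a ha b hb').symm

/-- The sign of the inversions of a list, with respect to the order given by `idx`. -/
def inv (β : α → α → ℤˣ) (idx : α → ℕ) : List α → ℤˣ
  | [] => 1
  | a :: l => (l.map fun b => if idx b < idx a then β a b else 1).prod * inv β idx l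

/-- The inversions of a list behave like a sign: this is why the sign of a rearrangement depends
only on its source and its target, if the elements are distinct. -/
theorem inv_eq (hβ : ∀ a b, β a b = β b a) (idx : α → ℕ) {l l' : List α} {s : ℤˣ}
    (h : KPerm β l l' s) (hl : (l.map idx).Nodup) : inv β idx l' = inv β idx l * s := by
  induction h with
  | nil => simp [inv]
  | cons a h ih =>
    rw [inv, inv, ih (List.nodup_cons.1 hl).2, mul_assoc]
    congr 1
    exact ((h.perm.map _).prod_eq).symm
  | swap a b l =>
    have hab : idx a ≠ idx b := by
      intro e
      simp [e] at hl
    simp only [inv, List.map_cons, List.prod_cons]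
    rcases lt_or_gt_of_ne hab with h | h
    · simp only [h, if_true, h.not_gt, if_false, one_mul, hβ b a]
      generalize β a b = x
      ac_rfl
    · simp only [h, if_true, h.not_gt, if_false, one_mul]
      have key : ∀ x y z t : ℤˣ, x * x = 1 → z * (y * t) = x * y * (z * t) * x := by
        intro x y z t h
        calc z * (y * t) = (x * x) * (z * (y * t)) := by rw [h, one_mul]
          _ = _ := by ac_rfl
      exact key _ _ _ _ (Int.units_mul_self _)
  | trans h1 h2 ih1 ih2 =>
    rw [ih2 ((h1.perm.map idx).nodup_iff.1 hl), ih1 hl, mul_assoc]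

theorem unique (hβ : ∀ a b, β a b = β b a) {l l' : List α} {s t : ℤˣ} (hl : l.Nodup)
    (h : KPerm β l l' s) (h' : KPerm β l l' t) : s = t := by
  classical
  have hn : (l.map fun a => l.idxOf a).Nodup :=
    hl.map_on fun a ha b _ e => (List.idxOf_inj ha).1 e
  have := (inv_eq hβ _ h hn).symm.trans (inv_eq hβ _ h' hn)
  exact mul_left_cancel this

theorem mul (hβ : ∀ a b, β a b = β b a) (hβ' : ∀ a b, β' a b = β' b a) {l l' : List α} {s t : ℤˣ}
    (hl : l.Nodup) (h : KPerm β l l' s) (h' : KPerm β' l l' t) :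
    KPerm (fun a b => β a b * β' a b) l l' (s * t) := by
  obtain ⟨s', t', h1, h2, h3⟩ := exists_both β β' h.perm
  rw [unique hβ hl h h1, unique hβ' hl h' h2]
  exact h3

/-- A rearrangement of blocks is a rearrangement of the elements of the blocks. -/
theorem flatMap_perm (F : γ → List α) {l l' : List γ} {s : ℤˣ}
    (h : KPerm (fun A B => ((F A).map fun a => ((F B).map (β a)).prod).prod) l l' s) :
    KPerm β (l.flatMap F) (l'.flatMap F) s := by
  induction h with
  | nil => exact .nil
  | cons a _ ih => exact ih.append_left (F a)
  | swap a b l =>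
    simp only [List.flatMap_cons, ← List.append_assoc]
    exact (swap_blocks _ _).append_right _
  | trans _ _ h1 h2 => exact h1.trans h2

theorem flatMap_congr (F G : γ → List α) (s : γ → ℤˣ) (l : List γ)
    (h : ∀ X ∈ l, KPerm β (F X) (G X) (s X)) :
    KPerm β (l.flatMap F) (l.flatMap G) (l.map s).prod := by
  induction l with
  | nil => exact .nil
  | cons a l ih =>
    simp only [List.flatMap_cons, List.map_cons, List.prod_cons]
    exact (h a (by simp)).append (ih fun X hX => h X (by simp [hX]))

end KPerm

theorem negOnePow_sum {ι : Type w} (l : List ι) (f : ι → ℤ) :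
    ((l.map f).sum).negOnePow = (l.map fun i => (f i).negOnePow).prod := by
  induction l with
  | nil => simp
  | cons a l ih => simp [Int.negOnePow_add, ih]

theorem kos_blocks (d : α → ℤ) (A B : List α) :
    (A.map fun a => (B.map (kos d a)).prod).prod = ((A.map d).sum * (B.map d).sum).negOnePow := by
  rw [← List.sum_map_mul_right, negOnePow_sum]
  congr 1
  refine List.map_congr_left fun a _ => ?_
  rw [← List.sum_map_mul_left, negOnePow_sum]
  rfl

open Classical in
/-- The sign of the rearrangement of `l` to `l'`, which is unique if the elements are distinct
(`ksgn_eq`). It is `1` by convention if `l'` is not a rearrangement of `l`. -/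
noncomputable def ksgn (β : α → α → ℤˣ) (l l' : List α) : ℤˣ :=
  if h : ∃ s, KPerm β l l' s then h.choose else 1

theorem ksgn_spec (β : α → α → ℤˣ) {l l' : List α} (h : l.Perm l') :
    KPerm β l l' (ksgn β l l') := by
  have := KPerm.exists_sign β h
  rw [ksgn, dif_pos this]
  exact this.choose_spec

theorem ksgn_eq {β : α → α → ℤˣ} (hβ : ∀ a b, β a b = β b a) {l l' : List α} {s : ℤˣ}
    (hl : l.Nodup) (h : KPerm β l l' s) : ksgn β l l' = s :=
  (ksgn_spec β h.perm).unique hβ hl h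

theorem koszul_eq_inv (d : ℕ → ℤ) (l : List ℕ) : koszul d l = KPerm.inv (kos d) id l := by
  induction l with
  | nil => rfl
  | cons a l ih => simp only [koszul, KPerm.inv, ih, kos, id]

/-- The sign `koszul` of a sorted list is `1`, so `koszul` is the sign of the rearrangement of the
sorted list. -/
theorem koszul_eq_ksgn (d : ℕ → ℤ) (n : ℕ) (l : List ℕ) (h : (List.range n).Perm l) :
    koszul d l = ksgn (kos d) (List.range n) l := by
  have h1 := KPerm.inv_eq (kos_symm d) id (ksgn_spec (kos d) h) (by simpa using List.nodup_range)
  rw [koszul_eq_inv, h1]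
  have h2 : ∀ l : List ℕ, l.Pairwise (· < ·) → KPerm.inv (kos d) id l = 1 := by
    intro l
    induction l with
    | nil => intro _; rfl
    | cons a l ih =>
      intro hl
      rw [List.pairwise_cons] at hl
      rw [KPerm.inv, ih hl.2, mul_one]
      refine List.prod_eq_one fun x hx => ?_
      obtain ⟨b, hb, rfl⟩ := List.mem_map.1 hx
      simp [(hl.1 b hb).not_gt]
  rw [h2 _ List.pairwise_lt_range, one_mul]

open Classical in
/-- The sum of the degrees of the elements before `m` (of all elements, if `m` is not in the list).
-/
noncomputable def pre (d : α → ℤ) : List α → α → ℤ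
  | [], _ => 0
  | a :: l, m => if a = m then 0 else d a + pre d l m

theorem pre_append_cons (d : α → ℤ) (l l' : List α) (m : α) (h : m ∉ l) :
    pre d (l ++ m :: l') m = (l.map d).sum := by
  induction l with
  | nil => simp [pre]
  | cons a l ih =>
    simp only [List.mem_cons, not_or] at h
    simp [pre, Ne.symm h.1, ih h.2]

theorem pre_congr {d d' : α → ℤ} {l : List α} {m : α} (h : ∀ a ∈ l, a ≠ m → d a = d' a) :
    pre d l m = pre d' l m := by
  induction l with
  | nil => rfl
  | cons a l ih =>
    simp only [pre]
    rw [ih fun b hb => h b (by simp [hb])]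
    by_cases ham : a = m
    · simp [ham]
    · simp [ham, h a (by simp) ham]

open Classical in
/-- The sign of a rearrangement after a map of degree `e` has been applied to the element `m`. -/
theorem KPerm.update {d : α → ℤ} {l l' : List α} {s : ℤˣ} (h : KPerm (kos d) l l' s)
    (hl : l.Nodup) (m : α) (hm : m ∈ l) (e : ℤ) :
    KPerm (kos (Function.update d m (d m + e))) l l'
      (s * (e * (pre d l m + pre d l' m)).negOnePow) := by
  induction h with
  | nil => simp at hm
  | @cons a l l' s h ih =>
    rw [List.nodup_cons] at hl
    by_cases ham : a = m
    · subst ham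
      refine (KPerm.cons a (h.congr fun x hx y hy => ?_)).of_eq (by simp [pre])
      have hx' : x ≠ a := fun e => hl.1 (e ▸ hx)
      have hy' : y ≠ a := fun e => hl.1 (e ▸ hy)
      simp [kos, hx', hy']
    · have hm' : m ∈ l := by simpa [Ne.symm ham] using hm
      refine (KPerm.cons a (ih hl.2 hm')).of_eq ?_
      congr 1
      simp only [pre, ham, if_false]
      rw [show e * (d a + pre d l m + (d a + pre d l' m)) =
        2 * (e * d a) + e * (pre d l m + pre d l' m) by ring, Int.negOnePow_add,
        Int.negOnePow_two_mul, one_mul]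
  | swap a b l =>
    have hab : a ≠ b := by
      rintro rfl
      simp at hl
    refine (KPerm.swap a b l).of_eq ?_
    simp only [kos, ← Int.negOnePow_add, pre]
    by_cases ha : a = m
    · subst ha
      simp only [Function.update_self, hab.symm, if_true, if_false, ne_eq, not_false_eq_true,
        Function.update_of_ne]
      congr 1; ring
    · by_cases hb : b = m
      · subst hb
        simp only [Function.update_self, if_true, if_false, ne_eq, not_false_eq_true, hab,
          Function.update_of_ne]
        congr 1; ring
      · simp only [ha, hb, if_false, ne_eq, not_false_eq_true, Function.update_of_ne]
        rw [Int.negOnePow_eq_iff]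
        refine ⟨-e * (d a + d b + pre d l m), by ring⟩
  | @trans l₁ l₂ l₃ s t h1 h2 ih1 ih2 =>
    refine ((ih1 hl hm).trans (ih2 (h1.perm.nodup_iff.1 hl) (h1.perm.mem_iff.1 hm))).of_eq ?_
    rw [mul_mul_mul_comm]
    congr 1
    rw [← Int.negOnePow_add, Int.negOnePow_eq_iff]
    exact ⟨e * pre d l₂ m, by ring⟩

end Signs

end BoxOperad

namespace BoxOperad

open Stacking

/-! ### Stackings with distinct labels -/

namespace Stacking

variable {α : Type u} {β : Type v}

theorem nodes_number_fst (t : Stacking α) (o : ℕ) :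
    (t.number o).nodes.map Prod.fst = List.range' o t.size := by
  rw [← nodes_map, nodes_number]

theorem number_snd (t : Stacking α) (o : ℕ) : (t.number o).map Prod.snd = t := by
  induction t generalizing o with
  | eta => rfl
  | box a n w ch ih => simp only [number, map, ih]

theorem nodes_number_eq (t : Stacking α) (o : ℕ) :
    (t.number o).nodes = (List.range' o t.size).zip t.nodes := by
  rw [← nodes_number_fst, ← number_snd t o, nodes_map, number_snd]
  exact (List.zip_of_prod rfl rfl)

/-- If the labels are distinct, the numbering in standard order is a relabelling. -/
theorem skel_eq_map [DecidableEq α] {t : Stacking α} (h : t.nodes.Nodup) :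
    t.skel = t.map fun a => t.nodes.idxOf a := by
  conv_rhs => rw [← number_snd t 0]
  rw [skel, map_map]
  refine map_congr fun x hx => ?_
  rw [nodes_number_eq] at hx
  obtain ⟨i, hi, rfl⟩ := List.mem_iff_getElem.1 hx
  rw [number_snd, List.getElem_zip]
  simp only [List.getElem_range', zero_add, one_mul]
  rw [h.idxOf_getElem]

theorem nodup_skel (t : Stacking α) : t.skel.nodes.Nodup := by
  rw [nodes_skel]; exact List.nodup_range

theorem map_id' (t : Stacking α) : t.map (fun a => a) = t := by
  induction t with
  | eta => rfl
  | box a n w ch ih => simp only [map, ih]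

theorem map_eq_self {f : α → α} {t : Stacking α} (h : ∀ a ∈ t.nodes, f a = a) : t.map f = t :=
  (map_congr h).trans (map_id' t)

theorem valid_congr {col col' : α → Colour} {t : Stacking α} (h : ∀ a ∈ t.nodes, col a = col' a) :
    t.Valid col ↔ t.Valid col' := by
  have := valid_map col id t
  rw [map_congr h, valid_map] at this
  exact this.symm

theorem arity_congr {col col' : α → Colour} {t : Stacking α} (h : ∀ a ∈ t.nodes, col a = col' a) :
    t.arity col = t.arity col' := by
  have := arity_map col id t
  rw [map_congr h, arity_map] at this
  exact this.symm

theorem nestNodes_map (g : α → β) (N : Stacking (Stacking α)) :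
    (N.map (Stacking.map g)).nestNodes = N.nestNodes.map g := by
  simp only [nestNodes, nodes_map, List.map_flatMap, List.flatMap_map]

theorem mem_nestNodes {N : Stacking (Stacking α)} {X : Stacking α} (hX : X ∈ N.nodes) {a : α}
    (ha : a ∈ X.nodes) : a ∈ N.nestNodes := List.mem_flatMap.2 ⟨X, hX, ha⟩

theorem nestings_perm {col : α → Colour} {S : Stacking α} {N : Stacking (Stacking α)}
    (h : N ∈ nestings col S) : S.nodes.Perm N.nestNodes := by
  obtain ⟨h1, -, rfl⟩ := h
  exact perm_flatten (Matched.of_valid h1.2)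

theorem mem_of_nesting {col : α → Colour} {S : Stacking α} {N : Stacking (Stacking α)}
    (h : N ∈ nestings col S) {X : Stacking α} (hX : X ∈ N.nodes) {a : α}
    (ha : a ∈ X.nodes) : a ∈ S.nodes := (nestings_perm h).mem_iff.2 (mem_nestNodes hX ha)

theorem nestings_nodup {col : α → Colour} {S : Stacking α} (hS : S.nodes.Nodup)
    {N : Stacking (Stacking α)} (h : N ∈ nestings col S) :
    N.nodes.Nodup ∧ ∀ X ∈ N.nodes, X.nodes.Nodup := by
  have h1 := (nestings_perm h).nodup_iff.1 hS
  rw [nestNodes, List.nodup_flatMap] at h1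
  refine ⟨?_, h1.1⟩
  have h2 := h1.2
  rw [List.Nodup]
  refine List.Pairwise.imp_of_mem (fun {X Y} hX hY hd e => ?_) h2
  subst e
  have hne : X.nodes ≠ [] := fun e => h.2.1 X hX (nodes_eq_nil.1 e)
  obtain ⟨a, ha⟩ := List.exists_mem_of_ne_nil _ hne
  exact hd ha ha

theorem nestValid_map {g : α → β} {col : β → Colour} {N : Stacking (Stacking α)} :
    (N.map (Stacking.map g)).NestValid col ↔ N.NestValid fun a => col (g a) := by
  simp only [NestValid, nodes_map, List.mem_map, forall_exists_index, and_imp,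
    forall_apply_eq_imp_iff₂, valid_map, arity_map]

/-- Decompositions can be relabelled. -/
theorem map_mem_nestings {g : α → β} {col : β → Colour} {S : Stacking α}
    {N : Stacking (Stacking α)} (h : N ∈ nestings (fun a => col (g a)) S) :
    N.map (Stacking.map g) ∈ nestings col (S.map g) := by
  obtain ⟨h1, h2, rfl⟩ := h
  refine ⟨nestValid_map.2 h1, ?_, (map_flatten _ _).symm⟩
  simp only [nodes_map, List.mem_map, forall_exists_index, and_imp, forall_apply_eq_imp_iff₂, ne_eq,
    map_eq_eta]
  exact h2

theorem nestings_congr {col col' : α → Colour} {S : Stacking α}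
    (h : ∀ a ∈ S.nodes, col a = col' a) : nestings col S ⊆ nestings col' S := by
  intro N hN
  have h' : ∀ X ∈ N.nodes, ∀ a ∈ X.nodes, col a = col' a := fun X hX a ha =>
    h a (mem_of_nesting hN hX ha)
  refine ⟨⟨fun X hX => (valid_congr (h' X hX)).1 (hN.1.1 X hX), ?_⟩, hN.2⟩
  exact (valid_congr fun X hX => arity_congr (h' X hX)).1 hN.1.2

theorem nesting_eta {col : α → Colour} {N : Stacking (Stacking α)} (h : N ∈ nestings col eta) :
    N = eta := (flatten_eq_eta h.2.1).1 h.2.2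

theorem eta_mem_nestings (col : α → Colour) : (eta : Stacking (Stacking α)) ∈ nestings col eta :=
  ⟨⟨by simp [nodes], trivial⟩, by simp [nodes], rfl⟩

/-- A relabelling by distinct labels does not change the decompositions. -/
theorem nestings_map_injOn {g : α → β} {col : β → Colour} {S : Stacking α}
    (hg : ∀ a ∈ S.nodes, ∀ b ∈ S.nodes, g a = g b → a = b) :
    Set.BijOn (Stacking.map (Stacking.map g)) (nestings (fun a => col (g a)) S)
      (nestings col (S.map g)) := by
  rcases isEmpty_or_nonempty α with hα | hα
  · have hS : S = eta := by
      cases S with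
      | eta => rfl
      | box a _ _ _ => exact hα.elim a
    subst hS
    refine ⟨fun N hN => map_mem_nestings hN, fun N hN N' hN' _ => ?_, fun N hN => ?_⟩
    · rw [nesting_eta hN, nesting_eta hN']
    · rw [nesting_eta hN]
      exact ⟨eta, eta_mem_nestings _, rfl⟩
  · set f : β → α := Function.invFunOn g {a | a ∈ S.nodes} with hf
    have hfg : ∀ a ∈ S.nodes, f (g a) = a := fun a ha =>
      Set.InjOn.leftInvOn_invFunOn (fun a ha b hb => hg a ha b hb) ha
    have back : ∀ N ∈ nestings (fun a => col (g a)) S,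
        (N.map (Stacking.map g)).map (Stacking.map f) = N := by
      intro N hN
      rw [map_map]
      refine map_eq_self fun X hX => ?_
      rw [map_map]
      exact map_eq_self fun a ha => hfg a (mem_of_nesting hN hX ha)
    refine ⟨fun N hN => map_mem_nestings hN, fun N hN N' hN' e => ?_, fun N hN => ?_⟩
    · rw [← back N hN, ← back N' hN']
      exact congrArg _ e
    · have hmem : ∀ X ∈ N.nodes, ∀ b ∈ X.nodes, g (f b) = b := by
        intro X hX b hb
        have := mem_of_nesting hN hX hb
        rw [nodes_map, List.mem_map] at this
        obtain ⟨a, ha, rfl⟩ := this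
        rw [hfg a ha]
      have e1 : (N.map (Stacking.map f)).map (Stacking.map g) = N := by
        rw [map_map]
        refine map_eq_self fun X hX => ?_
        rw [map_map]
        exact map_eq_self fun a ha => hmem X hX a ha
      refine ⟨N.map (Stacking.map f), ⟨?_, ?_, ?_⟩, e1⟩
      · rw [← nestValid_map, e1]; exact hN.1
      · intro X hX e
        rw [nodes_map, List.mem_map] at hX
        obtain ⟨Y, hY, rfl⟩ := hX
        exact hN.2.1 Y hY (map_eq_eta.1 e)
      · rw [← map_flatten, hN.2.2, map_map]
        exact map_eq_self hfg

end Stacking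

theorem pre_eq_sum {α : Type u} [DecidableEq α] (d : α → ℤ) (l : List α) (m : α) (hm : m ∈ l) :
    ∑ i ∈ Finset.range (l.idxOf m), (l.map d).getD i 0 = pre d l m := by
  induction l with
  | nil => simp at hm
  | cons a l ih =>
    by_cases ham : a = m
    · subst ham; simp [pre]
    · have hm' : m ∈ l := by simpa [Ne.symm ham] using hm
      rw [List.idxOf_cons_ne _ ham, Finset.sum_range_succ']
      simp only [List.map_cons, List.getD_cons_succ, List.getD_cons_zero, pre, ham, if_false]
      rw [ih hm', add_comm]

section Formulas

variable {k : Type u} [CommRing k]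
variable {M : Colour → ℤ → Type v} [∀ c n, AddCommGroup (M c n)] [∀ c n, Module k (M c n)]
variable {M' : Colour → ℤ → Type w} [∀ c n, AddCommGroup (M' c n)] [∀ c n, Module k (M' c n)]
variable {ι : Type*}

theorem lookup_map_idxOf [DecidableEq ι] (R : Stacking ι) (v : ι → Box M) {a : ι}
    (ha : a ∈ R.nodes) : lookup (R.map v) (R.nodes.idxOf a) = v a := by
  simp [lookup, nodes_map, List.getD_eq_getElem?_getD, List.getElem?_idxOf ha]

theorem skel_map_lookup (t : Stacking (Box M)) : t.skel.map (lookup t) = t := by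
  conv_rhs => rw [← number_snd t 0]
  rw [skel, map_map]
  refine map_congr fun x hx => ?_
  rw [nodes_number_eq] at hx
  obtain ⟨i, hi, rfl⟩ := List.mem_iff_getElem.1 hx
  rw [List.getElem_zip]
  have : i < t.nodes.length := by
    simp only [List.length_zip] at hi; omega
  simp [lookup, List.getD_eq_getElem?_getD, this]

/-- `T.inf` on a stacking with distinct labels. -/
theorem inf_gen [DecidableEq ι] {u : Bool} (f : ∀ c n, M c n →ₗ[k] M' c n)
    (g : ∀ c i j, M c i →ₗ[k] M' c j) (e : ℤ) {c : Colour} {i : ℤ} (j : ℤ) {R : Stacking ι}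
    (hR : R.nodes.Nodup) (v : ι → Box M) (h : Good u c i (R.map v)) :
    T.inf u f g e c i j (gen k u c i (R.map v)) = ∑ m ∈ R.nodes.toFinset,
      ((e * pre (fun l => (v l).deg) R.nodes m).negOnePow : ℤ) •
        gen k u c j (R.map fun l => if l = m then (v l).shift g e else (v l).map f) := by
  rw [T.inf, T.lift_gen, if_pos h]
  symm
  refine Finset.sum_nbij (fun a => R.nodes.idxOf a) ?_ ?_ ?_ ?_
  · intro a ha
    rw [Finset.mem_range, size_map]
    exact List.idxOf_lt_length_of_mem (List.mem_toFinset.1 ha)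
  · intro a ha b hb e
    exact (List.idxOf_inj (List.mem_toFinset.1 ha)).1 e
  · intro m hm
    rw [Finset.coe_range, Set.mem_Iio, size_map] at hm
    exact ⟨R.nodes[m]'hm, List.mem_toFinset.2 (List.getElem_mem _), hR.idxOf_getElem m hm⟩
  · intro m hm
    rw [List.mem_toFinset] at hm
    congr 3
    · congr 1
      rw [← pre_eq_sum _ _ _ hm]
      refine Finset.sum_congr rfl fun l hl => ?_
      rw [Finset.mem_range] at hl
      have : l < R.nodes.length := hl.trans (List.idxOf_lt_length_of_mem hm)
      simp [lookup, nodes_map, List.getD_eq_getElem?_getD, this]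
    · rw [skel_map, skel_eq_map hR, map_map]
      refine map_congr fun l hl => ?_
      simp only [lookup_map_idxOf R v hl, List.idxOf_inj hl]

/-- `decomp` on a stacking with distinct labels. -/
theorem decomp_gen {u : Bool} {c : Colour} {n : ℤ} {R : Stacking ι}
    (hR : R.nodes.Nodup) (v : ι → Box M) (h : Good u c n (R.map v)) :
    decomp u c n (gen k u c n (R.map v)) =
      ∑ N ∈ (finite_nestings (fun l => (v l).c) R).toFinset,
        (ksgn (kos fun l => (v l).deg) R.nodes N.nestNodes : ℤ) •
          gen k u c n (N.map fun X => part k (X.map v)) := by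
  classical
  rw [decomp, T.lift_gen, if_pos h]
  set idx : ι → ℕ := fun a => R.nodes.idxOf a with hidx
  have hsk : (R.map v).skel = R.map idx := by rw [skel_map, skel_eq_map hR]
  have hinj : ∀ a ∈ R.nodes, ∀ b ∈ R.nodes, idx a = idx b → a = b :=
    fun a ha b _ e => (List.idxOf_inj ha).1 e
  have hlook : ∀ a ∈ R.nodes, lookup (R.map v) (idx a) = v a := fun a ha =>
    lookup_map_idxOf R v ha
  have hbij := nestings_map_injOn (g := idx) (col := fun i => (lookup (R.map v) i).c) hinj
  have hcol : nestings (fun a => (lookup (R.map v) (idx a)).c) R = nestings (fun l => (v l).c) R :=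
    Set.Subset.antisymm (nestings_congr fun a ha => by rw [hlook a ha])
      (nestings_congr fun a ha => by rw [hlook a ha])
  rw [hcol, ← hsk] at hbij
  symm
  refine Finset.sum_nbij (Stacking.map (Stacking.map idx)) ?_ ?_ ?_ ?_
  · intro N hN
    rw [Set.Finite.mem_toFinset] at hN ⊢
    exact hbij.mapsTo hN
  · rw [Set.Finite.coe_toFinset]; exact hbij.injOn
  · rw [Set.Finite.coe_toFinset, Set.Finite.coe_toFinset]; exact hbij.surjOn
  · intro N hN
    rw [Set.Finite.mem_toFinset] at hN
    have hmem : ∀ X ∈ N.nodes, ∀ a ∈ X.nodes, a ∈ R.nodes := fun X hX a ha =>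
      mem_of_nesting hN hX ha
    congr 2
    · rw [nestNodes_map]
      have hp := nestings_perm hN
      have hr : List.range R.size = R.nodes.map idx := by
        rw [← nodes_skel, skel_eq_map hR, nodes_map]
      rw [koszul_eq_ksgn _ R.size _ (by rw [hr]; exact hp.map idx)]
      symm
      rw [hr]
      refine ksgn_eq (kos_symm _) (by rw [← hr]; exact List.nodup_range) (KPerm.map idx ?_)
      refine (ksgn_spec (kos fun l => (v l).deg) hp).congr fun a ha b hb => ?_
      simp only [kos, hlook a ha, hlook b hb]
    · rw [map_map]
      refine map_congr fun X hX => ?_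
      rw [map_map]
      exact congrArg _ (map_congr fun a ha => (hlook a (hmem X hX a ha)).symm)

end Formulas

end BoxOperad

namespace BoxOperad

open Stacking

/-! ### Functoriality of the cofree box cooperad -/

section Functoriality

variable {k : Type u} [CommRing k]
variable {M : Colour → ℤ → Type v} [∀ c n, AddCommGroup (M c n)] [∀ c n, Module k (M c n)]
variable {M' : Colour → ℤ → Type w} [∀ c n, AddCommGroup (M' c n)] [∀ c n, Module k (M' c n)]
variable {ι : Type*}

theorem good_map_iff {u : Bool} {c : Colour} {n : ℤ} {R : Stacking ι} {v : ι → Box M} :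
    Good u c n (R.map v) ↔ R.Valid (fun l => (v l).c) ∧ R.arity (fun l => (v l).c) = c ∧
      (R.nodes.map fun l => (v l).deg).sum = n ∧ (u = false → R ≠ eta) := by
  rw [Good, valid_map, arity_map, degree, nodes_map, List.map_map, ne_eq, map_eq_eta]
  rfl

theorem good_congr {u : Bool} {c : Colour} {n : ℤ} {R : Stacking ι} {v : ι → Box M}
    {v' : ι → Box M'} (h : ∀ l ∈ R.nodes, (v l).c = (v' l).c ∧ (v l).deg = (v' l).deg) :
    Good u c n (R.map v) ↔ Good u c n (R.map v') := by
  rw [good_map_iff, good_map_iff, valid_congr fun l hl => (h l hl).1,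
    arity_congr fun l hl => (h l hl).1, List.map_congr_left fun l hl => (h l hl).2]

theorem good_boxMap {u : Bool} {c : Colour} {n : ℤ} (f : ∀ c n, M c n →ₗ[k] M' c n)
    {t : Stacking (Box M)} : Good u c n (t.map (Box.map f)) ↔ Good u c n t := by
  conv_rhs => rw [← map_id' t]
  exact (good_congr fun l _ => ⟨rfl, rfl⟩)

theorem map_gen {u : Bool} {c : Colour} {n : ℤ} (f : ∀ c n, M c n →ₗ[k] M' c n)
    (t : Stacking (Box M)) :
    T.map u f c n (gen k u c n t) = gen k u c n (t.map (Box.map f)) := by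
  rw [T.map, T.lift_gen]
  split_ifs with h
  · rfl
  · rw [gen_of_not_good]
    rwa [good_boxMap]

theorem sum_update {ι : Type*} [DecidableEq ι] {l : List ι} (hl : l.Nodup) {m : ι} (hm : m ∈ l)
    (d : ι → ℤ) (e : ℤ) :
    (l.map fun a => if a = m then d a + e else d a).sum = (l.map d).sum + e := by
  induction l with
  | nil => simp at hm
  | cons a l ih =>
    rw [List.nodup_cons] at hl
    by_cases ham : a = m
    · subst ham
      have : (l.map fun b => if b = a then d b + e else d b) = l.map d :=
        List.map_congr_left fun b hb => if_neg (by rintro rfl; exact hl.1 hb)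
      rw [List.map_cons, List.sum_cons, this]
      simp only [if_true, List.map_cons, List.sum_cons]; ring
    · have hm' : m ∈ l := by simpa [Ne.symm ham] using hm
      simp only [List.map_cons, List.sum_cons, ham, if_false, ih hl.2 hm']
      ring

theorem good_inf [DecidableEq ι] {u : Bool} {c : Colour} {i j : ℤ}
    (f : ∀ c n, M c n →ₗ[k] M' c n) (g : ∀ c i j, M c i →ₗ[k] M' c j) (e : ℤ) {R : Stacking ι}
    (hR : R.nodes.Nodup) {v : ι → Box M} (h : Good u c i (R.map v)) {m : ι} (hm : m ∈ R.nodes) :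
    Good u c j (R.map fun l => if l = m then (v l).shift g e else (v l).map f) ↔ j = i + e := by
  rw [good_map_iff] at h ⊢
  have h1 : ∀ l, (if l = m then (v l).shift g e else (v l).map f).c = (v l).c := fun l => by
    split_ifs <;> rfl
  have h2 : ∀ l, (if l = m then (v l).shift g e else (v l).map f).deg =
      if l = m then (v l).deg + e else (v l).deg := fun l => by
    split_ifs <;> rfl
  simp only [h1, h2, sum_update hR hm, h.2.2.1]
  constructor
  · rintro ⟨-, -, h, -⟩; exact h.symm
  · intro hj; exact ⟨h.1, h.2.1, hj.symm, h.2.2.2⟩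

/-- An infinitesimal composite with a map of degree `e` has degree `e`, even if `g` does not: only
the component of degree `e` of `g` is used. -/
theorem inf_eq_zero {u : Bool} (f : ∀ c n, M c n →ₗ[k] M' c n)
    (g : ∀ c i j, M c i →ₗ[k] M' c j) (e : ℤ) (c : Colour) {i j : ℤ} (h : j ≠ i + e) :
    T.inf u f g e c i j = 0 := by
  refine T.hom_ext fun t ht => ?_
  rw [← skel_map_lookup t] at ht ⊢
  rw [inf_gen f g e j (nodup_skel t) _ ht, LinearMap.zero_apply]
  refine Finset.sum_eq_zero fun m hm => ?_
  rw [gen_of_not_good, smul_zero]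
  rwa [good_inf f g e (nodup_skel t) ht (List.mem_toFinset.1 hm)]

section Comp

variable {M'' : Colour → ℤ → Type*} [∀ c n, AddCommGroup (M'' c n)] [∀ c n, Module k (M'' c n)]

theorem inf_comp_map {u : Bool} (f : ∀ c n, M' c n →ₗ[k] M'' c n)
    (g : ∀ c i j, M' c i →ₗ[k] M'' c j) (e : ℤ) (h : ∀ c n, M c n →ₗ[k] M' c n)
    (c : Colour) (i j : ℤ) :
    T.inf u f g e c i j ∘ₗ T.map u h c i =
      T.inf u (fun c n => f c n ∘ₗ h c n) (fun c i j => g c i j ∘ₗ h c i) e c i j := by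
  refine T.hom_ext fun t ht => ?_
  rw [LinearMap.comp_apply, map_gen]
  rw [← skel_map_lookup t] at ht ⊢
  rw [map_map, inf_gen _ _ e j (nodup_skel t) _ ht, inf_gen f g e j (nodup_skel t)]
  · rfl
  · rw [← map_map]; rwa [good_boxMap]

theorem map_comp_inf {u : Bool} (h : ∀ c n, M' c n →ₗ[k] M'' c n) (f : ∀ c n, M c n →ₗ[k] M' c n)
    (g : ∀ c i j, M c i →ₗ[k] M' c j) (e : ℤ) (c : Colour) (i j : ℤ) :
    T.map u h c j ∘ₗ T.inf u f g e c i j =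
      T.inf u (fun c n => h c n ∘ₗ f c n) (fun c i j => h c j ∘ₗ g c i j) e c i j := by
  refine T.hom_ext fun t ht => ?_
  rw [LinearMap.comp_apply]
  rw [← skel_map_lookup t] at ht ⊢
  rw [inf_gen _ _ e j (nodup_skel t) _ ht, inf_gen _ _ e j (nodup_skel t) _ ht, map_sum]
  refine Finset.sum_congr rfl fun m _ => ?_
  rw [map_zsmul, map_gen, map_map]
  congr 3
  funext l
  split_ifs <;> rfl

end Comp

/-! ### Multilinearity of the generators -/

/-- A stacking with a zero element is zero. -/
theorem gen_eq_zero_of_label {u : Bool} {c : Colour} {n : ℤ} {R : Stacking ι}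
    (hR : R.nodes.Nodup) (v : ι → Box M) {m : ι} (hm : m ∈ R.nodes) {c' : Colour} {n' : ℤ}
    (h : v m = ⟨c', n', 0⟩) : gen k u c n (R.map v) = 0 := by
  classical
  have hc : R.nodes.countP (fun l => decide (l = m)) = 1 := List.count_eq_one_of_mem hR hm
  have hv : ∀ b ∈ R.nodes, decide (b = m) = true → v b = ⟨c', n', 0⟩ := fun b _ hb => by
    rw [of_decide_eq_true hb, h]
  have := gen_map (k := k) (u := u) (c := c) (n := n) R (fun l => decide (l = m)) hc
    c' n' 1 0 0 v v v (fun _ _ _ => rfl) (fun _ _ _ => rfl)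
    (fun b hb hbm => by rw [hv b hb hbm, smul_zero, add_zero]) hv hv
  rw [one_smul] at this
  simpa using this

theorem gen_smul_label [DecidableEq ι] {u : Bool} {c : Colour} {n : ℤ} {R : Stacking ι}
    (hR : R.nodes.Nodup) (v v' : ι → Box M) {m : ι} (hm : m ∈ R.nodes) (c' : Colour) (n' : ℤ)
    (a : k) (x : M c' n') (h : v m = ⟨c', n', a • x⟩) (h' : v' m = ⟨c', n', x⟩)
    (hv : ∀ l ∈ R.nodes, l ≠ m → v l = v' l) :
    gen k u c n (R.map v) = a • gen k u c n (R.map v') := by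
  have hc : R.nodes.countP (fun l => decide (l = m)) = 1 := List.count_eq_one_of_mem hR hm
  have := gen_map (k := k) (u := u) (c := c) (n := n) R (fun l => decide (l = m)) hc
    c' n' a x 0 v v' (Function.update v m ⟨c', n', 0⟩)
    (fun b hb h => (hv b hb (by simpa using h)).symm)
    (fun b _ h => by rw [Function.update_of_ne (by simpa using h)])
    (fun b _ hb => by
      have hb : b = m := by simpa using hb
      rw [hb, add_zero, h])
    (fun b _ hb => by
      have hb : b = m := by simpa using hb
      rw [hb, h'])
    (fun b _ hb => by
      have hb : b = m := by simpa using hb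
      rw [hb, Function.update_self])
  rw [this, gen_eq_zero_of_label (R := R) (m := m) hR (Function.update v m ⟨c', n', 0⟩) hm
    (Function.update_self _ _ _), add_zero]

/-- A stacking with distinct labels is a multilinear function of its elements. -/
noncomputable def genMulti (u : Bool) (c : Colour) (n : ℤ) {R : Stacking ι} (hR : R.nodes.Nodup)
    (C : ι → Colour) (D : ι → ℤ) :
    MultilinearMap k (fun l : {l // l ∈ R.nodes} => M (C l) (D l)) (T k M u c n) :=
  letI : ∀ l, Decidable (l ∈ R.nodes) := Classical.decPred _
  have key : ∀ [DecidableEq {l // l ∈ R.nodes}]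
      (x : ∀ l : {l // l ∈ R.nodes}, M (C l) (D l)) (l : {l // l ∈ R.nodes})
      (a : k) (y z : M (C l) (D l)),
      gen k u c n (R.map fun b => (⟨C b, D b,
        if h : b ∈ R.nodes then Function.update x l (a • y + z) ⟨b, h⟩ else 0⟩ : Box M)) =
      a • gen k u c n (R.map fun b => (⟨C b, D b,
        if h : b ∈ R.nodes then Function.update x l y ⟨b, h⟩ else 0⟩ : Box M)) +
      gen k u c n (R.map fun b => (⟨C b, D b,
        if h : b ∈ R.nodes then Function.update x l z ⟨b, h⟩ else 0⟩ : Box M)) := by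
    classical
    intro _ x l a y z
    obtain ⟨m, hm⟩ := l
    have hc : R.nodes.countP (fun l => decide (l = m)) = 1 := List.count_eq_one_of_mem hR hm
    have ne : ∀ (b : ι) (hb : b ∈ R.nodes) (y : M (C m) (D m)), b ≠ m →
        Function.update x ⟨m, hm⟩ y ⟨b, hb⟩ = x ⟨b, hb⟩ := fun b hb y h =>
      Function.update_of_ne (fun e => h (congrArg Subtype.val e)) _ _
    refine gen_map (k := k) (u := u) (c := c) (n := n) R (fun l => decide (l = m)) hc
      (C m) (D m) a y z _ _ _ ?_ ?_ ?_ ?_ ?_ <;> intro b hb hbm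
    · have hbm : b ≠ m := by simpa using hbm
      simp only [hb, dif_pos, ne b hb _ hbm]
    · have hbm : b ≠ m := by simpa using hbm
      simp only [hb, dif_pos, ne b hb _ hbm]
    all_goals
      have hbm : b = m := by simpa using hbm
      subst hbm
      simp [hb]
  { toFun := fun x => gen k u c n (R.map fun b =>
      ⟨C b, D b, if h : b ∈ R.nodes then x ⟨b, h⟩ else 0⟩)
    map_update_add' := fun x l y z => by
      have := key x l 1 y z
      rwa [one_smul, one_smul] at this
    map_update_smul' := fun x l a y => by
      have := key x l a y 0
      rw [add_zero] at this
      rw [this, add_eq_left]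
      exact gen_eq_zero_of_label hR _ l.2 (by rw [dif_pos l.2, Function.update_self]) }

theorem genMulti_apply {u : Bool} {c : Colour} {n : ℤ} {R : Stacking ι} (hR : R.nodes.Nodup)
    (C : ι → Colour) (D : ι → ℤ) (x : ∀ l : {l // l ∈ R.nodes}, M (C l) (D l))
    (v : ι → Box M) (hv : ∀ l (h : l ∈ R.nodes), v l = ⟨C l, D l, x ⟨l, h⟩⟩) :
    genMulti (k := k) u c n hR C D x = gen k u c n (R.map v) := by
  unfold genMulti
  refine congrArg (gen k u c n) (map_congr fun l hl => ?_)
  rw [hv l hl, dif_pos hl]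

/-! ### Composition of infinitesimal composites of degree `-1` -/

/-- Two maps of degree `e`, applied to `a` and to `b` in either order: the signs differ by that of
exchanging the maps. -/
theorem pre_update [DecidableEq ι] {l : List ι} (hl : l.Nodup) {a b : ι} (ha : a ∈ l) (hb : b ∈ l)
    (hab : a ≠ b) (d : ι → ℤ) (e : ℤ) :
    (pre d l a + pre (fun x => if x = a then d x + e else d x) l b =
      pre d l b + pre (fun x => if x = b then d x + e else d x) l a + e) ∨
    (pre d l a + pre (fun x => if x = a then d x + e else d x) l b =
      pre d l b + pre (fun x => if x = b then d x + e else d x) l a - e) := by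
  obtain ⟨l₁, l₂, rfl⟩ := List.append_of_mem ha
  rw [List.nodup_append] at hl
  obtain ⟨hl1, hl2, hl3⟩ := hl
  have ha1 : a ∉ l₁ := fun h => hl3 a h a (by simp) rfl
  have hup : ∀ (m : ι) (l : List ι), m ∉ l →
      (l.map fun x => if x = m then d x + e else d x) = l.map d := fun m l hm =>
    List.map_congr_left fun x hx => if_neg (by rintro rfl; exact hm hx)
  rcases List.mem_append.1 hb with hb | hb
  · right
    obtain ⟨l₃, l₄, rfl⟩ := List.append_of_mem hb
    rw [List.nodup_append] at hl1
    have hb3 : b ∉ l₃ := fun h => hl1.2.2 b h b (by simp) rfl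
    have hb4 : b ∉ l₄ := (List.nodup_cons.1 hl1.2.1).1
    simp only [List.mem_append, List.mem_cons, not_or] at ha1
    rw [pre_append_cons _ _ _ _ (by simp [ha1]),
      pre_append_cons _ _ _ _ (by simp [ha1])]
    simp only [List.append_assoc, List.cons_append]
    rw [pre_append_cons _ _ _ _ hb3, pre_append_cons _ _ _ _ hb3, hup _ _ ha1.1]
    simp only [List.map_append, List.map_cons, List.sum_append, List.sum_cons, if_true,
      hup _ _ hb3, hup _ _ hb4]
    ring
  · left
    have hb' : b ∈ l₂ := by simpa [hab.symm] using hb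
    have hb1 : b ∉ l₁ := fun h => hl3 b h b hb rfl
    obtain ⟨l₃, l₄, rfl⟩ := List.append_of_mem hb'
    have hl2' := (List.nodup_cons.1 hl2)
    have hb3 : b ∉ l₃ := fun h => (List.nodup_append.1 hl2'.2).2.2 b h b (by simp) rfl
    have ha3 : a ∉ l₃ := fun h => hl2'.1 (by simp [h])
    rw [pre_append_cons _ _ _ _ ha1, pre_append_cons _ _ _ _ ha1]
    have : l₁ ++ a :: (l₃ ++ b :: l₄) = (l₁ ++ a :: l₃) ++ b :: l₄ := by simp
    rw [this, pre_append_cons _ _ _ _ (by simp [hb1, hb3, hab.symm]),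
      pre_append_cons _ _ _ _ (by simp [hb1, hb3, hab.symm])]
    simp only [List.map_append, List.map_cons, List.sum_append, List.sum_cons, if_true,
      hup _ _ ha1, hup _ _ ha3, hup _ _ hb1]
    ring

section CompZero

variable {M'' : Colour → ℤ → Type*} [∀ c n, AddCommGroup (M'' c n)] [∀ c n, Module k (M'' c n)]

/-- The composite of two infinitesimal composites of degree `-1`: the terms in which the two maps
are applied to different boxes cancel in pairs. -/
theorem inf_comp_inf_eq_zero {u : Bool} (f : ∀ c n, M' c n →ₗ[k] M'' c n)
    (g : ∀ c i j, M' c i →ₗ[k] M'' c j) (f' : ∀ c n, M c n →ₗ[k] M' c n)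
    (g' : ∀ c i j, M c i →ₗ[k] M' c j)
    (hgg : ∀ c i j l, g c j l ∘ₗ g' c i j = 0)
    (hgf : ∀ c i j, g c i j ∘ₗ f' c i = f c j ∘ₗ g' c i j) (c : Colour) (i j l : ℤ) :
    T.inf u f g (-1) c j l ∘ₗ T.inf u f' g' (-1) c i j = 0 := by
  classical
  by_cases hj : j = i + -1
  swap
  · rw [inf_eq_zero f' g' (-1) c hj, LinearMap.comp_zero]
  refine T.hom_ext fun t ht => ?_
  rw [LinearMap.comp_apply, LinearMap.zero_apply]
  rw [← skel_map_lookup t] at ht ⊢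
  have hR := nodup_skel t
  revert ht hR
  generalize t.skel = R
  generalize lookup t = v
  intro ht hR
  rw [inf_gen _ _ _ j hR _ ht, map_sum]
  have step : ∀ m ∈ R.nodes.toFinset, T.inf u f g (-1) c j l
      (((-1 * pre (fun l => (v l).deg) R.nodes m).negOnePow : ℤ) •
        gen k u c j (R.map fun l => if l = m then (v l).shift g' (-1) else (v l).map f')) =
      ∑ m' ∈ R.nodes.toFinset,
        ((-1 * pre (fun l => (v l).deg) R.nodes m).negOnePow *
        (-1 * pre (fun l => if l = m then (v l).deg + -1 else (v l).deg) R.nodes m').negOnePow : ℤ)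
        • gen k u c l (R.map fun l => if l = m' then
            (if l = m then (v l).shift g' (-1) else (v l).map f').shift g (-1) else
            (if l = m then (v l).shift g' (-1) else (v l).map f').map f) := by
    intro m hm
    rw [map_zsmul, inf_gen f g (-1) l hR _
      ((good_inf f' g' (-1) hR ht (List.mem_toFinset.1 hm)).2 hj), Finset.smul_sum]
    refine Finset.sum_congr rfl fun m' _ => ?_
    rw [smul_smul]
    congr 5
    exact congrArg (fun d => pre d R.nodes m') (funext fun l => by split_ifs <;> rfl)
  have hzero : ∀ m, (if m = m then
      (if m = m then (v m).shift g' (-1) else (v m).map f').shift g (-1) else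
      (if m = m then (v m).shift g' (-1) else (v m).map f').map f) =
      ⟨(v m).c, (v m).deg + -1 + -1, 0⟩ := by
    intro m
    rw [if_pos rfl, if_pos rfl]
    have := LinearMap.congr_fun (hgg (v m).c (v m).deg ((v m).deg + -1) ((v m).deg + -1 + -1))
      (v m).x
    simp only [Box.shift, Box.mk.injEq, true_and, heq_eq_eq]
    exact this
  rw [Finset.sum_congr rfl step, ← Finset.sum_product']
  -- exchanging the two boxes is an involution of the terms; the terms with `m = m'` vanish
  refine Finset.sum_involution (fun x _ => (x.2, x.1)) ?_ ?_ ?_ ?_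
  · rintro ⟨m, m'⟩ hmm
    rw [Finset.mem_product, List.mem_toFinset, List.mem_toFinset] at hmm
    obtain ⟨hm, hm'⟩ := hmm
    dsimp only at hm hm' ⊢
    by_cases e : m = m'
    · subst e
      have : gen k u c l (R.map fun l => if l = m then
            (if l = m then (v l).shift g' (-1) else (v l).map f').shift g (-1) else
            (if l = m then (v l).shift g' (-1) else (v l).map f').map f) = 0 := by
        exact gen_eq_zero_of_label hR _ hm (hzero m)
      rw [this]; simp
    · have hbox : (R.map fun l => if l = m' then
            (if l = m then (v l).shift g' (-1) else (v l).map f').shift g (-1) else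
            (if l = m then (v l).shift g' (-1) else (v l).map f').map f) =
          (R.map fun l => if l = m then
            (if l = m' then (v l).shift g' (-1) else (v l).map f').shift g (-1) else
            (if l = m' then (v l).shift g' (-1) else (v l).map f').map f) := by
        refine map_congr fun b _ => ?_
        have h1 : ∀ b : Box M, (b.map f').shift g (-1) = (b.shift g' (-1)).map f := by
          rintro ⟨c, d, x⟩
          have := LinearMap.congr_fun (hgf c d (d + -1)) x
          simp only [Box.map, Box.shift, Box.mk.injEq, true_and, heq_eq_eq]
          exact this
        by_cases b1 : b = m
        · subst b1
          simp [e, h1]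
        · by_cases b2 : b = m'
          · subst b2
            simp [b1, h1]
          · simp [b1, b2]
      rw [hbox, ← add_smul]
      convert zero_smul ℤ _
      rw [← Units.val_mul, ← Units.val_mul, ← Int.negOnePow_add, ← Int.negOnePow_add]
      have : ∀ x y : ℤ, x = y + 1 ∨ x = y - 1 → ((x.negOnePow : ℤ) + (y.negOnePow : ℤ)) = 0 := by
        rintro x y (rfl | rfl)
        · rw [Int.negOnePow_succ]; simp
        · rw [Int.negOnePow_sub, Int.negOnePow_one]; simp
      refine this _ _ ?_
      rcases pre_update hR hm hm' e (fun l => (v l).deg) (-1) with h | h <;>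
        simp only [neg_one_mul] at h ⊢ <;> omega
  · rintro ⟨m, m'⟩ hmm h0 e
    simp only [Prod.mk.injEq] at e
    obtain ⟨rfl, -⟩ := e
    refine h0 ?_
    rw [Finset.mem_product] at hmm
    have hm := List.mem_toFinset.1 hmm.1
    dsimp only at hm ⊢
    rw [gen_eq_zero_of_label hR _ hm (hzero m'), smul_zero]
  · rintro ⟨m, m'⟩ hmm
    rw [Finset.mem_product] at hmm ⊢
    exact hmm.symm
  · rintro ⟨m, m'⟩ hmm
    rfl

end CompZero

end Functoriality

end BoxOperad

namespace BoxOperad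

open Stacking

/-! ### The counit -/

namespace Stacking

variable {α : Type u} {β : Type v}

theorem map_corolla (g : α → β) (col : β → Colour) (a : α) :
    (corolla (fun a => col (g a)) a).map g = corolla col (g a) := rfl

theorem nodes_corolla (col : α → Colour) (a : α) : (corolla col a).nodes = [a] := by
  simp [corolla, nodes]

theorem arity_corolla (col : α → Colour) (a : α) : (corolla col a).arity col = col a := by
  ext <;> simp [arity, corolla, left, right, leaves]

theorem valid_corolla (col : α → Colour) (a : α) : (corolla col a).Valid col :=
  ⟨rfl, fun _ => ⟨trivial, rfl, rfl⟩⟩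

theorem corolla_ne_eta (col : α → Colour) (a : α) : corolla col a ≠ eta := by simp [corolla]

/-- A stacking which becomes a one-box stacking after a relabelling is one. -/
theorem map_eq_corolla {g : α → β} {col : β → Colour} {X : Stacking α} {b : β}
    (h : X.map g = corolla col b) : ∃ a, X = corolla (fun a => col (g a)) a ∧ g a = b := by
  cases X with
  | eta => simp [map, corolla] at h
  | box a n w ch =>
    simp only [map, corolla, box.injEq] at h
    obtain ⟨rfl, rfl, h3, h4⟩ := h
    refine ⟨a, ?_, rfl⟩
    rw [heq_eq_eq] at h3 h4
    rw [corolla, h3]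
    congr 1
    funext i
    exact map_eq_eta.1 (congrFun h4 i)

theorem exists_map_corolla {col : α → Colour} (N : Stacking (Stacking α))
    (h : ∀ X ∈ N.nodes, ∃ a, X = corolla col a) : ∃ S : Stacking α, N = S.map (corolla col) := by
  induction N with
  | eta => exact ⟨eta, rfl⟩
  | box X n w ch ih =>
    obtain ⟨a, rfl⟩ := h X (mem_nodes_box.2 (Or.inl rfl))
    choose S hS using fun i => ih i fun Y hY => h Y (mem_nodes_box.2 (Or.inr ⟨i, hY⟩))
    exact ⟨box a n w S, by simp only [map, ← hS]⟩

theorem corolla_mem_nestings {col : α → Colour} {S : Stacking α} (hS : S.Valid col) (h : S ≠ eta) :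
    corolla (arity col) S ∈ nestings col S := by
  refine ⟨⟨?_, valid_corolla _ _⟩, ?_, flatten_corolla _ _⟩
  · rw [nodes_corolla]; simpa using hS
  · rw [nodes_corolla]; simpa using h

theorem valid_map_corolla {col : α → Colour} {S : Stacking α} :
    (S.map (corolla col)).Valid (arity col) ↔ S.Valid col := by
  rw [valid_map]
  exact valid_congr fun a _ => arity_corolla col a

theorem map_corolla_mem_nestings {col : α → Colour} {S : Stacking α} (hS : S.Valid col) :
    S.map (corolla col) ∈ nestings col S := by
  refine ⟨⟨?_, valid_map_corolla.2 hS⟩, ?_, flatten_map_corolla col hS⟩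
  · simp only [nodes_map, List.mem_map, forall_exists_index, and_imp, forall_apply_eq_imp_iff₂]
    exact fun a _ => valid_corolla col a
  · simp only [nodes_map, List.mem_map, forall_exists_index, and_imp, forall_apply_eq_imp_iff₂]
    exact fun a _ => corolla_ne_eta col a

end Stacking

section Counit

variable {k : Type u} [CommRing k]
variable {M : Colour → ℤ → Type v} [∀ c n, AddCommGroup (M c n)] [∀ c n, Module k (M c n)]
variable {M' : Colour → ℤ → Type w} [∀ c n, AddCommGroup (M' c n)] [∀ c n, Module k (M' c n)]
variable {ι : Type*}

theorem good_corolla (u : Bool) (b : Box M) : Good u b.c b.deg (corolla Box.c b) := by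
  refine ⟨valid_corolla _ _, arity_corolla _ _, ?_, fun _ => corolla_ne_eta _ _⟩
  simp [degree, nodes_corolla]

theorem counit_corolla (u : Bool) (b : Box M) :
    counit (k := k) u b.c b.deg (gen k u b.c b.deg (corolla Box.c b)) = b.x := by
  rw [counit, T.lift_gen, if_pos (good_corolla u b), if_pos ⟨b.c, rfl⟩]
  have : lookup (corolla Box.c b) 0 = b := by simp [lookup, nodes_corolla]
  rw [this]
  simp [Box.val]

theorem counit_eq_zero {u : Bool} {c : Colour} {n : ℤ} {R : Stacking ι} (v : ι → Box M)
    (h : ∀ a, R ≠ corolla (fun l => (v l).c) a) :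
    counit u c n (gen k u c n (R.map v)) = 0 := by
  rw [counit, T.lift_gen]
  split_ifs with h1 h2
  · obtain ⟨c', hc'⟩ := h2
    rw [map_map] at hc'
    obtain ⟨a, ha, -⟩ := map_eq_corolla hc'
    exact absurd ha (h a)
  · rfl
  · rfl

theorem part_eq {t : Stacking (Box M)} {c : Colour} {n : ℤ} (hc : t.arity Box.c = c)
    (hn : degree t = n) : part k t = ⟨c, n, gen k false c n t⟩ := by
  subst hc hn; rfl

theorem counit_part_corolla (v : ι → Box M) (a : ι) :
    (part k ((corolla (fun l => (v l).c) a).map v)).map (counit false) = v a := by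
  rw [map_corolla v Box.c a, part_eq (k := k) (good_corolla false (v a)).2.1
    (good_corolla false (v a)).2.2.1, Box.map]
  simp only [counit_corolla]

theorem corolla_map_eq (v : ι → Box M) (a : ι) :
    (corolla (fun l => (v l).c) a).map v = corolla Box.c (v a) := rfl

/-- The counit is natural with respect to infinitesimal composites. -/
theorem counit_comp_inf {u : Bool} (f : ∀ c n, M c n →ₗ[k] M' c n)
    (g : ∀ c i j, M c i →ₗ[k] M' c j) (e : ℤ) (c : Colour) (i : ℤ) :
    counit u c (i + e) ∘ₗ T.inf u f g e c i (i + e) = g c i (i + e) ∘ₗ counit u c i := by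
  classical
  refine T.hom_ext fun t ht => ?_
  rw [LinearMap.comp_apply, LinearMap.comp_apply]
  rw [← skel_map_lookup t] at ht ⊢
  have hR := nodup_skel t
  revert ht hR
  generalize t.skel = R
  generalize lookup t = v
  intro ht hR
  rw [inf_gen f g e _ hR v ht, map_sum]
  by_cases h : ∃ a, R = corolla (fun l => (v l).c) a
  · obtain ⟨a, rfl⟩ := h
    rw [nodes_corolla]
    obtain ⟨-, hc, hn, -⟩ := good_map_iff.1 ht
    rw [arity_corolla] at hc
    simp only [nodes_corolla, List.map_cons, List.map_nil, List.sum_cons, List.sum_nil,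
      add_zero] at hn
    subst hc hn
    simp only [List.toFinset_cons, List.toFinset_nil, insert_empty_eq, Finset.sum_singleton, pre,
      if_true, mul_zero, Int.negOnePow_zero, Units.val_one, one_smul]
    have h1 : (corolla (fun l => (v l).c) a).map
        (fun l => if l = a then (v l).shift g e else (v l).map f) =
        corolla Box.c ((v a).shift g e) := by
      simp only [corolla, Stacking.map, if_true]
      rfl
    rw [h1, corolla_map_eq, counit_corolla]
    exact counit_corolla u ((v a).shift g e)
  · push Not at h
    rw [counit_eq_zero v h, map_zero]
    refine Finset.sum_eq_zero fun m _ => ?_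
    rw [map_zsmul, counit_eq_zero, smul_zero]
    intro a ha
    refine h a (ha.trans ?_)
    congr 1
    funext l
    split_ifs <;> rfl

theorem good_nest {u : Bool} {c : Colour} {n : ℤ} {R : Stacking ι} {v : ι → Box M}
    (h : Good u c n (R.map v)) {N : Stacking (Stacking ι)}
    (hN : N ∈ nestings (fun l => (v l).c) R) :
    Good u c n (N.map fun X => part k (X.map v)) := by
  obtain ⟨h1, h2, h3, h4⟩ := good_map_iff.1 h
  have hp := nestings_perm hN
  rw [good_map_iff]
  simp only [part, arity_map]
  refine ⟨hN.1.2, ?_, ?_, ?_⟩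
  · exact (arity_flatten hN.1).symm.trans (by rw [hN.2.2, h2])
  · rw [← h3, (hp.map _).sum_eq, nestNodes, List.map_flatMap]
    simp only [degree, nodes_map, List.map_map, List.flatMap, List.sum_flatten]
    rfl
  · intro hu e
    subst e
    exact h4 hu hN.2.2.symm

theorem good_part {R : Stacking ι} {v : ι → Box M} {N : Stacking (Stacking ι)}
    (hN : N ∈ nestings (fun l => (v l).c) R) {X : Stacking ι} (hX : X ∈ N.nodes) :
    Good false (arity Box.c (X.map v)) (degree (X.map v)) (X.map v) :=
  ⟨(valid_map _ _ _).2 (hN.1.1 X hX), rfl, rfl, fun _ e => hN.2.1 X hX (map_eq_eta.1 e)⟩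

/-- Only the decomposition with a single part contributes. -/
theorem counit_comp_decomp (c : Colour) (n : ℤ) :
    counit false c n ∘ₗ decomp false c n = LinearMap.id (R := k) (M := T k M false c n) := by
  refine T.hom_ext fun t ht => ?_
  rw [LinearMap.comp_apply, LinearMap.id_apply]
  rw [← skel_map_lookup t] at ht ⊢
  have hR := nodup_skel t
  revert ht hR
  generalize t.skel = R
  generalize lookup t = v
  intro ht hR
  obtain ⟨h1, h2, h3, h4⟩ := good_map_iff.1 ht
  have hmem := corolla_mem_nestings h1 (h4 rfl)
  rw [decomp_gen hR v ht, map_sum, Finset.sum_eq_single (corolla (arity fun l => (v l).c) R)]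
  · have e1 : (corolla (arity fun l => (v l).c) R).nestNodes = R.nodes := by
      simp [nestNodes, nodes_corolla]
    rw [e1, ksgn_eq (kos_symm _) hR (KPerm.refl _), Units.val_one, one_smul]
    have e2 : (corolla (arity fun l => (v l).c) R).map (fun X => part k (X.map v)) =
        corolla Box.c (part k (R.map v)) := by
      rw [← map_corolla (fun X => part k (X.map v)) Box.c R]
      simp only [part, arity_map]
    rw [e2]
    obtain ⟨-, hc, hn, -⟩ := ht
    subst hc hn
    exact counit_corolla false (part k (R.map v))
  · intro N hN hne
    rw [Set.Finite.mem_toFinset] at hN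
    rw [map_zsmul, counit_eq_zero, smul_zero]
    intro X hX
    have hX' : N = corolla (arity fun l => (v l).c) X := by
      rw [hX]; simp only [part, arity_map]
    refine hne ?_
    have := hN.2.2
    rw [hX', flatten_corolla] at this
    rw [hX', this]
  · intro h
    exact absurd ((Set.Finite.mem_toFinset _).2 hmem) h

/-- Only the decomposition into single boxes contributes. -/
theorem map_counit_comp_decomp (u : Bool) (c : Colour) (n : ℤ) :
    T.map u (counit false) c n ∘ₗ decomp u c n = LinearMap.id (R := k) (M := T k M u c n) := by
  refine T.hom_ext fun t ht => ?_
  rw [LinearMap.comp_apply, LinearMap.id_apply]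
  rw [← skel_map_lookup t] at ht ⊢
  have hR := nodup_skel t
  revert ht hR
  generalize t.skel = R
  generalize lookup t = v
  intro ht hR
  obtain ⟨h1, h2, h3, h4⟩ := good_map_iff.1 ht
  have hmem := map_corolla_mem_nestings h1
  rw [decomp_gen hR v ht, map_sum, Finset.sum_eq_single (R.map (corolla fun l => (v l).c))]
  · have e1 : (R.map (corolla fun l => (v l).c)).nestNodes = R.nodes := by
      simp [nestNodes, nodes_map, List.flatMap_map, nodes_corolla]
    rw [e1, ksgn_eq (kos_symm _) hR (KPerm.refl _), Units.val_one, one_smul, map_gen, map_map,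
      map_map]
    refine congrArg _ (map_congr fun a _ => counit_part_corolla v a)
  · intro N hN hne
    rw [Set.Finite.mem_toFinset] at hN
    have : ∃ X ∈ N.nodes, ∀ a, X ≠ corolla (fun l => (v l).c) a := by
      by_contra! hc
      obtain ⟨S, rfl⟩ := exists_map_corolla N hc
      have h5 := hN.2.2
      rw [flatten_map_corolla _ (valid_map_corolla.1 hN.1.2)] at h5
      exact hne (by rw [h5])
    obtain ⟨X, hX, hXc⟩ := this
    rw [map_zsmul, map_gen, map_map]
    convert smul_zero _
    refine gen_eq_zero_of_label (nestings_nodup hR hN).1 _ hX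
      (c' := arity Box.c (X.map v)) (n' := degree (X.map v)) ?_
    rw [Box.map]
    congr 1
    exact counit_eq_zero v hXc
  · intro h
    exact absurd ((Set.Finite.mem_toFinset _).2 hmem) h

end Counit

end BoxOperad

namespace BoxOperad

open Stacking

/-! ### Naturality of the comultiplication -/

section Decomp

variable {k : Type u} [CommRing k]
variable {M : Colour → ℤ → Type v} [∀ c n, AddCommGroup (M c n)] [∀ c n, Module k (M c n)]
variable {M' : Colour → ℤ → Type w} [∀ c n, AddCommGroup (M' c n)] [∀ c n, Module k (M' c n)]
variable {ι : Type*}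

theorem eq_of_mem_nodes {L : List (Stacking ι)} (hd : (L.flatMap nodes).Nodup) {X Y : Stacking ι}
    (hX : X ∈ L) (hY : Y ∈ L) {l : ι} (hl : l ∈ X.nodes) (hm : l ∈ Y.nodes) : X = Y := by
  by_contra hne
  obtain ⟨l₁, l₂, h12⟩ := List.append_of_mem hY
  rw [h12, List.flatMap_append, List.flatMap_cons] at hd
  rw [h12, List.mem_append, List.mem_cons] at hX
  rw [List.nodup_append, List.nodup_append] at hd
  rcases hX with hX | hX | hX
  · exact hd.2.2 l (List.mem_flatMap.2 ⟨X, hX, hl⟩) l (by simp [hm]) rfl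
  · exact hne hX
  · exact hd.2.1.2.2 l hm l (List.mem_flatMap.2 ⟨X, hX, hl⟩) rfl

/-- A sum over the boxes, part by part. -/
theorem sum_nestings [DecidableEq ι] {A : Type*} [AddCommMonoid A] {col : ι → Colour}
    {R : Stacking ι} (hR : R.nodes.Nodup) {N : Stacking (Stacking ι)} (hN : N ∈ nestings col R)
    [DecidableEq (Stacking ι)] (F : Stacking ι → ι → A) (G : ι → A)
    (h : ∀ Y ∈ N.nodes, ∀ m ∈ Y.nodes, F Y m = G m) :
    ∑ Y ∈ N.nodes.toFinset, ∑ m ∈ Y.nodes.toFinset, F Y m = ∑ m ∈ R.nodes.toFinset, G m := by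
  have hp := nestings_perm hN
  have e : R.nodes.toFinset = N.nodes.toFinset.biUnion fun Y => Y.nodes.toFinset := by
    ext a
    rw [List.mem_toFinset, hp.mem_iff, nestNodes, List.mem_flatMap]
    simp
  have hd := (hp.nodup_iff.1 hR)
  rw [e, Finset.sum_biUnion]
  · refine Finset.sum_congr rfl fun Y hY => Finset.sum_congr rfl fun m hm => ?_
    exact h Y (List.mem_toFinset.1 hY) m (List.mem_toFinset.1 hm)
  · intro X hX Y hY hXY
    rw [Function.onFun, Finset.disjoint_left]
    intro a haX haY
    exact hXY (eq_of_mem_nodes hd (by simpa using hX) (by simpa using hY)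
      (List.mem_toFinset.1 haX) (List.mem_toFinset.1 haY))

/-- The position of an element in a decomposition. -/
theorem pre_nestNodes {α : Type*} (d : α → ℤ) {L : List (Stacking α)} {Y : Stacking α} {m : α}
    (hY : Y ∈ L) (hm : m ∈ Y.nodes) (hL : (L.flatMap nodes).Nodup) :
    pre d (L.flatMap nodes) m = pre (fun X => (X.nodes.map d).sum) L Y + pre d Y.nodes m := by
  obtain ⟨l₁, l₂, rfl⟩ := List.append_of_mem hY
  obtain ⟨l₃, l₄, h34⟩ := List.append_of_mem hm
  rw [List.flatMap_append, List.flatMap_cons, List.nodup_append] at hL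
  have hYn : Y.nodes.Nodup := (List.nodup_append.1 hL.2.1).1
  have h1 : m ∉ l₁.flatMap nodes := fun h => hL.2.2 m h m (by simp [hm]) rfl
  have hY1 : Y ∉ l₁ := fun h => h1 (List.mem_flatMap.2 ⟨Y, h, hm⟩)
  have h3 : m ∉ l₃ := by
    rw [h34, List.nodup_append] at hYn
    exact fun h => hYn.2.2 m h m (by simp) rfl
  rw [pre_append_cons _ _ _ _ hY1, h34, pre_append_cons _ _ _ _ h3]
  have : (l₁ ++ Y :: l₂).flatMap nodes =
      (l₁.flatMap nodes ++ l₃) ++ m :: (l₄ ++ l₂.flatMap nodes) := by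
    simp [h34]
  rw [this, pre_append_cons _ _ _ _ (by simp [h1, h3])]
  rw [List.map_append, List.sum_append, List.map_flatMap]
  congr 1
  simp only [List.flatMap, List.sum_flatten, List.map_map]
  rfl

theorem part_map (f : ∀ c n, M c n →ₗ[k] M' c n) (t : Stacking (Box M)) :
    (part k t).map (T.map false f) = part k (t.map (Box.map f)) := by
  rw [part_eq (k := k) (t := t.map (Box.map f)) (c := t.arity Box.c) (n := degree t)]
  · rw [Box.map, part]
    simp only [map_gen]
  · rw [arity_map]; rfl
  · rw [degree, nodes_map, List.map_map]; rfl

/-- A stacking as a linear function of one of its elements. -/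
noncomputable def genLabel [DecidableEq ι] (u : Bool) (c : Colour) (n : ℤ) {R : Stacking ι}
    (hR : R.nodes.Nodup) (v : ι → Box M) {m : ι} (hm : m ∈ R.nodes) (c' : Colour) (n' : ℤ) :
    M c' n' →ₗ[k] T k M u c n where
  toFun x := gen k u c n (R.map (Function.update v m ⟨c', n', x⟩))
  map_add' x y := by
    have hc : R.nodes.countP (fun l => decide (l = m)) = 1 := List.count_eq_one_of_mem hR hm
    have := gen_map (k := k) (u := u) (c := c) (n := n) R (fun l => decide (l = m)) hc c' n' 1 x y
      (Function.update v m ⟨c', n', x + y⟩) (Function.update v m ⟨c', n', x⟩)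
      (Function.update v m ⟨c', n', y⟩) (fun b _ hb => ?_) (fun b _ hb => ?_) (fun b _ hb => ?_)
      (fun b _ hb => ?_) (fun b _ hb => ?_)
    · rwa [one_smul] at this
    · have hb : b ≠ m := by simpa using hb
      rw [Function.update_of_ne hb, Function.update_of_ne hb]
    · have hb : b ≠ m := by simpa using hb
      rw [Function.update_of_ne hb, Function.update_of_ne hb]
    all_goals
      have hb : b = m := by simpa using hb
      subst hb
      simp
  map_smul' a x := gen_smul_label hR _ _ hm c' n' a x (Function.update_self _ _ _)
    (Function.update_self _ _ _) fun l _ hl => by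
      rw [Function.update_of_ne hl, Function.update_of_ne hl]

theorem genLabel_apply [DecidableEq ι] {u : Bool} {c : Colour} {n : ℤ} {R : Stacking ι}
    (hR : R.nodes.Nodup) (v v' : ι → Box M) {m : ι} (hm : m ∈ R.nodes) {c' : Colour} {n' : ℤ}
    (x : M c' n') (h : v' m = ⟨c', n', x⟩) (hv : ∀ l ∈ R.nodes, l ≠ m → v' l = v l) :
    gen k u c n (R.map v') = genLabel u c n hR v hm c' n' x := by
  refine congrArg (gen k u c n) (map_congr fun l hl => ?_)
  by_cases e : l = m
  · subst e; rw [h, Function.update_self]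
  · rw [hv l hl e, Function.update_of_ne e]

/-- The comultiplication is natural with respect to infinitesimal composites. -/
theorem decomp_comp_inf {u : Bool} (f : ∀ c n, M c n →ₗ[k] M' c n)
    (g : ∀ c i j, M c i →ₗ[k] M' c j) (e : ℤ) (c : Colour) (i j : ℤ) :
    decomp u c j ∘ₗ T.inf u f g e c i j =
      T.inf u (T.map false f) (T.inf false f g e) e c i j ∘ₗ decomp u c i := by
  classical
  by_cases hj : j = i + e
  swap
  · rw [inf_eq_zero _ _ _ _ hj, inf_eq_zero _ _ _ _ hj, LinearMap.comp_zero, LinearMap.zero_comp]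
  refine T.hom_ext fun t ht => ?_
  rw [LinearMap.comp_apply, LinearMap.comp_apply]
  rw [← skel_map_lookup t] at ht ⊢
  have hR := nodup_skel t
  revert ht hR
  generalize t.skel = R
  generalize lookup t = v
  intro ht hR
  rw [inf_gen f g e j hR v ht, decomp_gen hR v ht, map_sum, map_sum]
  set w : ℕ → ℕ → Box M' := fun m l => if l = m then (v l).shift g e else (v l).map f with hw
  have hwc : ∀ m, (fun l => (w m l).c) = fun l => (v l).c := fun m => funext fun l => by
    simp only [hw]; split_ifs <;> rfl
  have hwd : ∀ m, (fun l => (w m l).deg) =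
      Function.update (fun l => (v l).deg) m ((v m).deg + e) := fun m => funext fun l => by
    simp only [hw]
    split_ifs with h
    · subst h; simp [Box.shift]
    · rw [Function.update_of_ne h]; rfl
  have lhs : ∀ m ∈ R.nodes.toFinset, decomp u c j
      (((e * pre (fun l => (v l).deg) R.nodes m).negOnePow : ℤ) • gen k u c j (R.map (w m))) =
      ∑ N ∈ (finite_nestings (fun l => (v l).c) R).toFinset,
        ((e * pre (fun l => (v l).deg) R.nodes m).negOnePow *
          ksgn (kos fun l => (w m l).deg) R.nodes N.nestNodes : ℤ) •
          gen k u c j (N.map fun X => part k (X.map (w m))) := by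
    intro m hm
    rw [map_zsmul, decomp_gen hR (w m) ((good_inf f g e hR ht (List.mem_toFinset.1 hm)).2 hj),
      Finset.smul_sum]
    have : (finite_nestings (fun l => (w m l).c) R).toFinset =
        (finite_nestings (fun l => (v l).c) R).toFinset := by
      ext N; rw [Set.Finite.mem_toFinset, Set.Finite.mem_toFinset, hwc]
    rw [this]
    refine Finset.sum_congr rfl fun N _ => ?_
    rw [smul_smul]
  rw [Finset.sum_congr rfl lhs, Finset.sum_comm]
  refine Finset.sum_congr rfl fun N hN => ?_
  rw [Set.Finite.mem_toFinset] at hN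
  obtain ⟨hNn, hXn⟩ := nestings_nodup hR hN
  have hp := nestings_perm hN
  rw [map_zsmul, inf_gen _ _ e j hNn _ (good_nest ht hN), Finset.smul_sum]
  symm
  have key : ∀ Y ∈ N.nodes.toFinset,
      (ksgn (kos fun l => (v l).deg) R.nodes N.nestNodes : ℤ) •
        ((e * pre (fun X => (part k (X.map v)).deg) N.nodes Y).negOnePow : ℤ) •
        gen k u c j (N.map fun X => if X = Y then
          (part k (X.map v)).shift (T.inf false f g e) e else
          (part k (X.map v)).map (T.map false f)) =
      ∑ m ∈ Y.nodes.toFinset, (ksgn (kos fun l => (v l).deg) R.nodes N.nestNodes *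
        ((e * pre (fun X => (part k (X.map v)).deg) N.nodes Y).negOnePow *
        (e * pre (fun l => (v l).deg) Y.nodes m).negOnePow) : ℤ) •
          gen k u c j (N.map fun X => part k (X.map (w m))) := by
    intro Y hY
    rw [List.mem_toFinset] at hY
    have hgood := good_part hN hY
    rw [genLabel_apply (u := u) (c := c) (n := j) hNn
      (fun X => (part k (X.map v)).map (T.map false f)) _ hY
      (c' := arity Box.c (Y.map v)) (n' := degree (Y.map v) + e)
      (T.inf false f g e (arity Box.c (Y.map v)) (degree (Y.map v)) (degree (Y.map v) + e)
        (gen k false _ _ (Y.map v))) (by rw [if_pos rfl]; rfl)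
      (fun X _ hX => by rw [if_neg hX]), inf_gen f g e _ (hXn Y hY) v hgood, map_sum,
      Finset.smul_sum, Finset.smul_sum]
    refine Finset.sum_congr rfl fun m hm => ?_
    rw [List.mem_toFinset] at hm
    rw [map_zsmul, smul_smul, smul_smul, mul_assoc]
    congr 1
    symm
    refine genLabel_apply (u := u) (c := c) (n := j) hNn
      (fun X => (part k (X.map v)).map (T.map false f)) _ hY _ ?_ ?_
    · refine part_eq ?_ ?_
      · have := ((good_inf (j := degree (Y.map v) + e) f g e (hXn Y hY) hgood hm).2 rfl).2.1
        exact this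
      · have := ((good_inf (j := degree (Y.map v) + e) f g e (hXn Y hY) hgood hm).2 rfl).2.2.1
        exact this
    · intro X hX hXY
      rw [part_map, map_map]
      congr 1
      refine map_congr fun l hl => if_neg ?_
      rintro rfl
      exact hXY (eq_of_mem_nodes (hp.nodup_iff.1 hR) hX hY hl hm)
  rw [Finset.sum_congr rfl key]
  refine sum_nestings hR hN _ _ fun Y hY m hm => ?_
  congr 1
  have hmR : m ∈ R.nodes := mem_of_nesting hN hY hm
  -- the sign of the rearrangement changes by the positions of `m` before and after it
  have h1 := (ksgn_spec (kos fun l => (v l).deg) hp).update hR m hmR e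
  have h1' : KPerm (kos fun l => (w m l).deg) R.nodes N.nestNodes
      (ksgn (kos fun l => (v l).deg) R.nodes N.nestNodes *
        (e * (pre (fun l => (v l).deg) R.nodes m +
          pre (fun l => (v l).deg) N.nestNodes m)).negOnePow) := by
    rw [hwd m]; convert h1
  rw [ksgn_eq (kos_symm _) hR h1']
  have h2 : pre (fun l => (v l).deg) N.nestNodes m =
      pre (fun X => (part k (X.map v)).deg) N.nodes Y + pre (fun l => (v l).deg) Y.nodes m := by
    rw [nestNodes, pre_nestNodes _ hY hm (hp.nodup_iff.1 hR)]
    congr 1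
    refine congrArg (fun d => pre d N.nodes Y) (funext fun X => ?_)
    simp only [part, degree, nodes_map, List.map_map]
    rfl
  rw [h2, ← Units.val_mul, ← Units.val_mul, ← Units.val_mul, ← Int.negOnePow_add, mul_left_comm,
    ← Int.negOnePow_add]
  congr 2
  rw [Int.negOnePow_eq_iff]
  exact ⟨-e * pre (fun l => (v l).deg) R.nodes m, by ring⟩

end Decomp

end BoxOperad

namespace BoxOperad

open Stacking

/-! ### Coassociativity of the comultiplication -/

section Coassociativity

variable {k : Type u} [CommRing k]
variable {M : Colour → ℤ → Type v} [∀ c n, AddCommGroup (M c n)] [∀ c n, Module k (M c n)]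
variable {ι : Type*}

/-- A stacking whose labels are linear combinations, expanded. -/
theorem gen_sum {u : Bool} {c : Colour} {n : ℤ} {R : Stacking ι} (hR : R.nodes.Nodup)
    {J : Type*} [DecidableEq ι] (j₀ : J) (A : ι → Finset J) (C : ι → Colour) (D : ι → ℤ)
    (s : ι → J → ℤ) (x : ∀ l, J → M (C l) (D l)) :
    gen k u c n (R.map fun l => ⟨C l, D l, ∑ j ∈ A l, s l j • x l j⟩) =
      ∑ r ∈ Fintype.piFinset fun l : {l // l ∈ R.nodes} => A l,
        (R.nodes.map fun l => s l (if h : l ∈ R.nodes then r ⟨l, h⟩ else j₀)).prod •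
          gen k u c n (R.map fun l =>
            ⟨C l, D l, x l (if h : l ∈ R.nodes then r ⟨l, h⟩ else j₀)⟩) := by
  have e : ∀ (l : ι) (j : J), s l j • x l j = ((s l j : ℤ) : k) • x l j := fun l j =>
    (Int.cast_smul_eq_zsmul k _ _).symm
  rw [← genMulti_apply (k := k) (u := u) (c := c) (n := n) hR C D
    (fun l => ∑ j ∈ A l, s l j • x l j) _ fun l _ => rfl]
  simp only [e]
  rw [MultilinearMap.map_sum_finset]
  refine Finset.sum_congr rfl fun r _ => ?_
  rw [MultilinearMap.map_smul_univ, ← Int.cast_smul_eq_zsmul k]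
  congr 1
  · rw [Int.cast_list_prod, List.map_map, ← List.prod_toFinset _ hR]
    refine (Finset.prod_bij (fun l _ => l.1) (fun l _ => List.mem_toFinset.2 l.2)
      (fun _ _ _ _ h => Subtype.ext h)
      (fun l h => ⟨⟨l, List.mem_toFinset.1 h⟩, Finset.mem_univ _, rfl⟩)
      fun l _ => ?_)
    simp [l.2]
  · refine genMulti_apply hR C D _ _ fun l hl => ?_
    rw [dif_pos hl]

/-- A decomposition of a decomposition amounts to a decomposition of each part of a coarser
decomposition. -/
theorem map_flatten_mem_nestings {col : ι → Colour} {R : Stacking ι}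
    {N : Stacking (Stacking ι)} {Q : Stacking (Stacking (Stacking ι))}
    (hN : N ∈ nestings col R) (hQ : Q ∈ nestings (arity col) N) :
    Q.map flatten ∈ nestings col R ∧ ∀ N' ∈ Q.nodes, N' ∈ nestings col N'.flatten := by
  obtain ⟨⟨h1, h2⟩, h3, h4⟩ := hN
  obtain ⟨⟨k1, k2⟩, k3, rfl⟩ := hQ
  have hm : Q.Matched := Matched.of_valid k2
  have hmem : ∀ N' ∈ Q.nodes, ∀ Y ∈ N'.nodes, Y ∈ Q.flatten.nodes := fun N' hN' Y hY =>
    (perm_flatten hm).mem_iff.2 (mem_nestNodes hN' hY)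
  have hnv : ∀ N' ∈ Q.nodes, N'.NestValid col := fun N' hN' =>
    ⟨fun X hX => h1 X (hmem N' hN' X hX), k1 N' hN'⟩
  refine ⟨⟨⟨?_, ?_⟩, ?_, ?_⟩, fun N' hN' => ⟨hnv N' hN', fun X hX => h3 X (hmem N' hN' X hX), rfl⟩⟩
  · intro X hX
    rw [nodes_map, List.mem_map] at hX
    obtain ⟨N', hN', rfl⟩ := hX
    exact (flatten_valid (hnv N' hN')).1
  · rw [valid_map]
    exact (valid_congr fun N' hN' => arity_flatten (hnv N' hN')).2 k2
  · intro X hX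
    rw [nodes_map, List.mem_map] at hX
    obtain ⟨N', hN', rfl⟩ := hX
    rw [Ne, flatten_eq_eta fun X hX => h3 X (hmem N' hN' X hX)]
    exact k3 N' hN'
  · rw [← h4, flatten_flatten Q hm fun N' hN' => Matched.of_valid (k1 N' hN')]

/-- The converse of `map_flatten_mem_nestings`: decompositions of the parts of a decomposition. -/
theorem flatten_mem_nestings {col : ι → Colour} {R : Stacking ι}
    {Q : Stacking (Stacking (Stacking ι))} (hN : Q.map flatten ∈ nestings col R)
    (hQ : ∀ N' ∈ Q.nodes, N' ∈ nestings col N'.flatten) :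
    Q.flatten ∈ nestings col R ∧ Q ∈ nestings (arity col) Q.flatten := by
  obtain ⟨⟨h1, h2⟩, h3, h4⟩ := hN
  have k1 : ∀ N' ∈ Q.nodes, N'.Valid (arity col) := fun N' hN' => (hQ N' hN').1.2
  have k2 : Q.Valid (arity (arity col)) := by
    rw [valid_map] at h2
    exact (valid_congr fun N' hN' => arity_flatten (hQ N' hN').1).1 h2
  have hm : Q.Matched := Matched.of_valid k2
  have hmem : ∀ Y ∈ Q.flatten.nodes, ∃ N' ∈ Q.nodes, Y ∈ N'.nodes := fun Y hY => by
    have := (perm_flatten hm).mem_iff.1 hY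
    rwa [nestNodes, List.mem_flatMap] at this
  refine ⟨⟨⟨fun X hX => ?_, (flatten_valid ⟨k1, k2⟩).1⟩, fun X hX => ?_, ?_⟩, ⟨⟨k1, k2⟩, ?_, rfl⟩⟩
  · obtain ⟨N', hN', hX⟩ := hmem X hX
    exact (hQ N' hN').1.1 X hX
  · obtain ⟨N', hN', hX⟩ := hmem X hX
    exact (hQ N' hN').2.1 X hX
  · rw [flatten_flatten Q hm fun N' hN' => Matched.of_valid (k1 N' hN'), h4]
  · intro N' hN' he
    subst he
    exact h3 eta (by rw [nodes_map]; exact List.mem_map.2 ⟨eta, hN', rfl⟩) rfl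

/-- The comultiplication is coassociative. -/
theorem map_decomp_comp_decomp (u : Bool) (c : Colour) (n : ℤ) :
    T.map u (decomp (k := k) (M := M) false) c n ∘ₗ decomp u c n =
      decomp u c n ∘ₗ decomp u c n := by
  classical
  refine T.hom_ext fun t ht => ?_
  rw [LinearMap.comp_apply, LinearMap.comp_apply]
  rw [← skel_map_lookup t] at ht ⊢
  have hR := nodup_skel t
  revert ht hR
  generalize t.skel = R
  generalize lookup t = v
  intro ht hR
  rw [decomp_gen hR v ht, map_sum, map_sum]
  set col : ℕ → Colour := fun l => (v l).c with hcol
  have hpc : (fun Y => (part k (Y.map v)).c) = arity col := funext fun Y => arity_map v Box.c Y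
  have hpd : (fun Y : Stacking ℕ => (part k (Y.map v)).deg) =
      fun Y => (Y.nodes.map fun l => (v l).deg).sum :=
    funext fun Y => by simp only [part, degree, nodes_map, List.map_map]; rfl
  set 𝒩 := (finite_nestings col R).toFinset with h𝒩
  -- the sum on the right is over the two-step decompositions `Q`, grouped by `Q.flatten`; the sum
  -- on the left is over the same `Q`, grouped by `Q.map flatten`
  set 𝒬 := 𝒩.biUnion fun N => (finite_nestings (arity col) N).toFinset with h𝒬
  have mem𝒬 : ∀ Q, Q ∈ 𝒬 ↔ Q.map flatten ∈ nestings col R ∧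
      ∀ N' ∈ Q.nodes, N' ∈ nestings col N'.flatten := fun Q => by
    simp only [h𝒬, h𝒩, Finset.mem_biUnion, Set.Finite.mem_toFinset]
    exact ⟨fun ⟨N, hN, hQ⟩ => map_flatten_mem_nestings hN hQ,
      fun h => ⟨_, (flatten_mem_nestings h.1 h.2).1, (flatten_mem_nestings h.1 h.2).2⟩⟩
  set H : Stacking (Stacking (Stacking ℕ)) → T k (T k (T k M false) false) u c n := fun Q =>
    (ksgn (kos fun l => (v l).deg) R.nodes (Q.nodes.flatMap nestNodes) : ℤ) •
      gen k u c n (Q.map fun N' => part k (N'.map fun Y => part k (Y.map v))) with hH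
  have rhs : ∀ N ∈ 𝒩, decomp u c n ((ksgn (kos fun l => (v l).deg) R.nodes N.nestNodes : ℤ) •
      gen k u c n (N.map fun X => part k (X.map v))) =
      ∑ Q ∈ (finite_nestings (arity col) N).toFinset, H Q := by
    intro N hN
    rw [h𝒩, Set.Finite.mem_toFinset] at hN
    obtain ⟨hNn, -⟩ := nestings_nodup hR hN
    rw [map_zsmul, decomp_gen hNn _ (good_nest ht hN), Finset.smul_sum]
    simp only [hpc, hpd]
    refine Finset.sum_congr rfl fun Q hQ => ?_
    rw [Set.Finite.mem_toFinset] at hQ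
    rw [smul_smul, hH, ← Units.val_mul]
    congr 2
    symm
    refine ksgn_eq (kos_symm _) hR ((ksgn_spec _ (nestings_perm hN)).trans ?_)
    have := KPerm.flatMap_perm (β := kos fun l => (v l).deg) Stacking.nodes
      ((ksgn_spec (kos fun Y : Stacking ℕ => (Y.nodes.map fun l => (v l).deg).sum)
        (nestings_perm hQ)).congr fun A _ B _ => (kos_blocks _ _ _).symm)
    have h2 : Q.nestNodes.flatMap nodes = Q.nodes.flatMap nestNodes := List.flatMap_assoc
    rwa [h2] at this
  rw [Finset.sum_congr rfl rhs, ← Finset.sum_biUnion]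
  swap
  · intro N₁ _ N₂ _ hne
    rw [Function.onFun, Finset.disjoint_left]
    intro Q h1 h2
    rw [Set.Finite.mem_toFinset] at h1 h2
    exact hne (h1.2.2.symm.trans h2.2.2)
  rw [← Finset.sum_fiberwise_of_maps_to (s := 𝒬) (t := 𝒩) (g := fun Q => Q.map flatten)
    fun Q hQ => by rw [h𝒩, Set.Finite.mem_toFinset]; exact ((mem𝒬 Q).1 hQ).1]
  refine Finset.sum_congr rfl fun N hN => ?_
  rw [h𝒩, Set.Finite.mem_toFinset] at hN
  obtain ⟨hNn, hXn⟩ := nestings_nodup hR hN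
  rw [map_zsmul, map_gen, map_map]
  have e : N.map (fun X => (part k (X.map v)).map (decomp (k := k) (M := M) false)) =
      N.map fun X => ⟨arity Box.c (X.map v), degree (X.map v),
        ∑ N' ∈ (finite_nestings col X).toFinset,
          (ksgn (kos fun l => (v l).deg) X.nodes N'.nestNodes : ℤ) •
            gen k false (arity Box.c (X.map v)) (degree (X.map v))
              (N'.map fun Y => part k (Y.map v))⟩ := by
    refine map_congr fun X hX => ?_
    rw [part, Box.map]
    simp only [decomp_gen (hXn X hX) v (good_part hN hX)]
  rw [e, gen_sum hNn eta, Finset.smul_sum]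
  set r' : (∀ l : {X // X ∈ N.nodes}, Stacking (Stacking ℕ)) → Stacking ℕ → Stacking (Stacking ℕ) :=
    fun r X => if h : X ∈ N.nodes then r ⟨X, h⟩ else eta with hr'
  have hr : ∀ r ∈ Fintype.piFinset fun X : {X // X ∈ N.nodes} => (finite_nestings col X.1).toFinset,
      ∀ X ∈ N.nodes, r' r X ∈ nestings col X := by
    intro r hr X hX
    rw [Fintype.mem_piFinset] at hr
    have := hr ⟨X, hX⟩
    rw [Set.Finite.mem_toFinset] at this
    rw [hr']
    simp only [dif_pos hX]
    exact this
  refine Finset.sum_bij (fun r _ => N.map (r' r)) ?_ ?_ ?_ ?_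
  · intro r h
    have hfl : (N.map (r' r)).map flatten = N := by
      rw [map_map]
      exact map_eq_self fun X hX => (hr r h X hX).2.2
    rw [Finset.mem_filter, mem𝒬, hfl]
    refine ⟨⟨hN, fun N' hN' => ?_⟩, rfl⟩
    rw [nodes_map, List.mem_map] at hN'
    obtain ⟨X, hX, rfl⟩ := hN'
    rw [(hr r h X hX).2.2]
    exact hr r h X hX
  · intro r _ s _ heq
    have h1 := congrArg Stacking.nodes heq
    rw [nodes_map, nodes_map, List.map_inj_left] at h1
    funext X
    have := h1 X.1 X.2
    simpa only [hr', dif_pos X.2] using this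
  · intro Q hQ
    rw [Finset.mem_filter, mem𝒬] at hQ
    obtain ⟨⟨-, h2⟩, rfl⟩ := hQ
    have hmem : ∀ X : {X // X ∈ (Q.map flatten).nodes}, ∃ N' ∈ Q.nodes, N'.flatten = X.1 := by
      intro X
      exact List.mem_map.1 (nodes_map flatten Q ▸ X.2)
    choose r h3 h4 using hmem
    refine ⟨r, ?_, ?_⟩
    · rw [Fintype.mem_piFinset]
      intro X
      rw [Set.Finite.mem_toFinset, ← h4]
      exact h2 _ (h3 X)
    · rw [map_map]
      refine map_eq_self fun N' hN' => ?_
      have hX : N'.flatten ∈ (Q.map flatten).nodes := by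
        rw [nodes_map]; exact List.mem_map.2 ⟨N', hN', rfl⟩
      simp only [hr', dif_pos hX]
      rw [nodes_map] at hNn
      exact List.inj_on_of_nodup_map hNn (h3 ⟨_, hX⟩) hN' (h4 ⟨_, hX⟩)
  · intro r h
    rw [hH, smul_smul]
    have hs : (N.nodes.map fun X => (ksgn (kos fun l => (v l).deg) X.nodes
        (r' r X).nestNodes : ℤ)).prod =
        ((N.nodes.map fun X => ksgn (kos fun l => (v l).deg) X.nodes (r' r X).nestNodes).prod :
          ℤˣ) := by
      rw [← Units.coeHom_apply, map_list_prod, List.map_map]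
      rfl
    have hk : ksgn (kos fun l => (v l).deg) R.nodes N.nestNodes *
        (N.nodes.map fun X => ksgn (kos fun l => (v l).deg) X.nodes (r' r X).nestNodes).prod =
        ksgn (kos fun l => (v l).deg) R.nodes ((N.map (r' r)).nodes.flatMap nestNodes) := by
      symm
      refine ksgn_eq (kos_symm _) hR ((ksgn_spec _ (nestings_perm hN)).trans ?_)
      rw [nodes_map, List.flatMap_map]
      exact KPerm.flatMap_congr _ _ _ _ fun X hX => ksgn_spec _ (nestings_perm (hr r h X hX))
    simp only [← hk, Units.val_mul, map_map]
    congr 1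
    · rw [← hs]
    · refine congrArg (gen k u c n) (map_congr fun X hX => ?_)
      symm
      have hmem := hr r h X hX
      have hgood := good_nest (k := k) (good_part hN hX) hmem
      exact part_eq hgood.2.1 hgood.2.2.1

end Coassociativity

end BoxOperad

namespace BoxOperad

open Stacking

/-! ### Coderivations of the cofree conilpotent box cooperad -/

section Coderivations

variable {k : Type u} [CommRing k]
variable {M : Colour → ℤ → Type v} [∀ c n, AddCommGroup (M c n)] [∀ c n, Module k (M c n)]
variable {M' : Colour → ℤ → Type w} [∀ c n, AddCommGroup (M' c n)] [∀ c n, Module k (M' c n)]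

theorem inf_add {u : Bool} (f : ∀ c n, M c n →ₗ[k] M' c n) (g h : ∀ c i j, M c i →ₗ[k] M' c j)
    (e : ℤ) (c : Colour) (i j : ℤ) :
    T.inf u f (fun c i j => g c i j + h c i j) e c i j =
      T.inf u f g e c i j + T.inf u f h e c i j := by
  refine T.hom_ext fun t ht => ?_
  rw [← skel_map_lookup t] at ht ⊢
  have hR := nodup_skel t
  rw [LinearMap.add_apply, inf_gen _ _ _ _ hR _ ht, inf_gen _ _ _ _ hR _ ht,
    inf_gen _ _ _ _ hR _ ht, ← Finset.sum_add_distrib]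
  refine Finset.sum_congr rfl fun m hm => ?_
  rw [List.mem_toFinset] at hm
  rw [← smul_add]
  congr 1
  have key : ∀ g : ∀ c i j, M c i →ₗ[k] M' c j, gen k u c j (t.skel.map fun l =>
      if l = m then (lookup t l).shift g e else (lookup t l).map f) =
      genLabel u c j hR (fun l => (lookup t l).map f) hm (lookup t m).c ((lookup t m).deg + e)
        (g (lookup t m).c (lookup t m).deg ((lookup t m).deg + e) (lookup t m).x) := fun g =>
    genLabel_apply hR _ _ hm _ (by rw [if_pos rfl]; rfl) fun l _ hl => if_neg hl
  rw [key, key, key, LinearMap.add_apply, map_add]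

/-- The coderivation with corestriction `φ`, on `T` with (`u = true`) or without the unit. -/
noncomputable def coderivation (φ : ∀ c i j, T k M false c i →ₗ[k] M c j) (u : Bool)
    (c : Colour) (i j : ℤ) : T k M u c i →ₗ[k] T k M u c j :=
  T.inf u (counit false) φ (-1) c i j ∘ₗ decomp u c i

variable {φ : ∀ c i j, T k M false c i →ₗ[k] M c j}

/-- Coderivations have degree `-1`, for every `φ`. -/
theorem coderivation_eq_zero (u : Bool) (c : Colour) {i j : ℤ} (h : j + 1 ≠ i) :
    coderivation φ u c i j = 0 := by
  rw [coderivation, inf_eq_zero _ _ _ _ (by omega), LinearMap.zero_comp]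

/-- The corestriction determines the coderivation, and every map of degree `-1` occurs: this needs
only the naturality of the counit and the counit axiom. -/
theorem counit_comp_coderivation (hφ : ∀ c i j, j + 1 ≠ i → φ c i j = 0) (c : Colour) (i j : ℤ) :
    counit false c j ∘ₗ coderivation φ false c i j = φ c i j := by
  by_cases h : j + 1 = i
  · obtain rfl : j = i + -1 := by omega
    rw [coderivation, ← LinearMap.comp_assoc, counit_comp_inf, LinearMap.comp_assoc,
      counit_comp_decomp, LinearMap.comp_id]
  · rw [coderivation_eq_zero _ _ h, hφ _ _ _ h, LinearMap.comp_zero]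

/-- The coderivation property follows from naturality and coassociativity. -/
theorem inf_coderivation_comp_decomp (u : Bool) (c : Colour) (i j : ℤ) :
    T.inf u (fun _ _ => LinearMap.id) (coderivation φ false) (-1) c i j ∘ₗ decomp u c i =
      decomp u c j ∘ₗ coderivation φ u c i j := by
  have h := inf_comp_map (u := u) (T.map false (counit (k := k) (M := M) false))
    (T.inf false (counit false) φ (-1)) (-1) (decomp (k := k) (M := M) false) c i j
  have h0 : (fun c n => T.map false (counit (k := k) (M := M) false) c n ∘ₗ decomp false c n) =
      fun _ _ => LinearMap.id := funext fun c => funext fun n => map_counit_comp_decomp false c n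
  rw [h0] at h
  have h' : T.inf u (fun _ _ => LinearMap.id) (coderivation φ false) (-1) c i j = _ := h.symm
  rw [h', LinearMap.comp_assoc, map_decomp_comp_decomp, ← LinearMap.comp_assoc, ← decomp_comp_inf,
    coderivation, LinearMap.comp_assoc]

/-- A coderivation is determined by its corestriction. -/
theorem eq_coderivation {f : ∀ c i j, T k M false c i →ₗ[k] T k M false c j}
    (h : ∀ c i j, counit false c j ∘ₗ f c i j = φ c i j)
    (hf : ∀ c i j, T.inf false (fun _ _ => LinearMap.id) f (-1) c i j ∘ₗ decomp false c i =
        decomp false c j ∘ₗ f c i j) : f = coderivation φ false := by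
  funext c i j
  have h1 := congrArg (fun g => T.map false (counit false) c j ∘ₗ g) (hf c i j)
  rw [← LinearMap.comp_assoc, ← LinearMap.comp_assoc, map_counit_comp_decomp, LinearMap.id_comp,
    map_comp_inf] at h1
  rw [← h1, coderivation]
  simp only [h, LinearMap.comp_id]

/-- A coderivation squares to zero as soon as the corestriction of the square vanishes. -/
theorem coderivation_comp_self (hφ : ∀ c i j, j + 1 ≠ i → φ c i j = 0)
    (h : ∀ c i j l, φ c j l ∘ₗ coderivation φ false c i j = 0) (u : Bool) (c : Colour)
    (i j l : ℤ) : coderivation φ u c j l ∘ₗ coderivation φ u c i j = 0 := by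
  rw [coderivation, LinearMap.comp_assoc, ← inf_coderivation_comp_decomp, ← LinearMap.comp_assoc,
    inf_comp_inf_eq_zero _ _ _ _ h, LinearMap.zero_comp]
  intro c i j
  rw [counit_comp_coderivation hφ, LinearMap.comp_id]

/-- The coderivation induced by a differential on the boxes. -/
theorem inf_id_eq_coderivation (D : ∀ c i j, M c i →ₗ[k] M c j) (u : Bool) :
    T.inf u (fun _ _ => LinearMap.id) D (-1) =
      coderivation (fun c i j => D c i j ∘ₗ counit false c i) u := by
  funext c i j
  have h := inf_comp_map (u := u) (fun _ _ => LinearMap.id) D (-1)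
    (counit (k := k) (M := M) false) c i j
  simp only [LinearMap.id_comp] at h
  rw [coderivation]
  have h' : T.inf u (counit false) (fun c i j => D c i j ∘ₗ counit false c i) (-1) c i j = _ :=
    h.symm
  rw [h', LinearMap.comp_assoc, map_counit_comp_decomp, LinearMap.comp_id]

theorem coderivation_add (φ φ' : ∀ c i j, T k M false c i →ₗ[k] M c j) (u : Bool)
    (c : Colour) (i j : ℤ) :
    coderivation (fun c i j => φ c i j + φ' c i j) u c i j =
      coderivation φ u c i j + coderivation φ' u c i j := by
  rw [coderivation, inf_add, LinearMap.add_comp]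
  rfl

end Coderivations

section Bar

variable {k : Type u} [CommRing k] {B : DGBoxOperad.{u, v} k} (ε : B.Augmentation)

theorem isDifferential_idealD : IsDifferential ε.idealD :=
  ⟨fun c i j h => LinearMap.ext fun x =>
      Subtype.ext (LinearMap.congr_fun (B.differential.1 c i j h) x.1),
    fun c i j l => LinearMap.ext fun x =>
      Subtype.ext (LinearMap.congr_fun (B.differential.2 c i j l) x.1)⟩

theorem isDifferential_sIdealD : IsDifferential ε.sIdealD := by
  refine ⟨fun c i j h => LinearMap.ext fun x => ?_, fun c i j l => LinearMap.ext fun x => ?_⟩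
  · have h1 : ∀ x : ε.ideal c (i - thinShift c), ((thinShift c).negOnePow : ℤ) •
        ε.idealD c (i - thinShift c) (j - thinShift c) x = 0 := fun x => by
      rw [(isDifferential_idealD ε).1 _ _ _ (by omega), LinearMap.zero_apply, smul_zero]
    exact h1 x
  · have h1 : ∀ x : ε.ideal c (i - thinShift c), ((thinShift c).negOnePow : ℤ) •
        ε.idealD c (j - thinShift c) (l - thinShift c) (((thinShift c).negOnePow : ℤ) •
          ε.idealD c (i - thinShift c) (j - thinShift c) x) = 0 := fun x => by
      rw [map_zsmul, ← LinearMap.comp_apply, (isDifferential_idealD ε).2, LinearMap.zero_apply,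
        smul_zero, smul_zero]
    exact h1 x

theorem barSquare_eq (u : Bool) : ε.barSquare u = coderivation (ε.infComp false) u := rfl

theorem barD_eq (u : Bool) : ε.barD u = coderivation (fun c i j =>
    ε.sIdealD c i j ∘ₗ counit false c i + ε.infComp false c i j) u := by
  funext c i j
  rw [coderivation_add, ← inf_id_eq_coderivation]
  rfl

/-- The properties of the corestriction from which everything about the bar construction follows
formally. -/
theorem bar_properties
    (h0 : ∀ c i j, j + 1 ≠ i → ε.infComp false c i j = 0)
    (h1 : ∀ c i j l, ε.infComp false c j l ∘ₗ ε.barSquare false c i j = 0)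
    (h2 : ∀ c i j l, ε.infComp false c j l ∘ₗ ε.barInternal false c i j +
      ε.sIdealD c j l ∘ₗ ε.infComp false c i j = 0) :
    (∀ c i j, counit false c j ∘ₗ ε.barSquare false c i j = ε.infComp false c i j) ∧
    (∀ u c i j, T.inf u (fun _ _ => LinearMap.id) (ε.barSquare false) (-1) c i j ∘ₗ decomp u c i =
      decomp u c j ∘ₗ ε.barSquare u c i j) ∧
    (∀ f : ∀ c i j, T k ε.sIdeal false c i →ₗ[k] T k ε.sIdeal false c j,
      (∀ c i j, counit false c j ∘ₗ f c i j = ε.infComp false c i j) →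
      (∀ c i j, T.inf false (fun _ _ => LinearMap.id) f (-1) c i j ∘ₗ decomp false c i =
        decomp false c j ∘ₗ f c i j) →
      f = ε.barSquare false) ∧
    (∀ u, IsDifferential (ε.barSquare u)) ∧
    (∀ u, IsDifferential (ε.barD u)) ∧
    IsConilpotentDGBoxCooperad (ε.barD false) (decomp (M := ε.sIdeal) false) := by
  have hD := isDifferential_sIdealD ε
  have hφ : ∀ c i j, j + 1 ≠ i →
      ε.sIdealD c i j ∘ₗ counit false c i + ε.infComp false c i j = 0 := fun c i j h => by
    rw [h0 c i j h, hD.1 c i j h, LinearMap.zero_comp, add_zero]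
  have e1 : ∀ c i j, counit false c j ∘ₗ ε.barSquare false c i j = ε.infComp false c i j :=
    fun c i j => counit_comp_coderivation h0 c i j
  have e2 : ∀ c i j, counit false c j ∘ₗ ε.barInternal false c i j =
      ε.sIdealD c i j ∘ₗ counit false c i := fun c i j => by
    have h := counit_comp_coderivation (φ := fun c i j => ε.sIdealD c i j ∘ₗ counit false c i)
      (fun c i j h => by rw [hD.1 c i j h, LinearMap.zero_comp]) c i j
    rwa [← inf_id_eq_coderivation] at h
  have hbar : ∀ u, IsDifferential (ε.barD u) := fun u => by
    rw [barD_eq]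
    refine ⟨fun c i j => coderivation_eq_zero u c, coderivation_comp_self hφ (fun c i j l => ?_) u⟩
    have h3 := congrFun (congrFun (congrFun (barD_eq ε false) c) i) j
    rw [← h3, DGBoxOperad.Augmentation.barD, LinearMap.add_comp, LinearMap.comp_add,
      LinearMap.comp_add, LinearMap.comp_assoc, LinearMap.comp_assoc, e1, e2, h1, add_zero,
      ← LinearMap.comp_assoc, hD.2, LinearMap.zero_comp, zero_add, add_comm, h2]
  refine ⟨e1, fun u => inf_coderivation_comp_decomp u, fun f => eq_coderivation, fun u =>
    ⟨fun c i j => coderivation_eq_zero u c, coderivation_comp_self h0 h1 u⟩, hbar,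
    hbar false, counit_comp_decomp, map_decomp_comp_decomp false, fun c i j => ?_⟩
  rw [barD_eq]
  exact inf_coderivation_comp_decomp false c i j

end Bar

end BoxOperad

namespace BoxOperad

namespace Stacking

/-! ### The horizontal composite graph and the levels of a stacking -/

section Levels

variable {α : Type u} {β : Type v}

/-- The cuts of a stacking into a lower and an upper part, along horizontal levels: `Level col S x
y` if there is a cut which starts above the lowest `x` horizontal inputs and ends above the lowest
`y` horizontal outputs. The empty lower part is the cut `(0, 0)`; a nonempty one contains the bottom
box, and the lowest `v i` of the `w i` lines at the `i`-th side of the row. -/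
def Level (col : α → Colour) : Stacking α → ℕ → ℕ → Prop
  | eta, x, y => x = 0 ∧ y = 0
  | box a n w ch, x, y => (x = 0 ∧ y = 0) ∨ ∃ v : Fin (n + 1) → ℕ, (∀ i, v i ≤ w i) ∧
      (∀ i : Fin n, (ch i).Level col (v i.castSucc) (v i.succ)) ∧
      x = (col a).p + v 0 ∧ y = (col a).r + v (Fin.last n)

/-- No horizontal line crosses a vertical line. -/
def Flat : Stacking α → Prop
  | eta => True
  | box _ _ w ch => (∀ i, w i = 0) ∧ ∀ i, (ch i).Flat

/-- No box is semi-thin. -/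
def Balanced (col : α → Colour) (X : Stacking α) : Prop := ∀ a ∈ X.nodes, ¬ (col a).SemiThin

/-- Two boxes, one on top of the other, without horizontal lines over the lower box: the shape of
the thin-quadratic stackings of types I and II. -/
def IsDuo (col : α → Colour) (X : Stacking α) : Prop := X.Balanced col ∧ X.size = 2 ∧ X.Flat

/-- A thin box under non-thin boxes, with only the two trivial cuts: the shape of the thin-quadratic
stackings of type III. A line over the bottom box counts as something to cut, so the degenerate
stacking with one line over a box of colour `(0, 0, 0)` is of this shape. -/
def IsPrime (col : α → Colour) (X : Stacking α) : Prop :=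
  (∃ a l, X.nodes = a :: l ∧ (col a).Thin ∧ ∀ b ∈ l, (col b).NonThin) ∧ 0 < X.left col ∧
    ∀ x y, X.Level col x y → (x = 0 ∧ y = 0) ∨ (x = X.left col ∧ y = X.right col)

theorem level_zero (col : α → Colour) (X : Stacking α) : X.Level col 0 0 := by
  cases X <;> simp [Level]

theorem Flat.map_iff (f : α → β) (X : Stacking α) : (X.map f).Flat ↔ X.Flat := by
  induction X with
  | eta => rfl
  | box a n w ch ih => simp only [map, Flat, ih]

theorem level_map (f : α → β) (col : β → Colour) (X : Stacking α) (x y : ℕ) :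
    (X.map f).Level col x y ↔ X.Level (fun a => col (f a)) x y := by
  induction X generalizing x y with
  | eta => rfl
  | box a n w ch ih => simp only [map, Level, ih]

theorem not_semiThin {c : Colour} : ¬ c.SemiThin ↔ (c.p = 0 ↔ c.r = 0) := by
  unfold Colour.SemiThin; omega

theorem nonThin_iff {c : Colour} : c.NonThin ↔ 0 < c.p ∧ 0 < c.r := by
  unfold Colour.NonThin Colour.SemiThin Colour.Thin; omega

theorem Balanced.child {col : α → Colour} {a : α} {n w} {ch : Fin n → Stacking α}
    (h : Balanced col (box a n w ch)) (i : Fin n) : (ch i).Balanced col :=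
  fun b hb => h b (mem_nodes_box.2 (Or.inr ⟨i, hb⟩))

/-- A property which passes from every side of a row to the next one. -/
theorem forall_of_row {n : ℕ} {P : Fin (n + 1) → Prop}
    (h : ∀ i : Fin n, P i.castSucc ↔ P i.succ) (i j : Fin (n + 1)) : P i ↔ P j := by
  have key : ∀ i, P i ↔ P 0 := fun i => by
    induction i using Fin.induction with
    | zero => rfl
    | succ i ih => exact (h i).symm.trans ih
  exact (key i).trans (key j).symm

/-- Without semi-thin boxes, a stacking is not semi-thin. -/
theorem left_eq_zero_iff {col : α → Colour} {X : Stacking α} (hX : X.Valid col)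
    (hb : X.Balanced col) : X.left col = 0 ↔ X.right col = 0 := by
  induction X with
  | eta => rfl
  | box a n w ch ih =>
    have h0 := not_semiThin.1 (hb a (by simp [nodes]))
    have h1 := forall_of_row (P := fun i => w i = 0) (fun i => by
      rw [← (hX.2 i).2.1, ← (hX.2 i).2.2]
      exact ih i (hX.2 i).1 (hb.child i)) 0 (Fin.last n)
    simp only [left, right, Nat.add_eq_zero_iff, h0, h1]

theorem Level.le {col : α → Colour} {X : Stacking α} {x y : ℕ} (h : X.Level col x y) :
    x ≤ X.left col ∧ y ≤ X.right col := by
  cases X with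
  | eta => obtain ⟨rfl, rfl⟩ := h; simp
  | box a n w ch =>
    rcases h with ⟨rfl, rfl⟩ | ⟨v, hv, -, rfl, rfl⟩
    · simp
    · exact ⟨Nat.add_le_add_left (hv _) _, Nat.add_le_add_left (hv _) _⟩

theorem Level.eq_zero_iff {col : α → Colour} {X : Stacking α} (hb : X.Balanced col) {x y : ℕ}
    (h : X.Level col x y) : x = 0 ↔ y = 0 := by
  induction X generalizing x y with
  | eta => obtain ⟨rfl, rfl⟩ := h; simp
  | box a n w ch ih =>
    rcases h with ⟨rfl, rfl⟩ | ⟨v, -, hv, rfl, rfl⟩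
    · simp
    · have h0 := not_semiThin.1 (hb a (by simp [nodes]))
      have h1 := forall_of_row (P := fun i => v i = 0) (fun i => ih i (hb.child i) (hv i))
        0 (Fin.last n)
      simp only [Nat.add_eq_zero_iff, h0, h1]

theorem Level.eq_left_iff {col : α → Colour} {X : Stacking α} (hX : X.Valid col)
    (hb : X.Balanced col) {x y : ℕ} (h : X.Level col x y) :
    x = X.left col ↔ y = X.right col := by
  induction X generalizing x y with
  | eta => obtain ⟨rfl, rfl⟩ := h; simp [left, right]
  | box a n w ch ih =>
    rcases h with ⟨rfl, rfl⟩ | ⟨v, -, hv, rfl, rfl⟩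
    · have := left_eq_zero_iff hX hb
      omega
    · have h1 := forall_of_row (P := fun i => v i = w i) (fun i => by
        have := ih i (hX.2 i).1 (hb.child i) (hv i)
        rwa [(hX.2 i).2.1, (hX.2 i).2.2] at this) 0 (Fin.last n)
      simp only [left, right, Nat.add_left_cancel_iff, h1]

theorem level_full {col : α → Colour} {X : Stacking α} (hX : X.Valid col) :
    X.Level col (X.left col) (X.right col) := by
  induction X with
  | eta => simp [Level, left, right]
  | box a n w ch ih =>
    refine Or.inr ⟨w, fun _ => le_rfl, fun i => ?_, rfl, rfl⟩
    have := ih i (hX.2 i).1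
    rwa [(hX.2 i).2.1, (hX.2 i).2.2] at this

end Levels

section Graph

theorem length_lines (i m : ℕ) : (lines i m).length = m := by simp [lines]

theorem mem_lines {i m : ℕ} {x : ℕ × Option ℕ} :
    x ∈ lines i m ↔ ∃ s < m, x = (i, some s) := by
  simp [lines, eq_comm]

theorem length_leftBd {t : Stacking (ℕ × Colour)} (h : t.Valid Prod.snd) :
    t.leftBd.length = t.left Prod.snd := by
  induction t with
  | eta => rfl
  | box a n w ch ih =>
    simp only [leftBd, left, List.length_append, List.length_replicate]
    split_ifs with hn
    · rw [ih _ (h.2 _).1, (h.2 _).2.1]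
      rfl
    · rw [length_lines]

theorem length_rightBd {t : Stacking (ℕ × Colour)} (h : t.Valid Prod.snd) :
    t.rightBd.length = t.right Prod.snd := by
  induction t with
  | eta => rfl
  | box a n w ch ih =>
    simp only [rightBd, right, List.length_append, List.length_replicate]
    split_ifs with hn
    · rw [ih _ (h.2 _).1, (h.2 _).2.2]
      congr 2
      ext
      simp only [Fin.val_succ, Fin.val_last]
      omega
    · obtain rfl : n = 0 := by omega
      rw [length_lines]; rfl

theorem fst_mem_of_pieces {t : Stacking (ℕ × Colour)} {x : ℕ × Option ℕ} (h : x ∈ t.pieces) :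
    x.1 ∈ t.nodes.map Prod.fst := by
  induction t with
  | eta => exact h.elim
  | box a n w ch ih =>
    rw [List.mem_map]
    rcases h with rfl | ⟨-, h⟩ | ⟨i, h⟩
    · exact ⟨a, by simp [nodes], rfl⟩
    · obtain ⟨s, -, rfl⟩ := mem_lines.1 h
      exact ⟨a, by simp [nodes], rfl⟩
    · obtain ⟨b, hb, e⟩ := List.mem_map.1 (ih i h)
      exact ⟨b, mem_nodes_box.2 (Or.inr ⟨i, hb⟩), e⟩

theorem mem_pieces_of_leftBd {t : Stacking (ℕ × Colour)} {x : ℕ × Option ℕ} (h : x ∈ t.leftBd) :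
    x ∈ t.pieces := by
  induction t with
  | eta => simp [leftBd] at h
  | box a n w ch ih =>
    rcases List.mem_append.1 h with h | h
    · exact Or.inl (List.eq_of_mem_replicate h)
    · split_ifs at h with hn
      · exact Or.inr (Or.inr ⟨_, ih _ h⟩)
      · exact Or.inr (Or.inl ⟨by omega, h⟩)

theorem mem_pieces_of_rightBd {t : Stacking (ℕ × Colour)} {x : ℕ × Option ℕ} (h : x ∈ t.rightBd) :
    x ∈ t.pieces := by
  induction t with
  | eta => simp [rightBd] at h
  | box a n w ch ih =>
    rcases List.mem_append.1 h with h | h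
    · exact Or.inl (List.eq_of_mem_replicate h)
    · split_ifs at h with hn
      · exact Or.inr (Or.inr ⟨_, ih _ h⟩)
      · exact Or.inr (Or.inl ⟨by omega, h⟩)

theorem HAdj.mem {t : Stacking (ℕ × Colour)} {x y : ℕ × Option ℕ} (h : t.HAdj x y) :
    x ∈ t.pieces ∧ y ∈ t.pieces := by
  induction t with
  | eta => exact h.elim
  | box a n w ch ih =>
    rcases h with ⟨i, h⟩ | ⟨i, j, -, h⟩
    · exact ⟨Or.inr (Or.inr ⟨i, (ih i h).1⟩), Or.inr (Or.inr ⟨i, (ih i h).2⟩)⟩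
    · exact ⟨Or.inr (Or.inr ⟨i, mem_pieces_of_rightBd (List.of_mem_zip h).1⟩),
        Or.inr (Or.inr ⟨j, mem_pieces_of_leftBd (List.of_mem_zip h).2⟩)⟩

/-- A property of the vertices of the horizontal graph which is constant on connected components.
Properties of this kind replace paths in the arguments about connectedness. -/
def LocConst (t : Stacking (ℕ × Colour)) (f : ℕ × Option ℕ → Prop) : Prop :=
  ∀ x y, t.HAdj x y → (f x ↔ f y)

theorem LocConst.child {a n w ch} {f} (h : LocConst (box a n w ch) f) (i) : LocConst (ch i) f :=
  fun x y hxy => h x y (Or.inl ⟨i, hxy⟩)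

theorem nodup_child {α γ : Type*} {a : α} {n w} {ch : Fin n → Stacking α} {g : α → γ}
    (h : ((box a n w ch).nodes.map g).Nodup) (i : Fin n) : ((ch i).nodes.map g).Nodup := by
  simp only [nodes, List.map_cons, List.map_flatten, List.map_ofFn, List.nodup_cons] at h
  have := (List.nodup_flatten.1 h.2).1 ((ch i).nodes.map g)
  exact this (List.mem_ofFn.2 ⟨i, rfl⟩)

theorem root_notMem {α γ : Type*} {a : α} {n w} {ch : Fin n → Stacking α} {g : α → γ}
    (h : ((box a n w ch).nodes.map g).Nodup) (i : Fin n) : g a ∉ (ch i).nodes.map g := by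
  simp only [nodes, List.map_cons, List.map_flatten, List.map_ofFn, List.nodup_cons,
    List.mem_flatten, not_exists, not_and] at h
  exact h.1 _ (List.mem_ofFn.2 ⟨i, rfl⟩)

theorem eq_of_mem_child {α γ : Type*} {a : α} {n w} {ch : Fin n → Stacking α} {g : α → γ}
    (h : ((box a n w ch).nodes.map g).Nodup) {i j : Fin n} {x : γ}
    (hi : x ∈ (ch i).nodes.map g) (hj : x ∈ (ch j).nodes.map g) : i = j := by
  simp only [nodes, List.map_cons, List.map_flatten, List.map_ofFn, List.nodup_cons] at h
  have h2 := (List.nodup_flatten.1 h.2).2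
  rw [List.pairwise_ofFn] at h2
  rcases lt_trichotomy i j with hij | hij | hij
  · exact (h2 hij hi hj).elim
  · exact hij
  · exact (h2 hij hj hi).elim

/-- The criterion for two connected components: apart from the root, which is isolated, the graph
is not empty and connected. -/
theorem card_component_eq_two_iff {a : ℕ × Colour} {n w} {ch : Fin n → Stacking (ℕ × Colour)}
    (hd : ((box a n w ch).nodes.map Prod.fst).Nodup) :
    Nat.card (SimpleGraph.fromRel fun x y : (box a n w ch).pieces =>
        (box a n w ch).HAdj x.1 y.1).ConnectedComponent = 2 ↔
      (∃ x ∈ (box a n w ch).pieces, x ≠ (a.1, none)) ∧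
        ∀ f, LocConst (box a n w ch) f → ∀ x ∈ (box a n w ch).pieces,
          ∀ y ∈ (box a n w ch).pieces, x ≠ (a.1, none) → y ≠ (a.1, none) → f x → f y := by
  set t := box a n w ch with ht
  set G := SimpleGraph.fromRel fun x y : t.pieces => t.HAdj x.1 y.1 with hG
  have hroot : ∀ x y, t.HAdj x y → x ≠ (a.1, none) ∧ y ≠ (a.1, none) := by
    have key : ∀ i, ∀ x ∈ (ch i).pieces, x ≠ (a.1, none) := by
      rintro i x hx rfl
      exact root_notMem hd i (fst_mem_of_pieces hx)
    rintro x y (⟨i, h⟩ | ⟨i, j, -, h⟩)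
    · exact ⟨key i _ h.mem.1, key i _ h.mem.2⟩
    · exact ⟨key i _ (mem_pieces_of_rightBd (List.of_mem_zip h).1),
        key j _ (mem_pieces_of_leftBd (List.of_mem_zip h).2)⟩
  have hconst : ∀ f, LocConst t f → ∀ x y : t.pieces, G.Reachable x y → (f x ↔ f y) := by
    rintro f hf x y ⟨p⟩
    induction p with
    | nil => rfl
    | cons h _ ih =>
      refine Iff.trans ?_ ih
      rcases ((SimpleGraph.fromRel_adj _ _ _).1 h).2 with h | h
      · exact hf _ _ h
      · exact (hf _ _ h).symm
  have hreach : ∀ x : t.pieces, LocConst t fun z => ∃ h : z ∈ t.pieces, G.Reachable x ⟨z, h⟩ := by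
    intro x y z hyz
    by_cases e : y = z
    · rw [e]
    have hadj : G.Adj ⟨y, hyz.mem.1⟩ ⟨z, hyz.mem.2⟩ :=
      (SimpleGraph.fromRel_adj _ _ _).2 ⟨fun h => e (congrArg Subtype.val h), Or.inl hyz⟩
    exact ⟨fun ⟨_, h⟩ => ⟨hyz.mem.2, h.trans hadj.reachable⟩,
      fun ⟨_, h⟩ => ⟨hyz.mem.1, h.trans hadj.symm.reachable⟩⟩
  have hr : ((a.1, none) : ℕ × Option ℕ) ∈ t.pieces := Or.inl rfl
  have hrloc : LocConst t fun z => z = (a.1, none) := fun x y h => by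
    simp [(hroot x y h).1, (hroot x y h).2]
  set r : G.ConnectedComponent := G.connectedComponentMk ⟨_, hr⟩ with hr'
  have hne : ∀ x : t.pieces, x.1 ≠ (a.1, none) → G.connectedComponentMk x ≠ r := by
    intro x hx h
    exact hx ((hconst _ hrloc _ _ (SimpleGraph.ConnectedComponent.exact h)).2 rfl)
  rw [Nat.card_eq_two_iff' r]
  constructor
  · rintro ⟨C, hC, huniq⟩
    have hmk : ∀ x : t.pieces, x.1 ≠ (a.1, none) → G.connectedComponentMk x = C := fun x hx =>
      huniq _ (hne x hx)
    refine ⟨?_, fun f hf x hx y hy hxr hyr hfx => ?_⟩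
    · obtain ⟨x, rfl⟩ := C.exists_rep
      refine ⟨x.1, x.2, fun h => hC ?_⟩
      have : x = ⟨_, hr⟩ := Subtype.ext h
      rw [this]; rfl
    · have := (hmk ⟨x, hx⟩ hxr).trans (hmk ⟨y, hy⟩ hyr).symm
      exact (hconst f hf _ _ (SimpleGraph.ConnectedComponent.exact this)).1 hfx
  · rintro ⟨⟨x, hx, hxr⟩, h⟩
    refine ⟨G.connectedComponentMk ⟨x, hx⟩, hne _ hxr, fun D hD => ?_⟩
    obtain ⟨y, rfl⟩ := D.exists_rep
    have hyr : y.1 ≠ (a.1, none) := fun e => hD (by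
      have : y = ⟨_, hr⟩ := Subtype.ext e
      rw [this]; rfl)
    obtain ⟨h1, h2⟩ := h _ (hreach ⟨x, hx⟩) x hx y.1 y.2 hxr hyr ⟨hx, SimpleGraph.Reachable.rfl⟩
    exact (SimpleGraph.ConnectedComponent.eq.2 h2).symm

end Graph

end Stacking

end BoxOperad

namespace BoxOperad

namespace Stacking

/-! ### Connected components and levels -/

section Classification

/-- Initial segments cut out by a property which is preserved along a matching of two lists have the
same length. -/
theorem takeWhile_length_eq {X : Type*} (f : X → Prop) [DecidablePred f] {l₁ l₂ : List X}
    (hl : l₁.length = l₂.length) (h : ∀ x y, (x, y) ∈ l₁.zip l₂ → (f x ↔ f y)) :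
    (l₁.takeWhile fun x => decide (f x)).length = (l₂.takeWhile fun x => decide (f x)).length := by
  induction l₁ generalizing l₂ with
  | nil => rw [List.length_eq_zero_iff.1 hl.symm]
  | cons a l₁ ih =>
    cases l₂ with
    | nil => simp at hl
    | cons b l₂ =>
      have hab := h a b (by simp)
      have := ih (by simpa using hl) fun x y hxy => h x y (by simp [hxy])
      by_cases ha : f a
      · rw [List.takeWhile_cons_of_pos (by simpa using ha),
          List.takeWhile_cons_of_pos (by simpa using hab.1 ha), List.length_cons, List.length_cons,
          this]
      · rw [List.takeWhile_cons_of_neg (by simpa using ha),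
          List.takeWhile_cons_of_neg (by simpa using fun hb => ha (hab.2 hb))]

theorem forall_zip {X : Type*} (f : X → Prop) {l₁ l₂ : List X}
    (hl : l₁.length = l₂.length) (h : ∀ x y, (x, y) ∈ l₁.zip l₂ → (f x ↔ f y))
    (h₁ : ∀ x ∈ l₁, f x) : ∀ y ∈ l₂, f y := by
  intro y hy
  obtain ⟨i, hi, rfl⟩ := List.getElem_of_mem hy
  have hi' : i < l₁.length := hl ▸ hi
  have : (l₁[i], l₂[i]) ∈ l₁.zip l₂ := by
    rw [← List.getElem_zip (h := by simp [hi, hi'])]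
    exact List.getElem_mem _
  exact (h _ _ this).1 (h₁ _ (List.getElem_mem _))

variable {a : ℕ × Colour} {n : ℕ} {w : Fin (n + 1) → ℕ} {ch : Fin n → Stacking (ℕ × Colour)}

theorem length_sides (hV : (box a n w ch).Valid Prod.snd) (i j : Fin n)
    (hij : j.val = i.val + 1) : (ch i).rightBd.length = (ch j).leftBd.length := by
  rw [length_rightBd (hV.2 i).1, length_leftBd (hV.2 j).1, (hV.2 i).2.2, (hV.2 j).2.1]
  congr 1
  ext
  simp [hij]

/-- The left boundary of the row over the bottom box. -/
def rowLeft (a : ℕ × Colour) {n : ℕ} (w : Fin (n + 1) → ℕ) (ch : Fin n → Stacking (ℕ × Colour)) :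
    List (ℕ × Option ℕ) :=
  if h : 0 < n then (ch ⟨0, h⟩).leftBd else lines a.1 (w 0)

/-- The right boundary of the row over the bottom box. -/
def rowRight (a : ℕ × Colour) {n : ℕ} (w : Fin (n + 1) → ℕ) (ch : Fin n → Stacking (ℕ × Colour)) :
    List (ℕ × Option ℕ) :=
  if h : 0 < n then (ch ⟨n - 1, by omega⟩).rightBd else lines a.1 (w 0)

open Classical in
/-- A union of connected components determines a cut of a row. -/
theorem exists_row_level (hV : (box a n w ch).Valid Prod.snd) {f : ℕ × Option ℕ → Prop}
    (hf : LocConst (box a n w ch) f)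
    (ih : ∀ i, (ch i).Level Prod.snd ((ch i).leftBd.takeWhile fun x => decide (f x)).length
      ((ch i).rightBd.takeWhile fun x => decide (f x)).length) :
    ∃ v : Fin (n + 1) → ℕ, (∀ i, v i ≤ w i) ∧
      (∀ i : Fin n, (ch i).Level Prod.snd (v i.castSucc) (v i.succ)) ∧
      v 0 = ((rowLeft a w ch).takeWhile fun x => decide (f x)).length ∧
      v (Fin.last n) = ((rowRight a w ch).takeWhile fun x => decide (f x)).length := by
  rcases Nat.eq_zero_or_pos n with rfl | hn
  · refine ⟨fun _ => ((lines a.1 (w 0)).takeWhile fun x => decide (f x)).length, fun i => ?_,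
      fun i => i.elim0, by simp [rowLeft], by simp [rowRight]⟩
    rw [Fin.fin_one_eq_zero i]
    exact ((List.takeWhile_sublist _).length_le).trans (length_lines _ _).le
  · set v : Fin (n + 1) → ℕ := fun i => if h : i.val < n then
      ((ch ⟨i, h⟩).leftBd.takeWhile fun x => decide (f x)).length else
      ((rowRight a w ch).takeWhile fun x => decide (f x)).length with hv
    have v1 : ∀ i : Fin n, v i.castSucc =
        ((ch i).leftBd.takeWhile fun x => decide (f x)).length := fun i => by simp [hv]
    have v2 : ∀ i : Fin n, v i.succ =
        ((ch i).rightBd.takeWhile fun x => decide (f x)).length := fun i => by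
      by_cases hi : i.val + 1 < n
      · have := takeWhile_length_eq f (length_sides hV i ⟨i + 1, hi⟩ rfl) fun x y hxy =>
          hf x y (Or.inr ⟨i, ⟨i + 1, hi⟩, rfl, hxy⟩)
        simp [hv, hi, this]
      · have : (⟨n - 1, by omega⟩ : Fin n) = i := Fin.ext (by simp only; omega)
        simp [hv, hi, rowRight, hn, this]
    refine ⟨v, fun i => ?_, fun i => by rw [v1, v2]; exact ih i, ?_, ?_⟩
    · have : (∃ j : Fin n, i = j.castSucc) ∨ ∃ j : Fin n, i = j.succ := by
        refine i.lastCases (Or.inr ⟨⟨n - 1, by omega⟩, ?_⟩) fun j => Or.inl ⟨j, rfl⟩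
        ext; simp only [Fin.val_last, Fin.val_succ]; omega
      rcases this with ⟨j, rfl⟩ | ⟨j, rfl⟩
      · rw [v1, ← (hV.2 j).2.1, ← length_leftBd (hV.2 j).1]
        exact (List.takeWhile_sublist _).length_le
      · rw [v2, ← (hV.2 j).2.2, ← length_rightBd (hV.2 j).1]
        exact (List.takeWhile_sublist _).length_le
    · simp [hv, hn, rowLeft]
    · simp [hv]

open Classical in
/-- Every union of connected components of a stacking of non-thin boxes determines a cut: the
components of the lowest horizontal inputs are followed up to the first input which is not in the
union. -/
theorem level_takeWhile {t : Stacking (ℕ × Colour)} (hV : t.Valid Prod.snd)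
    (hN : ∀ b ∈ t.nodes, b.2.NonThin) {f : ℕ × Option ℕ → Prop} (hf : LocConst t f) :
    t.Level Prod.snd (t.leftBd.takeWhile fun x => decide (f x)).length
      (t.rightBd.takeWhile fun x => decide (f x)).length := by
  induction t with
  | eta => simp [Level, leftBd, rightBd]
  | box a n w ch ih =>
    have ha := nonThin_iff.1 (hN a (by simp [nodes]))
    by_cases hfa : f (a.1, none)
    · obtain ⟨v, h1, h2, h3, h4⟩ := exists_row_level hV hf fun i =>
        ih i (hV.2 i).1 (fun b hb => hN b (mem_nodes_box.2 (Or.inr ⟨i, hb⟩))) (hf.child i)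
      refine Or.inr ⟨v, h1, h2, ?_, ?_⟩
      · rw [h3, leftBd, List.takeWhile_append_of_pos, List.length_append, List.length_replicate]
        · rfl
        · intro x hx; rw [List.eq_of_mem_replicate hx]; simpa using hfa
      · rw [h4, rightBd, List.takeWhile_append_of_pos, List.length_append, List.length_replicate]
        · rfl
        · intro x hx; rw [List.eq_of_mem_replicate hx]; simpa using hfa
    · left
      obtain ⟨p, hp⟩ := Nat.exists_eq_succ_of_ne_zero ha.1.ne'
      obtain ⟨r, hr⟩ := Nat.exists_eq_succ_of_ne_zero ha.2.ne'
      simp [leftBd, rightBd, hp, hr, List.replicate_succ, hfa]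

/-- A union of connected components which contains the left side of a row contains the row. -/
theorem forall_pieces_of_row (hV : (box a n w ch).Valid Prod.snd) {f : ℕ × Option ℕ → Prop}
    (hf : LocConst (box a n w ch) f)
    (ih : ∀ i, (∀ x ∈ (ch i).leftBd, f x) → ∀ x ∈ (ch i).pieces, f x)
    (h : ∀ x ∈ rowLeft a w ch, f x) : ∀ i, ∀ x ∈ (ch i).pieces, f x := by
  have key : ∀ m (hm : m < n), ∀ x ∈ (ch ⟨m, hm⟩).leftBd, f x := by
    intro m
    induction m with
    | zero =>
      intro hm x hx
      exact h x (by rw [rowLeft, dif_pos hm]; exact hx)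
    | succ m ihm =>
      intro hm
      refine forall_zip f (length_sides hV ⟨m, by omega⟩ ⟨m + 1, hm⟩ rfl) (fun x y hxy =>
        hf x y (Or.inr ⟨⟨m, by omega⟩, ⟨m + 1, hm⟩, rfl, hxy⟩)) fun x hx => ?_
      exact ih _ (ihm (by omega)) x (mem_pieces_of_rightBd hx)
  exact fun i => ih i (key i i.2)

/-- Every connected component of a stacking of non-thin boxes meets the left boundary. -/
theorem forall_pieces {t : Stacking (ℕ × Colour)} (hV : t.Valid Prod.snd)
    (hN : ∀ b ∈ t.nodes, b.2.NonThin) {f : ℕ × Option ℕ → Prop} (hf : LocConst t f)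
    (h : ∀ x ∈ t.leftBd, f x) : ∀ x ∈ t.pieces, f x := by
  induction t with
  | eta => exact fun x hx => hx.elim
  | box a n w ch ih =>
    have ha := nonThin_iff.1 (hN a (by simp [nodes]))
    rintro x (rfl | ⟨rfl, hx⟩ | ⟨i, hx⟩)
    · exact h _ (List.mem_append_left _ (by simp [ha.1.ne']))
    · exact h _ (List.mem_append_right _ (by simpa using hx))
    · exact forall_pieces_of_row hV hf (fun i => ih i (hV.2 i).1
        (fun b hb => hN b (mem_nodes_box.2 (Or.inr ⟨i, hb⟩))) (hf.child i))
        (fun x hx => h x (List.mem_append_right _ hx)) i x hx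

/-- A cut determines a union of connected components: the part below the cut. -/
theorem Level.exists_locConst {t : Stacking (ℕ × Colour)} (hV : t.Valid Prod.snd)
    (hd : (t.nodes.map Prod.fst).Nodup) {x y : ℕ} (h : t.Level Prod.snd x y) :
    ∃ f, LocConst t f ∧ (∀ i (hi : i < t.leftBd.length), f t.leftBd[i] ↔ i < x) ∧
      ∀ i (hi : i < t.rightBd.length), f t.rightBd[i] ↔ i < y := by
  induction t generalizing x y with
  | eta => exact ⟨fun _ => True, fun _ _ h => h.elim, fun i hi => by simp [leftBd] at hi,
      fun i hi => by simp [rightBd] at hi⟩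
  | box a n w ch ih =>
    rcases h with ⟨rfl, rfl⟩ | ⟨v, hv, hl, rfl, rfl⟩
    · exact ⟨fun _ => False, fun _ _ _ => Iff.rfl, by simp, by simp⟩
    choose g g1 g2 g3 using fun i => ih i (hV.2 i).1 (nodup_child hd i) (hl i)
    set f : ℕ × Option ℕ → Prop := fun z =>
      (z.1 = a.1 ∧ (z.2 = none ∨ ∃ s < v 0, z.2 = some s)) ∨
        ∃ i, z.1 ∈ (ch i).nodes.map Prod.fst ∧ g i z with hf
    have hfi : ∀ i, ∀ z ∈ (ch i).pieces, f z ↔ g i z := by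
      intro i z hz
      have hz' := fst_mem_of_pieces hz
      constructor
      · rintro (⟨h1, -⟩ | ⟨j, h1, h2⟩)
        · exact absurd (h1 ▸ hz') (root_notMem hd i)
        · rwa [eq_of_mem_child hd hz' h1]
      · exact fun h => Or.inr ⟨i, hz', h⟩
    have hline : ∀ s, f (a.1, some s) ↔ s < v 0 := by
      intro s
      constructor
      · rintro (⟨-, h1 | ⟨s', h1, h2⟩⟩ | ⟨j, h1, -⟩)
        · cases h1
        · cases h2; exact h1
        · exact absurd h1 (root_notMem hd j)
      · exact fun h => Or.inl ⟨rfl, Or.inr ⟨s, h, rfl⟩⟩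
    have hroot : f (a.1, none) := Or.inl ⟨rfl, Or.inl rfl⟩
    refine ⟨f, ?_, ?_, ?_⟩
    · rintro x y (⟨i, h⟩ | ⟨i, j, hij, h⟩)
      · rw [hfi i x h.mem.1, hfi i y h.mem.2]
        exact g1 i x y h
      · obtain ⟨m, hm, e⟩ := List.getElem_of_mem h
        rw [List.getElem_zip, Prod.mk.injEq] at e
        obtain ⟨rfl, rfl⟩ := e
        rw [hfi i _ (mem_pieces_of_rightBd (List.getElem_mem _)),
          hfi j _ (mem_pieces_of_leftBd (List.getElem_mem _)), g3, g2]
        have : i.succ = j.castSucc := Fin.ext (by simp [hij])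
        rw [this]
    · intro i hi
      simp only [leftBd, List.getElem_append, List.length_replicate, List.getElem_replicate]
      split_ifs with h1 h2
      · simp only [hroot, true_iff]; omega
      · have hi' : i - a.2.p < (ch ⟨0, h2⟩).leftBd.length := by
          simp only [leftBd, List.length_append, List.length_replicate, dif_pos h2] at hi; omega
        have := g2 ⟨0, h2⟩ (i - a.2.p) hi'
        rw [hfi ⟨0, h2⟩ _ (mem_pieces_of_leftBd (List.getElem_mem _)), this]
        have e : (⟨0, h2⟩ : Fin n).castSucc = 0 := rfl
        rw [e]; omega
      · simp only [lines, List.getElem_map, List.getElem_range]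
        rw [hline]; omega
    · intro i hi
      simp only [rightBd, List.getElem_append, List.length_replicate, List.getElem_replicate]
      split_ifs with h1 h2
      · simp only [hroot, true_iff]; omega
      · have hi' : i - a.2.r < (ch ⟨n - 1, by omega⟩).rightBd.length := by
          simp only [rightBd, List.length_append, List.length_replicate, dif_pos h2] at hi; omega
        have := g3 ⟨n - 1, by omega⟩ (i - a.2.r) hi'
        rw [hfi ⟨n - 1, by omega⟩ _ (mem_pieces_of_rightBd (List.getElem_mem _)), this]
        have e : (⟨n - 1, by omega⟩ : Fin n).succ = Fin.last n :=
          Fin.ext (by simp only [Fin.val_succ, Fin.val_last]; omega)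
        rw [e]; omega
      · obtain rfl : n = 0 := by omega
        simp only [lines, List.getElem_map, List.getElem_range]
        rw [hline]
        have e : Fin.last 0 = 0 := rfl
        rw [e]; omega

theorem mem_pieces_ne_root {x : ℕ × Option ℕ} (hx : x ∈ (box a n w ch).pieces)
    (hr : x ≠ (a.1, none)) : (n = 0 ∧ x ∈ lines a.1 (w 0)) ∨ ∃ i, x ∈ (ch i).pieces :=
  hx.resolve_left hr

theorem rowLeft_mem (hd : ((box a n w ch).nodes.map Prod.fst).Nodup) {x : ℕ × Option ℕ}
    (hx : x ∈ rowLeft a w ch) : x ∈ (box a n w ch).pieces ∧ x ≠ (a.1, none) := by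
  rw [rowLeft] at hx
  split_ifs at hx with h
  · refine ⟨Or.inr (Or.inr ⟨_, mem_pieces_of_leftBd hx⟩), ?_⟩
    rintro rfl
    exact root_notMem hd _ (fst_mem_of_pieces (mem_pieces_of_leftBd hx))
  · refine ⟨Or.inr (Or.inl ⟨by omega, hx⟩), ?_⟩
    obtain ⟨s, -, rfl⟩ := mem_lines.1 hx
    simp

/-- If the bottom box is thin and the other boxes are non-thin, then the graph has two connected
components if and only if there are only the two trivial cuts. -/
theorem card_eq_two_iff_level (hV : (box a n w ch).Valid Prod.snd)
    (hd : ((box a n w ch).nodes.map Prod.fst).Nodup) (ha : a.2.Thin)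
    (hN : ∀ i, ∀ b ∈ (ch i).nodes, b.2.NonThin) :
    ((∃ x ∈ (box a n w ch).pieces, x ≠ (a.1, none)) ∧
        ∀ f, LocConst (box a n w ch) f → ∀ x ∈ (box a n w ch).pieces,
          ∀ y ∈ (box a n w ch).pieces, x ≠ (a.1, none) → y ≠ (a.1, none) → f x → f y) ↔
      0 < (box a n w ch).left Prod.snd ∧ ∀ x y, (box a n w ch).Level Prod.snd x y →
        (x = 0 ∧ y = 0) ∨ (x = (box a n w ch).left Prod.snd ∧
          y = (box a n w ch).right Prod.snd) := by
  classical
  have hbd : (box a n w ch).leftBd = rowLeft a w ch := by simp [leftBd, ha.1, rowLeft]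
  have hbd' : (box a n w ch).rightBd = rowRight a w ch := by simp [rightBd, ha.2, rowRight]
  have hsub : ∀ z ∈ (box a n w ch).leftBd, z ∈ rowLeft a w ch := fun z h => hbd ▸ h
  have hlen := length_leftBd hV
  have hb : Balanced Prod.snd (box a n w ch) := by
    intro b hb
    rcases mem_nodes_box.1 hb with rfl | ⟨i, hb⟩
    · exact not_semiThin.2 (by simp [ha.1, ha.2])
    · exact (hN i b hb).2
  have hall : ∀ f, LocConst (box a n w ch) f → (∀ x ∈ rowLeft a w ch, f x) →
      ∀ x ∈ (box a n w ch).pieces, x ≠ (a.1, none) → f x := by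
    intro f hf h x hx hr
    rcases mem_pieces_ne_root hx hr with ⟨rfl, hx⟩ | ⟨i, hx⟩
    · exact h x (by simpa [rowLeft] using hx)
    · exact forall_pieces_of_row hV hf (fun i => forall_pieces (hV.2 i).1 (hN i) (hf.child i)) h i
        x hx
  constructor
  · rintro ⟨⟨z, hz, hzr⟩, h⟩
    refine ⟨Nat.pos_of_ne_zero fun h0 => ?_, fun x y hxy => ?_⟩
    · rw [hbd, h0, List.length_eq_zero_iff] at hlen
      exact hall (fun _ => False) (fun _ _ _ => Iff.rfl) (by simp [hlen]) z hz hzr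
    · obtain ⟨f, hf, h1, -⟩ := hxy.exists_locConst hV hd
      by_cases hx : x = 0
      · exact Or.inl ⟨hx, (hxy.eq_zero_iff hb).1 hx⟩
      · right
        have hx' : x = (box a n w ch).left Prod.snd := by
          by_contra hne
          have hlt := lt_of_le_of_ne hxy.le.1 hne
          rw [← hlen] at hlt
          have m0 := List.getElem_mem (l := (box a n w ch).leftBd) (n := 0) (by omega)
          have m1 := List.getElem_mem hlt
          have f0 := (h1 0 (by omega)).2 (by omega)
          have f1 : ¬ f _ := fun h' => lt_irrefl _ ((h1 x hlt).1 h')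
          have k0 := rowLeft_mem hd (hsub _ m0)
          have k1 := rowLeft_mem hd (hsub _ m1)
          exact f1 (h f hf _ k0.1 _ k1.1 k0.2 k1.2 f0)
        exact ⟨hx', (hxy.eq_left_iff hV hb).1 hx'⟩
  · rintro ⟨hpos, hs⟩
    have hpos' : 0 < (box a n w ch).leftBd.length := by omega
    have m0 := List.getElem_mem hpos'
    set z := (box a n w ch).leftBd[0] with hz
    have m0' := hsub _ m0
    refine ⟨⟨z, (rowLeft_mem hd m0').1, (rowLeft_mem hd m0').2⟩, ?_⟩
    have key : ∀ f, LocConst (box a n w ch) f → f z →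
        ∀ x ∈ (box a n w ch).pieces, x ≠ (a.1, none) → f x := by
      intro f hf hfz
      refine hall f hf fun x hx => ?_
      obtain ⟨v, h1, h2, h3, h4⟩ := exists_row_level hV hf fun i =>
        level_takeWhile (hV.2 i).1 (hN i) (hf.child i)
      have hlev : (box a n w ch).Level Prod.snd (v 0) (v (Fin.last n)) :=
        Or.inr ⟨v, h1, h2, by simp [ha.1], by simp [ha.2]⟩
      rw [← hbd] at h3 hx
      have hv0 : v 0 ≠ 0 := by
        rw [h3]
        obtain ⟨l, hl⟩ : ∃ l, (box a n w ch).leftBd = z :: l := by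
          cases hc : (box a n w ch).leftBd with
          | nil => rw [hc] at hpos'; simp at hpos'
          | cons b l => exact ⟨l, by simp only [hz, hc]; simp⟩
        rw [hl, List.takeWhile_cons_of_pos (by simpa using hfz)]
        simp
      have hv : v 0 = (box a n w ch).leftBd.length := by
        rw [hlen]
        exact ((hs _ _ hlev).resolve_left fun h => hv0 h.1).1
      have htw := (List.takeWhile_prefix (l := (box a n w ch).leftBd)
        fun x => decide (f x)).eq_of_length (by rw [← h3, hv])
      rw [← htw] at hx
      simpa using List.mem_takeWhile_imp hx
    intro f hf x hx y hy hxr hyr hfx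
    by_cases hfz : f z
    · exact key f hf hfz y hy hyr
    · exact absurd hfx (key (fun x => ¬ f x) (fun x y h => not_congr (hf x y h)) hfz x hx hxr)

end Classification

end Stacking

end BoxOperad

namespace BoxOperad

namespace Stacking

/-! ### The shapes of the thin-quadratic stackings -/

section TwoBoxes

variable {α : Type u} {β : Type v}

theorem size_box (a : α) (n : ℕ) (w : Fin (n + 1) → ℕ) (ch : Fin n → Stacking α) :
    (box a n w ch).size = 1 + ∑ i, (ch i).size := by
  simp only [size, nodes, List.length_cons, List.length_flatten, List.map_ofFn, List.sum_ofFn,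
    Function.comp_def]
  omega

theorem size_eq_zero {X : Stacking α} : X.size = 0 ↔ X = eta := by
  rw [size, List.length_eq_zero_iff, nodes_eq_nil]

theorem size_eq_one {X : Stacking α} (h : X.size = 1) : ∃ b m w, X = box b m w fun _ => eta := by
  cases X with
  | eta => simp [size, nodes] at h
  | box b m w ch =>
    rw [size_box] at h
    have h1 : ∀ i, (ch i).size = 0 := fun i =>
      (Finset.sum_eq_zero_iff.1 (by omega : ∑ i, (ch i).size = 0)) i (Finset.mem_univ i)
    exact ⟨b, m, w, congrArg _ (funext fun i => size_eq_zero.1 (h1 i))⟩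

/-- The row which is empty except for one entry. -/
def single {n : ℕ} (j : Fin n) (X : Stacking α) : Fin n → Stacking α :=
  Function.update (fun _ => eta) j X

theorem single_self {n : ℕ} (j : Fin n) (X : Stacking α) : single j X j = X := by simp [single]

theorem single_ne {n : ℕ} {i j : Fin n} (h : i ≠ j) (X : Stacking α) : single j X i = eta := by
  simp [single, h]

theorem nodes_box_single (a : α) {n : ℕ} (w : Fin (n + 1) → ℕ) (j : Fin n) (X : Stacking α) :
    (box a n w (single j X)).nodes = a :: X.nodes := by
  rw [nodes]
  congr 1
  have key : ∀ {n : ℕ} (j : Fin n),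
      (List.ofFn fun i => (single j X i).nodes).flatten = X.nodes := by
    intro n
    induction n with
    | zero => exact fun j => j.elim0
    | succ n ih =>
      intro j
      rw [List.ofFn_succ, List.flatten_cons]
      refine j.cases ?_ fun j => ?_
      · have : ∀ i : Fin n, (single (0 : Fin (n + 1)) X i.succ).nodes = [] := fun i => by
          rw [single_ne (Fin.succ_ne_zero i)]; rfl
        simp [this, single_self]
      · have : ∀ i : Fin n, single j.succ X i.succ = single j X i := fun i => by
          by_cases h : i = j
          · subst h; rw [single_self, single_self]
          · rw [single_ne h, single_ne (by simpa using h)]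
        rw [single_ne (Fin.succ_ne_zero j).symm]
        simp only [this, ih]
        rfl
  exact key j

/-- A stacking with two boxes is a box with another one on one of its inputs. -/
theorem size_eq_two {X : Stacking α} (h : X.size = 2) : ∃ a n w j b m w',
    X = box a n w (single j (box b m w' fun _ => eta)) := by
  cases X with
  | eta => simp [size, nodes] at h
  | box a n w ch =>
    rw [size_box] at h
    obtain ⟨j, -, hj⟩ := Finset.exists_ne_zero_of_sum_ne_zero
      (by omega : ∑ i, (ch i).size ≠ 0)
    have hs := Finset.add_sum_erase Finset.univ (fun i => (ch i).size) (Finset.mem_univ j)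
    obtain ⟨b, m, w', hb⟩ := size_eq_one (by omega : (ch j).size = 1)
    refine ⟨a, n, w, j, b, m, w', congrArg _ (funext fun i => ?_)⟩
    by_cases hij : i = j
    · subst hij; rw [single_self, hb]
    · rw [single_ne hij]
      have := (Finset.sum_eq_zero_iff.1
        (by omega : ∑ i ∈ Finset.univ.erase j, (ch i).size = 0)) i (by simp [hij])
      exact size_eq_zero.1 this

theorem nodes_duo (a : α) {n : ℕ} (w : Fin (n + 1) → ℕ) (j : Fin n) (b : α) {m : ℕ}
    (w' : Fin (m + 1) → ℕ) :
    (box a n w (single j (box b m w' fun _ => eta))).nodes = [a, b] := by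
  rw [nodes_box_single]
  simp [nodes]

theorem Flat.left_eq {col : α → Colour} {a : α} {n w} {ch : Fin n → Stacking α}
    (h : Flat (box a n w ch)) : (box a n w ch).left col = (col a).p ∧
      (box a n w ch).right col = (col a).r := by
  simp [left, right, h.1]

theorem Flat.thin_child {col : α → Colour} {a : α} {n w} {ch : Fin n → Stacking α}
    (hV : (box a n w ch).Valid col) (h : Flat (box a n w ch)) (i : Fin n) :
    (ch i).left col = 0 ∧ (ch i).right col = 0 := by
  rw [(hV.2 i).2.1, (hV.2 i).2.2]
  exact ⟨h.1 _, h.1 _⟩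

theorem Flat.thin_of_mem {col : α → Colour} {X : Stacking α} (hV : X.Valid col) (h : X.Flat)
    (h0 : X.left col = 0 ∧ X.right col = 0) : ∀ b ∈ X.nodes, (col b).Thin := by
  induction X with
  | eta => simp [nodes]
  | box a n w ch ih =>
    intro b hb
    rw [h.left_eq.1, h.left_eq.2] at h0
    rcases mem_nodes_box.1 hb with rfl | ⟨i, hb⟩
    · exact h0
    · exact ih i (hV.2 i).1 (h.2 i) (h.thin_child hV i) b hb

/-- If no horizontal line crosses a vertical line, then all boxes but the bottom one are thin. -/
theorem Flat.thin {col : α → Colour} {a : α} {n w} {ch : Fin n → Stacking α}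
    (hV : (box a n w ch).Valid col) (h : Flat (box a n w ch)) {b : α} {i : Fin n}
    (hb : b ∈ (ch i).nodes) : (col b).Thin :=
  (h.2 i).thin_of_mem (hV.2 i).1 (h.thin_child hV i) b hb

/-- For two boxes, the upper one thin, the graph has two connected components if and only if there
are no horizontal lines. -/
theorem card_eq_two_iff_flat {a b : ℕ × Colour} {n : ℕ} {w : Fin (n + 1) → ℕ} {j : Fin n}
    {m : ℕ} {w' : Fin (m + 1) → ℕ}
    (hV : (box a n w (single j (box b m w' fun _ => eta))).Valid Prod.snd)
    (hd : ((box a n w (single j (box b m w' fun _ => eta))).nodes.map Prod.fst).Nodup)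
    (hb : b.2.Thin) :
    ((∃ x ∈ (box a n w (single j (box b m w' fun _ => eta))).pieces, x ≠ (a.1, none)) ∧
        ∀ f, LocConst (box a n w (single j (box b m w' fun _ => eta))) f →
          ∀ x ∈ (box a n w (single j (box b m w' fun _ => eta))).pieces,
          ∀ y ∈ (box a n w (single j (box b m w' fun _ => eta))).pieces,
            x ≠ (a.1, none) → y ≠ (a.1, none) → f x → f y) ↔
      (box a n w (single j (box b m w' fun _ => eta))).Flat := by
  have hab : b.1 ≠ a.1 := by
    rw [nodes_duo] at hd
    simp only [List.map_cons, List.map_nil, List.nodup_cons, List.mem_singleton] at hd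
    exact fun h => hd.1 h.symm
  have hloc : ∀ f, LocConst (box a n w (single j (box b m w' fun _ => eta))) f := by
    rintro f x y (⟨i, h⟩ | ⟨i, i', hii, h⟩)
    · exfalso
      by_cases hij : i = j
      · subst hij
        rw [single_self] at h
        rcases h with ⟨_, h⟩ | ⟨i, i', _, h⟩
        · exact h
        · simp [leftBd, rightBd] at h
      · rw [single_ne hij] at h
        exact h
    · exfalso
      by_cases hij : i = j
      · have : i' ≠ j := by rintro rfl; rw [hij] at hii; omega
        rw [single_ne this] at h
        simp [leftBd] at h
      · rw [single_ne hij] at h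
        simp [rightBd] at h
  have hpc : ∀ x, x ∈ (box a n w (single j (box b m w' fun _ => eta))).pieces ↔
      x = (a.1, none) ∨ x = (b.1, none) ∨ (m = 0 ∧ x ∈ lines b.1 (w' 0)) := by
    intro x
    constructor
    · rintro (h | ⟨rfl, -⟩ | ⟨i, h⟩)
      · exact Or.inl h
      · exact j.elim0
      · by_cases hij : i = j
        · subst hij
          rw [single_self] at h
          rcases h with h | h | ⟨_, h⟩
          · exact Or.inr (Or.inl h)
          · exact Or.inr (Or.inr h)
          · exact h.elim
        · rw [single_ne hij] at h; exact h.elim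
    · rintro (h | h | h)
      · exact Or.inl h
      · exact Or.inr (Or.inr ⟨j, by rw [single_self]; exact Or.inl h⟩)
      · exact Or.inr (Or.inr ⟨j, by rw [single_self]; exact Or.inr (Or.inl h)⟩)
  have hvb := (hV.2 j).1
  rw [single_self] at hvb
  have hbne : ((b.1, none) : ℕ × Option ℕ) ≠ (a.1, none) := fun h => hab (Prod.mk.inj h).1
  constructor
  · rintro ⟨-, h⟩
    have hw' : ∀ i, w' i = 0 := by
      rcases Nat.eq_zero_or_pos m with rfl | hm
      · intro i
        rw [Fin.fin_one_eq_zero i]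
        by_contra h0
        have := h (fun x => x = (b.1, none)) (hloc _) (b.1, none) ((hpc _).2 (by simp))
          (b.1, some 0) ((hpc _).2 (Or.inr (Or.inr ⟨rfl, mem_lines.2 ⟨0, by omega, rfl⟩⟩)))
          hbne (by simp) rfl
        simp at this
      · intro i
        have : (∃ j : Fin m, i = j.castSucc) ∨ ∃ j : Fin m, i = j.succ := by
          refine i.lastCases (Or.inr ⟨⟨m - 1, by omega⟩, ?_⟩) fun j => Or.inl ⟨j, rfl⟩
          ext; simp only [Fin.val_last, Fin.val_succ]; omega
        rcases this with ⟨i, rfl⟩ | ⟨i, rfl⟩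
        · exact (hvb.2 i).2.1.symm
        · exact (hvb.2 i).2.2.symm
    have hs : ∀ i, (single j (box b m w' fun _ => eta) i).left Prod.snd = 0 ∧
        (single j (box b m w' fun _ => eta) i).right Prod.snd = 0 := by
      intro i
      by_cases hij : i = j
      · subst hij; rw [single_self]; simp [left, right, hw', hb.1, hb.2]
      · rw [single_ne hij]; exact ⟨rfl, rfl⟩
    refine ⟨fun i => ?_, fun i => ?_⟩
    · have : (∃ j : Fin n, i = j.castSucc) ∨ ∃ j : Fin n, i = j.succ := by
        refine i.lastCases (Or.inr ⟨⟨n - 1, by have := j.2; omega⟩, ?_⟩) fun j => Or.inl ⟨j, rfl⟩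
        have := j.2
        ext; simp only [Fin.val_last, Fin.val_succ]; omega
      rcases this with ⟨i, rfl⟩ | ⟨i, rfl⟩
      · rw [← (hV.2 i).2.1, (hs i).1]
      · rw [← (hV.2 i).2.2, (hs i).2]
    · by_cases hij : i = j
      · subst hij; rw [single_self]; exact ⟨hw', fun _ => trivial⟩
      · rw [single_ne hij]; trivial
  · intro hF
    have hw' : w' 0 = 0 := by
      have := hF.2 j
      rw [single_self] at this
      exact this.1 0
    have huniq : ∀ x ∈ (box a n w (single j (box b m w' fun _ => eta))).pieces,
        x ≠ (a.1, none) → x = (b.1, none) := by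
      intro x hx hr
      rcases (hpc x).1 hx with h | h | ⟨-, h⟩
      · exact absurd h hr
      · exact h
      · rw [hw'] at h; simp [lines] at h
    exact ⟨⟨(b.1, none), (hpc _).2 (by simp), hbne⟩, fun f _ x hx y hy hxr hyr hfx => by
      rwa [huniq y hy hyr, ← huniq x hx hxr]⟩

end TwoBoxes

section Classification

variable {S : Stacking Colour}

theorem card_two_iff {a n w ch} (e : S.number 0 = box a n w ch) :
    Nat.card S.hGraph.ConnectedComponent = 2 ↔
      (∃ x ∈ (box a n w ch).pieces, x ≠ (a.1, none)) ∧
        ∀ f, LocConst (box a n w ch) f → ∀ x ∈ (box a n w ch).pieces,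
          ∀ y ∈ (box a n w ch).pieces, x ≠ (a.1, none) → y ≠ (a.1, none) → f x → f y := by
  have hd : ((S.number 0).nodes.map Prod.fst).Nodup := by
    rw [nodes_number_fst]; exact List.nodup_range'
  rw [e] at hd
  rw [← card_component_eq_two_iff hd, hGraph]
  rw [e]

theorem number_facts (hV : S.Valid id) {a n w ch} (e : S.number 0 = box a n w ch) :
    (box a n w ch).Valid Prod.snd ∧ ((box a n w ch).nodes.map Prod.fst).Nodup ∧
      S = (box a n w ch).map Prod.snd := by
  have h := number_snd S 0
  refine ⟨?_, ?_, by rw [← e, h]⟩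
  · rw [← h, valid_map, e] at hV
    exact hV
  · rw [← e, nodes_number_fst]; exact List.nodup_range'

theorem card_two_iff_isPrime (hV : S.Valid id) {a : Colour} {l : List Colour}
    (hn : S.nodes = a :: l) (ha : a.Thin) (hl : ∀ b ∈ l, b.NonThin) :
    Nat.card S.hGraph.ConnectedComponent = 2 ↔ S.IsPrime id := by
  obtain ⟨t, e⟩ : ∃ t, S.number 0 = t := ⟨_, rfl⟩
  cases t with
  | eta =>
    have := number_snd S 0
    rw [e] at this
    rw [← this] at hn
    simp [map, nodes] at hn
  | box a' n w ch =>
    obtain ⟨h1, h2, h3⟩ := number_facts hV e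
    have hn' := hn
    rw [h3] at hn'
    simp only [map, nodes, List.cons.injEq] at hn'
    rw [card_two_iff e, card_eq_two_iff_level h1 h2 (hn'.1 ▸ ha)]
    · have hl : S.left id = (box a' n w ch).left Prod.snd := by rw [h3, left_map]; rfl
      have hr : S.right id = (box a' n w ch).right Prod.snd := by rw [h3, right_map]; rfl
      have hL : ∀ x y, S.Level id x y ↔ (box a' n w ch).Level Prod.snd x y := fun x y => by
        rw [h3, level_map]; rfl
      simp only [IsPrime, hl, hr, hL, hn]
      exact ⟨fun h => ⟨⟨a, l, rfl, ha, by assumption⟩, h⟩, fun h => h.2⟩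
    · intro i b hb
      refine hl b.2 ?_
      rw [← hn'.2]
      refine List.mem_flatten.2 ⟨_, List.mem_ofFn.2 ⟨i, rfl⟩, ?_⟩
      rw [nodes_map]
      exact List.mem_map.2 ⟨b, hb, rfl⟩

theorem card_two_iff_flat (hV : S.Valid id) {a b : Colour} (hn : S.nodes = [a, b])
    (hb : b.Thin) : Nat.card S.hGraph.ConnectedComponent = 2 ↔ S.Flat := by
  have hs : (S.number 0).size = 2 := by
    have := congrArg size (number_snd S 0)
    rw [size_map] at this
    rw [this, size, hn]; rfl
  obtain ⟨a', n, w, j, b', m, w', e⟩ := size_eq_two hs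
  obtain ⟨h1, h2, h3⟩ := number_facts hV e
  have hb' : b'.2 = b := by
    rw [h3, nodes_map, nodes_duo] at hn
    simp at hn
    exact hn.2
  rw [card_two_iff e, card_eq_two_iff_flat h1 h2 (hb' ▸ hb), h3, Flat.map_iff]

theorem IsDuo.exists_nodes {α : Type u} {col : α → Colour} {X : Stacking α} (hV : X.Valid col)
    (h : X.IsDuo col) : ∃ a b, X.nodes = [a, b] ∧ (col b).Thin ∧ X.left col = (col a).p ∧
      X.right col = (col a).r := by
  obtain ⟨h1, h2, h3⟩ := h
  obtain ⟨a, n, w, j, b, m, w', rfl⟩ := size_eq_two h2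
  exact ⟨a, b, nodes_duo _ _ _ _ _, h3.thin hV (i := j) (by rw [single_self]; simp [nodes]),
    h3.left_eq⟩

theorem IsTypeIII.isPrime (hV : S.Valid id) (h : S.IsTypeIII) : S.IsPrime id := by
  obtain ⟨h1, a, l, hn, ha, hl⟩ := h
  exact (card_two_iff_isPrime hV hn ha hl).1 h1.2.2

/-- For two boxes, the condition on the connected components says that there are no horizontal
lines. -/
theorem isDuo_of_type (hV : S.Valid id) (h : S.IsTypeI ∨ S.IsTypeII) : S.IsDuo id := by
  have : S.ThinQuadratic ∧ ∃ a b, S.nodes = [a, b] ∧ b.Thin := by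
    rcases h with ⟨h, a, b, hn, -, hb⟩ | ⟨h, a, b, hn, -, hb⟩ <;> exact ⟨h, a, b, hn, hb⟩
  obtain ⟨h1, a, b, hn, hb⟩ := this
  exact ⟨h1.1, by rw [size, hn]; rfl, (card_two_iff_flat hV hn hb).1 h1.2.2⟩

theorem IsPrime.isTypeIII (hV : S.Valid id) (h : S.IsPrime id) :
    S.IsTypeIII ∧ ¬ S.IsTypeI ∧ ¬ S.IsTypeII := by
  classical
  have h' := h
  obtain ⟨⟨a, l, hn, ha, hl⟩, hpos, -⟩ := h'
  refine ⟨⟨⟨?_, ?_, (card_two_iff_isPrime hV hn ha hl).2 h⟩, a, l, hn, ha, hl⟩, ?_, ?_⟩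
  · intro c hc
    rw [hn] at hc
    rcases List.mem_cons.1 hc with rfl | hc
    · exact not_semiThin.2 (iff_of_true ha.1 ha.2)
    · exact (hl c hc).2
  · rw [thinDegree, if_neg (by omega), size, hn,
      List.countP_cons_of_pos (p := fun c : Colour => decide c.Thin) (a := a) (decide_eq_true ha),
      List.countP_eq_zero.2]
    · push_cast; ring
    · exact fun c hc hcc => (hl c hc).1 (of_decide_eq_true hcc)
  · rintro ⟨-, a', b, hn', -, hb⟩
    rw [hn'] at hn
    simp only [List.cons.injEq] at hn
    exact (hl b (by simp [← hn.2])).1 hb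
  · rintro ⟨-, a', b, hn', ha', -⟩
    rw [hn'] at hn
    simp only [List.cons.injEq] at hn
    exact ha'.1 (hn.1 ▸ ha)

theorem IsDuo.isType (hV : S.Valid id) (h : S.IsDuo id) : ∃ a b, S.nodes = [a, b] ∧
    (a.Thin → S.IsTypeI) ∧ (¬ a.Thin → ¬ S.IsTypeI ∧ S.IsTypeII) := by
  classical
  obtain ⟨a, b, hn, hb, hl, hr⟩ := h.exists_nodes hV
  have hab := h.1 a (by rw [hn]; simp)
  have hTQ : S.ThinQuadratic := by
    refine ⟨h.1, ?_, (card_two_iff_flat hV hn hb).2 h.2.2⟩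
    rw [thinDegree, hl, hr, size, hn]
    by_cases ha : a.Thin
    · rw [if_pos (show (id a).p = 0 ∧ (id a).r = 0 from ha)]; simp
    · rw [if_neg (show ¬ ((id a).p = 0 ∧ (id a).r = 0) from ha),
        List.countP_cons_of_neg (p := fun c : Colour => decide c.Thin) fun h =>
          ha (of_decide_eq_true h),
        List.countP_cons_of_pos (p := fun c : Colour => decide c.Thin) (a := b) (decide_eq_true hb)]
      simp
  refine ⟨a, b, hn, fun ha => ⟨hTQ, a, b, hn, ha, hb⟩, fun ha => ⟨?_, hTQ, a, b, hn, ⟨ha, hab⟩, hb⟩⟩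
  rintro ⟨-, a', b', hn', ha', -⟩
  rw [hn'] at hn
  simp only [List.cons.injEq] at hn
  exact ha (hn.1 ▸ ha')

end Classification

end Stacking

open Stacking

section BarSign

variable {ι : Type u}

/-- The sign of the thin suspended infinitesimal composition, for a stacking whose boxes have
colours `col` and (unsuspended) degrees `δ`: for types I and II it is the suspended degree of the
lower box. -/
theorem barSign_duo {X : Stacking ι} {col : ι → Colour} {δ : ι → ℤ} (hV : X.Valid col)
    (h : X.IsDuo col) {a b : ι} (hn : X.nodes = [a, b]) :
    barSign (X.map fun l => (col l, δ l)) = ((δ a + thinShift (col a)).negOnePow : ℤ) := by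
  have e : (X.map fun l => (col l, δ l)).map Prod.fst = X.map col := map_map _ _ _
  have hV' : (X.map col).Valid id := (valid_map _ _ _).2 hV
  have hD : (X.map col).IsDuo id := by
    refine ⟨fun c hc => ?_, by rw [size_map]; exact h.2.1, (Flat.map_iff _ _).2 h.2.2⟩
    rw [nodes_map] at hc
    obtain ⟨l, hl, rfl⟩ := List.mem_map.1 hc
    exact h.1 l hl
  obtain ⟨a', b', hn', h1, h2⟩ := hD.isType hV'
  have ha' : a' = col a := by
    rw [nodes_map, hn] at hn'
    simp only [List.map_cons, List.cons.injEq] at hn'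
    exact hn'.1.symm
  subst ha'
  have hh : (((X.map fun l => (col l, δ l)).nodes.map Prod.snd).headD 0) = δ a := by
    rw [nodes_map, hn]; rfl
  rw [barSign, e, hh]
  by_cases ht : (col a).Thin
  · rw [if_pos (h1 ht), thinShift, if_pos ht]
  · rw [if_neg (h2 ht).1, if_pos (h2 ht).2, thinShift, if_neg ht, add_zero]

theorem isPrime_map {X : Stacking ι} {col : ι → Colour} :
    (X.map col).IsPrime id ↔ X.IsPrime col := by
  have h : (fun a => id (col a)) = col := rfl
  simp only [IsPrime, left_map, right_map, level_map, nodes_map, h]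
  refine and_congr_left fun _ => ?_
  constructor
  · rintro ⟨a, l, hn, ha, hl⟩
    cases hX : X.nodes with
    | nil => rw [hX] at hn; simp at hn
    | cons b m =>
      rw [hX] at hn
      simp only [List.map_cons, List.cons.injEq] at hn
      exact ⟨b, m, rfl, by rw [hn.1]; exact ha, fun c hc => hl _ (by
        rw [← hn.2]; exact List.mem_map.2 ⟨c, hc, rfl⟩)⟩
  · rintro ⟨a, l, hn, ha, hl⟩
    refine ⟨col a, l.map col, by rw [hn]; rfl, ha, fun c hc => ?_⟩
    obtain ⟨b, hb, rfl⟩ := List.mem_map.1 hc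
    exact hl b hb

theorem barSign_prime {X : Stacking ι} {col : ι → Colour} {δ : ι → ℤ} (hV : X.Valid col)
    (h : X.IsPrime col) : barSign (X.map fun l => (col l, δ l)) = -1 := by
  have e : (X.map fun l => (col l, δ l)).map Prod.fst = X.map col := map_map _ _ _
  obtain ⟨h1, h2, h3⟩ := (isPrime_map.2 h).isTypeIII ((valid_map _ _ _).2 hV)
  rw [barSign, e, if_neg h2, if_neg h3, if_pos h1]

theorem barSign_eq_zero {X : Stacking ι} {col : ι → Colour} {δ : ι → ℤ} (hV : X.Valid col)
    (h : ¬ (X.IsDuo col ∨ X.IsPrime col)) : barSign (X.map fun l => (col l, δ l)) = 0 := by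
  have e : (X.map fun l => (col l, δ l)).map Prod.fst = X.map col := map_map _ _ _
  have hV' : (X.map col).Valid id := (valid_map _ _ _).2 hV
  have hD : ¬ (X.map col).IsDuo id := fun hD => h (Or.inl ⟨fun l hl => hD.1 _ (by
    rw [nodes_map]; exact List.mem_map.2 ⟨l, hl, rfl⟩), by rw [← size_map col]; exact hD.2.1,
      (Flat.map_iff _ _).1 hD.2.2⟩)
  rw [barSign, e, if_neg fun h1 => hD (isDuo_of_type hV' (Or.inl h1)),
    if_neg fun h1 => hD (isDuo_of_type hV' (Or.inr h1)),
    if_neg fun h1 => h (Or.inr (isPrime_map.1 (h1.isPrime hV')))]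

end BarSign

end BoxOperad

namespace BoxOperad

open Stacking

/-! ### The infinitesimal composition and the internal differential -/

section Compositions

variable {k : Type u} [CommRing k]
variable {M : Colour → ℤ → Type v} [∀ c n, AddCommGroup (M c n)] [∀ c n, Module k (M c n)]
variable {M' : Colour → ℤ → Type w} [∀ c n, AddCommGroup (M' c n)] [∀ c n, Module k (M' c n)]

theorem Good.incl {c : Colour} {n : ℤ} {t : Stacking (Box M)} (h : Good false c n t) :
    Good true c n t := ⟨h.1, h.2.1, h.2.2.1, by simp⟩

theorem incl_gen {c : Colour} {n : ℤ} {t : Stacking (Box M)} (h : t ≠ eta) :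
    T.incl c n (gen k false c n t) = gen k true c n t := by
  rw [T.incl, T.lift_gen]
  split_ifs with hg
  · rfl
  · exact (gen_of_not_good fun hg' => hg ⟨hg'.1, hg'.2.1, hg'.2.2.1, fun _ => h⟩).symm

theorem incl_comp_inf (f : ∀ c n, M c n →ₗ[k] M' c n) (g : ∀ c i j, M c i →ₗ[k] M' c j) (e : ℤ)
    (c : Colour) (i j : ℤ) :
    T.incl c j ∘ₗ T.inf false f g e c i j = T.inf true f g e c i j ∘ₗ T.incl c i := by
  refine T.hom_ext fun t ht => ?_
  rw [← skel_map_lookup t] at ht ⊢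
  have hR := nodup_skel t
  have hne : t.skel ≠ eta := fun h => ht.2.2.2 rfl (by rw [h]; rfl)
  rw [LinearMap.comp_apply, LinearMap.comp_apply, incl_gen (ht.2.2.2 rfl),
    inf_gen _ _ _ _ hR _ ht, inf_gen _ _ _ _ hR _ ht.incl, map_sum]
  refine Finset.sum_congr rfl fun m _ => ?_
  rw [map_zsmul, incl_gen]
  exact fun h => hne (map_eq_eta.1 h)

end Compositions

section Ideal

variable {k : Type u} [CommRing k] {B : DGBoxOperad.{u, v} k} (ε : B.Augmentation)

/-- The composition of the augmentation ideal is a chain map. -/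
theorem idealMu_comp_inf (c : Colour) (i j : ℤ) :
    ε.idealMu c j ∘ₗ T.inf false (fun _ _ => LinearMap.id) ε.idealD (-1) c i j =
      ε.idealD c i j ∘ₗ ε.idealMu c i := by
  refine LinearMap.ext fun z => Subtype.ext ?_
  have h1 : ((ε.idealMu c j ∘ₗ T.inf false (fun _ _ => LinearMap.id) ε.idealD (-1) c i j) z).1 =
      B.mu c j (T.incl c j ((T.map false (fun _ _ => Submodule.subtype _) c j ∘ₗ
        T.inf false (fun _ _ => LinearMap.id) ε.idealD (-1) c i j) z)) := rfl
  have h2 : ((ε.idealD c i j ∘ₗ ε.idealMu c i) z).1 = (B.d c i j ∘ₗ B.mu c i) (T.incl c i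
      (T.map false (fun _ _ => Submodule.subtype _) c i z)) := rfl
  rw [h1, h2, ← B.mu_d, map_comp_inf]
  have h3 := LinearMap.congr_fun (incl_comp_inf (fun c n => LinearMap.id (R := k)
    (M := B.carrier c n)) B.d (-1) c i j) (T.map false (fun _ _ => Submodule.subtype _) c i z)
  rw [LinearMap.comp_apply, LinearMap.comp_apply] at h3
  rw [LinearMap.comp_apply, ← h3, ← LinearMap.comp_apply (T.inf _ _ _ _ _ _ _), inf_comp_map]
  rfl

/-- The infinitesimal composition of a stacking with distinct labels. -/
theorem infCompAux_gen {ι : Type*} {c : Colour} {i : ℤ} (m : ℤ) {R : Stacking ι}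
    {v : ι → Box ε.sIdeal} (h : Good false c i (R.map v)) :
    ε.infCompAux false c i m (gen k false c i (R.map v)) =
      barSign (R.map fun l => ((v l).c, (v l).deg - thinShift (v l).c)) •
        ε.idealMu c m (gen k false c m (R.map fun l => unsuspend (v l))) := by
  rw [DGBoxOperad.Augmentation.infCompAux, T.lift_gen, if_pos h, map_map, map_map]

theorem thinShift_of_thin {c : Colour} (h : c.Thin) : thinShift c = 1 := if_pos h

theorem thinShift_of_not_thin {c : Colour} (h : ¬ c.Thin) : thinShift c = 0 := if_neg h

theorem thinShift_congr {c c' : Colour} (hp : c.p = c'.p) (hr : c.r = c'.r) :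
    thinShift c = thinShift c' := by
  have h : c.Thin ↔ c'.Thin := by rw [Colour.Thin, Colour.Thin, hp, hr]
  by_cases hc : c.Thin
  · rw [thinShift_of_thin hc, thinShift_of_thin (h.1 hc)]
  · rw [thinShift_of_not_thin hc, thinShift_of_not_thin fun h' => hc (h.2 h')]

/-- The suspension of a thin-quadratic stacking has one more thin shift than that of its composite.
This is why `μ_(1)` has degree `-1`. -/
theorem sum_thinShift {ι : Type*} {col : ι → Colour} {X : Stacking ι} (hV : X.Valid col)
    (h : X.IsDuo col ∨ X.IsPrime col) :
    (X.nodes.map fun l => thinShift (col l)).sum = thinShift (X.arity col) + 1 := by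
  rcases h with h | ⟨⟨a, l, hn, ha, hl⟩, hpos, -⟩
  · obtain ⟨a, b, hn, hb, hle, hr⟩ := h.exists_nodes hV
    rw [hn]
    have : thinShift (X.arity col) = thinShift (col a) := thinShift_congr hle hr
    simp [this, thinShift_of_thin hb]
  · have h1 : ¬ (X.arity col).Thin := fun h => hpos.ne' h.1
    have h2 : (l.map fun b => thinShift (col b)) = l.map fun _ => (0 : ℤ) :=
      List.map_congr_left fun b hb => thinShift_of_not_thin (hl b hb).1
    rw [hn, List.map_cons, List.sum_cons, thinShift_of_thin ha, thinShift_of_not_thin h1, h2]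
    simp

/-- The degree of the composite of the unsuspended elements. -/
theorem good_unsuspend {ι : Type*} {c : Colour} {i m : ℤ} {R : Stacking ι}
    {v : ι → Box ε.sIdeal} (h : Good false c i (R.map v))
    (hR : R.IsDuo (fun l => (v l).c) ∨ R.IsPrime fun l => (v l).c) :
    Good false c m (R.map fun l => unsuspend (v l)) ↔ m = i - (thinShift c + 1) := by
  rw [good_map_iff] at h ⊢
  obtain ⟨h1, h2, h3, h4⟩ := h
  have h5 := sum_thinShift h1 hR
  have h6 : (R.nodes.map fun l => (unsuspend (v l)).deg).sum = i - (thinShift c + 1) := by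
    have h7 := List.sum_map_add (l := R.nodes) (f := fun l => (unsuspend (v l)).deg)
      (g := fun l => thinShift (v l).c)
    simp only [unsuspend, sub_add_cancel, h3, h5, h2] at h7
    simp only [unsuspend]
    omega
  rw [h6]
  exact ⟨fun h => h.2.2.1.symm, fun h => ⟨h1, h2, h.symm, h4⟩⟩

/-- The map `ψ` has degree `-1`. -/
theorem infComp_eq_zero (c : Colour) (i j : ℤ) (hij : j + 1 ≠ i) :
    ε.infComp false c i j = 0 := by
  refine T.hom_ext fun t ht => ?_
  rw [← map_id' t] at ht ⊢
  have key : ε.infCompAux false c i (j - thinShift c) (gen k false c i (t.map fun b => b)) = 0 := by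
    rw [infCompAux_gen ε _ ht]
    by_cases hR : t.IsDuo Box.c ∨ t.IsPrime Box.c
    · rw [gen_of_not_good, map_zero, smul_zero]
      rw [good_unsuspend ε ht hR]
      omega
    · rw [barSign_eq_zero (good_map_iff.1 ht).1 hR, zero_smul]
  exact key

theorem box_eq_of_deg {M M' : Colour → ℤ → Type*} [∀ c n, AddCommGroup (M c n)]
    [∀ c n, Module k (M c n)] [∀ c n, AddCommGroup (M' c n)] [∀ c n, Module k (M' c n)]
    (g : ∀ c i j, M c i →ₗ[k] M' c j) (s : ℤ) {c : Colour} {i j j' : ℤ} (h : j = j') (x : M c i) :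
    (⟨c, j, s • g c i j x⟩ : Box M') = ⟨c, j', s • g c i j' x⟩ := by
  subst h; rfl

/-- The sign rule behind the compatibility of the infinitesimal composition with the internal
differentials. -/
theorem barSign_update {ι : Type*} [DecidableEq ι] {R : Stacking ι} (hR : R.nodes.Nodup)
    {col : ι → Colour} (δ : ι → ℤ) (hV : R.Valid col) (h : R.IsDuo col ∨ R.IsPrime col) {m : ι}
    (hm : m ∈ R.nodes) :
    ((-1 * pre (fun l => δ l + thinShift (col l)) R.nodes m).negOnePow : ℤ) *
      (barSign (R.map fun l => (col l, if l = m then δ l + -1 else δ l)) *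
        ((thinShift (col m)).negOnePow : ℤ)) +
      ((thinShift (R.arity col)).negOnePow : ℤ) * (barSign (R.map fun l => (col l, δ l)) *
        ((-1 * pre δ R.nodes m).negOnePow : ℤ)) = 0 := by
  rcases h with h | h
  · obtain ⟨a, b, hn, hb, hl, hr⟩ := h.exists_nodes hV
    have hth : thinShift (R.arity col) = thinShift (col a) := thinShift_congr hl hr
    rw [barSign_duo hV h hn, barSign_duo hV h hn, hth]
    rw [hn] at hm hR ⊢
    have hab : a ≠ b := by simpa using hR
    rcases List.mem_cons.1 hm with rfl | hm
    · simp only [pre, if_true, mul_zero, Int.negOnePow_zero, Units.val_one, one_mul, mul_one,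
        Int.negOnePow_add, Units.val_mul, Int.negOnePow_neg, Int.negOnePow_one, Units.val_neg]
      ring
    · obtain rfl : m = b := by simpa using hm
      simp only [pre, if_neg hab, if_true, Int.negOnePow_add, Units.val_mul,
        Int.negOnePow_neg, Int.negOnePow_one, Units.val_neg, thinShift_of_thin hb, neg_mul, one_mul,
        add_zero, Units.val_one]
      ring
  · rw [barSign_prime hV h, barSign_prime hV h]
    obtain ⟨⟨a, l, hn, ha, hl⟩, hpos, -⟩ := h
    rw [thinShift_of_not_thin (c := R.arity col) fun h => hpos.ne' h.1]
    rw [hn] at hm hR ⊢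
    by_cases ham : a = m
    · subst ham
      simp [pre, thinShift_of_thin ha]
    · have hml : m ∈ l := by
        rcases List.mem_cons.1 hm with rfl | h
        · exact absurd rfl ham
        · exact h
      have hpre : pre (fun l => δ l + thinShift (col l)) l m = pre δ l m :=
        pre_congr fun b hb _ => by rw [thinShift_of_not_thin (hl b hb).1, add_zero]
      simp only [pre, if_neg ham, hpre, thinShift_of_thin ha, thinShift_of_not_thin (hl m hml).1,
        mul_add, Int.negOnePow_add, Units.val_mul]
      simp

/-- The map `ψ` anticommutes with the internal differentials. -/
theorem infComp_comp_barInternal (c : Colour) (i j l : ℤ) :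
    ε.infComp false c j l ∘ₗ ε.barInternal false c i j +
      ε.sIdealD c j l ∘ₗ ε.infComp false c i j = 0 := by
  classical
  by_cases hj : j + 1 = i
  swap
  · rw [infComp_eq_zero ε c i j hj, DGBoxOperad.Augmentation.barInternal,
      inf_eq_zero _ _ _ _ (by omega), LinearMap.comp_zero, LinearMap.comp_zero, add_zero]
  by_cases hl : l + 1 = j
  swap
  · rw [infComp_eq_zero ε c j l hl, (isDifferential_sIdealD ε).1 _ _ _ hl, LinearMap.zero_comp,
      LinearMap.zero_comp, add_zero]
  refine T.hom_ext fun t ht => ?_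
  suffices key : ε.infCompAux false c j (l - thinShift c)
      (ε.barInternal false c i j (gen k false c i t)) + ((thinShift c).negOnePow : ℤ) •
      ε.idealD c (j - thinShift c) (l - thinShift c)
        (ε.infCompAux false c i (j - thinShift c) (gen k false c i t)) = 0 from key
  rw [← skel_map_lookup t] at ht ⊢
  have hR := nodup_skel t
  revert ht hR
  generalize t.skel = R
  generalize lookup t = v
  intro ht hR
  set col : ℕ → Colour := fun l => (v l).c with hcol
  set un : ℕ → Box ε.ideal := fun l => unsuspend (v l) with hun
  set w : ℕ → ℕ → Box ε.sIdeal := fun m l =>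
    if l = m then (v l).shift ε.sIdealD (-1) else (v l).map fun _ _ => LinearMap.id (R := k) with hw
  have hwc : ∀ m l, (w m l).c = col l := fun m l => by simp only [hw]; split_ifs <;> rfl
  have hwd : ∀ m l, (w m l).deg - thinShift (col l) =
      if l = m then (un l).deg + -1 else (un l).deg := fun m l => by
    simp only [hw, hun, unsuspend]
    split_ifs
    · simp only [Box.shift]; ring
    · rfl
  rw [infCompAux_gen ε _ ht, DGBoxOperad.Augmentation.barInternal,
    inf_gen _ _ _ _ hR _ ht, map_sum]
  have hV := (good_map_iff.1 ht).1
  have hc := (good_map_iff.1 ht).2.1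
  have h1 : ∀ m ∈ R.nodes.toFinset, ε.infCompAux false c j (l - thinShift c)
      (((-1 * pre (fun l => (v l).deg) R.nodes m).negOnePow : ℤ) • gen k false c j (R.map (w m))) =
      (((-1 * pre (fun l => (un l).deg + thinShift (col l)) R.nodes m).negOnePow : ℤ) *
        (barSign (R.map fun l => (col l, if l = m then (un l).deg + -1 else (un l).deg)) *
          ((thinShift (col m)).negOnePow : ℤ))) •
        ε.idealMu c (l - thinShift c) (gen k false c (l - thinShift c) (R.map fun l =>
          if l = m then (un l).shift ε.idealD (-1) else
            (un l).map fun _ _ => LinearMap.id (R := k))) := by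
    intro m hm
    rw [List.mem_toFinset] at hm
    have hd : (fun l => (v l).deg) = fun l => (un l).deg + thinShift (col l) := funext fun l => by
      simp [hun, hcol, unsuspend]
    rw [map_zsmul, infCompAux_gen ε (v := w m) _ ((good_inf _ _ _ hR ht hm).2 (by omega)), mul_smul,
      mul_smul, hd]
    simp only [hwc, hwd]
    congr 2
    rw [gen_smul_label (k := k) hR (fun l => unsuspend (w m l)) (fun l =>
          if l = m then (un l).shift ε.idealD (-1) else
            (un l).map fun _ _ => LinearMap.id (R := k)) hm
        (col m) ((un m).deg + -1) ((((thinShift (col m)).negOnePow : ℤ) : ℤ) : k)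
        (ε.idealD (col m) (un m).deg ((un m).deg + -1) (un m).x) ?_ ?_ ?_]
    · rw [map_smul, Int.cast_smul_eq_zsmul]
    · simp only [hw, if_true]
      rw [Int.cast_smul_eq_zsmul]
      exact box_eq_of_deg ε.idealD _ (by simp only [hun, unsuspend, Box.shift]; ring) (un m).x
    · simp only [if_true]; rfl
    · intro l _ hlm
      simp only [hw, if_neg hlm]
      rfl
  rw [Finset.sum_congr rfl h1]
  by_cases hq : R.IsDuo col ∨ R.IsPrime col
  swap
  · rw [barSign_eq_zero hV hq, zero_smul, map_zero, smul_zero, add_zero]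
    refine Finset.sum_eq_zero fun m _ => ?_
    rw [barSign_eq_zero hV hq, zero_mul, mul_zero, zero_smul]
  have hg : Good false c (j - thinShift c) (R.map un) := (good_unsuspend ε ht hq).2 (by omega)
  rw [map_zsmul, ← LinearMap.comp_apply, ← idealMu_comp_inf, LinearMap.comp_apply,
    inf_gen _ _ _ _ hR _ hg, map_sum, Finset.smul_sum, Finset.smul_sum, ← Finset.sum_add_distrib]
  refine Finset.sum_eq_zero fun m hm => ?_
  rw [map_zsmul, smul_smul, smul_smul, mul_assoc, ← add_smul]
  have := barSign_update hR (fun l => (un l).deg) hV hq (List.mem_toFinset.1 hm)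
  rw [hc] at this
  exact (congrArg (· • _) this).trans (zero_smul _ _)

end Ideal

end BoxOperad

namespace BoxOperad

open Stacking

/-! ### The square of the coderivation as a sum over pairs of infinitesimal decompositions -/

section Flatten

variable {k : Type u} [CommRing k]
variable {M : Colour → ℤ → Type v} [∀ c n, AddCommGroup (M c n)] [∀ c n, Module k (M c n)]
variable {ι : Type*}

theorem good_of_nest {u : Bool} {c : Colour} {n : ℤ} {R : Stacking ι} {v : ι → Box M}
    {N : Stacking (Stacking ι)} (hN : N ∈ nestings (fun l => (v l).c) R)
    (h : Good u c n (N.map fun X => part k (X.map v))) : Good u c n (R.map v) := by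
  obtain ⟨h1, h2, h3, h4⟩ := good_map_iff.1 h
  have hp := nestings_perm hN
  simp only [part, arity_map] at h1 h2 h3
  rw [good_map_iff, ← hN.2.2]
  refine ⟨(flatten_valid hN.1).1, (arity_flatten hN.1).trans h2, ?_, fun hu e => ?_⟩
  · rw [hN.2.2, ← h3, (hp.map _).sum_eq, nestNodes, List.map_flatMap]
    simp only [degree, nodes_map, List.map_map, List.flatMap, List.sum_flatten]
    rfl
  · exact h4 hu ((flatten_eq_eta hN.2.1).1 e)

end Flatten

section Coefficients

variable {ι : Type u}

open Classical in
/-- The coefficient with which the substacking `Y` of the decomposition `N` of `R` contributes to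
the square of the infinitesimal composition: it vanishes unless the other substackings are single
boxes, and both `Y` and `N` are thin-quadratic. -/
noncomputable def pairCoeff (col : ι → Colour) (δ : ι → ℤ) (R : Stacking ι)
    (N : Stacking (Stacking ι)) (Y : Stacking ι) : ℤ :=
  if ∀ X ∈ N.nodes, X ≠ Y → ∃ a, X = corolla col a then
    (ksgn (kos fun l => δ l + thinShift (col l)) R.nodes N.nestNodes : ℤ) *
      (((-1 * pre (fun X => (X.nodes.map fun l => δ l + thinShift (col l)).sum) N.nodes
        Y).negOnePow : ℤ) *
        (barSign (N.map fun X => (arity col X, (X.nodes.map δ).sum)) *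
          (barSign (Y.map fun l => (col l, δ l)) *
            (ksgn (kos δ) R.nodes N.nestNodes : ℤ))))
  else 0

end Coefficients

section Square

variable {k : Type u} [CommRing k] {B : DGBoxOperad.{u, v} k} (ε : B.Augmentation)

/-- The composite of a single box is its element. -/
theorem idealMu_corolla (b : Box ε.ideal) :
    (part k (corolla Box.c b)).map ε.idealMu = b := by
  rw [part_eq (k := k) (good_corolla false b).2.1 (good_corolla false b).2.2.1, Box.map]
  have h : ε.idealMu b.c b.deg (gen k false b.c b.deg (corolla Box.c b)) = b.x := by
    refine Subtype.ext ?_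
    have h1 : (ε.idealMu b.c b.deg (gen k false b.c b.deg (corolla Box.c b))).1 =
      B.mu b.c b.deg (T.incl b.c b.deg (T.map false (fun _ _ => Submodule.subtype _) b.c b.deg
        (gen k false b.c b.deg (corolla Box.c b)))) := rfl
    rw [h1, map_gen, incl_gen fun h => corolla_ne_eta _ _ (map_eq_eta.1 h)]
    exact B.mu_corolla (b.map fun _ _ => Submodule.subtype _)
  rw [h]

theorem idealMu_val {c : Colour} {n : ℤ} {t : Stacking (Box ε.ideal)} (ht : t ≠ eta) :
    (ε.idealMu c n (gen k false c n t)).1 =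
      B.mu c n (gen k true c n (t.map (Box.map fun _ _ => Submodule.subtype _))) := by
  have h1 : (ε.idealMu c n (gen k false c n t)).1 =
      B.mu c n (T.incl c n (T.map false (fun _ _ => Submodule.subtype _) c n
        (gen k false c n t))) := rfl
  rw [h1, map_gen, incl_gen fun h => ht (map_eq_eta.1 h)]

/-- Associativity of the composition of the augmentation ideal. -/
theorem idealMu_flatten {c : Colour} {n : ℤ} {R : Stacking ℕ} (hR : R.nodes = List.range R.size)
    {v : ℕ → Box ε.ideal} {N : Stacking (Stacking ℕ)}
    (hN : N ∈ nestings (fun l => (v l).c) R) :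
    ε.idealMu c n (gen k false c n (R.map v)) =
      (ksgn (kos fun l => (v l).deg) R.nodes N.nestNodes : ℤ) • ε.idealMu c n
        (gen k false c n (N.map fun X => (part k (X.map v)).map ε.idealMu)) := by
  have hmm : (N.map fun X => (part k (X.map v)).map ε.idealMu) =
      (N.map fun X => part k (X.map v)).map (Box.map ε.idealMu) := (map_map _ _ _).symm
  by_cases hg : Good false c n (R.map v)
  swap
  · rw [gen_of_not_good hg, gen_of_not_good, map_zero, smul_zero]
    rw [hmm, good_boxMap]
    exact fun h => hg (good_of_nest hN h)
  have hne : R ≠ eta := fun h => hg.2.2.2 rfl (by rw [h]; rfl)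
  have hNne : N ≠ eta := fun h => hne (by rw [← hN.2.2, h]; rfl)
  refine Subtype.ext ?_
  have hs : ∀ (s : ℤ) (x : ε.ideal c n), (s • x).1 = s • x.1 := fun s x => rfl
  rw [hs, idealMu_val ε fun h => hne (map_eq_eta.1 h), idealMu_val ε fun h => hNne (map_eq_eta.1 h),
    map_map, map_map]
  set v' : ℕ → Box B.carrier := fun l => (v l).map fun _ _ => Submodule.subtype _ with hv'
  have hNf := hN.2.2
  have := B.mu_flatten N v' c n hN.1 (by rw [hNf, hR]) (by
    rw [hNf]
    have h2 := ((good_boxMap (k := k) (M := ε.ideal) (M' := B.carrier)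
      fun c n => Submodule.subtype (LinearMap.ker (ε.aug c n))).2
      hg.incl)
    rwa [map_map] at h2)
  rw [hNf] at this
  rw [this, koszul_eq_ksgn _ R.size _ (hR ▸ nestings_perm hN), ← hR]
  refine congrArg (fun z => (ksgn (kos fun l => (v' l).deg) R.nodes N.nestNodes : ℤ) •
    B.mu c n (gen k true c n z)) (map_congr fun X hX => ?_)
  have hval := idealMu_val ε (c := arity Box.c (X.map v)) (n := degree (X.map v))
    (t := X.map v) fun h => hN.2.1 X hX (map_eq_eta.1 h)
  have ha : arity Box.c (X.map v') = arity Box.c (X.map v) := by rw [arity_map, arity_map]; rfl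
  have hd : degree (X.map v') = degree (X.map v) := by
    simp only [degree, nodes_map, List.map_map]; rfl
  rw [ha, hd]
  simp only [Box.map, part]
  congr 1
  rw [map_map] at hval
  exact hval.symm

theorem box_smul_eq {M : Colour → ℤ → Type*} [∀ c n, AddCommGroup (M c n)] (s : ℤ)
    {c : Colour} {n n' : ℤ} (f : ∀ n, M c n) (h : n = n') :
    (⟨c, n, s • f n⟩ : Box M) = ⟨c, n', s • f n'⟩ := by
  subst h; rfl

/-- The term of the square which belongs to a decomposition and one of its parts. -/
theorem infCompAux_term [DecidableEq (Stacking ℕ)] {c : Colour} {j : ℤ} (m : ℤ) {R : Stacking ℕ}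
    (hR : R.nodes = List.range R.size) {v : ℕ → Box ε.sIdeal} {N : Stacking (Stacking ℕ)}
    (hN : N ∈ nestings (fun l => (v l).c) R) {Y : Stacking ℕ} (hY : Y ∈ N.nodes)
    (hg : Good false c j (N.map fun X => if X = Y then
      (part k (X.map v)).shift (ε.infComp false) (-1) else (part k (X.map v)).map (counit false))) :
    (ksgn (kos fun l => (v l).deg) R.nodes N.nestNodes : ℤ) •
      ((-1 * pre (fun X => (part k (X.map v)).deg) N.nodes Y).negOnePow : ℤ) •
      ε.infCompAux false c j m (gen k false c j (N.map fun X => if X = Y then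
        (part k (X.map v)).shift (ε.infComp false) (-1) else
          (part k (X.map v)).map (counit false))) =
    pairCoeff (fun l => (v l).c) (fun l => (v l).deg - thinShift (v l).c) R N Y •
      ε.idealMu c m (gen k false c m (R.map fun l => unsuspend (v l))) := by
  classical
  have hRn : R.nodes.Nodup := by rw [hR]; exact List.nodup_range
  obtain ⟨hNn, hXn⟩ := nestings_nodup hRn hN
  set un : ℕ → Box ε.ideal := fun l => unsuspend (v l) with hun
  set col : ℕ → Colour := fun l => (v l).c with hcol
  set δ : ℕ → ℤ := fun l => (v l).deg - thinShift (v l).c with hδ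
  set Z : Stacking ℕ → Box ε.sIdeal := fun X => if X = Y then
    (part k (X.map v)).shift (ε.infComp false) (-1) else (part k (X.map v)).map (counit false)
    with hZ
  have hZY : Z Y = (part k (Y.map v)).shift (ε.infComp false) (-1) := if_pos rfl
  have hZX : ∀ X, X ≠ Y → Z X = (part k (X.map v)).map (counit false) := fun X h => if_neg h
  have hσ : (fun l => δ l + thinShift (col l)) = fun l => (v l).deg := funext fun l => by
    simp [hδ, hcol]
  have hpart : ∀ X : Stacking ℕ, (part k (X.map v)).deg = (X.nodes.map fun l => (v l).deg).sum :=
    fun X => by simp only [part, degree, nodes_map, List.map_map]; rfl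
  rw [infCompAux_gen ε (v := Z) m hg, pairCoeff, hσ]
  simp only [hpart]
  by_cases hcor : ∀ X ∈ N.nodes, X ≠ Y → ∃ a, X = corolla col a
  swap
  · rw [if_neg hcor, zero_smul]
    push Not at hcor
    obtain ⟨X, hX, hXY, hXc⟩ := hcor
    rw [gen_eq_zero_of_label hNn (fun X => unsuspend (Z X)) hX (c' := arity Box.c (X.map v))
      (n' := degree (X.map v) - thinShift (arity Box.c (X.map v))), map_zero, smul_zero, smul_zero,
      smul_zero]
    rw [hZX X hXY]
    exact congrArg (fun x => unsuspend (⟨arity Box.c (X.map v), degree (X.map v), x⟩ :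
      Box ε.sIdeal)) (counit_eq_zero (k := k) (u := false) v hXc)
  rw [if_pos hcor]
  have hYV : Y.Valid col := hN.1.1 Y hY
  by_cases hq : Y.IsDuo col ∨ Y.IsPrime col
  swap
  · rw [barSign_eq_zero hYV hq, zero_mul, mul_zero, mul_zero, mul_zero, zero_smul]
    rw [gen_eq_zero_of_label hNn (fun X => unsuspend (Z X)) hY (c' := arity Box.c (Y.map v))
      (n' := degree (Y.map v) + -1 - thinShift (arity Box.c (Y.map v))), map_zero, smul_zero,
      smul_zero, smul_zero]
    rw [hZY]
    have h0 : ε.infCompAux false (arity Box.c (Y.map v)) (degree (Y.map v))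
        (degree (Y.map v) + -1 - thinShift (arity Box.c (Y.map v)))
        (gen k false _ _ (Y.map v)) = 0 := by
      rw [infCompAux_gen ε _ (good_part hN hY), barSign_eq_zero hYV hq, zero_smul]
    have h1 : ε.infComp false (arity Box.c (Y.map v)) (degree (Y.map v))
        (degree (Y.map v) + -1) (gen k false _ _ (Y.map v)) = 0 := h0
    exact congrArg (fun x => unsuspend (⟨arity Box.c (Y.map v), degree (Y.map v) + -1, x⟩ :
      Box ε.sIdeal)) h1
  have hdegY : degree (Y.map v) + -1 - thinShift (arity Box.c (Y.map v)) = degree (Y.map un) := by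
    have := (good_unsuspend ε (m := degree (Y.map v) + -1 - thinShift (arity Box.c (Y.map v)))
      (good_part hN hY) hq).2 (by ring)
    exact this.2.2.1.symm
  have harY : arity Box.c (Y.map un) = arity Box.c (Y.map v) := by rw [arity_map, arity_map]; rfl
  have hdeg : ∀ X : Stacking ℕ, degree (X.map un) = (X.nodes.map δ).sum := fun X => by
    simp only [degree, nodes_map, List.map_map]; rfl
  have hcorZ : ∀ X ∈ N.nodes, X ≠ Y → unsuspend (Z X) = (part k (X.map un)).map ε.idealMu := by
    intro X hX hXY
    obtain ⟨a, rfl⟩ := hcor X hX hXY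
    rw [hZX _ hXY, counit_part_corolla v a]
    exact (idealMu_corolla ε (un a)).symm
  have hbar : (N.map fun X => ((Z X).c, (Z X).deg - thinShift (Z X).c)) =
      N.map fun X => (arity col X, (X.nodes.map δ).sum) := by
    refine map_congr fun X hX => ?_
    by_cases hXY : X = Y
    · subst hXY
      rw [hZY, ← hdeg, ← hdegY]
      simp only [Box.shift, part, arity_map]
      rfl
    · have h1 := congrArg Box.c (hcorZ X hX hXY)
      have h2 := congrArg Box.deg (hcorZ X hX hXY)
      simp only [unsuspend, Box.map, part, arity_map] at h1 h2
      rw [h2, h1, hdeg]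
      rfl
  have hlabY : unsuspend (Z Y) = ⟨arity Box.c (Y.map un), degree (Y.map un),
      ((barSign (Y.map fun l => (col l, δ l)) : ℤ) : k) •
        ε.idealMu _ _ (gen k false _ _ (Y.map un))⟩ := by
    rw [hZY, Int.cast_smul_eq_zsmul, harY]
    rw [← box_smul_eq (M := ε.ideal) _ (fun n => ε.idealMu (arity Box.c (Y.map v)) n
      (gen k false (arity Box.c (Y.map v)) n (Y.map un))) hdegY]
    have h0 := infCompAux_gen ε (degree (Y.map v) + -1 - thinShift (arity Box.c (Y.map v)))
      (good_part hN hY)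
    exact congrArg (fun x => (⟨arity Box.c (Y.map v),
      degree (Y.map v) + -1 - thinShift (arity Box.c (Y.map v)), x⟩ : Box ε.ideal)) h0
  rw [hbar, gen_smul_label hNn (fun X => unsuspend (Z X))
    (fun X => (part k (X.map un)).map ε.idealMu) hY _ _ _ _ hlabY rfl hcorZ, map_smul,
    Int.cast_smul_eq_zsmul, idealMu_flatten ε hR (v := un) hN]
  have hk : (ksgn (kos fun l => (un l).deg) R.nodes N.nestNodes : ℤ) *
      (ksgn (kos fun l => (un l).deg) R.nodes N.nestNodes : ℤ) = 1 := by
    rw [← Units.val_mul, Int.units_mul_self, Units.val_one]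
  have hδ' : (fun l => (un l).deg) = δ := rfl
  rw [hδ'] at hk ⊢
  simp only [smul_smul]
  congr 1
  rw [mul_assoc, mul_assoc, mul_assoc, mul_assoc, hk, mul_one]

/-- By associativity, every term of `ψ ∘ d_□` on a stacking is a multiple of the composite of the
whole stacking. So `ψ ∘ d_□` vanishes if the sums of the coefficients vanish. -/
theorem infComp_comp_barSquare_of [DecidableEq (Stacking ℕ)]
    (h : ∀ (R : Stacking ℕ) (col : ℕ → Colour) (δ : ℕ → ℤ), R.nodes.Nodup → R.Valid col →
      ∑ N ∈ (finite_nestings col R).toFinset, ∑ Y ∈ N.nodes.toFinset, pairCoeff col δ R N Y = 0)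
    (c : Colour) (i j l : ℤ) : ε.infComp false c j l ∘ₗ ε.barSquare false c i j = 0 := by
  classical
  by_cases hj : j = i + -1
  swap
  · rw [barSquare_eq, coderivation_eq_zero _ _ (by omega), LinearMap.comp_zero]
  refine T.hom_ext fun t ht => ?_
  suffices key : ε.infCompAux false c j (l - thinShift c)
      (ε.barSquare false c i j (gen k false c i t)) = 0 from key
  rw [← skel_map_lookup t] at ht ⊢
  have hR := nodes_skel t
  rw [← size_skel] at hR
  revert ht hR
  generalize t.skel = R
  generalize lookup t = v
  intro ht hR
  have hRn : R.nodes.Nodup := by rw [hR]; exact List.nodup_range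
  rw [DGBoxOperad.Augmentation.barSquare, LinearMap.comp_apply, decomp_gen hRn v ht, map_sum,
    map_sum]
  have key : ∀ N ∈ (finite_nestings (fun l => (v l).c) R).toFinset,
      ε.infCompAux false c j (l - thinShift c) (T.inf false (counit false) (ε.infComp false) (-1)
        c i j ((ksgn (kos fun l => (v l).deg) R.nodes N.nestNodes : ℤ) •
          gen k false c i (N.map fun X => part k (X.map v)))) =
      (∑ Y ∈ N.nodes.toFinset, pairCoeff (fun l => (v l).c)
        (fun l => (v l).deg - thinShift (v l).c) R N Y) •
        ε.idealMu c (l - thinShift c)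
          (gen k false c (l - thinShift c) (R.map fun l => unsuspend (v l))) := by
    intro N hN
    rw [Set.Finite.mem_toFinset] at hN
    have hNn := (nestings_nodup hRn hN).1
    rw [map_zsmul, map_zsmul, inf_gen _ _ _ _ hNn _ (good_nest ht hN), map_sum, Finset.smul_sum,
      Finset.sum_smul]
    refine Finset.sum_congr rfl fun Y hY => ?_
    rw [List.mem_toFinset] at hY
    rw [map_zsmul]
    exact infCompAux_term ε _ hR hN hY ((good_inf _ _ _ hNn (good_nest ht hN) hY).2 hj)
  rw [Finset.sum_congr rfl key, ← Finset.sum_smul]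
  convert zero_smul ℤ _
  convert h R (fun l => (v l).c) (fun l => (v l).deg - thinShift (v l).c) hRn
    (good_map_iff.1 ht).1

end Square

end BoxOperad

namespace BoxOperad

namespace Stacking

/-! ### Substackings and their surroundings -/

/-- A box of a stacking, with a marked vertical input `j`: one step on the way from a substacking
to the bottom box.  The entry `ch j` is ignored. -/
structure Frame (α : Type u) where
  a : α
  n : ℕ
  w : Fin (n + 1) → ℕ
  j : Fin n
  ch : Fin n → Stacking α

section Frames

variable {α : Type u} {β : Type v}

/-- Put a stacking on the marked input. -/
def Frame.plug (f : Frame α) (X : Stacking α) : Stacking α :=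
  box f.a f.n f.w (Function.update f.ch f.j X)

/-- Relabel a frame. -/
def Frame.map (g : α → β) (f : Frame α) : Frame β :=
  ⟨g f.a, f.n, f.w, f.j, fun i => (f.ch i).map g⟩

theorem Frame.plug_mk (a : α) (n : ℕ) (w : Fin (n + 1) → ℕ) (j : Fin n) (ch : Fin n → Stacking α)
    (X : Stacking α) :
    (⟨a, n, w, j, ch⟩ : Frame α).plug X = box a n w (Function.update ch j X) := rfl

theorem Frame.map_mk (g : α → β) (a : α) (n : ℕ) (w : Fin (n + 1) → ℕ) (j : Fin n)
    (ch : Fin n → Stacking α) :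
    (⟨a, n, w, j, ch⟩ : Frame α).map g = ⟨g a, n, w, j, fun i => (ch i).map g⟩ := rfl

/-- Put a stacking into its surroundings, which are given by a list of frames, from top to
bottom. -/
def plug : List (Frame α) → Stacking α → Stacking α
  | [], X => X
  | f :: C, X => plug C (f.plug X)

/-- The entries on the marked inputs, which `plug` ignores, are empty. With this convention the
surroundings of a substacking are unique. -/
def Normal (C : List (Frame α)) : Prop := ∀ f ∈ C, f.ch f.j = eta

theorem plug_append (C D : List (Frame α)) (X : Stacking α) :
    plug (C ++ D) X = plug D (plug C X) := by
  induction C generalizing X with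
  | nil => rfl
  | cons f C ih => exact ih _

/-- The boxes of a frame which precede the marked input. -/
def Frame.pre (f : Frame α) : List α :=
  f.a :: ((List.ofFn fun i => (f.ch i).nodes).take f.j).flatten

/-- The boxes of a frame which come after the marked input. -/
def Frame.post (f : Frame α) : List α :=
  ((List.ofFn fun i => (f.ch i).nodes).drop (f.j + 1)).flatten

/-- The boxes of the surroundings which precede the substacking. -/
def preNodes : List (Frame α) → List α
  | [] => []
  | f :: C => preNodes C ++ f.pre

/-- The boxes of the surroundings which come after the substacking. -/
def postNodes : List (Frame α) → List α
  | [] => []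
  | f :: C => f.post ++ postNodes C

theorem Frame.nodes_plug (f : Frame α) (X : Stacking α) :
    (f.plug X).nodes = f.pre ++ (X.nodes ++ f.post) := by
  have h : (List.ofFn fun i => (Function.update f.ch f.j X i).nodes) =
      (List.ofFn fun i => (f.ch i).nodes).set f.j X.nodes := by
    refine List.ext_getElem (by simp) fun m h1 h2 => ?_
    rw [List.getElem_set, List.getElem_ofFn]
    split_ifs with hm
    · have : (⟨m, by simpa using h1⟩ : Fin f.n) = f.j := Fin.ext hm.symm
      rw [this, Function.update_self]
    · rw [List.getElem_ofFn, Function.update_of_ne]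
      exact fun h => hm (congrArg Fin.val h).symm
  rw [plug, nodes, h, List.set_eq_take_append_cons_drop, if_pos (by simp), List.flatten_append,
    List.flatten_cons]
  rfl

theorem nodes_plug (C : List (Frame α)) (X : Stacking α) :
    (plug C X).nodes = preNodes C ++ (X.nodes ++ postNodes C) := by
  induction C generalizing X with
  | nil => simp [plug, preNodes, postNodes]
  | cons f C ih => simp [plug, preNodes, postNodes, ih, Frame.nodes_plug]

theorem preNodes_map (g : α → β) (C : List (Frame α)) :
    preNodes (C.map (Frame.map g)) = (preNodes C).map g := by
  induction C with
  | nil => rfl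
  | cons f C ih =>
    simp only [List.map_cons, preNodes, ih, List.map_append, Frame.pre, Frame.map, nodes_map,
      List.map_flatten, List.map_take, List.map_ofFn]
    rfl

theorem postNodes_map (g : α → β) (C : List (Frame α)) :
    postNodes (C.map (Frame.map g)) = (postNodes C).map g := by
  induction C with
  | nil => rfl
  | cons f C ih =>
    simp only [List.map_cons, postNodes, ih, List.map_append, Frame.post, Frame.map, nodes_map,
      List.map_flatten, List.map_drop, List.map_ofFn]
    rfl

/-- Every box has its place. -/
theorem exists_plug {S : Stacking α} {t : α} (ht : t ∈ S.nodes) :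
    ∃ C n w ch, Normal C ∧ S = plug C (box t n w ch) := by
  induction S with
  | eta => simp [nodes] at ht
  | box a n w ch ih =>
    rcases mem_nodes_box.1 ht with rfl | ⟨i, hi⟩
    · exact ⟨[], n, w, ch, by simp [Normal], rfl⟩
    · obtain ⟨C, m, w', ch', hC, e⟩ := ih i hi
      refine ⟨C ++ [⟨a, n, w, i, Function.update ch i eta⟩], m, w', ch', ?_, ?_⟩
      · intro f hf
        rcases List.mem_append.1 hf with hf | hf
        · exact hC f hf
        · rw [List.mem_singleton.1 hf]; simp
      · rw [plug_append, ← e]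
        simp [plug, Frame.plug]

theorem child_mem_of_update {n : ℕ} {ch : Fin n → Stacking α}
    {j : Fin n} {X : Stacking α} {t : α} (ht : t ∈ X.nodes) :
    t ∈ (Function.update ch j X j).nodes := by rwa [Function.update_self]

/-- A box has only one place. -/
theorem plug_unique {t : α} {C C' : List (Frame α)} {n n' w w'} {ch : Fin n → Stacking α}
    {ch' : Fin n' → Stacking α} (hC : Normal C) (hC' : Normal C')
    (hd : (plug C (box t n w ch)).nodes.Nodup)
    (h : plug C (box t n w ch) = plug C' (box t n' w' ch')) :
    C = C' ∧ box t n w ch = box t n' w' ch' := by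
  have hmem : ∀ (D : List (Frame α)) n w (ch : Fin n → Stacking α),
      t ∈ (plug D (box t n w ch)).nodes := fun D n w ch => by rw [nodes_plug]; simp [nodes]
  have hroot : ∀ (D : List (Frame α)) (f : Frame α) n w (ch : Fin n → Stacking α),
      (plug (D ++ [f]) (box t n w ch)).nodes.Nodup → f.a ≠ t := by
    intro D f n w ch hd e
    rw [plug_append, plug, plug, Frame.plug] at hd
    have := root_notMem (g := id) (by rwa [List.map_id]) f.j
    rw [Function.update_self, List.map_id] at this
    exact this (e ▸ hmem D n w ch)
  induction C using List.reverseRecOn generalizing C' with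
  | nil =>
    rcases List.eq_nil_or_concat C' with rfl | ⟨D', f', rfl⟩
    · exact ⟨rfl, h⟩
    · rw [List.concat_eq_append] at *
      rw [h] at hd
      have h1 := hroot D' f' _ _ _ hd
      rw [plug_append] at h
      simp only [plug, Frame.plug, box.injEq] at h
      exact absurd h.1.symm h1
  | append_singleton D f ih =>
    rcases List.eq_nil_or_concat C' with rfl | ⟨D', f', rfl⟩
    · have h1 := hroot D f _ _ _ hd
      rw [plug_append] at h
      simp only [plug, Frame.plug, box.injEq] at h
      exact absurd h.1 h1
    · rw [List.concat_eq_append] at *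
      have hf := hC f (by simp)
      have hf' := hC' f' (by simp)
      obtain ⟨a, m, v, j, c⟩ := f
      obtain ⟨a', m', v', j', c'⟩ := f'
      rw [plug_append, plug_append] at h
      rw [plug_append] at hd
      simp only [plug, Frame.plug] at h hd
      injection h with h1 h2 h3 h4
      subst h1
      subst h2
      rw [heq_eq_eq] at h3 h4
      subst h3
      have hj : j = j' := by
        have hd' :
            ((box a m v (Function.update c j (plug D (box t n w ch)))).nodes.map id).Nodup := by
          rwa [List.map_id]
        refine eq_of_mem_child (g := id) (x := t) hd' ?_ ?_
        · rw [List.map_id]; exact child_mem_of_update (hmem _ _ _ _)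
        · rw [h4, List.map_id]; exact child_mem_of_update (hmem _ _ _ _)
      subst hj
      have h5 := congrFun h4 j
      rw [Function.update_self, Function.update_self] at h5
      have hd' := nodup_child (g := id) (by rwa [List.map_id]) j
      rw [Function.update_self, List.map_id] at hd'
      obtain ⟨h6, h7⟩ := ih (fun f hf => hC f (by simp [hf])) (fun f hf => hC' f (by simp [hf]))
        hd' h5
      refine ⟨?_, h7⟩
      have : c = c' := by
        funext i
        by_cases hi : i = j
        · subst hi; simp only at hf hf'; rw [hf, hf']
        · have := congrFun h4 i
          rwa [Function.update_of_ne hi, Function.update_of_ne hi] at this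
      rw [h6, this]

variable {col : α → Colour} {col' : β → Colour} {g : α → β}

theorem valid_of_plug {C : List (Frame α)} {X : Stacking α} (h : (plug C X).Valid col) :
    X.Valid col := by
  induction C generalizing X with
  | nil => exact h
  | cons f C ih =>
    have := (ih h).2 f.j
    rw [Function.update_self] at this
    exact this.1

/-- Validity depends only on the boundary of a substacking. -/
theorem plug_congr (hg : ∀ a, col' (g a) = col a) {C : List (Frame α)} {X : Stacking α}
    {Z : Stacking β} (h : (plug C X).Valid col) (hZ : Z.Valid col')
    (hl : Z.left col' = X.left col) (hr : Z.right col' = X.right col) :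
    (plug (C.map (Frame.map g)) Z).Valid col' ∧
      (plug (C.map (Frame.map g)) Z).left col' = (plug C X).left col ∧
      (plug (C.map (Frame.map g)) Z).right col' = (plug C X).right col := by
  have hcol : (fun a => col' (g a)) = col := funext hg
  induction C generalizing X Z with
  | nil => exact ⟨hZ, hl, hr⟩
  | cons f C ih =>
    have hf := valid_of_plug (X := f.plug X) h
    refine ih (X := f.plug X) h (Z := (f.map g).plug Z) ?_ ?_ ?_
    · obtain ⟨a, n, w, j, ch⟩ := f
      simp only [Frame.map_mk, Frame.plug_mk] at hf ⊢
      refine ⟨(congrArg Colour.q (hg a)).trans hf.1, fun i => ?_⟩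
      have hi := hf.2 i
      by_cases hij : i = j
      · subst hij
        rw [Function.update_self] at hi ⊢
        rw [hl, hr]
        exact ⟨hZ, hi.2⟩
      · rw [Function.update_of_ne hij] at hi ⊢
        simp only [valid_map, left_map, right_map, hcol]
        exact hi
    · simp [Frame.plug, left, Frame.map, hg]
    · simp [Frame.plug, right, Frame.map, hg]

/-- The cuts depend only on the cuts of a substacking. -/
theorem level_plug (hg : ∀ a, col' (g a) = col a) {C : List (Frame α)} {X : Stacking α}
    {Z : Stacking β} (h : ∀ x y, X.Level col x y ↔ Z.Level col' x y) (x y : ℕ) :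
    (plug C X).Level col x y ↔ (plug (C.map (Frame.map g)) Z).Level col' x y := by
  have hcol : (fun a => col' (g a)) = col := funext hg
  induction C generalizing X Z with
  | nil => exact h x y
  | cons f C ih =>
    refine ih (X := f.plug X) (Z := (f.map g).plug Z) fun x y => ?_
    obtain ⟨a, n, w, j, ch⟩ := f
    have key : ∀ i x y, (Function.update ch j X i).Level col x y ↔
        (Function.update (fun i => (ch i).map g) j Z i).Level col' x y := by
      intro i x y
      by_cases hij : i = j
      · subst hij
        rw [Function.update_self, Function.update_self]
        exact h x y
      · rw [Function.update_of_ne hij, Function.update_of_ne hij, level_map, hcol]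
    simp only [Frame.map_mk, Frame.plug_mk, Level, key, hg]

theorem flat_plug {C : List (Frame α)} {X : Stacking α} {Z : Stacking β} (h : X.Flat ↔ Z.Flat) :
    (plug C X).Flat ↔ (plug (C.map (Frame.map g)) Z).Flat := by
  induction C generalizing X Z with
  | nil => exact h
  | cons f C ih =>
    refine ih (X := f.plug X) (Z := (f.map g).plug Z) ?_
    obtain ⟨a, n, w, j, ch⟩ := f
    have key : ∀ i, (Function.update ch j X i).Flat ↔
        (Function.update (fun i => (ch i).map g) j Z i).Flat := by
      intro i
      by_cases hij : i = j
      · subst hij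
        rw [Function.update_self, Function.update_self]
        exact h
      · rw [Function.update_of_ne hij, Function.update_of_ne hij]
        exact (Flat.map_iff g _).symm
    simp only [Frame.map_mk, Frame.plug_mk, Flat, key]

theorem flat_of_plug {C : List (Frame α)} {X : Stacking α} (h : (plug C X).Flat) : X.Flat := by
  induction C generalizing X with
  | nil => exact h
  | cons f C ih =>
    have := (ih (X := f.plug X) h).2 f.j
    rwa [Function.update_self] at this

/-- Surroundings which consist of single boxes are not changed by `flatten`. -/
theorem flatten_plug {C : List (Frame α)} {Z : Stacking (Stacking α)}
    (h : (plug (C.map (Frame.map (corolla col))) Z).Valid (arity col)) :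
    (plug (C.map (Frame.map (corolla col))) Z).flatten = plug C Z.flatten := by
  induction C generalizing Z with
  | nil => rfl
  | cons f C ih =>
    rw [List.map_cons, plug, ih h, plug]
    congr 1
    have hf := valid_of_plug (C := C.map (Frame.map (corolla col)))
      (X := (f.map (corolla col)).plug Z) h
    obtain ⟨a, n, w, j, ch⟩ := f
    simp only [Frame.map_mk, Frame.plug_mk] at hf ⊢
    have hn : (col a).q = n := by
      have := hf.1
      rwa [arity_corolla] at this
    subst hn
    simp only [flatten, graft_corolla, zero_add]
    congr 1
    · funext i; simp [i.2]
    · funext i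
      rw [dif_pos i.2]
      by_cases hij : i = j
      · subst hij; simp
      · have hv := (hf.2 i).1
        rw [Function.update_of_ne hij] at hv
        rw [Function.update_of_ne hij, Function.update_of_ne hij]
        exact flatten_map_corolla col (valid_map_corolla.1 hv)

/-- Substitution into the surroundings without a change of the labels. -/
theorem Frame.map_id (f : Frame α) : f.map id = f := by
  obtain ⟨a, n, w, j, ch⟩ := f
  simp only [Frame.map]
  congr 1
  funext i
  exact map_id' _

theorem valid_plug_congr {C : List (Frame α)} {X Z : Stacking α} (h : (plug C X).Valid col)
    (hZ : Z.Valid col) (hl : Z.left col = X.left col) (hr : Z.right col = X.right col) :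
    (plug C Z).Valid col := by
  have := (plug_congr (g := id) (fun _ => rfl) h hZ hl hr).1
  rwa [show (Frame.map id : Frame α → Frame α) = id from funext Frame.map_id, List.map_id] at this

end Frames

end Stacking

end BoxOperad

namespace BoxOperad

/-! ### Rows and cuts -/

section Glue

open Stacking

variable {β : Type*}

theorem exists_block {n : ℕ} (f : Fin n → ℕ) {m : ℕ} (hm : m < ∑ i, f i) :
    ∃ i : Fin n, ∃ k < f i, m = before f i + k := by
  induction n with
  | zero => simp at hm
  | succ n ih =>
    rw [Fin.sum_univ_castSucc] at hm
    by_cases h : m < ∑ i : Fin n, f i.castSucc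
    · obtain ⟨i, k, hk, e⟩ := ih (fun i => f i.castSucc) h
      exact ⟨i.castSucc, k, hk, by rw [Fin.val_castSucc, before_castSucc f _ i.2.le]; exact e⟩
    · refine ⟨Fin.last n, m - ∑ i : Fin n, f i.castSucc, by omega, ?_⟩
      rw [Fin.val_last, before_castSucc f _ le_rfl, before_all _ _ le_rfl]
      omega

/-- Sequences on the consecutive blocks of a row form one sequence. -/
theorem exists_glue [Inhabited β] {n : ℕ} (f : Fin n → ℕ) (g : Fin n → ℕ → β) :
    ∃ F : ℕ → β, ∀ i : Fin n, ∀ k < f i, F (before f i + k) = g i k := by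
  induction n with
  | zero => exact ⟨fun _ => default, fun i => i.elim0⟩
  | succ n ih =>
    obtain ⟨F, hF⟩ := ih (fun i => f i.castSucc) fun i => g i.castSucc
    refine ⟨fun m => if m < before f n then F m else g (Fin.last n) (m - before f n), fun i => ?_⟩
    refine i.lastCases (fun k _ => ?_) fun i k hk => ?_
    · simp
    · have h1 := before_add_le (fun i : Fin n => f i.castSucc) i
      have h2 := before_castSucc f n le_rfl
      rw [before_all _ _ le_rfl] at h2
      have h3 := before_castSucc f i.val i.2.le
      simp only [Fin.val_castSucc]
      rw [if_pos (by omega), h3, hF i k hk]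

/-- Sequences on the consecutive blocks of a row which agree at the common ends form one
sequence. -/
theorem exists_glue_ends {n : ℕ} (f : Fin n → ℕ) (b : Fin (n + 1) → β) (g : Fin n → ℕ → β)
    (h0 : ∀ i : Fin n, g i 0 = b i.castSucc) (h1 : ∀ i : Fin n, g i (f i) = b i.succ) :
    ∃ F : ℕ → β, (∀ i : Fin n, ∀ k ≤ f i, F (before f i + k) = g i k) ∧
      ∀ i : Fin (n + 1), F (before f i) = b i := by
  have hlt : ∀ i : Fin n, before f i + f i = before f i.succ := fun i => (before_succ f i).symm
  have : Inhabited β := ⟨b 0⟩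
  -- the value at the very end of the row is not covered by the blocks
  obtain ⟨F, hF⟩ := exists_glue f g
  refine ⟨fun m => if m < ∑ i, f i then F m else b (Fin.last n), ?_⟩
  have key : ∀ i : Fin (n + 1), (if before f i < ∑ i, f i then F (before f i) else
      b (Fin.last n)) = b i := by
    intro i
    induction i using Fin.reverseInduction with
    | last => rw [Fin.val_last, before_all _ _ le_rfl, if_neg (lt_irrefl _)]
    | cast i ih =>
      rcases Nat.eq_zero_or_pos (f i) with h | h
      · have e := hlt i
        rw [h, add_zero] at e
        rw [Fin.val_castSucc, e, ih, ← h1 i, h, h0 i]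
      · have := before_add_le f i
        rw [Fin.val_castSucc, if_pos (by omega), ← h0 i, ← hF i 0 h, add_zero]
  refine ⟨fun i k hk => ?_, key⟩
  rcases hk.lt_or_eq with h | rfl
  · have := before_add_le f i
    beta_reduce
    rw [if_pos (by omega), hF i k h]
  · rw [hlt i]
    exact (key _).trans (h1 i).symm

end Glue

namespace Stacking

variable {α : Type u} {β : Type v} {col : α → Colour}

/-- `Y` is the lower part, and `U` is the row of the upper parts, with widths `W`, of a cut of `D`
along a horizontal level. -/
structure Cut (col : α → Colour) (D Y : Stacking α) (W : ℕ → ℕ) (U : ℕ → Stacking α) : Prop where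
  eq : D = Y.graft W U 0
  valid : Y.Valid col
  row : Row col W U 0 Y.leaves

theorem Cut.left_eq {D Y : Stacking α} {W U} (h : Cut col D Y W U) :
    D.left col = Y.left col + W 0 := by rw [h.eq, left_graft col Y W U 0 h.row]

theorem Cut.right_eq {D Y : Stacking α} {W U} (h : Cut col D Y W U) :
    D.right col = Y.right col + W Y.leaves := by
  rw [h.eq, right_graft col Y W U 0 h.row, zero_add]

/-- The empty lower part is a cut of every stacking. -/
theorem cut_eta {D : Stacking α} (hD : D.Valid col) :
    Cut col D eta (fun i => if i = 0 then D.left col else D.right col) fun _ => D :=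
  ⟨rfl, trivial, fun i hi => by
    obtain rfl : i = 0 := by simpa [leaves] using hi
    simp [hD]⟩

/-- Cuts of the entries of a row with matching ends form a cut. -/
theorem exists_cut_box {a : α} {n : ℕ} {w : Fin (n + 1) → ℕ} {ch : Fin n → Stacking α}
    (hV : (box a n w ch).Valid col) {v : Fin (n + 1) → ℕ} (hv : ∀ i, v i ≤ w i)
    {Y : Fin n → Stacking α} (hY : ∀ i, (Y i).left col = v i.castSucc ∧
      (Y i).right col = v i.succ ∧ ∃ W U, Cut col (ch i) (Y i) W U) :
    ∃ W U, Cut col (box a n w ch) (box a n v Y) W U := by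
  choose hl hr W U hc using hY
  obtain ⟨FW, hFW, hb⟩ := exists_glue_ends (fun i => (Y i).leaves) (fun i => w i - v i) W
    (fun i => by
      have := (hc i).left_eq
      rw [(hV.2 i).2.1, hl] at this
      omega)
    (fun i => by
      have := (hc i).right_eq
      rw [(hV.2 i).2.2, hr] at this
      omega)
  have : Inhabited (Stacking α) := ⟨eta⟩
  obtain ⟨FU, hFU⟩ := exists_glue (fun i => (Y i).leaves) U
  refine ⟨FW, FU, ?_, ⟨hV.1, fun i => ⟨(hc i).valid, hl i, hr i⟩⟩, ?_⟩
  · rw [graft]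
    congr 1
    · funext i
      rw [zero_add, hb]
      have := hv i
      omega
    · funext i
      rw [zero_add, (hc i).eq]
      exact (graft_congr _ (fun k hk => by rw [zero_add, hFW i k hk])
        fun k hk => by rw [zero_add, hFU i k hk]).symm
  · intro m hm
    obtain ⟨i, k, hk, rfl⟩ := exists_block _ hm
    have := (hc i).row k hk
    rw [zero_add] at this ⊢
    rw [hFU i k hk, hFW i k hk.le, add_assoc, hFW i (k + 1) hk]
    exact this

/-- The numerical cuts of `Level` are realized by lower and upper parts. -/
theorem exists_cut_of_level {D : Stacking α} (hD : D.Valid col) {x y : ℕ} (h : D.Level col x y) :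
    ∃ Y, Y.left col = x ∧ Y.right col = y ∧ ∃ W U, Cut col D Y W U := by
  induction D generalizing x y with
  | eta =>
    obtain ⟨rfl, rfl⟩ := h
    exact ⟨eta, rfl, rfl, _, _, cut_eta hD⟩
  | box a n w ch ih =>
    rcases h with ⟨rfl, rfl⟩ | ⟨v, hv, hl, rfl, rfl⟩
    · exact ⟨eta, rfl, rfl, _, _, cut_eta hD⟩
    · choose Y hY using fun i => ih i (hD.2 i).1 (hl i)
      exact ⟨box a n v Y, rfl, rfl, exists_cut_box hD hv hY⟩

/-- The levels of a stacking with a cut: they are in the lower part or in the row over it. -/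
theorem level_graft {Y : Stacking α} (hV : Y.Valid col) (hb : Y.Balanced col) {W : ℕ → ℕ}
    {U : ℕ → Stacking α} {o : ℕ} (hr : Row col W U o Y.leaves) (x y : ℕ) :
    (Y.graft W U o).Level col x y ↔ Y.Level col x y ∨ ∃ v : ℕ → ℕ,
      (∀ i ≤ Y.leaves, v i ≤ W (o + i)) ∧
      (∀ i < Y.leaves, (U (o + i)).Level col (v i) (v (i + 1))) ∧
      x = Y.left col + v 0 ∧ y = Y.right col + v Y.leaves := by
  induction Y generalizing o x y with
  | eta =>
    have h0 := hr 0 (by simp [leaves])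
    rw [add_zero] at h0
    constructor
    · intro h
      refine Or.inr ⟨fun i => if i = 0 then x else y, fun i hi => ?_, fun i hi => ?_, ?_, ?_⟩
      · simp only [leaves] at hi
        have := Level.le (X := U o) h
        rcases Nat.le_one_iff_eq_zero_or_eq_one.1 hi with rfl | rfl
        · rw [h0.2.1] at this; simpa using this.1
        · rw [h0.2.2] at this; simpa using this.2
      · obtain rfl : i = 0 := by simpa [leaves] using hi
        simpa [graft] using h
      · simp [left]
      · simp [right, leaves]
    · rintro (⟨rfl, rfl⟩ | ⟨v, -, h, rfl, rfl⟩)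
      · exact level_zero _ _
      · have := h 0 (by simp [leaves])
        simpa [graft, left, right, leaves] using this
  | box a n w' Y ih =>
    have ih' : ∀ i x y, _ := fun i x y =>
      ih i (hV.2 i).1 (hb.child i) (o := o + before (fun j => (Y j).leaves) i) (hr.segment i) x y
    have hs : ∀ i : Fin n, before (fun j => (Y j).leaves) i + (Y i).leaves =
        before (fun j => (Y j).leaves) i.succ := fun i => (before_succ _ i).symm
    have hle : ∀ i, before (fun j => (Y j).leaves) i ≤ ∑ i, (Y i).leaves := before_le_sum _
    constructor
    · rintro (⟨rfl, rfl⟩ | ⟨v, hv, hl, rfl, rfl⟩)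
      · exact Or.inl (level_zero _ _)
      have hP : ∀ i j, w' i ≤ v i ↔ w' j ≤ v j := forall_of_row (P := fun i => w' i ≤ v i)
        fun i => by
          have h1 := (hV.2 i).2.1
          have h2 := (hV.2 i).2.2
          rcases (ih' i _ _).1 (hl i) with h | ⟨u, -, -, e1, e2⟩
          · have := h.eq_left_iff (hV.2 i).1 (hb.child i)
            have := h.le
            omega
          · omega
      by_cases h0 : w' 0 ≤ v 0
      · -- the cut is above the lower part
        have h0' : ∀ i, w' i ≤ v i := fun i => (hP 0 i).1 h0
        have hu : ∀ i : Fin n, ∃ u : ℕ → ℕ,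
            (∀ k ≤ (Y i).leaves, u k ≤ W (o + before (fun j => (Y j).leaves) i + k)) ∧
            (∀ k < (Y i).leaves, (U (o + before (fun j => (Y j).leaves) i + k)).Level col
              (u k) (u (k + 1))) ∧ u 0 = v i.castSucc - w' i.castSucc ∧
              u (Y i).leaves = v i.succ - w' i.succ := by
          intro i
          have h1 := (hV.2 i).2.1
          have h2 := (hV.2 i).2.2
          have h3 := h0' i.castSucc
          have h4 := h0' i.succ
          rcases (ih' i _ _).1 (hl i) with h | ⟨u, hu1, hu2, e1, e2⟩
          · have := h.le
            have := h.eq_left_iff (hV.2 i).1 (hb.child i)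
            exact ⟨fun _ => 0, fun _ _ => Nat.zero_le _, fun _ _ => level_zero _ _,
              show 0 = _ by omega, show 0 = _ by omega⟩
          · exact ⟨u, hu1, hu2, by omega, by omega⟩
        choose u hu1 hu2 hu3 hu4 using hu
        obtain ⟨F, hF, hFb⟩ := exists_glue_ends (fun i => (Y i).leaves) (fun i => v i - w' i) u
          hu3 hu4
        have hF0 := hFb 0
        have hFl := hFb (Fin.last n)
        rw [Fin.val_last, before_all _ _ le_rfl] at hFl
        rw [show before (fun i => (Y i).leaves) ((0 : Fin (n + 1)) : ℕ) = 0 by simp [before]] at hF0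
        refine Or.inr ⟨F, fun m hm => ?_, fun m hm => ?_, ?_, ?_⟩
        · rcases Nat.lt_or_eq_of_le hm with hm | rfl
          · obtain ⟨i, k, hk, rfl⟩ := exists_block _ hm
            rw [hF i k hk.le, ← add_assoc]
            exact hu1 i k hk.le
          · have := hv (Fin.last n)
            beta_reduce at this
            rw [Fin.val_last, before_all _ _ le_rfl] at this
            simp only [leaves]
            omega
        · obtain ⟨i, k, hk, rfl⟩ := exists_block _ hm
          rw [hF i k hk.le, add_assoc, hF i (k + 1) hk, ← add_assoc]
          exact hu2 i k hk
        · have := h0' 0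
          simp only [left, hF0]
          omega
        · have := h0' (Fin.last n)
          simp only [right, leaves, hFl]
          omega
      · refine Or.inl (Or.inr ⟨v, fun i => ?_, fun i => ?_, rfl, rfl⟩)
        · exact le_of_not_ge fun h => h0 ((hP i 0).1 h)
        · rcases (ih' i _ _).1 (hl i) with h | ⟨u, -, -, e1, -⟩
          · exact h
          · refine absurd ((hP i.castSucc 0).1 ?_) h0
            have h1 := (hV.2 i).2.1
            omega
    · rintro (h | ⟨v, hv, hl, rfl, rfl⟩)
      · rcases h with ⟨rfl, rfl⟩ | ⟨v, hv, hl, rfl, rfl⟩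
        · exact level_zero _ _
        · exact Or.inr ⟨v, fun i => (hv i).trans (Nat.le_add_right _ _),
            fun i => (ih' i _ _).2 (Or.inl (hl i)), rfl, rfl⟩
      · refine Or.inr ⟨fun i => w' i + v (before (fun j => (Y j).leaves) i), fun i => ?_,
          fun i => ?_, ?_, ?_⟩
        · exact Nat.add_le_add_left (hv _ (hle _)) _
        · have h3 := before_add_le (fun j => (Y j).leaves) i
          refine (ih' i _ _).2 (Or.inr ⟨fun k => v (before (fun j => (Y j).leaves) i + k),
            fun k hk => ?_, fun k hk => ?_, ?_, ?_⟩)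
          · rw [add_assoc]
            exact hv _ (by simp only [leaves]; omega)
          · rw [add_assoc]
            exact hl _ (by simp only [leaves]; omega)
          · rw [(hV.2 i).2.1]; rfl
          · rw [(hV.2 i).2.2]
            simp only [hs]
        · simp [left, before, add_assoc]
        · simp [right, leaves, before_all, add_assoc]

/-- Horizontal lines of a composite belong to the lower part, to the row, or to an entry of the row.
-/
theorem flat_graft (Y : Stacking α) (W : ℕ → ℕ) (U : ℕ → Stacking α) (o : ℕ) :
    (Y.graft W U o).Flat ↔ Y.Flat ∧ (Y ≠ eta → ∀ i ≤ Y.leaves, W (o + i) = 0) ∧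
      ∀ i < Y.leaves, (U (o + i)).Flat := by
  induction Y generalizing o with
  | eta => simp [graft, leaves, Flat]
  | box a n w' Y ih =>
    have h3 := before_add_le fun j => (Y j).leaves
    simp only [graft, Flat, ih, ne_eq, reduceCtorEq, not_false_eq_true, forall_const, leaves]
    constructor
    · rintro ⟨hw, hc⟩
      refine ⟨⟨fun i => (Nat.add_eq_zero_iff.1 (hw i)).1, fun i => (hc i).1⟩, fun m hm => ?_,
        fun m hm => ?_⟩
      · rcases exists_segment _ m hm with ⟨i, rfl⟩ | ⟨i, h1, h2⟩
        · exact (Nat.add_eq_zero_iff.1 (hw i)).2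
        · have hne : Y i ≠ eta := by
            intro h
            simp only [h, leaves] at h2
            omega
          have := (hc i).2.1 hne (m - before (fun j => (Y j).leaves) i) (by omega)
          rwa [add_assoc, Nat.add_sub_cancel' h1.le] at this
      · obtain ⟨i, k, hk, rfl⟩ := exists_block _ hm
        rw [← add_assoc]
        exact (hc i).2.2 k hk
    · rintro ⟨⟨hw, hc⟩, hW, hU⟩
      refine ⟨fun i => ?_, fun i => ⟨hc i, fun _ k hk => ?_, fun k hk => ?_⟩⟩
      · rw [hw i, hW _ (before_le_sum _ _)]
      · rw [add_assoc]; exact hW _ (by have := h3 i; omega)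
      · rw [add_assoc]; exact hU _ (by have := h3 i; omega)

/-- Two lower parts of cuts over the same bottom box, if the lower parts of the entries of the row
are comparable. -/
theorem cut_compare_box {a : α} {n : ℕ} {v v' : Fin (n + 1) → ℕ} {Y Y' : Fin n → Stacking α}
    (hV : (box a n v Y).Valid col) (hV' : (box a n v' Y').Valid col)
    (hc : ∀ i, (Y i).left col ≤ (Y' i).left col → (Y i).right col ≤ (Y' i).right col ∧
      (Y' i).Level col ((Y i).left col) ((Y i).right col) ∧
      ((Y i).left col = (Y' i).left col → (Y i).right col = (Y' i).right col ∧ Y i = Y' i))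
    (hle : (box a n v Y).left col ≤ (box a n v' Y').left col) :
    (box a n v Y).right col ≤ (box a n v' Y').right col ∧
      (box a n v' Y').Level col ((box a n v Y).left col) ((box a n v Y).right col) ∧
      ((box a n v Y).left col = (box a n v' Y').left col →
        (box a n v Y).right col = (box a n v' Y').right col ∧ box a n v Y = box a n v' Y') := by
  simp only [left, right, Nat.add_le_add_iff_left] at hle ⊢
  have hc' : ∀ i : Fin n, v i.castSucc ≤ v' i.castSucc → v i.succ ≤ v' i.succ ∧
      (Y' i).Level col (v i.castSucc) (v i.succ) ∧
      (v i.castSucc = v' i.castSucc → v i.succ = v' i.succ ∧ Y i = Y' i) := by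
    intro i
    have := hc i
    rwa [(hV.2 i).2.1, (hV.2 i).2.2, (hV'.2 i).2.1, (hV'.2 i).2.2] at this
  have hall : ∀ i, v i ≤ v' i := fun i => by
    induction i using Fin.induction with
    | zero => exact hle
    | succ i ih => exact (hc' i ih).1
  refine ⟨hall _, Or.inr ⟨v, hall, fun i => (hc' i (hall _)).2.1, rfl, rfl⟩, fun e => ?_⟩
  have hal : ∀ i, v i = v' i := fun i => by
    induction i using Fin.induction with
    | zero => exact Nat.add_left_cancel e
    | succ i ih => exact ((hc' i (hall _)).2.2 ih).1
  refine ⟨by rw [hal], ?_⟩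
  rw [show v = v' from funext hal, show Y = Y' from
    funext fun i => ((hc' i (hall _)).2.2 (hal _)).2]

/-- If every box has horizontal inputs, then a cut is determined by its left end, and a cut below
another one is a cut of the lower part of the latter. -/
theorem cut_compare {Y Y' : Stacking α} {W W' : ℕ → ℕ} {U U' : ℕ → Stacking α} {o o' : ℕ}
    (h : Y.graft W U o = Y'.graft W' U' o') (hV : Y.Valid col) (hV' : Y'.Valid col)
    (hp : ∀ a ∈ Y.nodes, 0 < (col a).p) (hp' : ∀ a ∈ Y'.nodes, 0 < (col a).p)
    (hle : Y.left col ≤ Y'.left col) :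
    Y.right col ≤ Y'.right col ∧ Y'.Level col (Y.left col) (Y.right col) ∧
      (Y.left col = Y'.left col → Y.right col = Y'.right col ∧ Y = Y') := by
  induction Y generalizing Y' o o' with
  | eta =>
    refine ⟨Nat.zero_le _, level_zero _ _, fun e => ?_⟩
    cases Y' with
    | eta => exact ⟨rfl, rfl⟩
    | box a n v Y =>
      have := hp' a (by simp [nodes])
      simp only [left] at e
      omega
  | box a n v Y ih =>
    cases Y' with
    | eta =>
      have := hp a (by simp [nodes])
      simp only [left] at hle
      omega
    | box a' n' v' Y' =>
      simp only [graft] at h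
      injection h with h1 h2 h3 h4
      subst h1
      subst h2
      rw [heq_eq_eq] at h4
      exact cut_compare_box hV hV' (fun i => ih i (congrFun h4 i) (hV.2 i).1 (hV'.2 i).1
        (fun b hb => hp b (mem_nodes_box.2 (Or.inr ⟨i, hb⟩)))
        (fun b hb => hp' b (mem_nodes_box.2 (Or.inr ⟨i, hb⟩)))) hle

end Stacking

end BoxOperad

namespace BoxOperad

namespace Stacking

/-! ### Decompositions with a single substacking of more than one box -/

section Nests

variable {α : Type u} {col : α → Colour}

theorem before_add_le_before {n : ℕ} (f : Fin n → ℕ) {i j : Fin n} (h : i < j) :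
    before f i + f i ≤ before f j := by
  rw [← before_succ]
  refine Finset.sum_le_sum fun k _ => ?_
  have : i.val < j.val := h
  split_ifs <;> omega

theorem graft_box_single (a : α) {n : ℕ} (w : Fin (n + 1) → ℕ) (Y : Fin n → Stacking α) (j : Fin n)
    {m : ℕ} (hm : m < (Y j).leaves) (Z : Stacking α) (o : ℕ) :
    (box a n w Y).graft (fun _ => 0)
        (fun i => if i = o + (before (fun j => (Y j).leaves) j + m) then Z else eta) o =
      box a n w (Function.update Y j ((Y j).graft (fun _ => 0)
        (fun i => if i = o + before (fun j => (Y j).leaves) j + m then Z else eta)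
        (o + before (fun j => (Y j).leaves) j))) := by
  simp only [graft, add_zero]
  congr 1
  funext i
  by_cases hij : i = j
  · subst hij
    rw [Function.update_self]
    simp only [add_assoc]
  · rw [Function.update_of_ne hij]
    refine graft_eta' (fun _ _ => rfl) fun k hk => if_neg ?_
    rcases lt_or_gt_of_ne hij with h | h <;>
    · have := before_add_le_before (fun j => (Y j).leaves) h
      omega

/-- The surroundings of a vertical input. -/
theorem exists_plug_of_leaf (Y : Stacking α) {m : ℕ} (hm : m < Y.leaves) (o : ℕ) :
    ∃ D, Normal D ∧ ∀ Z, Y.graft (fun _ => 0) (fun i => if i = o + m then Z else eta) o =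
      plug D Z := by
  induction Y generalizing m o with
  | eta =>
    obtain rfl : m = 0 := by simpa [leaves] using hm
    exact ⟨[], by simp [Normal], fun Z => by simp [graft, plug]⟩
  | box a n w Y ih =>
    obtain ⟨j, k, hk, rfl⟩ := exists_block _ hm
    obtain ⟨D, hD, e⟩ := ih j hk (o + before (fun j => (Y j).leaves) j)
    refine ⟨D ++ [⟨a, n, w, j, Function.update Y j eta⟩], ?_, fun Z => ?_⟩
    · intro f hf
      rcases List.mem_append.1 hf with hf | hf
      · exact hD f hf
      · rw [List.mem_singleton.1 hf]; simp
    · rw [graft_box_single _ _ _ _ hk, e, plug_append]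
      simp [plug, Frame.plug]

/-- The vertical input which belongs to given surroundings. -/
theorem exists_leaf_of_plug (D : List (Frame α)) (o : ℕ) : ∃ m < (plug D eta).leaves, ∀ Z,
    (plug D eta).graft (fun _ => 0) (fun i => if i = o + m then Z else eta) o = plug D Z := by
  induction D using List.reverseRecOn generalizing o with
  | nil => exact ⟨0, by simp [plug, leaves], fun Z => by simp [graft, plug]⟩
  | append_singleton D f ih =>
    obtain ⟨a, n, w, j, ch⟩ := f
    simp only [plug_append, plug, Frame.plug_mk]
    obtain ⟨m, hm, e⟩ := ih (o + before (fun i => (Function.update ch j (plug D eta) i).leaves) j)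
    have hm' : m < (Function.update ch j (plug D eta) j).leaves := by rwa [Function.update_self]
    refine ⟨before (fun i => (Function.update ch j (plug D eta) i).leaves) j + m, ?_, fun Z => ?_⟩
    · have := before_add_le (fun i => (Function.update ch j (plug D eta) i).leaves) j
      simp only [leaves]
      omega
    · rw [graft_box_single _ _ _ _ hm']
      simp only [Function.update_self, e, Function.update_idem]

theorem plug_injective (C : List (Frame α)) {X X' : Stacking α} (h : plug C X = plug C X') :
    X = X' := by
  induction C generalizing X X' with
  | nil => exact h
  | cons f C ih =>
    have := ih h
    simp only [Frame.plug, box.injEq, heq_eq_eq, true_and] at this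
    have := congrFun this f.j
    rwa [Function.update_self, Function.update_self] at this

/-- The stacking of stackings with the part `Y`, which is surrounded by `C` and has the row `U`,
with widths `W`, on it; the other parts are single boxes. In the bar construction these are the
infinitesimal decompositions. -/
def nest (col : α → Colour) (C : List (Frame α)) (Y : Stacking α) (W : ℕ → ℕ)
    (U : ℕ → Stacking α) : Stacking (Stacking α) :=
  plug (C.map (Frame.map (corolla col)))
    (box Y Y.leaves (fun i => W i) (fun i => (U i).map (corolla col)))

/-- `Y` is a substacking of `S` with surroundings `C` and with the row `U`, with widths `W`, on it.
Here `Y` together with the row is given as a cut of the stacking on the marked input of `C`. -/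
structure IsNest (col : α → Colour) (S : Stacking α) (C : List (Frame α)) (Y : Stacking α)
    (W : ℕ → ℕ) (U : ℕ → Stacking α) : Prop where
  normal : Normal C
  ne_eta : Y ≠ eta
  cut : Cut col (Y.graft W U 0) Y W U
  eq : S = plug C (Y.graft W U 0)

/-- The boxes in the row over `Y`. -/
def rowNodes (Y : Stacking α) (U : ℕ → Stacking α) : List α :=
  (List.ofFn fun i : Fin Y.leaves => (U i).nodes).flatten

variable {S : Stacking α} {C : List (Frame α)} {Y : Stacking α} {W : ℕ → ℕ} {U : ℕ → Stacking α}

theorem nodes_nest : (nest col C Y W U).nodes = (preNodes C).map (corolla col) ++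
    Y :: (rowNodes Y U ++ postNodes C).map (corolla col) := by
  rw [nest, nodes_plug, preNodes_map, postNodes_map, nodes, rowNodes]
  simp only [nodes_map, List.map_append, List.map_flatten, List.map_ofFn, List.cons_append]
  rfl

theorem mem_nest : Y ∈ (nest col C Y W U).nodes := by simp [nodes_nest]

theorem nestNodes_nest : (nest col C Y W U).nestNodes =
    preNodes C ++ (Y.nodes ++ (rowNodes Y U ++ postNodes C)) := by
  have h : ∀ l : List α, (l.map (corolla col)).flatMap nodes = l := fun l => by
    rw [List.flatMap_map]
    simp [nodes_corolla]
  rw [nestNodes, nodes_nest, List.flatMap_append, List.flatMap_cons, h, h]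

theorem eq_corolla_of_mem_nest {X : Stacking α} (hX : X ∈ (nest col C Y W U).nodes) (h : X ≠ Y) :
    ∃ a, X = corolla col a := by
  rw [nodes_nest] at hX
  simp only [List.mem_append, List.mem_map, List.mem_cons] at hX
  rcases hX with ⟨a, -, rfl⟩ | rfl | ⟨a, -, rfl⟩
  · exact ⟨a, rfl⟩
  · exact absurd rfl h
  · exact ⟨a, rfl⟩

namespace IsNest

theorem nest_valid (hS : S.Valid col) (h : IsNest col S C Y W U) :
    (nest col C Y W U).Valid (arity col) ∧ (nest col C Y W U).left (arity col) = S.left col ∧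
      (nest col C Y W U).right (arity col) = S.right col := by
  have hg : ∀ a, arity col (corolla col a) = col a := arity_corolla col
  rw [h.eq] at hS ⊢
  refine plug_congr hg hS ⟨rfl, fun i => ?_⟩ ?_ ?_
  · have := h.cut.row i i.2
    rw [zero_add] at this
    simp only [valid_map_corolla, left_map, right_map, hg]
    exact this
  · exact h.cut.left_eq.symm
  · exact h.cut.right_eq.symm

theorem flatten_nest (hS : S.Valid col) (h : IsNest col S C Y W U) :
    (nest col C Y W U).flatten = S := by
  rw [nest, flatten_plug (h.nest_valid hS).1, h.eq]
  congr 1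
  rw [flatten]
  refine graft_congr _ (fun i hi => ?_) fun i hi => ?_
  · rw [zero_add, dif_pos (Nat.lt_succ_of_le hi)]
  · rw [zero_add, dif_pos hi]
    have := (h.cut.row i hi).1
    rw [zero_add] at this
    exact flatten_map_corolla col this

theorem mem_nestings (hS : S.Valid col) (h : IsNest col S C Y W U) :
    nest col C Y W U ∈ nestings col S := by
  refine ⟨⟨fun X hX => ?_, (h.nest_valid hS).1⟩, fun X hX => ?_, h.flatten_nest hS⟩ <;>
  · by_cases hXY : X = Y
    · subst hXY
      first | exact h.cut.valid | exact h.ne_eta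
    · obtain ⟨a, rfl⟩ := eq_corolla_of_mem_nest hX hXY
      first | exact valid_corolla col a | exact corolla_ne_eta col a

theorem perm (hS : S.Valid col) (h : IsNest col S C Y W U) :
    S.nodes.Perm (preNodes C ++ (Y.nodes ++ (rowNodes Y U ++ postNodes C))) := by
  have := nestings_perm (h.mem_nestings hS)
  rwa [nestNodes_nest] at this

/-- A decomposition is determined by the substacking and its surroundings. -/
theorem nest_eq {W' : ℕ → ℕ} {U' : ℕ → Stacking α} (h : IsNest col S C Y W U)
    (h' : IsNest col S C Y W' U') : nest col C Y W U = nest col C Y W' U' := by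
  obtain ⟨h1, h2⟩ := graft_inj Y (plug_injective C (h.eq.symm.trans h'.eq))
  simp only [zero_add] at h1 h2
  rw [nest, nest]
  congr 2
  · funext i
    exact h1 h.ne_eta i (Nat.le_of_lt_succ i.2)
  · funext i
    rw [h2 i i.2]

/-- If `Y` has only the trivial cuts, then the cuts of `S` do not meet `Y`, so they are the cuts of
the decomposition. -/
theorem level_nest (hb : Y.Balanced col)
    (hY : ∀ x y, Y.Level col x y → (x = 0 ∧ y = 0) ∨ (x = Y.left col ∧ y = Y.right col))
    (h : IsNest col S C Y W U) (x y : ℕ) :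
    S.Level col x y ↔ (nest col C Y W U).Level (arity col) x y := by
  have hg : ∀ a, arity col (corolla col a) = col a := arity_corolla col
  rw [h.eq]
  refine level_plug hg (fun x y => ?_) x y
  rw [level_graft h.cut.valid hb h.cut.row]
  simp only [Level, level_map, hg, zero_add]
  constructor
  · rintro (hl | ⟨v, hv, hl, e1, e2⟩)
    · rcases hY x y hl with h0 | ⟨rfl, rfl⟩
      · exact Or.inl h0
      · exact Or.inr ⟨fun _ => 0, fun _ => Nat.zero_le _, fun _ => level_zero _ _, rfl, rfl⟩
    · exact Or.inr ⟨fun i => v i, fun i => hv i (Nat.le_of_lt_succ i.2), fun i => hl i i.2, e1, e2⟩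
  · rintro (⟨rfl, rfl⟩ | ⟨v, hv, hl, e1, e2⟩)
    · exact Or.inl (level_zero _ _)
    · refine Or.inr ⟨fun i => if hi : i < Y.leaves + 1 then v ⟨i, hi⟩ else 0, fun i hi => ?_,
        fun i hi => ?_, ?_, ?_⟩
      · beta_reduce
        rw [dif_pos (by omega)]
        exact hv ⟨i, _⟩
      · beta_reduce
        rw [dif_pos (by omega), dif_pos (by omega)]
        exact hl ⟨i, hi⟩
      · beta_reduce
        rw [dif_pos (by omega)]
        exact e1
      · beta_reduce
        rw [dif_pos (by omega)]
        exact e2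

theorem flat_nest (h : IsNest col S C Y W U) :
    S.Flat ↔ (nest col C Y W U).Flat ∧ Y.Flat := by
  have hg : ∀ a, arity col (corolla col a) = col a := arity_corolla col
  have key : ∀ hY : Y.Flat, S.Flat ↔ (nest col C Y W U).Flat := fun hY => by
    rw [h.eq]
    refine flat_plug ?_
    rw [flat_graft]
    simp only [hY, true_and, Flat, Flat.map_iff, zero_add]
    refine and_congr ⟨fun h1 i => h1 h.ne_eta i (Nat.le_of_lt_succ i.2),
      fun h1 _ i hi => h1 ⟨i, Nat.lt_succ_of_le hi⟩⟩
      ⟨fun h1 i => h1 i i.2, fun h1 i hi => h1 ⟨i, hi⟩⟩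
  constructor
  · intro hS
    have hY : Y.Flat := by
      rw [h.eq] at hS
      exact ((flat_graft _ _ _ _).1 (flat_of_plug hS)).1
    exact ⟨(key hY).1 hS, hY⟩
  · rintro ⟨h1, h2⟩
    exact (key h2).2 h1

end IsNest

theorem exists_lift_frames {C' : List (Frame (Stacking α))} (hC' : Normal C')
    (h : ∀ X, X ∈ preNodes C' ∨ X ∈ postNodes C' → ∃ a, X = corolla col a) :
    ∃ C, Normal C ∧ C' = C.map (Frame.map (corolla col)) := by
  induction C' with
  | nil => exact ⟨[], by simp [Normal], rfl⟩
  | cons f C' ih =>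
    obtain ⟨C, hC, rfl⟩ := ih (fun f hf => hC' f (List.mem_cons_of_mem _ hf)) fun X hX =>
      h X (by simp only [preNodes, postNodes, List.mem_append]; tauto)
    have hf : ∀ X ∈ (f.plug eta).nodes, ∃ a, X = corolla col a := fun X hX => by
      rw [Frame.nodes_plug] at hX
      refine h X ?_
      simp only [preNodes, postNodes, List.mem_append, nodes, List.not_mem_nil, false_or] at hX ⊢
      tauto
    have hj := hC' f (by simp)
    obtain ⟨A, n, w, j, ch⟩ := f
    rw [Frame.plug_mk, ← show ch j = eta from hj, Function.update_eq_self] at hf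
    obtain ⟨R, hR⟩ := exists_map_corolla (col := col) _ hf
    cases R with
    | eta => simp [map] at hR
    | box a n' w' ch' =>
      rw [map] at hR
      injection hR with h1 h2 h3 h4
      subst h2
      rw [heq_eq_eq] at h3 h4
      subst h1 h3 h4
      refine ⟨⟨a, n, w, j, ch'⟩ :: C, ?_, rfl⟩
      intro f hf
      rcases List.mem_cons.1 hf with rfl | hf
      · exact map_eq_eta.1 hj
      · exact hC f hf

/-- Every decomposition of which all parts but `Y` are single boxes is of the form `nest`. -/
theorem exists_isNest {N : Stacking (Stacking α)} (hd : S.nodes.Nodup) (hN : N ∈ nestings col S)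
    (hY : Y ∈ N.nodes) (hc : ∀ X ∈ N.nodes, X ≠ Y → ∃ a, X = corolla col a) :
    ∃ C W U, IsNest col S C Y W U ∧ N = nest col C Y W U := by
  obtain ⟨C', n, w, ch, hC', rfl⟩ := exists_plug hY
  have hNd := (nestings_nodup hd hN).1
  have hV := hN.1.2
  rw [nodes_plug, nodes] at hNd hc
  have hne : ∀ X, (X ∈ preNodes C' ∨ X ∈ (List.ofFn fun i => (ch i).nodes).flatten ∨
      X ∈ postNodes C') → X ≠ Y := by
    rw [List.cons_append, List.nodup_middle, List.nodup_cons] at hNd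
    rintro X hX rfl
    refine hNd.1 ?_
    simp only [List.mem_append]
    tauto
  have hcor : ∀ X, (X ∈ preNodes C' ∨ X ∈ (List.ofFn fun i => (ch i).nodes).flatten ∨
      X ∈ postNodes C') → ∃ a, X = corolla col a := fun X hX => hc X (by
    simp only [List.mem_append, List.mem_cons]; tauto) (hne X hX)
  obtain ⟨C, hC, rfl⟩ := exists_lift_frames (col := col) hC' fun X hX => hcor X (by tauto)
  choose R hR using fun i => exists_map_corolla (col := col) (ch i) fun X hX =>
    hcor X (Or.inr (Or.inl (List.mem_flatten.2 ⟨_, List.mem_ofFn.2 ⟨i, rfl⟩, hX⟩)))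
  obtain rfl : ch = fun i => (R i).map (corolla col) := funext hR
  have hg : ∀ a, arity col (corolla col a) = col a := arity_corolla col
  obtain ⟨hn, hrow⟩ := valid_of_plug hV
  obtain rfl : Y.leaves = n := hn
  simp only [valid_map_corolla, left_map, right_map, hg] at hrow
  have hW : (nest col C Y (fun i => if h : i < Y.leaves + 1 then w ⟨i, h⟩ else 0)
      fun i => if h : i < Y.leaves then R ⟨i, h⟩ else eta) =
      plug (C.map (Frame.map (corolla col)))
        (box Y Y.leaves w fun i => (R i).map (corolla col)) := by
    rw [nest]
    congr 2
    · funext i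
      exact dif_pos i.2
    · funext i
      rw [dif_pos i.2]
  refine ⟨C, _, _, ⟨hC, hN.2.1 Y hY, ⟨rfl, hN.1.1 Y hY, fun i hi => ?_⟩, ?_⟩, hW.symm⟩
  · rw [zero_add, dif_pos hi, dif_pos (by omega), dif_pos (by omega)]
    exact hrow ⟨i, hi⟩
  · rw [← hN.2.2, flatten_plug hV]
    congr 1
    rw [flatten]
    refine graft_congr _ (fun i hi => rfl) fun i hi => ?_
    rw [zero_add, dif_pos hi, dif_pos hi]
    exact flatten_map_corolla col (hrow ⟨i, hi⟩).1

end Nests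

end Stacking

end BoxOperad

namespace BoxOperad

namespace Stacking

/-! ### Existence and uniqueness of the quadratic substackings -/

section Shapes

variable {α : Type u} {col : α → Colour} {S : Stacking α} {C : List (Frame α)} {Y : Stacking α}
  {W : ℕ → ℕ} {U : ℕ → Stacking α}

theorem IsNest.of_cut {D : Stacking α} (hC : Normal C) (hY : Y ≠ eta) (hc : Cut col D Y W U)
    (h : S = plug C D) : IsNest col S C Y W U := by
  obtain ⟨rfl, h1, h2⟩ := hc
  exact ⟨hC, hY, ⟨rfl, h1, h2⟩, h⟩

theorem exists_cut_corolla {t : α} {n : ℕ} {w : Fin (n + 1) → ℕ} {ch : Fin n → Stacking α}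
    (hV : (box t n w ch).Valid col) : ∃ W U, Cut col (box t n w ch) (corolla col t) W U := by
  obtain ⟨rfl, -⟩ := id hV
  exact exists_cut_box hV (v := fun _ => 0) (fun _ => Nat.zero_le _) fun i =>
    ⟨rfl, rfl, _, _, cut_eta (hV.2 i).1⟩

/-- A thin box and the box below it. -/
theorem exists_duo_nest (hS : S.Valid col) {f : Frame α} (hC : Normal (f :: C)) {t : α} {n : ℕ}
    {w : Fin (n + 1) → ℕ} {ch : Fin n → Stacking α} (ht : (col t).Thin)
    (e : S = plug (f :: C) (box t n w ch)) :
    ∃ Y W U, IsNest col S C Y W U ∧ Y.nodes = [f.a, t] ∧ Y.Flat := by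
  obtain ⟨a, m, w₀, j, c⟩ := f
  rw [plug, Frame.plug_mk] at e
  have hV := valid_of_plug (e ▸ hS)
  have hVt := (hV.2 j).1
  rw [Function.update_self] at hVt
  obtain ⟨W, U, hc⟩ := exists_cut_box hV (v := fun _ => 0) (fun _ => Nat.zero_le _)
    (Y := single j (corolla col t)) fun i => by
      by_cases hij : i = j
      · subst hij
        rw [single_self, Function.update_self]
        exact ⟨by simp [corolla, left, ht.1], by simp [corolla, right, ht.2],
          exists_cut_corolla hVt⟩
      · rw [single_ne hij, Function.update_of_ne hij]
        have := (hV.2 i).1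
        rw [Function.update_of_ne hij] at this
        exact ⟨rfl, rfl, _, _, cut_eta this⟩
  refine ⟨_, W, U, IsNest.of_cut (fun f hf => hC f (List.mem_cons_of_mem _ hf)) (by simp) hc e,
    nodes_duo _ _ _ _ _, fun _ => rfl, fun i => ?_⟩
  by_cases hij : i = j
  · subst hij
    rw [single_self]
    exact ⟨fun _ => rfl, fun _ => trivial⟩
  · rw [single_ne hij]; trivial

theorem duo_eq {a t : α} (hV : Y.Valid col) (hF : Y.Flat) (hn : Y.nodes = [a, t]) :
    ∃ j, Y = box a (col a).q (fun _ => 0) (single j (corolla col t)) := by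
  obtain ⟨a', n, w, j, t', m, w', rfl⟩ := size_eq_two (X := Y) (by rw [size, hn]; rfl)
  rw [nodes_duo] at hn
  obtain ⟨rfl, h2⟩ := List.cons.inj hn
  obtain ⟨rfl, -⟩ := List.cons.inj h2
  obtain ⟨rfl, hr⟩ := hV
  have h1 := (hr j).1
  have h3 := hF.2 j
  rw [single_self] at h1 h3
  obtain ⟨rfl, -⟩ := h1
  refine ⟨j, ?_⟩
  rw [show w = fun _ => 0 from funext hF.1, show w' = fun _ => 0 from funext h3.1]
  rfl

/-- The lower one of two boxes is determined by the upper one. -/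
theorem duo_unique (hd : S.nodes.Nodup) {C' : List (Frame α)} {Y' : Stacking α} {W' : ℕ → ℕ}
    {U' : ℕ → Stacking α} {a a' t : α} (h : IsNest col S C Y W U) (h' : IsNest col S C' Y' W' U')
    (hF : Y.Flat) (hF' : Y'.Flat) (hn : Y.nodes = [a, t]) (hn' : Y'.nodes = [a', t]) :
    Y = Y' ∧ nest col C Y W U = nest col C' Y' W' U' := by
  obtain ⟨j, rfl⟩ := duo_eq h.cut.valid hF hn
  obtain ⟨j', rfl⟩ := duo_eq h'.cut.valid hF' hn'
  have key : ∀ (C : List (Frame α)) a (j : Fin (col a).q) W U,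
      IsNest col S C (box a (col a).q (fun _ => 0) (single j (corolla col t))) W U →
      ∃ w₀ c w ch, Normal (⟨a, (col a).q, w₀, j, c⟩ :: C) ∧
        S = plug (⟨a, (col a).q, w₀, j, c⟩ :: C) (box t (col t).q w ch) := by
    intro C a j W U h
    obtain ⟨w₀, c, e⟩ : ∃ w₀ c, (box a (col a).q (fun _ => 0) (single j (corolla col t))).graft
      W U 0 = box a (col a).q w₀ c ∧ c j = _ := ⟨_, _, rfl, rfl⟩
    rw [single_self, graft_corolla] at e
    have e3 : S = plug (⟨a, (col a).q, w₀, j, Function.update c j eta⟩ :: C) (c j) := by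
      rw [h.eq, e.1, plug, Frame.plug_mk, Function.update_idem, Function.update_eq_self]
    rw [e.2] at e3
    refine ⟨w₀, Function.update c j eta, _, _, fun f hf => ?_, e3⟩
    rcases List.mem_cons.1 hf with rfl | hf
    · simp
    · exact h.normal f hf
  obtain ⟨w₀, c, w, ch, h1, e⟩ := key C a j W U h
  obtain ⟨w₀', c', w', ch', h1', e'⟩ := key C' a' j' W' U' h'
  obtain ⟨h2, -⟩ := plug_unique h1 h1' (e ▸ hd) (e.symm.trans e')
  obtain ⟨h3, rfl⟩ := List.cons.inj h2
  injection h3 with h3 h4 h5 h6 h7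
  subst h3
  rw [heq_eq_eq] at h6
  subst h6
  exact ⟨rfl, h.nest_eq h'⟩

theorem exists_eq_box_of_graft (hY : Y ≠ eta) {o : ℕ} {t : α} {n : ℕ} {w : Fin (n + 1) → ℕ}
    {ch : Fin n → Stacking α} (h : Y.graft W U o = box t n w ch) :
    ∃ v Y', Y = box t n v Y' := by
  cases Y with
  | eta => exact absurd rfl hY
  | box a m v Y =>
    simp only [graft] at h
    injection h with h1 h2
    subst h1 h2
    exact ⟨v, Y, rfl⟩

theorem exists_graft_eq_box {t : α} {l : List α} (h : Y.nodes = t :: l) :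
    ∃ n w ch, Y.graft W U 0 = box t n w ch := by
  cases Y with
  | eta => simp [nodes] at h
  | box a m v Y =>
    rw [nodes] at h
    obtain ⟨rfl, -⟩ := List.cons.inj h
    exact ⟨_, _, _, rfl⟩

/-- A thin box under non-thin boxes is the bottom box of the lower part of a lowest cut. -/
theorem exists_prime_nest (hS : S.Valid col) (hC : Normal C) {t : α} {n : ℕ}
    {w : Fin (n + 1) → ℕ} {ch : Fin n → Stacking α} (ht : (col t).Thin)
    (hch : ∀ i, ∀ b ∈ (ch i).nodes, (col b).NonThin) (hl : 0 < (box t n w ch).left col)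
    (e : S = plug C (box t n w ch)) :
    ∃ Y W U, IsNest col S C Y W U ∧ (∃ l, Y.nodes = t :: l) ∧ Y.IsPrime col := by
  have hV := valid_of_plug (e ▸ hS)
  have hex : ∃ x, 0 < x ∧ ∃ y, (box t n w ch).Level col x y := ⟨_, hl, _, level_full hV⟩
  -- the lowest nonempty cut: its lower part has only the two trivial cuts
  classical
  obtain ⟨hx, y, hy⟩ := Nat.find_spec hex
  obtain ⟨Y, rfl', rfl'', W, U, hc⟩ := exists_cut_of_level hV hy
  have hY : Y ≠ eta := by
    rintro rfl
    rw [← rfl'] at hx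
    exact hx.ne rfl
  obtain ⟨v, Y', rfl⟩ := exists_eq_box_of_graft hY hc.eq.symm
  have hsub : ∀ i, ∀ b ∈ (Y' i).nodes, (col b).NonThin := by
    intro i b hb
    have h2 := hc.eq
    simp only [graft] at h2
    injection h2 with _ _ _ h3
    refine hch i b ?_
    rw [h3, (perm_graft _ _ _ _).mem_iff]
    exact List.mem_append_left _ hb
  have hn : ∀ b ∈ (List.ofFn fun i => (Y' i).nodes).flatten, (col b).NonThin := by
    intro b hb
    obtain ⟨_, h1, hb⟩ := List.mem_flatten.1 hb
    obtain ⟨i, rfl⟩ := List.mem_ofFn.1 h1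
    exact hsub i b hb
  have hbal : (box t n v Y').Balanced col := by
    intro b hb
    rcases List.mem_cons.1 hb with rfl | hb
    · exact not_semiThin.2 (iff_of_true ht.1 ht.2)
    · exact (hn b hb).2
  refine ⟨_, W, U, IsNest.of_cut hC hY hc e, ⟨_, rfl⟩, ⟨t, _, rfl, ht, hn⟩, by rwa [rfl'], ?_⟩
  intro x' y' hl'
  by_cases h0 : x' = 0
  · exact Or.inl ⟨h0, (hl'.eq_zero_iff hbal).1 h0⟩
  · have h1 : (box t n w ch).Level col x' y' := by
      rw [hc.eq, level_graft hc.valid hbal hc.row]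
      exact Or.inl hl'
    have h2 := Nat.find_min' hex ⟨Nat.pos_of_ne_zero h0, y', h1⟩
    have h3 := hl'.le.1
    have h4 : x' = (box t n v Y').left col := by omega
    exact Or.inr ⟨h4, (hl'.eq_left_iff hc.valid hbal).1 h4⟩

/-- A prime substacking is determined by its bottom box: of two lower parts with the same bottom
box, one is a cut of the other, by comparing the left ends. -/
theorem prime_unique (hd : S.nodes.Nodup) {C' : List (Frame α)} {Y' : Stacking α} {W' : ℕ → ℕ}
    {U' : ℕ → Stacking α} {t : α} {l l' : List α} (h : IsNest col S C Y W U)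
    (h' : IsNest col S C' Y' W' U') (hP : Y.IsPrime col) (hP' : Y'.IsPrime col)
    (hn : Y.nodes = t :: l) (hn' : Y'.nodes = t :: l') :
    Y = Y' ∧ nest col C Y W U = nest col C' Y' W' U' := by
  obtain ⟨n, w, ch, e⟩ := exists_graft_eq_box (W := W) (U := U) hn
  obtain ⟨n', w', ch', e'⟩ := exists_graft_eq_box (W := W') (U := U') hn'
  have h1 := h.eq
  have h1' := h'.eq
  rw [e] at h1
  rw [e'] at h1'
  obtain ⟨rfl, h2⟩ := plug_unique h.normal h'.normal (h1 ▸ hd) (h1.symm.trans h1')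
  have hg : Y.graft W U 0 = Y'.graft W' U' 0 := by rw [e, e', h2]
  obtain ⟨v, Z, rfl⟩ := exists_eq_box_of_graft h.ne_eta e
  obtain ⟨v', Z', rfl⟩ := exists_eq_box_of_graft h'.ne_eta (hg ▸ e)
  have hpos : ∀ {v : Fin (n + 1) → ℕ} {Z : Fin n → Stacking α}, (box t n v Z).IsPrime col →
      ∀ i, ∀ b ∈ (Z i).nodes, 0 < (col b).p := by
    rintro v Z ⟨⟨a, l, hn, -, hl⟩, -⟩ i b hb
    refine (nonThin_iff.1 (hl b ?_)).1
    rw [nodes] at hn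
    rw [← (List.cons.inj hn).2]
    exact List.mem_flatten.2 ⟨_, List.mem_ofFn.2 ⟨i, rfl⟩, hb⟩
  have key : ∀ {v v' : Fin (n + 1) → ℕ} {Z Z' : Fin n → Stacking α} {W W' : ℕ → ℕ}
      {U U' : ℕ → Stacking α}, (box t n v Z).Valid col → (box t n v' Z').Valid col →
      (box t n v Z).IsPrime col → (box t n v' Z').IsPrime col →
      (box t n v Z).graft W U 0 = (box t n v' Z').graft W' U' 0 →
      (box t n v Z).left col ≤ (box t n v' Z').left col → box t n v Z = box t n v' Z' := by
    intro v v' Z Z' W W' U U' hV hV' hP hP' hg hle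
    simp only [graft] at hg
    injection hg with _ _ _ hg
    -- the smaller lower part is a cut of the larger one, which has only the trivial cuts
    obtain ⟨-, h1, h2⟩ := cut_compare_box hV hV' (fun i => cut_compare (congrFun hg i) (hV.2 i).1
      (hV'.2 i).1 (hpos hP i) (hpos hP' i)) hle
    rcases hP'.2.2 _ _ h1 with h3 | h3
    · exact absurd h3.1 hP.2.1.ne'
    · exact (h2 h3.1).2
  have hYY : box t n v Z = box t n v' Z' := by
    rcases le_total ((box t n v Z).left col) ((box t n v' Z').left col) with hle | hle
    · exact key h.cut.valid h'.cut.valid hP hP' hg hle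
    · exact (key h'.cut.valid h.cut.valid hP' hP hg.symm hle).symm
  obtain ⟨rfl, h3⟩ := box.inj hYY |>.2.2.imp_left eq_of_heq
  rw [heq_eq_eq] at h3
  subst h3
  exact ⟨rfl, h.nest_eq h'⟩

theorem rowNodes_single {m : ℕ} (hm : m < Y.leaves) (X : Stacking α) :
    rowNodes Y (fun i => if i = m then X else eta) = X.nodes := by
  have h : (fun i : Fin Y.leaves => ((if i.val = m then X else eta : Stacking α)).nodes) =
      fun i => (single ⟨m, hm⟩ X i).nodes := by
    funext i
    by_cases hi : i = ⟨m, hm⟩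
    · subst hi; rw [single_self, if_pos rfl]
    · rw [single_ne hi, if_neg fun h => hi (Fin.ext h)]
  rw [rowNodes, h]
  have h2 : ∀ (a : α), (box a Y.leaves (fun _ => 0) (single ⟨m, hm⟩ X)).nodes = a :: X.nodes :=
    fun a => nodes_box_single a _ _ X
  cases X with
  | eta => simp [single, nodes]
  | box a n w ch =>
    have := h2 a
    rw [nodes] at this
    exact (List.cons.inj this).2

/-- A thin box without horizontal lines over it can be taken off. -/
theorem exists_erase_nest (hS : S.Valid col) {D : List (Frame α)} (hD : D ≠ []) {t : α}
    (ht : (col t).Thin) (e : S = plug D (corolla col t)) :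
    ∃ Y W U, IsNest col S [] Y W U ∧ (nest col [] Y W U).nodes = [Y, corolla col t] ∧
      (nest col [] Y W U).Flat := by
  have hl : (corolla col t).left col = 0 := by simp [corolla, left, ht.1]
  have hr : (corolla col t).right col = 0 := by simp [corolla, right, ht.2]
  obtain ⟨m, hm, hm'⟩ := exists_leaf_of_plug D 0
  simp only [zero_add] at hm'
  have hne : plug D eta ≠ eta := by
    rcases List.eq_nil_or_concat D with rfl | ⟨D, f, rfl⟩
    · exact absurd rfl hD
    · rw [List.concat_eq_append, plug_append]
      simp [plug, Frame.plug]
  refine ⟨plug D eta, fun _ => 0, fun i => if i = m then corolla col t else eta,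
    ⟨by simp [Normal], hne, ⟨rfl, ?_, fun i _ => ?_⟩, by rw [hm', e]; rfl⟩, ?_, ?_⟩
  · exact valid_plug_congr (e ▸ hS) trivial hl.symm hr.symm
  · rw [zero_add]
    split_ifs
    · exact ⟨valid_corolla col t, hl, hr⟩
    · exact ⟨trivial, rfl, rfl⟩
  · rw [nodes_nest, rowNodes_single hm]
    simp [preNodes, postNodes, nodes_corolla]
  · refine ⟨fun _ => rfl, fun i => ?_⟩
    rw [Flat.map_iff]
    beta_reduce
    split_ifs
    · exact ⟨fun _ => rfl, fun _ => trivial⟩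
    · trivial

/-- If two parts remain, of which the upper one is a single box `t`, then the lower part is obtained
by deleting `t`. -/
theorem exists_of_erase {t : α} (h : IsNest col S C Y W U) (hF : (nest col C Y W U).Flat)
    (hn : (nest col C Y W U).nodes = [Y, corolla col t]) (hne : Y ≠ corolla col t)
    (hV : (nest col C Y W U).Valid (arity col)) :
    C = [] ∧ ∃ D, Normal D ∧ S = plug D (corolla col t) ∧ Y = plug D eta := by
  have hpre : preNodes C = [] := by
    have h1 := nodes_nest (col := col) (C := C) (Y := Y) (W := W) (U := U)
    rw [hn] at h1
    cases hp : preNodes C with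
    | nil => rfl
    | cons a l =>
      rw [hp] at h1
      simp only [List.map_cons, List.cons_append, List.cons.injEq] at h1
      have h2 := h1.2
      have h3 := congrArg List.length h2
      simp only [List.length_append, List.length_map, List.length_cons, List.length_nil] at h3
      obtain rfl : l = [] := List.length_eq_zero_iff.1 (by omega)
      simp only [List.map_nil, List.nil_append, List.cons.injEq] at h2
      exact absurd h2.1.symm hne
  have hC : C = [] := by
    cases C with
    | nil => rfl
    | cons f C => simp [preNodes, Frame.pre] at hpre
  subst hC
  refine ⟨rfl, ?_⟩
  obtain ⟨j, hj⟩ : ∃ j : Fin Y.leaves, nest col [] Y W U = box Y Y.leaves (fun _ => 0)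
      (single j (corolla (arity col) (corolla col t))) := duo_eq hV hF hn
  simp only [nest, plug, List.map_nil] at hj
  injection hj with _ _ h3 h4
  have hU : ∀ i : Fin Y.leaves, U i = if i = j then corolla col t else eta := by
    intro i
    have h5 := congrFun h4 i
    by_cases hij : i = j
    · subst hij
      rw [if_pos rfl]
      rw [single_self] at h5
      obtain ⟨a, h6, h7⟩ := map_eq_corolla h5
      have h8 : a = t := by
        have := congrArg nodes h7
        rw [nodes_corolla, nodes_corolla] at this
        exact (List.cons.inj this).1
      rw [h6, h8]
      congr 1
      funext a
      exact arity_corolla col a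
    · rw [if_neg hij]
      rw [single_ne hij] at h5
      exact map_eq_eta.1 h5
  obtain ⟨D, hD, hZ⟩ := exists_plug_of_leaf Y j.2 0
  refine ⟨D, hD, ?_, ?_⟩
  · rw [h.eq, plug, ← hZ]
    refine graft_congr _ (fun i hi => ?_) fun i hi => ?_
    · have := congrFun h3 ⟨i, Nat.lt_succ_of_le hi⟩
      rw [zero_add]
      exact this
    · have := hU ⟨i, hi⟩
      rw [zero_add, zero_add]
      simpa [Fin.ext_iff] using this
  · rw [← hZ, graft_eta' (fun _ _ => rfl) fun i _ => by simp]

/-- The stacking which remains after taking off a box is unique. -/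
theorem erase_unique (hd : S.nodes.Nodup) (hS : S.Valid col) {C' : List (Frame α)}
    {Y' : Stacking α} {W' : ℕ → ℕ}
    {U' : ℕ → Stacking α} {t : α} (h : IsNest col S C Y W U) (h' : IsNest col S C' Y' W' U')
    (hF : (nest col C Y W U).Flat) (hF' : (nest col C' Y' W' U').Flat)
    (hn : (nest col C Y W U).nodes = [Y, corolla col t])
    (hn' : (nest col C' Y' W' U').nodes = [Y', corolla col t]) :
    Y = Y' ∧ nest col C Y W U = nest col C' Y' W' U' := by
  have hne : ∀ {C Y W U}, IsNest col S C Y W U →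
      (nest col C Y W U).nodes = [Y, corolla col t] → Y ≠ corolla col t := by
    intro C Y W U h hn e
    have := (nestings_nodup hd (h.mem_nestings hS)).1
    rw [hn, e] at this
    simp at this
  obtain ⟨rfl, D, hD, e, rfl⟩ := exists_of_erase h hF hn (hne h hn) (h.nest_valid hS).1
  obtain ⟨rfl, D', hD', e', rfl⟩ := exists_of_erase h' hF' hn' (hne h' hn') (h'.nest_valid hS).1
  rw [corolla] at e e'
  obtain ⟨rfl, -⟩ := plug_unique hD hD' (e ▸ hd) (e.symm.trans e')
  exact ⟨rfl, h.nest_eq h'⟩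

end Shapes

end Stacking

end BoxOperad

namespace BoxOperad

namespace Stacking

/-! ### Pairs of nested quadratic substackings -/

section Pairs

variable {α : Type u} {col : α → Colour} {S : Stacking α} {C : List (Frame α)} {Y : Stacking α}
  {W : ℕ → ℕ} {U : ℕ → Stacking α}

/-- The shape of a thin-quadratic stacking, of type I or II, or of type III. -/
def IsQuad (col : α → Colour) (X : Stacking α) : Prop := X.IsDuo col ∨ X.IsPrime col

theorem IsQuad.balanced {X : Stacking α} (h : X.IsQuad col) : X.Balanced col := by
  rcases h with h | ⟨⟨a, l, hn, ha, hl⟩, -⟩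
  · exact h.1
  · intro b hb
    rw [hn] at hb
    rcases List.mem_cons.1 hb with rfl | hb
    · exact not_semiThin.2 (iff_of_true ha.1 ha.2)
    · exact (hl b hb).2

theorem IsQuad.level {X : Stacking α} (h : X.IsQuad col) (x y : ℕ) (hl : X.Level col x y) :
    (x = 0 ∧ y = 0) ∨ (x = X.left col ∧ y = X.right col) := by
  rcases h with h | h
  · cases X with
    | eta => exact Or.inl hl
    | box a n w ch =>
      rcases hl with hl | ⟨v, hv, -, rfl, rfl⟩
      · exact Or.inl hl
      · have hw := h.2.2.1
        have h0 := hv 0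
        have h1 := hv (Fin.last n)
        simp only [hw, Nat.le_zero] at h0 h1
        exact Or.inr (by simp [left, right, hw, h0, h1])
  · exact h.2.2 x y hl

theorem IsPrime.not_flat {X : Stacking α} (h : X.IsPrime col) : ¬ X.Flat := by
  obtain ⟨⟨a, l, hn, ha, -⟩, hpos, -⟩ := h
  intro hF
  cases X with
  | eta => simp [left] at hpos
  | box b n w ch =>
    rw [nodes] at hn
    obtain ⟨rfl, -⟩ := List.cons.inj hn
    rw [hF.left_eq.1, ha.1] at hpos
    exact lt_irrefl _ hpos

theorem IsPrime.not_thin {X : Stacking α} (h : X.IsPrime col) : ¬ (X.arity col).Thin :=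
  fun h' => h.2.1.ne' h'.1

theorem IsPrime.nonThin {X : Stacking α} (hV : X.Valid col) (h : X.IsPrime col) :
    (X.arity col).NonThin := by
  have h1 := left_eq_zero_iff hV (IsQuad.balanced (Or.inr h))
  have h2 := h.2.1
  exact nonThin_iff.2 ⟨h2, Nat.pos_of_ne_zero fun h3 => h2.ne' (h1.2 h3)⟩

theorem corolla_injective : Function.Injective (corolla col) := fun a b h => by
  have := congrArg nodes h
  rw [nodes_corolla, nodes_corolla] at this
  exact (List.cons.inj this).1

namespace IsNest

/-- If the decomposition has two parts, then the single box is over the substacking or below it. -/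
theorem duo_cases (hS : S.Valid col) (h : IsNest col S C Y W U)
    (hN : (nest col C Y W U).IsDuo (arity col)) :
    (preNodes C = [] ∧ ∃ b, rowNodes Y U ++ postNodes C = [b] ∧ (col b).Thin ∧
      (nest col C Y W U).nodes = [Y, corolla col b]) ∨
    (∃ a, preNodes C = [a] ∧ rowNodes Y U ++ postNodes C = [] ∧ (Y.arity col).Thin ∧
      (nest col C Y W U).nodes = [corolla col a, Y]) := by
  obtain ⟨X₁, X₂, hn, ht, -⟩ := hN.exists_nodes (h.nest_valid hS).1
  have h1 := nodes_nest (col := col) (C := C) (Y := Y) (W := W) (U := U)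
  rw [hn] at h1
  rw [hn]
  cases hp : preNodes C with
  | nil =>
    left
    rw [hp] at h1
    simp only [List.map_nil, List.nil_append, List.cons.injEq] at h1
    obtain ⟨rfl, h1⟩ := h1
    obtain ⟨b, hb, rfl⟩ := List.map_eq_singleton_iff.1 h1.symm
    rw [arity_corolla] at ht
    exact ⟨rfl, b, hb, ht, rfl⟩
  | cons a l =>
    right
    rw [hp] at h1
    simp only [List.map_cons, List.cons_append, List.cons.injEq] at h1
    obtain ⟨rfl, h1⟩ := h1
    have h3 := congrArg List.length h1
    simp only [List.length_append, List.length_map, List.length_cons, List.length_nil] at h3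
    obtain rfl : l = [] := List.length_eq_zero_iff.1 (by omega)
    simp only [List.map_nil, List.nil_append, List.cons.injEq] at h1
    obtain ⟨rfl, h1⟩ := h1
    exact ⟨a, rfl, List.map_eq_nil_iff.1 h1.symm, ht, rfl⟩

/-- If the decomposition is prime, then the substacking is its thin bottom part, or one of the
non-thin ones. -/
theorem prime_cases (hN : (nest col C Y W U).IsPrime (arity col)) :
    (preNodes C = [] ∧ (Y.arity col).Thin ∧
      ∀ b ∈ rowNodes Y U ++ postNodes C, (col b).NonThin) ∨
    (∃ r l, preNodes C = r :: l ∧ (col r).Thin ∧ (Y.arity col).NonThin ∧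
      ∀ b ∈ l ++ (rowNodes Y U ++ postNodes C), (col b).NonThin) := by
  obtain ⟨⟨X, L, hn, hX, hL⟩, -⟩ := hN
  rw [nodes_nest] at hn
  cases hp : preNodes C with
  | nil =>
    left
    rw [hp] at hn
    simp only [List.map_nil, List.nil_append, List.cons.injEq] at hn
    obtain ⟨rfl, rfl⟩ := hn
    refine ⟨rfl, hX, fun b hb => ?_⟩
    have := hL _ (List.mem_map.2 ⟨b, hb, rfl⟩)
    rwa [arity_corolla] at this
  | cons r l =>
    right
    rw [hp] at hn
    simp only [List.map_cons, List.cons_append, List.cons.injEq] at hn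
    obtain ⟨rfl, rfl⟩ := hn
    rw [arity_corolla] at hX
    refine ⟨r, l, rfl, hX, hL Y (by simp), fun b hb => ?_⟩
    have := hL (corolla col b) (by
      rcases List.mem_append.1 hb with hb | hb
      · exact List.mem_append_left _ (List.mem_map.2 ⟨b, hb, rfl⟩)
      · exact List.mem_append_right _ (List.mem_cons_of_mem _ (List.mem_map.2 ⟨b, hb, rfl⟩)))
    rwa [arity_corolla] at this

/-- The bottom box is the first one, in the decomposition too. -/
theorem exists_cons (h : IsNest col S C Y W U) :
    ∃ r l l', S.nodes = r :: l ∧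
      preNodes C ++ (Y.nodes ++ (rowNodes Y U ++ postNodes C)) = r :: l' := by
  have h1 := congrArg nodes h.eq
  rw [nodes_plug] at h1
  cases hp : preNodes C with
  | cons r l => rw [hp] at h1; exact ⟨r, _, _, h1, rfl⟩
  | nil =>
    rw [hp] at h1
    have hne := h.ne_eta
    cases Y with
    | eta => exact absurd rfl hne
    | box a n w ch => exact ⟨a, _, _, h1, rfl⟩

theorem balanced (hS : S.Valid col) (h : IsNest col S C Y W U)
    (hN : (nest col C Y W U).Balanced (arity col)) (hY : Y.Balanced col) : S.Balanced col := by
  intro a ha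
  rw [(h.perm hS).mem_iff] at ha
  by_cases haY : a ∈ Y.nodes
  · exact hY a haY
  · have := hN (corolla col a) (by
      rw [nodes_nest]
      simp only [List.mem_append, List.mem_cons, List.mem_map, corolla_injective.eq_iff,
        exists_eq_right] at ha ⊢
      tauto)
    rwa [arity_corolla] at this

theorem balanced_part (hS : S.Valid col) (h : IsNest col S C Y W U) (hb : S.Balanced col) :
    Y.Balanced col := fun a ha => hb a ((h.perm hS).mem_iff.2 (by simp [ha]))

theorem balanced_nest (hS : S.Valid col) (h : IsNest col S C Y W U) (hb : S.Balanced col) :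
    (nest col C Y W U).Balanced (arity col) := by
  intro X hX
  by_cases hXY : X = Y
  · subst hXY
    exact not_semiThin.2 (left_eq_zero_iff h.cut.valid (h.balanced_part hS hb))
  · have hX' := hX
    rw [nodes_nest] at hX'
    obtain ⟨a, rfl⟩ := eq_corolla_of_mem_nest hX hXY
    rw [arity_corolla]
    refine hb a ((h.perm hS).mem_iff.2 ?_)
    simp only [List.mem_append, List.mem_cons, List.mem_map, corolla_injective.eq_iff,
        exists_eq_right] at hX' ⊢
    tauto

end IsNest

/-- A prime stacking with a further thin box `t`: the stackings which consist of two prime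
stackings, or of a prime one and a pair of boxes. -/
structure IsDoublePrime (col : α → Colour) (S : Stacking α) (r t : α) (L₁ L₂ : List α) : Prop where
  nodes_eq : S.nodes = r :: (L₁ ++ t :: L₂)
  root : (col r).Thin
  thin : (col t).Thin
  nonThin : ∀ b ∈ L₁ ++ L₂, (col b).NonThin
  pos : 0 < S.left col
  level : ∀ x y, S.Level col x y → (x = 0 ∧ y = 0) ∨ (x = S.left col ∧ y = S.right col)

/-- Three boxes without horizontal lines over boxes. -/
structure IsTriple (col : α → Colour) (S : Stacking α) (a b t : α) : Prop where
  nodes_eq : S.nodes = [a, b, t]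
  flat : S.Flat
  balanced : S.Balanced col

/-- The shapes of the pairs of nested quadratic substackings of a double prime stacking, with boxes
`r :: (M₁ ++ t :: M₂)` in the order of the decomposition. -/
inductive PrimeShape (col : α → Colour) (C : List (Frame α)) (Y : Stacking α) (W : ℕ → ℕ)
    (U : ℕ → Stacking α) (r t : α) (M₁ M₂ : List α) : Prop
  | duo (e : α) (hY : Y.IsDuo col) (hN : (nest col C Y W U).IsPrime (arity col))
      (hn : Y.nodes = [e, t]) (hp : preNodes C ++ [e] = r :: M₁)
  | erase (hY : Y.IsPrime col) (hN : (nest col C Y W U).IsDuo (arity col))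
      (hn : (nest col C Y W U).nodes = [Y, corolla col t]) (hp : preNodes C = [])
      (hn' : Y.nodes = r :: M₁) (hM : M₂ = [])
  | prime (l : List α) (hY : Y.IsPrime col) (hN : (nest col C Y W U).IsPrime (arity col))
      (hn : Y.nodes = t :: l) (hp : preNodes C = r :: M₁)

/-- Two nested quadratic stackings, not both with two boxes, form a stacking with exactly two thin
boxes, one of which is at the bottom; the other one is in the substacking or over it. -/
theorem IsNest.exists_primeShape (hS : S.Valid col) (h : IsNest col S C Y W U)
    (hN : (nest col C Y W U).IsQuad (arity col)) (hY : Y.IsQuad col) (hF : ¬ S.Flat) :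
    0 < S.left col ∧ ∃ r t M₁ M₂, PrimeShape col C Y W U r t M₁ M₂ ∧
      preNodes C ++ (Y.nodes ++ (rowNodes Y U ++ postNodes C)) = r :: (M₁ ++ t :: M₂) ∧
      (col r).Thin ∧ (col t).Thin ∧ ∀ b ∈ M₁ ++ M₂, (col b).NonThin := by
  have hNV := h.nest_valid hS
  rcases hY with hY | hY
  · obtain ⟨e, t, hn, ht, hl, hr⟩ := hY.exists_nodes h.cut.valid
    have hth : (Y.arity col).Thin ↔ (col e).Thin := by
      simp only [Colour.Thin, arity, hl, hr]
    have hnth : (Y.arity col).NonThin ↔ (col e).NonThin := by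
      simp only [nonThin_iff, arity, hl, hr]
    rcases hN with hN | hN
    · exact absurd (h.flat_nest.2 ⟨hN.2.2, hY.2.2⟩) hF
    · refine ⟨hNV.2.1 ▸ hN.2.1, ?_⟩
      rcases prime_cases hN with ⟨hp, h1, h2⟩ | ⟨r, l, hp, h1, h2, h3⟩
      · exact ⟨e, t, [], _, .duo e hY hN hn (by rw [hp]; rfl), by rw [hp, hn]; rfl,
          hth.1 h1, ht, h2⟩
      · refine ⟨r, t, l ++ [e], rowNodes Y U ++ postNodes C, .duo e hY hN hn (by rw [hp]; rfl),
          by rw [hp, hn]; simp, h1, ht,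
          fun b hb => ?_⟩
        simp only [List.mem_append, List.mem_cons, List.not_mem_nil, or_false] at hb
        rcases hb with (hb | rfl) | hb
        · exact h3 b (by simp [hb])
        · exact hnth.1 h2
        · exact h3 b (by simp only [List.mem_append]; tauto)
  · obtain ⟨a, l, hn, ha, hl⟩ := id hY.1
    rcases hN with hN | hN
    · rcases h.duo_cases hS hN with ⟨hp, b, hb, ht, hnn⟩ | ⟨-, -, -, h1, -⟩
      · refine ⟨?_, a, b, l, [], .erase hY hN hnn hp hn rfl, by rw [hp, hn, hb]; rfl, ha, ht,
          by simpa using hl⟩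
        obtain ⟨X₁, X₂, hn', -, h1, -⟩ := hN.exists_nodes hNV.1
        rw [hnn] at hn'
        rw [← hNV.2.1, h1, ← (List.cons.inj hn').1]
        exact hY.2.1
      · exact absurd h1 hY.not_thin
    · refine ⟨hNV.2.1 ▸ hN.2.1, ?_⟩
      rcases prime_cases hN with ⟨hp, h1, h2⟩ | ⟨r, l', hp, h1, h2, h3⟩
      · exact absurd h1 hY.not_thin
      · refine ⟨r, a, l', l ++ (rowNodes Y U ++ postNodes C), .prime l hY hN hn hp,
          by rw [hp, hn]; rfl, h1, ha, fun b hb => ?_⟩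
        rcases List.mem_append.1 hb with hb | hb
        · exact h3 b (List.mem_append_left _ hb)
        rcases List.mem_append.1 hb with hb | hb
        · exact hl b hb
        · exact h3 b (List.mem_append_right _ hb)

/-- Only two kinds of stackings contain nested quadratic stackings. -/
theorem IsNest.isDoublePrime_or_isTriple (hS : S.Valid col) (h : IsNest col S C Y W U)
    (hN : (nest col C Y W U).IsQuad (arity col)) (hY : Y.IsQuad col) :
    (∃ r t L₁ L₂, IsDoublePrime col S r t L₁ L₂) ∨ ∃ a b t, IsTriple col S a b t := by
  by_cases hF : S.Flat
  · right
    obtain ⟨hF1, hF2⟩ := h.flat_nest.1 hF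
    have hN' := hN.resolve_right fun hN => hN.not_flat hF1
    have hY' := hY.resolve_right fun hY => hY.not_flat hF2
    have hlen := (h.perm hS).length_eq
    have h2 : (nest col C Y W U).nodes.length = 2 := hN'.2.1
    have h3 : Y.nodes.length = 2 := hY'.2.1
    rw [nodes_nest] at h2
    simp only [List.length_append, List.length_map, List.length_cons] at hlen h2
    obtain ⟨a, b, t, e⟩ := List.length_eq_three.1 (show S.nodes.length = 3 by omega)
    exact ⟨a, b, t, e, hF, h.balanced hS hN.balanced hY.balanced⟩
  · left
    obtain ⟨hpos, r, t, M₁, M₂, -, hL, hr, ht, hM⟩ := h.exists_primeShape hS hN hY hF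
    obtain ⟨r', l, l', h1, h2⟩ := h.exists_cons
    have hp := h.perm hS
    rw [h2] at hL
    obtain ⟨rfl, rfl⟩ := List.cons.inj hL
    rw [h2, h1, List.perm_cons] at hp
    obtain ⟨L₁, L₂, rfl⟩ := List.append_of_mem (hp.mem_iff.2 (by simp : t ∈ M₁ ++ t :: M₂))
    have hp' : (L₁ ++ L₂).Perm (M₁ ++ M₂) :=
      (List.perm_cons t).1 ((List.perm_middle.symm.trans hp).trans List.perm_middle)
    refine ⟨r', t, L₁, L₂, h1, hr, ht, fun b hb => hM b (hp'.mem_iff.1 hb), hpos, fun x y hl => ?_⟩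
    have := (h.level_nest hY.balanced hY.level x y).1 hl
    have := hN.level x y this
    rwa [(h.nest_valid hS).2.1, (h.nest_valid hS).2.2] at this

end Pairs

end Stacking

end BoxOperad

namespace BoxOperad

namespace Stacking

/-! ### The two pairs in a double prime stacking -/

section Pairs

variable {α : Type u} {col : α → Colour} {S : Stacking α} {C : List (Frame α)} {Y : Stacking α}
  {W : ℕ → ℕ} {U : ℕ → Stacking α}

/-- The surroundings of a box which is not the bottom one. -/
theorem exists_frame {r t : α} {l : List α} (hd : S.nodes.Nodup) (hn : S.nodes = r :: l)
    (ht : t ∈ l) : ∃ f C n w ch, Normal (f :: C) ∧ S = plug (f :: C) (box t n w ch) := by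
  obtain ⟨D, n, w, ch, hD, e⟩ := exists_plug (S := S) (t := t) (by rw [hn]; simp [ht])
  cases D with
  | cons f C => exact ⟨f, C, n, w, ch, hD, e⟩
  | nil =>
    rw [plug] at e
    rw [e, nodes] at hn
    obtain ⟨rfl, -⟩ := List.cons.inj hn
    rw [e, nodes, List.nodup_cons] at hd
    rw [(List.cons.inj hn).2] at hd
    exact absurd ht hd.1

theorem preNodes_ne_nil {f : Frame α} {C : List (Frame α)} : preNodes (f :: C) ≠ [] := by
  simp [preNodes, Frame.pre]

namespace IsDoublePrime

variable {r t : α} {L₁ L₂ : List α}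

theorem not_flat (h : IsDoublePrime col S r t L₁ L₂) : ¬ S.Flat := by
  intro hF
  have hn := h.nodes_eq
  have hpos := h.pos
  cases S with
  | eta => simp [left] at hpos
  | box b n w ch =>
    rw [nodes] at hn
    obtain ⟨rfl, -⟩ := List.cons.inj hn
    rw [hF.left_eq.1, h.root.1] at hpos
    exact lt_irrefl _ hpos

theorem nonThin_of_mem (h : IsDoublePrime col S r t L₁ L₂) {b : α} (hb : b ∈ S.nodes)
    (hr : b ≠ r) (ht : b ≠ t) : (col b).NonThin := by
  rw [h.nodes_eq] at hb
  simp only [List.mem_cons, List.mem_append] at hb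
  exact h.nonThin b (by simp only [List.mem_append]; tauto)

theorem eq_of_thin (h : IsDoublePrime col S r t L₁ L₂) {b : α} (hb : b ∈ S.nodes)
    (hr : b ≠ r) (hth : (col b).Thin) : b = t := by
  by_contra ht
  exact (h.nonThin_of_mem hb hr ht).1 hth

theorem balanced (h : IsDoublePrime col S r t L₁ L₂) : S.Balanced col := by
  intro b hb
  by_cases hr : b = r
  · subst hr; exact not_semiThin.2 (iff_of_true h.root.1 h.root.2)
  by_cases ht : b = t
  · subst ht; exact not_semiThin.2 (iff_of_true h.thin.1 h.thin.2)
  exact (h.nonThin_of_mem hb hr ht).2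

/-- The shape of a pair of nested quadratic substackings. -/
theorem primeShape (h : IsDoublePrime col S r t L₁ L₂) (hd : S.nodes.Nodup) (hS : S.Valid col)
    (hC : IsNest col S C Y W U) (hN : (nest col C Y W U).IsQuad (arity col))
    (hY : Y.IsQuad col) : ∃ M₁ M₂, PrimeShape col C Y W U r t M₁ M₂ ∧
      preNodes C ++ (Y.nodes ++ (rowNodes Y U ++ postNodes C)) = r :: (M₁ ++ t :: M₂) := by
  obtain ⟨-, r', t', M₁, M₂, hs, hL, -, ht', -⟩ := hC.exists_primeShape hS hN hY h.not_flat
  obtain ⟨r'', l, l', h1, h2⟩ := hC.exists_cons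
  have hp := hC.perm hS
  rw [hL] at h2 hp
  rw [h.nodes_eq] at h1
  obtain rfl : r' = r := (List.cons.inj h2).1.trans (List.cons.inj h1).1.symm
  have hd' := hp.nodup_iff.1 hd
  obtain rfl : t' = t := h.eq_of_thin (hp.mem_iff.2 (by simp)) (by
    rintro rfl
    simp at hd') ht'
  exact ⟨M₁, M₂, hs, hL⟩

/-- A substacking with the other thin box has a prime complement. -/
theorem isPrime_nest (h : IsDoublePrime col S r t L₁ L₂) (hd : S.nodes.Nodup) (hS : S.Valid col)
    (hC : IsNest col S C Y W U) (hY : Y.IsQuad col) (ht : t ∈ Y.nodes)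
    (h0 : preNodes C = [] → (Y.arity col).Thin) (h1 : preNodes C ≠ [] → (Y.arity col).NonThin) :
    (nest col C Y W U).IsPrime (arity col) := by
  have hN := hC.nest_valid hS
  have hp := hC.perm hS
  have hd' := hp.nodup_iff.1 hd
  obtain ⟨r', l, l', e1, e2⟩ := hC.exists_cons
  rw [h.nodes_eq] at e1
  obtain ⟨rfl, -⟩ := List.cons.inj e1
  refine ⟨?_, hN.2.1 ▸ h.pos, fun x y hl => ?_⟩
  · have hmem : ∀ b, b ∈ preNodes C ∨ b ∈ rowNodes Y U ++ postNodes C →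
        b ∈ S.nodes ∧ b ≠ t := by
      intro b hb
      refine ⟨hp.mem_iff.2 ?_, ?_⟩
      · simp only [List.mem_append] at hb ⊢; tauto
      · rintro rfl
        rw [List.nodup_append, List.nodup_append] at hd'
        rcases hb with hb | hb
        · exact hd'.2.2 _ hb _ (List.mem_append_left _ ht) rfl
        · exact hd'.2.1.2.2 _ ht _ hb rfl
    rw [nodes_nest]
    cases hpre : preNodes C with
    | nil =>
      refine ⟨Y, _, rfl, h0 hpre, fun X hX => ?_⟩
      obtain ⟨b, hb, rfl⟩ := List.mem_map.1 hX
      rw [arity_corolla]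
      have := hmem b (Or.inr hb)
      refine h.nonThin_of_mem this.1 ?_ this.2
      rintro rfl
      rw [hpre, List.nil_append] at e2 hd'
      have hne := hC.ne_eta
      rw [Ne, ← nodes_eq_nil] at hne
      obtain ⟨c, k, hk⟩ := List.exists_cons_of_ne_nil hne
      rw [hk] at e2 hd'
      obtain ⟨rfl, -⟩ := List.cons.inj e2
      simp only [List.cons_append, List.nodup_cons] at hd'
      exact hd'.1 (List.mem_append_right _ hb)
    | cons c k =>
      rw [hpre] at e2 hd'
      obtain ⟨rfl, -⟩ := List.cons.inj e2
      refine ⟨corolla col c, _, rfl, by rw [arity_corolla]; exact h.root, fun X hX => ?_⟩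
      rw [List.cons_append, List.nodup_cons] at hd'
      have key : ∀ b, b ∈ k ∨ b ∈ rowNodes Y U ++ postNodes C → (col b).NonThin := by
        intro b hb
        have := hmem b (by rw [hpre]; simp only [List.mem_cons]; tauto)
        refine h.nonThin_of_mem this.1 ?_ this.2
        rintro rfl
        refine hd'.1 ?_
        simp only [List.mem_append] at hb ⊢
        tauto
      rcases List.mem_append.1 hX with hX | hX
      · obtain ⟨b, hb, rfl⟩ := List.mem_map.1 hX
        rw [arity_corolla]
        exact key b (Or.inl hb)
      · rcases List.mem_cons.1 hX with rfl | hX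
        · exact h1 (by rw [hpre]; simp)
        · obtain ⟨b, hb, rfl⟩ := List.mem_map.1 hX
          rw [arity_corolla]
          exact key b (Or.inr hb)
  · rw [hN.2.1, hN.2.2]
    exact h.level x y ((hC.level_nest hY.balanced hY.level x y).2 hl)

/-- The other thin box and the box below it. -/
theorem exists_duo (h : IsDoublePrime col S r t L₁ L₂) (hd : S.nodes.Nodup) (hS : S.Valid col)
    {f : Frame α} (hC : Normal (f :: C)) {n : ℕ} {w : Fin (n + 1) → ℕ} {ch : Fin n → Stacking α}
    (e : S = plug (f :: C) (box t n w ch)) :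
    ∃ Y W U, IsNest col S C Y W U ∧ Y.IsDuo col ∧ Y.nodes = [f.a, t] ∧
      (nest col C Y W U).IsPrime (arity col) := by
  obtain ⟨Y, W, U, hN, hn, hF⟩ := exists_duo_nest hS hC h.thin e
  have hY : Y.IsDuo col := ⟨hN.balanced_part hS h.balanced, by rw [size, hn]; rfl, hF⟩
  refine ⟨Y, W, U, hN, hY, hn, h.isPrime_nest hd hS hN (Or.inl hY) (by simp [hn]) ?_ ?_⟩ <;>
  · intro hp
    obtain ⟨a, b, hn', -, hl, hr⟩ := hY.exists_nodes hN.cut.valid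
    rw [hn] at hn'
    obtain ⟨rfl, -⟩ := List.cons.inj hn'
    have hp' := hN.perm hS
    have hd' := hp'.nodup_iff.1 hd
    obtain ⟨r', l, l', e1, e2⟩ := hN.exists_cons
    rw [h.nodes_eq] at e1
    obtain ⟨rfl, -⟩ := List.cons.inj e1
    rw [hn] at hp' hd' e2
    simp only [Colour.Thin, nonThin_iff, arity, hl, hr]
    first
    | rw [hp] at e2
      obtain ⟨e3, -⟩ := List.cons.inj e2
      exact e3 ▸ h.root
    | obtain ⟨c, k, hk⟩ := List.exists_cons_of_ne_nil hp
      rw [hk] at e2 hd'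
      obtain ⟨rfl, -⟩ := List.cons.inj e2
      rw [List.cons_append, List.nodup_cons] at hd'
      refine nonThin_iff.1 (h.nonThin_of_mem (hp'.mem_iff.2 (by simp)) ?_ ?_)
      · intro e3
        exact hd'.1 (by simp [← e3])
      · intro e3
        rw [← e3] at hd'
        simp [List.nodup_append] at hd'

/-- Over the other thin box there are only non-thin boxes. -/
theorem nonThin_over (h : IsDoublePrime col S r t L₁ L₂) (hd : S.nodes.Nodup)
    {f : Frame α} {n : ℕ} {w : Fin (n + 1) → ℕ} {ch : Fin n → Stacking α}
    (e : S = plug (f :: C) (box t n w ch)) (i : Fin n) : ∀ b ∈ (ch i).nodes, (col b).NonThin := by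
  intro b hb
  have hn := congrArg nodes e
  rw [nodes_plug, nodes] at hn
  obtain ⟨c, k, hk⟩ := List.exists_cons_of_ne_nil (preNodes_ne_nil (f := f) (C := C))
  have hb' : b ∈ (List.ofFn fun i => (ch i).nodes).flatten :=
    List.mem_flatten.2 ⟨_, List.mem_ofFn.2 ⟨i, rfl⟩, hb⟩
  rw [hk] at hn
  have hc : c = r := by
    have := hn.symm.trans h.nodes_eq
    exact (List.cons.inj this).1
  subst hc
  rw [hn] at hd
  simp only [List.cons_append, List.nodup_cons, List.mem_append, List.mem_cons,
    List.nodup_append] at hd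
  refine h.nonThin_of_mem (by rw [hn]; simp only [List.mem_cons, List.mem_append]; tauto) ?_ ?_
  · rintro rfl; tauto
  · rintro rfl; tauto

/-- If there are no horizontal lines over the other thin box, then it is at the top. -/
theorem eq_corolla (h : IsDoublePrime col S r t L₁ L₂) (hd : S.nodes.Nodup) (hS : S.Valid col)
    {f : Frame α} {n : ℕ} {w : Fin (n + 1) → ℕ} {ch : Fin n → Stacking α}
    (e : S = plug (f :: C) (box t n w ch)) (hl : (box t n w ch).left col = 0) :
    box t n w ch = corolla col t := by
  have hV := valid_of_plug (e ▸ hS)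
  have hch := h.nonThin_over hd e
  have hw : ∀ i, w i = 0 := fun i => by
    have h0 : w 0 = 0 := by
      simp only [left] at hl
      omega
    refine (forall_of_row (P := fun i => w i = 0) (fun i => ?_) 0 i).1 h0
    have := left_eq_zero_iff (hV.2 i).1 fun b hb => (hch i b hb).2
    rwa [(hV.2 i).2.1, (hV.2 i).2.2] at this
  have hc : ∀ i, ch i = eta := fun i => by
    have h1 := (hV.2 i).2.1
    have h2 := hch i
    rw [hw] at h1
    cases hi : ch i with
    | eta => rfl
    | box b m v X =>
      rw [hi] at h1 h2
      have := (nonThin_iff.1 (h2 b (by simp [nodes]))).1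
      simp only [left] at h1
      omega
  obtain ⟨rfl, -⟩ := hV
  rw [corolla, show w = fun _ => 0 from funext hw, show ch = fun _ => eta from funext hc]

/-- If the other thin box is at the top, it can be taken off. -/
theorem exists_erase (h : IsDoublePrime col S r t L₁ L₂) (hd : S.nodes.Nodup) (hS : S.Valid col)
    {f : Frame α} (e : S = plug (f :: C) (corolla col t)) :
    ∃ Y W U, IsNest col S [] Y W U ∧ Y.IsPrime col ∧
      (nest col [] Y W U).nodes = [Y, corolla col t] ∧
      (nest col [] Y W U).IsDuo (arity col) := by
  obtain ⟨Y, W, U, hN, hn, hF⟩ := exists_erase_nest hS (by simp) h.thin e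
  have hNV := hN.nest_valid hS
  have hND : (nest col [] Y W U).IsDuo (arity col) :=
    ⟨hN.balanced_nest hS h.balanced, by rw [size, hn]; rfl, hF⟩
  obtain ⟨X, X', hn', -, hl, hr⟩ := hND.exists_nodes hNV.1
  rw [hn] at hn'
  obtain ⟨rfl, -⟩ := List.cons.inj hn'
  rw [hNV.2.1] at hl
  rw [hNV.2.2] at hr
  change S.left col = Y.left col at hl
  change S.right col = Y.right col at hr
  refine ⟨Y, W, U, hN, ⟨?_, hl ▸ h.pos, fun x y hxy => ?_⟩, hn, hND⟩
  · have hrow : rowNodes Y U ++ postNodes ([] : List (Frame α)) = [t] := by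
      have h1 := nodes_nest (col := col) (C := []) (Y := Y) (W := W) (U := U)
      rw [hn] at h1
      simp only [preNodes, List.map_nil, List.nil_append, List.cons.injEq, true_and] at h1
      exact corolla_injective.list_map h1.symm
    obtain ⟨r', l, l', e1, e2⟩ := hN.exists_cons
    have hp := hN.perm hS
    have hd' := hp.nodup_iff.1 hd
    rw [hrow, preNodes, List.nil_append] at e2 hp hd'
    have hne := hN.ne_eta
    rw [Ne, ← nodes_eq_nil] at hne
    obtain ⟨c, k, hk⟩ := List.exists_cons_of_ne_nil hne
    rw [hk] at e2 hp hd'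
    rw [h.nodes_eq] at e1
    obtain ⟨rfl, -⟩ := List.cons.inj e1
    obtain ⟨rfl, -⟩ := List.cons.inj e2
    refine ⟨c, k, hk, h.root, fun b hb => h.nonThin_of_mem (hp.mem_iff.2 (by simp [hb])) ?_ ?_⟩
    · rintro rfl
      simp [hb] at hd'
    · rintro rfl
      rw [List.nodup_append] at hd'
      exact hd'.2.2 b (List.mem_cons_of_mem _ hb) b (by simp) rfl
  · have h1 : S.Level col x y := by
      rw [hN.eq, plug, level_graft hN.cut.valid (hN.balanced_part hS h.balanced) hN.cut.row]
      exact Or.inl hxy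
    have h2 := h.level x y h1
    rwa [hl, hr] at h2

/-- If there are horizontal lines over the other thin box, it is the bottom box of a prime
substacking. -/
theorem exists_prime (h : IsDoublePrime col S r t L₁ L₂) (hd : S.nodes.Nodup) (hS : S.Valid col)
    {f : Frame α} (hC : Normal (f :: C)) {n : ℕ} {w : Fin (n + 1) → ℕ} {ch : Fin n → Stacking α}
    (e : S = plug (f :: C) (box t n w ch)) (hl : 0 < (box t n w ch).left col) :
    ∃ Y W U, IsNest col S (f :: C) Y W U ∧ Y.IsPrime col ∧ (∃ l, Y.nodes = t :: l) ∧
      (nest col (f :: C) Y W U).IsPrime (arity col) := by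
  obtain ⟨Y, W, U, hN, ⟨l, hn⟩, hY⟩ :=
    exists_prime_nest hS hC h.thin (h.nonThin_over hd e) hl e
  exact ⟨Y, W, U, hN, hY, ⟨l, hn⟩, h.isPrime_nest hd hS hN (Or.inr hY) (by simp [hn])
    (fun hp => absurd hp preNodes_ne_nil) fun _ => hY.nonThin hN.cut.valid⟩

/-- There are exactly two pairs of nested quadratic substackings: the other thin box `t` is joined
with the box below it, or else it is the bottom box of a prime substacking, if there are lines over
it, and is taken off, if there are none. -/
theorem exists_two_pairs (h : IsDoublePrime col S r t L₁ L₂) (hd : S.nodes.Nodup)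
    (hS : S.Valid col) : ∃ C Y W U C' Y' W' U',
    IsNest col S C Y W U ∧ (nest col C Y W U).IsPrime (arity col) ∧ Y.IsDuo col ∧
    IsNest col S C' Y' W' U' ∧ (nest col C' Y' W' U').IsQuad (arity col) ∧ Y'.IsPrime col ∧
    ∀ C₁ Y₁ W₁ U₁, IsNest col S C₁ Y₁ W₁ U₁ → (nest col C₁ Y₁ W₁ U₁).IsQuad (arity col) →
      Y₁.IsQuad col → (Y₁ = Y ∧ nest col C₁ Y₁ W₁ U₁ = nest col C Y W U) ∨
        (Y₁ = Y' ∧ nest col C₁ Y₁ W₁ U₁ = nest col C' Y' W' U') := by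
  obtain ⟨f, C, n, w, ch, hC, e⟩ := exists_frame hd h.nodes_eq (by simp : t ∈ L₁ ++ t :: L₂)
  obtain ⟨Y, W, U, hN, hY, hn, hNP⟩ := h.exists_duo hd hS hC e
  rcases Nat.eq_zero_or_pos ((box t n w ch).left col) with hl | hl
  · rw [h.eq_corolla hd hS e hl] at e
    obtain ⟨Y', W', U', hN', hY', hn', hND⟩ := h.exists_erase hd hS e
    refine ⟨C, Y, W, U, [], Y', W', U', hN, hNP, hY, hN', Or.inl hND, hY', ?_⟩
    intro C₁ Y₁ W₁ U₁ h₁ hq hq'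
    obtain ⟨M₁, M₂, hs, -⟩ := h.primeShape hd hS h₁ hq hq'
    cases hs with
    | duo e' hY₁ hN₁ hn₁ _ => exact Or.inl (duo_unique hd h₁ hN hY₁.2.2 hY.2.2 hn₁ hn)
    | erase hY₁ hN₁ hn₁ _ _ _ =>
      exact Or.inr (erase_unique hd hS h₁ hN' hN₁.2.2 hND.2.2 hn₁ hn')
    | prime l hY₁ hN₁ hn₁ _ =>
      -- a prime substacking with the bottom box `t` needs lines over `t`
      exfalso
      obtain ⟨n', w', ch', e'⟩ := exists_graft_eq_box (W := W₁) (U := U₁) hn₁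
      have h1 := h₁.eq
      rw [e'] at h1
      obtain ⟨-, h2⟩ := plug_unique h₁.normal hC (h1 ▸ hd) (h1.symm.trans e)
      have h3 := h₁.cut.left_eq
      rw [e', h2] at h3
      have h4 := hY₁.2.1
      have h5 : (corolla col t).left col = 0 := by simp [corolla, left, h.thin.1]
      rw [corolla] at h5
      omega
  · obtain ⟨Y', W', U', hN', hY', ⟨l', hn'⟩, hNP'⟩ := h.exists_prime hd hS hC e hl
    refine ⟨C, Y, W, U, f :: C, Y', W', U', hN, hNP, hY, hN', Or.inr hNP', hY', ?_⟩
    intro C₁ Y₁ W₁ U₁ h₁ hq hq'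
    obtain ⟨M₁, M₂, hs, -⟩ := h.primeShape hd hS h₁ hq hq'
    cases hs with
    | duo e' hY₁ hN₁ hn₁ _ => exact Or.inl (duo_unique hd h₁ hN hY₁.2.2 hY.2.2 hn₁ hn)
    | erase hY₁ hN₁ hn₁ _ _ _ =>
      -- only a box without lines over it can be taken off
      exfalso
      obtain ⟨-, D, hD, e', -⟩ := exists_of_erase h₁ hN₁.2.2 hn₁ (by
        rintro rfl
        have h4 := hY₁.2.1
        simp [corolla, left, h.thin.1] at h4) (h₁.nest_valid hS).1
      rw [corolla] at e'
      obtain ⟨-, h2⟩ := plug_unique hD hC (e' ▸ hd) (e'.symm.trans e)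
      rw [← h2] at hl
      simp [left, h.thin.1] at hl
    | prime l hY₁ hN₁ hn₁ _ =>
      exact Or.inr (prime_unique hd h₁ hN' hY₁ hY' hn₁ hn')

end IsDoublePrime

end Pairs

end Stacking

end BoxOperad

namespace BoxOperad

namespace Stacking

/-! ### The two pairs in a stacking of three boxes -/

section Triples

variable {α : Type u} {col : α → Colour} {S : Stacking α} {C : List (Frame α)} {Y : Stacking α}
  {W : ℕ → ℕ} {U : ℕ → Stacking α}

namespace IsTriple

variable {a b t : α}

theorem thin (h : IsTriple col S a b t) (hS : S.Valid col) : (col b).Thin ∧ (col t).Thin := by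
  have hn := h.nodes_eq
  have hF := h.flat
  cases S with
  | eta => simp [nodes] at hn
  | box c n w ch =>
    rw [nodes] at hn
    have h2 := (List.cons.inj hn).2
    have key : ∀ x ∈ [b, t], (col x).Thin := fun x hx => by
      rw [← h2] at hx
      obtain ⟨l, hl, hx⟩ := List.mem_flatten.1 hx
      obtain ⟨i, rfl⟩ := List.mem_ofFn.1 hl
      exact hF.thin hS hx
    exact ⟨key b (by simp), key t (by simp)⟩

theorem isDuo (h : IsTriple col S a b t) (hC : IsNest col S C Y W U)
    (hN : (nest col C Y W U).IsQuad (arity col)) (hY : Y.IsQuad col) :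
    (nest col C Y W U).IsDuo (arity col) ∧ Y.IsDuo col := by
  obtain ⟨hF1, hF2⟩ := hC.flat_nest.1 h.flat
  exact ⟨hN.resolve_right fun hN => hN.not_flat hF1, hY.resolve_right fun hY => hY.not_flat hF2⟩

/-- The three pairs of nested substackings which can occur. The first two, in which `t` is on `a` or
on `b`, exclude each other. -/
theorem shape (h : IsTriple col S a b t) (hd : S.nodes.Nodup) (hS : S.Valid col)
    (hC : IsNest col S C Y W U) (hN : (nest col C Y W U).IsDuo (arity col)) (hY : Y.IsDuo col) :
    (preNodes C = [] ∧ rowNodes Y U ++ postNodes C = [b] ∧ Y.nodes = [a, t] ∧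
      (nest col C Y W U).nodes = [Y, corolla col b]) ∨
    (preNodes C = [a] ∧ rowNodes Y U ++ postNodes C = [] ∧ Y.nodes = [b, t] ∧
      (nest col C Y W U).nodes = [corolla col a, Y]) ∨
    (preNodes C = [] ∧ rowNodes Y U ++ postNodes C = [t] ∧ Y.nodes = [a, b] ∧
      (nest col C Y W U).nodes = [Y, corolla col t]) := by
  obtain ⟨x, y, hn, -⟩ := hY.exists_nodes hC.cut.valid
  obtain ⟨r, l, l', e1, e2⟩ := hC.exists_cons
  have hp := hC.perm hS
  have hSn := hC.eq
  rw [h.nodes_eq] at e1 hp hd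
  obtain ⟨rfl, -⟩ := List.cons.inj e1
  rcases hC.duo_cases hS hN with ⟨h1, c, h2, -, h3⟩ | ⟨c, h1, h2, -, h3⟩
  · rw [h1, h2, hn] at e2 hp
    simp only [List.nil_append, List.cons_append, List.cons.injEq] at e2
    obtain ⟨rfl, -⟩ := e2
    simp only [List.nil_append, List.cons_append, List.perm_cons] at hp
    have hp' : [b, t] = [y, c] ∨ [b, t] = [c, y] := List.perm_pair.1 hp
    rcases hp' with hp' | hp' <;>
    · simp only [List.cons.injEq, and_true] at hp'
      obtain ⟨rfl, rfl⟩ := hp'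
      simp only [h1, h2, h3, hn, true_and, and_true]
      tauto
  · right; left
    rw [h1, h2, hn] at e2 hp
    simp only [List.cons_append, List.cons.injEq] at e2
    obtain ⟨rfl, -⟩ := e2
    obtain ⟨n, w, ch, e⟩ := exists_graft_eq_box (W := W) (U := U) hn
    have h4 := congrArg nodes hSn
    rw [nodes_plug, h1, e, nodes, h.nodes_eq] at h4
    simp only [List.cons_append, List.nil_append, List.cons.injEq, true_and] at h4
    obtain ⟨rfl, -⟩ := h4
    have h5 := hp
    simp only [List.cons_append, List.nil_append, List.perm_cons, List.perm_singleton,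
      List.append_nil, List.cons.injEq, and_true] at h5
    subst h5
    exact ⟨h1, h2, hn, h3⟩

/-- There are exactly two pairs of nested quadratic substackings: the last box `t` is joined with
the box below it, or it is taken off. -/
theorem exists_two_pairs (h : IsTriple col S a b t) (hd : S.nodes.Nodup)
    (hS : S.Valid col) : ∃ C Y W U e C' Y' W' U',
    IsNest col S C Y W U ∧ (nest col C Y W U).IsDuo (arity col) ∧ Y.IsDuo col ∧
    Y.nodes = [e, t] ∧
    IsNest col S C' Y' W' U' ∧ (nest col C' Y' W' U').IsDuo (arity col) ∧ Y'.IsDuo col ∧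
    Y'.nodes = [a, b] ∧
    ∀ C₁ Y₁ W₁ U₁, IsNest col S C₁ Y₁ W₁ U₁ → (nest col C₁ Y₁ W₁ U₁).IsQuad (arity col) →
      Y₁.IsQuad col → (Y₁ = Y ∧ nest col C₁ Y₁ W₁ U₁ = nest col C Y W U) ∨
        (Y₁ = Y' ∧ nest col C₁ Y₁ W₁ U₁ = nest col C' Y' W' U') := by
  have ht := (h.thin hS).2
  obtain ⟨f, C, n, w, ch, hC, e⟩ := exists_frame hd h.nodes_eq (by simp : t ∈ [b, t])
  have hlen : S.nodes.length = 3 := by rw [h.nodes_eq]; rfl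
  -- a box over the last one would come after it
  have hT : box t n w ch = corolla col t := by
    have h1 := congrArg nodes e
    rw [nodes_plug, nodes, h.nodes_eq, List.cons_append] at h1
    have hch : (List.ofFn fun i => (ch i).nodes).flatten = [] := by
      have h2 := hd
      rw [h.nodes_eq, h1] at h2
      by_contra hne
      have h3 : t = (preNodes (f :: C) ++
          t :: ((List.ofFn fun i => (ch i).nodes).flatten ++ postNodes (f :: C))).getLast
            (by simp) := by
        simp only [← h1]; rfl
      rw [List.getLast_append_of_ne_nil _ (by simp), List.getLast_cons (by simp [hne])] at h3
      have h4 := List.getLast_mem (l := (List.ofFn fun i => (ch i).nodes).flatten ++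
        postNodes (f :: C)) (by simp [hne])
      rw [← h3] at h4
      rw [List.nodup_append, List.nodup_cons] at h2
      exact h2.2.1.1 h4
    have hV := valid_of_plug (e ▸ hS)
    have hF := flat_of_plug (e ▸ h.flat)
    obtain ⟨rfl, -⟩ := hV
    rw [corolla, show w = fun _ => 0 from funext hF.1, show ch = fun _ => eta from funext fun i =>
      nodes_eq_nil.1 (List.flatten_eq_nil_iff.1 hch _ (List.mem_ofFn.2 ⟨i, rfl⟩))]
  obtain ⟨Y, W, U, hN, hn, hF⟩ := exists_duo_nest hS hC ht e
  have hY : Y.IsDuo col := ⟨hN.balanced_part hS h.balanced, by rw [size, hn]; rfl, hF⟩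
  have hND : (nest col C Y W U).IsDuo (arity col) := by
    refine ⟨hN.balanced_nest hS h.balanced, ?_, (hN.flat_nest.1 h.flat).1⟩
    have h1 := (hN.perm hS).length_eq
    rw [hn, hlen] at h1
    rw [size, nodes_nest]
    simp only [List.length_append, List.length_map, List.length_cons, List.length_nil] at h1 ⊢
    omega
  rw [hT] at e
  obtain ⟨Y', W', U', hN', hn', hF'⟩ := exists_erase_nest hS (by simp) ht e
  have hND' : (nest col [] Y' W' U').IsDuo (arity col) :=
    ⟨hN'.balanced_nest hS h.balanced, by rw [size, hn']; rfl, hF'⟩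
  have hY' : Y'.IsDuo col := by
    refine ⟨hN'.balanced_part hS h.balanced, ?_, (hN'.flat_nest.1 h.flat).2⟩
    have h1 := (hN'.perm hS).length_eq
    have h2 := congrArg List.length hn'
    rw [nodes_nest] at h2
    rw [hlen] at h1
    rw [size]
    simp only [List.length_append, List.length_map, List.length_cons, List.length_nil] at h1 h2 ⊢
    omega
  have hne : b ≠ t := fun e => by
    rw [h.nodes_eq] at hd
    simp [e] at hd
  have hYn' : Y'.nodes = [a, b] := by
    rcases h.shape hd hS hN' hND' hY' with ⟨-, -, h1, h2⟩ | ⟨h1, -⟩ | ⟨-, -, h1, -⟩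
    · rw [hn'] at h2
      simp only [List.cons.injEq, and_true, true_and, corolla_injective.eq_iff] at h2
      exact absurd h2.symm hne
    · simp [preNodes] at h1
    · exact h1
  refine ⟨C, Y, W, U, f.a, [], Y', W', U', hN, hND, hY, hn, hN', hND', hY', hYn', ?_⟩
  intro C₁ Y₁ W₁ U₁ h₁ hq hq'
  obtain ⟨hD₁, hY₁⟩ := h.isDuo h₁ hq hq'
  rcases h.shape hd hS h₁ hD₁ hY₁ with ⟨-, -, h2, -⟩ | ⟨-, -, h2, -⟩ | ⟨-, -, -, h2⟩
  · exact Or.inl (duo_unique hd h₁ hN hY₁.2.2 hF h2 hn)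
  · exact Or.inl (duo_unique hd h₁ hN hY₁.2.2 hF h2 hn)
  · exact Or.inr (erase_unique hd hS h₁ hN' hD₁.2.2 hF' h2 hn')

end IsTriple

end Triples

end Stacking

end BoxOperad

namespace BoxOperad

open Stacking

/-! ### The signs of the pairs -/

section PairSigns

variable {α : Type u} {col : α → Colour} {δ : α → ℤ} {S : Stacking α} {C : List (Frame α)}
  {Y : Stacking α} {W : ℕ → ℕ} {U : ℕ → Stacking α}

/-- The degree of the suspension of an element of degree `δ l`. -/
noncomputable def suspDeg (col : α → Colour) (δ : α → ℤ) (l : α) : ℤ := δ l + thinShift (col l)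

/-- The Koszul pairing after suspension, divided by the one before. In the coefficients of the
square both signs occur, since the comultiplication uses the suspended and the associativity of the
composition uses the unsuspended degrees. -/
noncomputable def suspKos (col : α → Colour) (δ : α → ℤ) (a b : α) : ℤˣ :=
  kos (suspDeg col δ) a b * kos δ a b

/-- The pairing is symmetric. -/
theorem suspKos_symm (a b : α) : suspKos col δ a b = suspKos col δ b a := by
  rw [suspKos, suspKos, kos_symm, kos_symm δ]

theorem suspKos_nonThin {a b : α} (ha : (col a).NonThin) (hb : (col b).NonThin) :
    suspKos col δ a b = 1 := by
  rw [suspKos, kos, kos, suspDeg, suspDeg, thinShift_of_not_thin ha.1,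
    thinShift_of_not_thin hb.1, add_zero, add_zero]
  exact Int.units_mul_self _

theorem suspKos_thin_nonThin {a b : α} (ha : (col a).Thin) (hb : (col b).NonThin) :
    suspKos col δ a b = (suspDeg col δ b).negOnePow := by
  rw [suspKos, kos, kos, suspDeg, suspDeg, thinShift_of_thin ha, thinShift_of_not_thin hb.1,
    ← Int.negOnePow_add, Int.negOnePow_eq_iff]
  exact ⟨δ a * δ b, by ring⟩

theorem suspKos_thin {a b : α} (ha : (col a).Thin) (hb : (col b).Thin) :
    suspKos col δ a b = (suspDeg col δ a + suspDeg col δ b + 1).negOnePow := by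
  rw [suspKos, kos, kos, suspDeg, suspDeg, thinShift_of_thin ha, thinShift_of_thin hb,
    ← Int.negOnePow_add, Int.negOnePow_eq_iff]
  exact ⟨δ a * δ b - 1, by ring⟩

/-- The sign of a rearrangement of a list with two thin elements, the first of them fixed. -/
theorem kperm_thin {r t : α} {L₁ L₂ M₁ M₂ : List α} (ht : (col t).Thin)
    (hL : ∀ b ∈ L₁ ++ L₂, (col b).NonThin)
    (hp : (r :: (L₁ ++ t :: L₂)).Perm (r :: (M₁ ++ t :: M₂))) :
    KPerm (suspKos col δ) (r :: (L₁ ++ t :: L₂)) (r :: (M₁ ++ t :: M₂))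
      ((L₁.map (suspDeg col δ)).sum + (M₁.map (suspDeg col δ)).sum).negOnePow := by
  have hp' : (L₁ ++ L₂).Perm (M₁ ++ M₂) := (List.perm_cons t).1
    ((List.perm_middle.symm.trans ((List.perm_cons r).1 hp)).trans List.perm_middle)
  have key : ∀ L : List α, (∀ b ∈ L, (col b).NonThin) →
      (L.map (suspKos col δ t)).prod = ((L.map (suspDeg col δ)).sum).negOnePow := fun L hL => by
    rw [negOnePow_sum]
    exact congrArg _ (List.map_congr_left fun b hb => suspKos_thin_nonThin ht (hL b hb))
  refine (((KPerm.move' t L₁ L₂).symm suspKos_symm).trans (((KPerm.one_of_trivial hp'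
    fun a ha b hb => suspKos_nonThin (hL a ha) (hL b hb)).cons t).trans
      (KPerm.move' t M₁ M₂))).cons r |>.of_eq ?_
  rw [one_mul, key L₁ fun b hb => hL b (by simp [hb]), key M₁ fun b hb =>
    hL b (hp'.mem_iff.2 (by simp [hb])), Int.negOnePow_add]

theorem sum_suspDeg_of_isQuad (hV : Y.Valid col) (h : Y.IsQuad col) :
    (Y.nodes.map (suspDeg col δ)).sum = (Y.nodes.map δ).sum + thinShift (Y.arity col) + 1 := by
  have h1 := List.sum_map_add (l := Y.nodes) (f := δ) (g := fun l => thinShift (col l))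
  rw [sum_thinShift hV h] at h1
  rw [add_assoc, ← h1]
  rfl

/-- The sign of a decomposition into a quadratic substacking with a box on it: suspension raises the
degree of the substacking by one more than that of its composite. -/
theorem barSign_nest_left (hS : S.Valid col) (h : IsNest col S C Y W U)
    (hN : (nest col C Y W U).IsDuo (arity col)) (hY : Y.IsQuad col) {X : Stacking α}
    (hn : (nest col C Y W U).nodes = [Y, X]) :
    barSign ((nest col C Y W U).map fun X => (arity col X, (X.nodes.map δ).sum)) =
      (((Y.nodes.map (suspDeg col δ)).sum - 1).negOnePow : ℤ) := by
  rw [barSign_duo (h.nest_valid hS).1 hN hn, sum_suspDeg_of_isQuad h.cut.valid hY,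
    add_sub_cancel_right]

/-- The coefficient of a pair of nested substackings in terms of the sign `s` of the rearrangement.
-/
theorem pairCoeff_nest (hd : S.nodes.Nodup) (hS : S.Valid col) (h : IsNest col S C Y W U) {s : ℤˣ}
    (hs : KPerm (suspKos col δ) S.nodes (preNodes C ++ (Y.nodes ++ (rowNodes Y U ++ postNodes C)))
      s) :
    pairCoeff col δ S (nest col C Y W U) Y =
      (s : ℤ) * ((((preNodes C).map (suspDeg col δ)).sum.negOnePow : ℤ) *
        (barSign ((nest col C Y W U).map fun X => (arity col X, (X.nodes.map δ).sum)) *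
          barSign (Y.map fun l => (col l, δ l)))) := by
  have hp := h.perm hS
  have hsgn : ksgn (kos fun l => δ l + thinShift (col l)) S.nodes (nest col C Y W U).nestNodes *
      ksgn (kos δ) S.nodes (nest col C Y W U).nestNodes = s := by
    rw [nestNodes_nest]
    exact KPerm.unique suspKos_symm hd ((ksgn_spec _ hp).mul (kos_symm _) (kos_symm _) hd
      (ksgn_spec _ hp)) hs
  have hY : Y ∉ (preNodes C).map (corolla col) := fun hY => by
    have h1 := (nestings_nodup hd (h.mem_nestings hS)).1
    rw [nodes_nest, List.nodup_append] at h1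
    exact h1.2.2 Y hY Y (by simp) rfl
  have hpre : pre (fun X => (X.nodes.map fun l => δ l + thinShift (col l)).sum)
      (nest col C Y W U).nodes Y = ((preNodes C).map (suspDeg col δ)).sum := by
    rw [nodes_nest, pre_append_cons _ _ _ _ hY, List.map_map]
    congr 1
    refine List.map_congr_left fun a _ => ?_
    simp [nodes_corolla, suspDeg]
  rw [pairCoeff, if_pos fun X hX hXY => eq_corolla_of_mem_nest hX hXY, hpre, ← hsgn, neg_one_mul,
    Int.negOnePow_neg, Units.val_mul]
  ring

/-- The two pairs in a double prime stacking have opposite signs: one of them has a substacking with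
two boxes, the other one a prime substacking. -/
theorem pairCoeff_doublePrime {r t : α} {L₁ L₂ : List α} (hQ : IsDoublePrime col S r t L₁ L₂)
    (hd : S.nodes.Nodup) (hS : S.Valid col) (h : IsNest col S C Y W U)
    (hN : (nest col C Y W U).IsQuad (arity col)) (hY : Y.IsQuad col) :
    (Y.IsDuo col → pairCoeff col δ S (nest col C Y W U) Y =
      -((suspDeg col δ r + (L₁.map (suspDeg col δ)).sum).negOnePow : ℤ)) ∧
    (Y.IsPrime col → pairCoeff col δ S (nest col C Y W U) Y =
      ((suspDeg col δ r + (L₁.map (suspDeg col δ)).sum).negOnePow : ℤ)) := by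
  obtain ⟨M₁, M₂, hs, hL⟩ := hQ.primeShape hd hS h hN hY
  have hp := h.perm hS
  rw [hL, hQ.nodes_eq] at hp
  have hk := kperm_thin (δ := δ) hQ.thin hQ.nonThin hp
  rw [← hQ.nodes_eq, ← hL] at hk
  rw [pairCoeff_nest hd hS h hk]
  have hNV := (h.nest_valid hS).1
  cases hs with
  | duo e hY hN hn hp =>
    have h1 := congrArg (fun l => (l.map (suspDeg col δ)).sum) hp
    simp only [List.map_append, List.map_cons, List.map_nil, List.sum_append, List.sum_cons,
      List.sum_nil, add_zero] at h1
    refine ⟨fun _ => ?_, fun hY' => absurd hY.2.2 hY'.not_flat⟩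
    rw [barSign_prime hNV hN, barSign_duo h.cut.valid hY hn]
    simp only [mul_neg, neg_mul, one_mul, ← Units.val_mul, ← Int.negOnePow_add]
    rw [neg_inj, Units.val_inj, Int.negOnePow_eq_iff]
    refine ⟨(M₁.map (suspDeg col δ)).sum, ?_⟩
    rw [show δ e + thinShift (col e) = suspDeg col δ e from rfl, h1]
    ring
  | erase hY hN hn hp hn' hM =>
    refine ⟨fun hY' => absurd hY'.2.2 hY.not_flat, fun _ => ?_⟩
    rw [barSign_nest_left hS h hN (Or.inr hY) hn,
      barSign_prime h.cut.valid hY, hp, hn']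
    simp only [mul_neg, mul_one, List.map_nil, List.sum_nil, Int.negOnePow_zero, Units.val_one,
      one_mul, List.map_cons, List.sum_cons, Int.negOnePow_sub, Int.negOnePow_one, Units.val_neg,
      neg_neg, ← Units.val_mul, ← Int.negOnePow_add]
    rw [Units.val_inj, Int.negOnePow_eq_iff]
    exact ⟨(M₁.map (suspDeg col δ)).sum, by ring⟩
  | prime l hY hN hn hp =>
    refine ⟨fun hY' => absurd hY'.2.2 hY.not_flat, fun _ => ?_⟩
    rw [barSign_prime hNV hN, barSign_prime h.cut.valid hY, hp]
    simp only [mul_neg, mul_one, neg_neg, List.map_cons, List.sum_cons,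
      ← Units.val_mul, ← Int.negOnePow_add]
    rw [Units.val_inj, Int.negOnePow_eq_iff]
    exact ⟨(M₁.map (suspDeg col δ)).sum, by ring⟩

/-- The two pairs in a stacking of three boxes have opposite signs. -/
theorem pairCoeff_triple {a b t : α} (hQ : IsTriple col S a b t)
    (hd : S.nodes.Nodup) (hS : S.Valid col) (h : IsNest col S C Y W U)
    (hN : (nest col C Y W U).IsDuo (arity col)) (hY : Y.IsDuo col) :
    (∀ e, Y.nodes = [e, t] →
      pairCoeff col δ S (nest col C Y W U) Y = ((suspDeg col δ b).negOnePow : ℤ)) ∧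
    (Y.nodes = [a, b] →
      pairCoeff col δ S (nest col C Y W U) Y = -((suspDeg col δ b).negOnePow : ℤ)) := by
  obtain ⟨hb, ht⟩ := hQ.thin hS
  have hbt : b ≠ t := fun e => by
    rw [hQ.nodes_eq] at hd
    simp [e] at hd
  have hNV := (h.nest_valid hS).1
  rcases hQ.shape hd hS h hN hY with ⟨h1, h2, h3, h4⟩ | ⟨h1, h2, h3, h4⟩ | ⟨h1, h2, h3, h4⟩
  · have hk : KPerm (suspKos col δ) S.nodes
        (preNodes C ++ (Y.nodes ++ (rowNodes Y U ++ postNodes C))) (suspKos col δ b t) := by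
      rw [hQ.nodes_eq, h1, h2, h3]
      exact (KPerm.swap b t []).cons a
    refine ⟨fun e he => ?_, fun he => absurd (h3.symm.trans he) (by simp [hbt.symm])⟩
    rw [pairCoeff_nest hd hS h hk, barSign_nest_left hS h hN (Or.inl hY) h4,
      barSign_duo h.cut.valid hY h3, h1, h3, suspKos_thin hb ht]
    simp only [← Units.val_mul, ← Int.negOnePow_add]
    rw [Units.val_inj, Int.negOnePow_eq_iff]
    refine ⟨suspDeg col δ a + suspDeg col δ t, ?_⟩
    rw [show δ a + thinShift (col a) = suspDeg col δ a from rfl]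
    simp only [List.map_nil, List.sum_nil, List.map_cons, List.sum_cons]
    ring
  · have hk : KPerm (suspKos col δ) S.nodes
        (preNodes C ++ (Y.nodes ++ (rowNodes Y U ++ postNodes C))) 1 := by
      rw [hQ.nodes_eq, h1, h2, h3]
      exact KPerm.refl _
    refine ⟨fun e he => ?_, fun he => absurd (h3.symm.trans he) (by simp [hbt.symm])⟩
    rw [pairCoeff_nest hd hS h hk, barSign_duo hNV hN h4, barSign_duo h.cut.valid hY h3, h1,
      arity_corolla, nodes_corolla]
    simp only [← Units.val_mul, ← Int.negOnePow_add, one_mul]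
    rw [Units.val_inj, Int.negOnePow_eq_iff]
    refine ⟨suspDeg col δ a, ?_⟩
    simp only [List.map_nil, List.sum_nil, List.map_cons, List.sum_cons, suspDeg]
    ring
  · have hk : KPerm (suspKos col δ) S.nodes
        (preNodes C ++ (Y.nodes ++ (rowNodes Y U ++ postNodes C))) 1 := by
      rw [hQ.nodes_eq, h1, h2, h3]
      exact KPerm.refl _
    refine ⟨fun e he => absurd (h3.symm.trans he) (by simp [hbt]), fun _ => ?_⟩
    rw [pairCoeff_nest hd hS h hk, barSign_nest_left hS h hN (Or.inl hY) h4,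
      barSign_duo h.cut.valid hY h3, h1, h3]
    simp only [← Units.val_mul, ← Int.negOnePow_add, one_mul]
    rw [← Units.val_neg, Units.val_inj, ← Int.negOnePow_succ, Int.negOnePow_eq_iff]
    refine ⟨suspDeg col δ a - 1, ?_⟩
    rw [show δ a + thinShift (col a) = suspDeg col δ a from rfl]
    simp only [List.map_nil, List.sum_nil, List.map_cons, List.sum_cons]
    ring

theorem exists_isNest_of_pairCoeff_ne_zero (hd : S.nodes.Nodup) {N : Stacking (Stacking α)}
    (hN : N ∈ nestings col S) (hY : Y ∈ N.nodes) (h : pairCoeff col δ S N Y ≠ 0) :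
    ∃ C W U, IsNest col S C Y W U ∧ N = nest col C Y W U ∧ N.IsQuad (arity col) ∧ Y.IsQuad col := by
  rw [pairCoeff] at h
  split_ifs at h with hc
  · obtain ⟨C, W, U, h1, h2⟩ := exists_isNest hd hN hY hc
    refine ⟨C, W, U, h1, h2, ?_, ?_⟩
    · by_contra hq
      exact h (by rw [barSign_eq_zero hN.1.2 hq, zero_mul, mul_zero, mul_zero])
    · by_contra hq
      exact h (by rw [barSign_eq_zero h1.cut.valid hq, zero_mul, mul_zero, mul_zero, mul_zero])
  · exact absurd rfl h

/-- If there are exactly two pairs, and their coefficients are opposite, then the sum vanishes. -/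
theorem sum_pairCoeff_of_two [DecidableEq (Stacking α)] {C' : List (Frame α)} {Y' : Stacking α}
    {W' : ℕ → ℕ} {U' : ℕ → Stacking α} (hd : S.nodes.Nodup) (hS : S.Valid col)
    (h : IsNest col S C Y W U) (h' : IsNest col S C' Y' W' U')
    (hsum : pairCoeff col δ S (nest col C Y W U) Y +
      pairCoeff col δ S (nest col C' Y' W' U') Y' = 0)
    (huniq : ∀ C₁ Y₁ W₁ U₁, IsNest col S C₁ Y₁ W₁ U₁ →
      (nest col C₁ Y₁ W₁ U₁).IsQuad (arity col) → Y₁.IsQuad col →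
      (Y₁ = Y ∧ nest col C₁ Y₁ W₁ U₁ = nest col C Y W U) ∨
        (Y₁ = Y' ∧ nest col C₁ Y₁ W₁ U₁ = nest col C' Y' W' U')) (hYY : Y ≠ Y') :
    ∑ N ∈ (finite_nestings col S).toFinset, ∑ Y ∈ N.nodes.toFinset, pairCoeff col δ S N Y = 0 := by
  classical
  rw [Finset.sum_sigma']
  rw [Finset.sum_eq_add (⟨nest col C Y W U, Y⟩ : Σ _ : Stacking (Stacking α), Stacking α)
    ⟨nest col C' Y' W' U', Y'⟩ (fun e => hYY (congrArg Sigma.snd e)) ?_ ?_ ?_]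
  · exact hsum
  · rintro ⟨N, X⟩ hNX ⟨h1, h2⟩
    rw [Finset.mem_sigma, Set.Finite.mem_toFinset, List.mem_toFinset] at hNX
    by_contra hnz
    obtain ⟨C₁, W₁, U₁, h3, h4, h5, h6⟩ :=
      exists_isNest_of_pairCoeff_ne_zero hd hNX.1 hNX.2 hnz
    dsimp only at h3 h4 h5 h6
    subst h4
    rcases huniq _ _ _ _ h3 h5 h6 with ⟨e1, e2⟩ | ⟨e1, e2⟩
    · exact h1 (by rw [e2, e1])
    · exact h2 (by rw [e2, e1])
  · intro hn
    refine absurd (Finset.mem_sigma.2 ⟨?_, ?_⟩) hn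
    · exact (Set.Finite.mem_toFinset _).2 (h.mem_nestings hS)
    · exact List.mem_toFinset.2 mem_nest
  · intro hn
    refine absurd (Finset.mem_sigma.2 ⟨?_, ?_⟩) hn
    · exact (Set.Finite.mem_toFinset _).2 (h'.mem_nestings hS)
    · exact List.mem_toFinset.2 mem_nest

/-- The coefficients of all pairs of nested thin-quadratic stackings add up to zero: this is the
combinatorial identity behind `d_□² = 0`. -/
theorem sum_pairCoeff [DecidableEq (Stacking α)] (hd : S.nodes.Nodup) (hS : S.Valid col) :
    ∑ N ∈ (finite_nestings col S).toFinset, ∑ Y ∈ N.nodes.toFinset, pairCoeff col δ S N Y = 0 := by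
  by_cases hz : ∀ N ∈ (finite_nestings col S).toFinset, ∀ Y ∈ N.nodes.toFinset,
      pairCoeff col δ S N Y = 0
  · exact Finset.sum_eq_zero fun N hN => Finset.sum_eq_zero fun Y hY => hz N hN Y hY
  push Not at hz
  obtain ⟨N, hN, Y, hY, hnz⟩ := hz
  rw [Set.Finite.mem_toFinset] at hN
  rw [List.mem_toFinset] at hY
  obtain ⟨C, W, U, h1, rfl, h3, h4⟩ := exists_isNest_of_pairCoeff_ne_zero hd hN hY hnz
  rcases h1.isDoublePrime_or_isTriple hS h3 h4 with ⟨r, t, L₁, L₂, hQ⟩ | ⟨a, b, t, hQ⟩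
  · obtain ⟨C, Y, W, U, C', Y', W', U', hC, hN, hY, hC', hN', hY', huniq⟩ :=
      hQ.exists_two_pairs hd hS
    have e1 := pairCoeff_doublePrime (δ := δ) hQ hd hS hC (Or.inr hN) (Or.inl hY) |>.1 hY
    have e2 := pairCoeff_doublePrime (δ := δ) hQ hd hS hC' hN' (Or.inr hY') |>.2 hY'
    exact sum_pairCoeff_of_two hd hS hC hC' (by rw [e1, e2]; ring) huniq
      fun e => hY'.not_flat (e ▸ hY.2.2)
  · obtain ⟨C, Y, W, U, e, C', Y', W', U', hC, hN, hY, hn, hC', hN', hY', hn', huniq⟩ :=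
      hQ.exists_two_pairs hd hS
    have e1 := (pairCoeff_triple (δ := δ) hQ hd hS hC hN hY).1 e hn
    have e2 := (pairCoeff_triple (δ := δ) hQ hd hS hC' hN' hY').2 hn'
    refine sum_pairCoeff_of_two hd hS hC hC' (by rw [e1, e2]; ring) huniq
      fun hYY => ?_
    rw [hYY, hn'] at hn
    have hbt : b = t := by simp at hn; exact hn.2
    have hd' := hd
    rw [hQ.nodes_eq] at hd'
    simp [hbt] at hd'

end PairSigns

end BoxOperad

/-! ### The bar construction -/

open BoxOperad in
theorem lemma2 {k : Type u} [Field k] (B : DGBoxOperad.{u, v} k) (ε : B.Augmentation) :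
    -- `d_□` is the unique coderivation with the prescribed corestriction
    (∀ c i j, counit false c j ∘ₗ ε.barSquare false c i j = ε.infComp false c i j) ∧
    (∀ u c i j, T.inf u (fun _ _ => LinearMap.id) (ε.barSquare false) (-1) c i j ∘ₗ decomp u c i =
      decomp u c j ∘ₗ ε.barSquare u c i j) ∧
    (∀ f : ∀ c i j, T k ε.sIdeal false c i →ₗ[k] T k ε.sIdeal false c j,
      (∀ c i j, counit false c j ∘ₗ f c i j = ε.infComp false c i j) →
      (∀ c i j, T.inf false (fun _ _ => LinearMap.id) f (-1) c i j ∘ₗ decomp false c i =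
        decomp false c j ∘ₗ f c i j) →
      f = ε.barSquare false) ∧
    -- `d_□` and `d_{s B} + d_□` are differentials on `T(s B)`
    (∀ u, IsDifferential (ε.barSquare u)) ∧
    (∀ u, IsDifferential (ε.barD u)) ∧
    -- the bar construction is a conilpotent dg box cooperad
    IsConilpotentDGBoxCooperad (ε.barD false) (decomp (M := ε.sIdeal) false) := by
  exact bar_properties ε (infComp_eq_zero ε)
    (by classical exact infComp_comp_barSquare_of ε fun R col δ hR hV =>
      sum_pairCoeff hR hV)
    (infComp_comp_barInternal ε)
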